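/- Let $\Omega=(0,1)\times(-\pi,\pi)$, let $0<\alpha\le 1$ and let $\varepsilon,c$ be real numbers with $|\varepsilon|<1$. Let $D_x^\alpha$ denote the Caputo derivative in $x$, $$D_x^\alpha u(x,y)=\frac{1}{\Gamma(1-\alpha)}\int_0^x (x-s)^{-\alpha}\,\frac{\partial u}{\partial s}(s,y)\,ds\quad(0<\alpha<1),\qquad D_x^1u=\frac{\partial u}{\partial x},$$ and put $L_x^{2\alpha}=D_x^\alpha D_x^\alpha$. Let $0<\delta<1$, $\varphi\in C^{2+\delta}[-\pi,\pi]$ and $\psi\in C^{1+\delta}[-\pi,\pi]$ with $\varphi(-\pi)=\varphi(\pi)=0$ and $\psi(-\pi)=\psi(\pi)=0$. Then there is exactly one function $u\in C(\overline\Omega)$ such that $D_x^\alpha u$, $L_x^{2\alpha}u$ and $u_{yy}$ exist and are continuous in $\Omega$, $$L_x^{2\alpha}u(x,y)+u_{yy}(x,y)-\varepsilon u_{yy}(x,-y)-c^2u(x,y)=0,\qquad (x,y)\in\Omega,$$ $$u(0,y)=\varphi(y),\quad u(1,y)=\psi(y)\quad(-\pi\le y\le\pi),\qquad u(x,-\pi)=u(x,\pi)=0\quad(0\le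 x\le 1).$$ For all $(x,y)\in\overline\Omega$ this solution is the sum of two convergent series, $$u(x,y)=\sum_{k=1}^\infty\bigl[\varphi_{2k-1}C(\mu_{2k-1}x)+\psi_{2k-1}S(\mu_{2k-1}x)\bigr]\sin ky+\sum_{k=1}^\infty\bigl[\varphi_{2k}C(\mu_{2k}x)+\psi_{2k}S(\mu_{2k}x)\bigr]\cos\bigl(k-\tfrac12\bigr)y .$$ Here $\mu_{2k-1}=\sqrt{(1+\varepsilon)k^2+c^2}$ and $\mu_{2k}=\sqrt{(1-\varepsilon)(k-\frac12)^2+c^2}$; the Fourier coefficients of $f=\varphi,\psi$ are $f_{2k-1}=\frac1\pi\int_{-\pi}^{\pi}f(y)\sin ky\,dy$ and $f_{2k}=\frac1\pi\int_{-\pi}^{\pi}f(y)\cos(k-\frac12)y\,dy$; and, with $E_{a,b}(z)=\sum_{j=0}^\infty z^j/\Gamma(aj+b)$, $$C(\mu t)=\frac{E_{\alpha,1}(\mu)E_{\alpha,1}(-\mu t^\alpha)-E_{\alpha,1}(-\mu)E_{\alpha,1}(\mu t^\alpha)}{2\mu E_{2\alpha,\alpha+1}(\mu^2)},\qquad S(\mu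 t)=\frac{t^\alpha E_{2\alpha,\alpha+1}(\mu^2t^{2\alpha})}{E_{2\alpha,\alpha+1}(\mu^2)} .$$ -/

import Mathlib

open Set MeasureTheory

noncomputable section

/-- The two-parameter Mittag-Leffler function
`E_{α,β}(z) = ∑_{k ≥ 0} z ^ k / Γ(α k + β)` of a real argument. -/
def mittagLeffler (α β z : ℝ) : ℝ :=
  ∑' k : ℕ, z ^ k / Real.Gamma (α * k + β)

/-- The Caputo derivative of order `α ∈ (0,1]` with base point `0`. For `α < 1` it is
`Γ(1-α)⁻¹ ∫₀ˣ (x-s)^(-α) f'(s) ds`; for `α = 1` it is the ordinary derivative. -/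
def caputoDeriv (α : ℝ) (f : ℝ → ℝ) (x : ℝ) : ℝ :=
  if α = 1 then deriv f x
  else (Real.Gamma (1 - α))⁻¹ * ∫ s in (0 : ℝ)..x, (x - s) ^ (-α) * deriv f s

/-- The Caputo derivative of order `α` of `f` exists at all points of `(0,1)`: `f` is
differentiable in `(0,1)` and, for `α < 1`, the defining integrals converge absolutely. -/
def CaputoDifferentiable (α : ℝ) (f : ℝ → ℝ) : Prop :=
  ∀ x ∈ Ioo (0 : ℝ) 1, DifferentiableAt ℝ f x ∧
    (α < 1 → IntervalIntegrable (fun s => (x - s) ^ (-α) * deriv f s) volume 0 x)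

/-- The partial Caputo derivative `D_x^α u`. -/
def caputoX (α : ℝ) (u : ℝ → ℝ → ℝ) (x y : ℝ) : ℝ :=
  caputoDeriv α (fun s => u s y) x

/-- The second partial derivative `u_yy`. -/
def partialYY (u : ℝ → ℝ → ℝ) (x y : ℝ) : ℝ :=
  deriv (deriv (u x)) y

/-- The open rectangle `Ω = (0,1) × (-π,π)`. -/
def rect : Set (ℝ × ℝ) := Ioo (0 : ℝ) 1 ×ˢ Ioo (-Real.pi) Real.pi

/-- The closed rectangle `[0,1] × [-π,π]`. -/
def closedRect : Set (ℝ × ℝ) := Icc (0 : ℝ) 1 ×ˢ Icc (-Real.pi) Real.pi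

/-- The regularity of a regular solution: `u` is continuous on the closed rectangle, and
`D_x^α u`, `D_x^α D_x^α u`, `u_yy` exist and are continuous in the open rectangle.
Only the values of `u` on the closed rectangle matter. -/
structure IsRegularFunction (α : ℝ) (u : ℝ → ℝ → ℝ) : Prop where
  continuousOn : ContinuousOn (Function.uncurry u) closedRect
  caputo_exists : ∀ y ∈ Ioo (-Real.pi) Real.pi, CaputoDifferentiable α (fun x => u x y)
  caputo_continuousOn : ContinuousOn (Function.uncurry (caputoX α u)) rect
  caputo_caputo_exists :
    ∀ y ∈ Ioo (-Real.pi) Real.pi, CaputoDifferentiable α (fun x => caputoX α u x y)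
  caputo_caputo_continuousOn :
    ContinuousOn (Function.uncurry (caputoX α (caputoX α u))) rect
  yy_exists : ∀ x ∈ Ioo (0 : ℝ) 1, ∀ y ∈ Ioo (-Real.pi) Real.pi,
    DifferentiableAt ℝ (u x) y ∧ DifferentiableAt ℝ (deriv (u x)) y
  yy_continuousOn : ContinuousOn (Function.uncurry (partialYY u)) rect

/-- `u` is a regular solution of the equation
`D_x^α D_x^α u(x,y) + u_yy(x,y) - ε u_yy(x,-y) - c² u(x,y) = 0` in the open rectangle with
`u(0,y) = φ(y)`, `u(1,y) = ψ(y)` and `u(x,-π) = u(x,π) = 0`. -/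
structure IsSolutionProblemD (α ε c : ℝ) (φ ψ : ℝ → ℝ) (u : ℝ → ℝ → ℝ) : Prop where
  regular : IsRegularFunction α u
  equation : ∀ x ∈ Ioo (0 : ℝ) 1, ∀ y ∈ Ioo (-Real.pi) Real.pi,
    caputoX α (caputoX α u) x y + partialYY u x y - ε * partialYY u x (-y)
      - c ^ 2 * u x y = 0
  left : ∀ y ∈ Icc (-Real.pi) Real.pi, u 0 y = φ y
  right : ∀ y ∈ Icc (-Real.pi) Real.pi, u 1 y = ψ y
  bottom : ∀ x ∈ Icc (0 : ℝ) 1, u x (-Real.pi) = 0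
  top : ∀ x ∈ Icc (0 : ℝ) 1, u x Real.pi = 0

/-- The Hölder class `C^{m+δ}[-π,π]`: `f` is `m` times continuously differentiable on the
closed interval (one-sided at the end points) and its `m`-th derivative is `δ`-Hölder. -/
def IsHolderClass (m : ℕ) (δ : ℝ) (f : ℝ → ℝ) : Prop :=
  ContDiffOn ℝ m f (Icc (-Real.pi) Real.pi) ∧
  ∃ K : ℝ, ∀ y ∈ Icc (-Real.pi) Real.pi, ∀ z ∈ Icc (-Real.pi) Real.pi,
    |iteratedDerivWithin m f (Icc (-Real.pi) Real.pi) y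
      - iteratedDerivWithin m f (Icc (-Real.pi) Real.pi) z| ≤ K * |y - z| ^ δ

/-- `C(μ t) = (E_{α,1}(μ) E_{α,1}(-μ t^α) - E_{α,1}(-μ) E_{α,1}(μ t^α))
/ (2 μ E_{2α,α+1}(μ²))`. -/
def profileC (α μ t : ℝ) : ℝ :=
  (mittagLeffler α 1 μ * mittagLeffler α 1 (-μ * t ^ α)
    - mittagLeffler α 1 (-μ) * mittagLeffler α 1 (μ * t ^ α))
  / (2 * μ * mittagLeffler (2 * α) (α + 1) (μ ^ 2))

/-- `S(μ t) = t^α E_{2α,α+1}(μ² t^{2α}) / E_{2α,α+1}(μ²)`. -/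
def profileS (α μ t : ℝ) : ℝ :=
  t ^ α * mittagLeffler (2 * α) (α + 1) (μ ^ 2 * t ^ (2 * α))
  / mittagLeffler (2 * α) (α + 1) (μ ^ 2)

/-- The eigenfunctions `sin ky`, `k = 1, 2, …`. -/
def sinMode (k : ℕ) (y : ℝ) : ℝ := Real.sin (k * y)

/-- The eigenfunctions `cos (k - 1/2)y`, `k = 1, 2, …`. -/
def cosMode (k : ℕ) (y : ℝ) : ℝ := Real.cos (((k : ℝ) - 1 / 2) * y)

/-- The Fourier coefficient of `f` for a mode `Y` with `∫ Y² = π` over `[-π,π]`. -/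
def fourierCoefficient (f Y : ℝ → ℝ) : ℝ :=
  Real.pi⁻¹ * ∫ y in (-Real.pi)..Real.pi, f y * Y y

/-- `μ = √(λ + c²)` for the eigenvalue `λ = (1 + ε) k²` of `sin ky`. -/
def sinMu (ε c : ℝ) (k : ℕ) : ℝ :=
  Real.sqrt ((1 + ε) * (k : ℝ) ^ 2 + c ^ 2)

/-- `μ = √(λ + c²)` for the eigenvalue `λ = (1 - ε) (k - 1/2)²` of `cos (k - 1/2)y`. -/
def cosMu (ε c : ℝ) (k : ℕ) : ℝ :=
  Real.sqrt ((1 - ε) * ((k : ℝ) - 1 / 2) ^ 2 + c ^ 2)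

/-- The `k`-th term of the series over the modes `sin ky`. -/
def sinTerm (α ε c : ℝ) (φ ψ : ℝ → ℝ) (k : ℕ) (x y : ℝ) : ℝ :=
  (fourierCoefficient φ (sinMode k) * profileC α (sinMu ε c k) x
    + fourierCoefficient ψ (sinMode k) * profileS α (sinMu ε c k) x) * sinMode k y

/-- The `k`-th term of the series over the modes `cos (k - 1/2)y`. -/
def cosTerm (α ε c : ℝ) (φ ψ : ℝ → ℝ) (k : ℕ) (x y : ℝ) : ℝ :=
  (fourierCoefficient φ (cosMode k) * profileC α (cosMu ε c k) x
    + fourierCoefficient ψ (cosMode k) * profileS α (cosMu ε c k) x) * cosMode k y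

end

/-! Write J^γ for `fracInt γ`.

Existence is separation of variables. Each mode leads to D^α D^α f = μ² f on (0,1) with prescribed
values at 0 and 1. One solution is E_{α,1}(-μ x^α), an eigenfunction of D^α for the eigenvalue -μ;
another is S. By `profileC_eq`, C is the first minus E_{α,1}(-μ) times S, so two kinds of estimate
suffice. At negative arguments, Mittag-Leffler functions are controlled through the positivity of
the resolvent kernel x^(α-1) E_{α,α}(-x^α) (`mlKernel_neg_one_pos`). At positive arguments, the
quotients in S decay faster than any power of μ as long as x stays away from 1
(`exists_pow_mul_mlKernel_div_le`). Integration by parts and Bessel's inequality bound the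
coefficients of φ and ψ by square summable sequences divided by the second and the first power of
the frequency. This gives majorants for termwise Caputo differentiation (`caputo_tsum`,
`separatedSeries_profile`). The boundary values at x = 0, 1 follow from the completeness of the
modes.

Uniqueness is harder, because the derivatives of a regular solution are controlled only inside the
open rectangle; testing the equation with a mode and integrating by parts is not available. The
combinations u(x,y) ± u(x,-y), moved to z in [0,π], satisfy equations h + a w_zz = c² w without
reflection, where h = D^α D^α w. For α = 1 the maximum principle finishes the proof. For α < 1,
integrating twice in x gives J^(2-2α) w = g₀(z) x^(2-α)/Γ(3-α) + J² h
(`isVolterraPair_caputoDeriv`), and the Green operator in z removes w_zz. The resulting potential is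
continuous up to the boundary, and its mixed second differences in interior rectangles see only g₀.
Hence it equals x^(2-α)/Γ(3-α) Γ(z) + x Ψ(z), with Γ'' = g₀ in integrated form
(`exists_potential_eq`). Once Ψ = 0, every sine coefficient of w solves a Volterra equation with one
free constant, and its zero at x = 1 kills that constant.

The crux is Ψ = 0. For fixed z the term J² h is o(x), but not uniformly in z. For α ≤ 1/2 the size
of J^(2-2α) w alone excludes a term linear in x. For α > 1/2 two facts are combined. By Baire's
theorem Ψ is affine near each point of a dense set (`exists_secondDiff_eq_zero`). A Laplace
transform at the frequency κ with κ^(2α) = a k² shows that the sine coefficients of k² Ψ and -A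
k^(3-1/α) Γ agree up to O(k^(-1/α)) (`exists_coeff_balance`). So Ψ'' is a fractional Laplacian of Γ
of order 3-1/α, which lies in (1,2), plus a continuous function. As Γ is C² inside, Ψ'' is
continuous inside; it vanishes on a dense set, hence everywhere, and Ψ is affine with zero boundary
values (`eq_zero_of_coeff_balance`). -/

/-! ### Fractional integrals, Beta integrals and the semigroup law. -/

/-- The Riemann–Liouville fractional integral of order `γ` with base point `0`. -/
noncomputable def fracInt (γ : ℝ) (f : ℝ → ℝ) (x : ℝ) : ℝ :=
  (Real.Gamma γ)⁻¹ * ∫ s in (0 : ℝ)..x, (x - s) ^ (γ - 1) * f s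

/-- The scaled complex Beta integral; all bases are nonnegative reals, so the complex powers are
casts of real ones. -/
theorem integral_sub_rpow_mul_rpow {a b x : ℝ} (ha : 0 < a) (hb : 0 < b) (hx : 0 < x) :
    ∫ s in (0 : ℝ)..x, (x - s) ^ (a - 1) * s ^ (b - 1)
      = x ^ (a + b - 1) * (Real.Gamma a * Real.Gamma b / Real.Gamma (a + b)) := by
  have h := Complex.betaIntegral_scaled (b : ℂ) (a : ℂ) hx
  have h2 := Complex.betaIntegral_eq_Gamma_mul_div (b : ℂ) (a : ℂ) (by simpa) (by simpa)
  rw [h2] at h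
  have h3 : ∫ s in (0 : ℝ)..x, (s : ℂ) ^ ((b : ℂ) - 1) * ((x : ℂ) - s) ^ ((a : ℂ) - 1)
      = ((∫ s in (0 : ℝ)..x, (x - s) ^ (a - 1) * s ^ (b - 1) : ℝ) : ℂ) := by
    rw [← intervalIntegral.integral_ofReal]
    refine intervalIntegral.integral_congr fun s hs => ?_
    rw [uIcc_of_le hx.le] at hs
    rw [Complex.ofReal_mul, Complex.ofReal_cpow hs.1, Complex.ofReal_cpow (by linarith [hs.2])]
    push_cast
    ring
  rw [h3] at h
  have h4 : ((x : ℂ) ^ ((b : ℂ) + a - 1) * (Complex.Gamma b * Complex.Gamma a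
      / Complex.Gamma (b + a))) = ((x ^ (a + b - 1) *
        (Real.Gamma a * Real.Gamma b / Real.Gamma (a + b)) : ℝ) : ℂ) := by
    rw [Complex.ofReal_mul, Complex.ofReal_cpow hx.le, Complex.ofReal_div, Complex.ofReal_mul,
      ← Complex.Gamma_ofReal, ← Complex.Gamma_ofReal, ← Complex.Gamma_ofReal]
    push_cast
    rw [add_comm (b : ℂ) a, mul_comm (Complex.Gamma b)]
  rw [h4] at h
  exact_mod_cast h

/-- A function that is not integrable has integral 0 by convention, so the nonzero Beta value
already proves integrability. -/
theorem intervalIntegrable_sub_rpow_mul_rpow {a b x : ℝ} (ha : 0 < a) (hb : 0 < b) (hx : 0 < x) :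
    IntervalIntegrable (fun s => (x - s) ^ (a - 1) * s ^ (b - 1)) volume 0 x := by
  apply intervalIntegral.intervalIntegrable_of_integral_ne_zero
  rw [integral_sub_rpow_mul_rpow ha hb hx]
  have := Real.Gamma_pos_of_pos ha
  have := Real.Gamma_pos_of_pos hb
  have := Real.Gamma_pos_of_pos (add_pos ha hb)
  positivity

theorem integral_sub_rpow_mul_sub_rpow {a b r x : ℝ} (ha : 0 < a) (hb : 0 < b) (hx : r < x) :
    ∫ s in r..x, (x - s) ^ (a - 1) * (s - r) ^ (b - 1)
      = (x - r) ^ (a + b - 1) * (Real.Gamma a * Real.Gamma b / Real.Gamma (a + b)) := by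
  rw [← integral_sub_rpow_mul_rpow ha hb (sub_pos.2 hx)]
  have := intervalIntegral.integral_comp_sub_right
    (fun s => (x - r - s) ^ (a - 1) * s ^ (b - 1)) r (a := r) (b := x)
  simp only [sub_self] at this
  rw [← this]
  refine intervalIntegral.integral_congr fun s _ => ?_
  congr 2; ring

theorem intervalIntegrable_sub_rpow_mul_sub_rpow {a b r x : ℝ} (ha : 0 < a) (hb : 0 < b)
    (hx : r < x) :
    IntervalIntegrable (fun s => (x - s) ^ (a - 1) * (s - r) ^ (b - 1)) volume r x := by
  apply intervalIntegral.intervalIntegrable_of_integral_ne_zero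
  rw [integral_sub_rpow_mul_sub_rpow ha hb hx]
  have := Real.Gamma_pos_of_pos ha
  have := Real.Gamma_pos_of_pos hb
  have := Real.Gamma_pos_of_pos (add_pos ha hb)
  have : 0 < x - r := by linarith
  positivity

theorem intervalIntegrable_sub_rpow {a x : ℝ} (ha : 0 < a) (hx : 0 < x) :
    IntervalIntegrable (fun s => (x - s) ^ (a - 1)) volume 0 x := by
  simpa using intervalIntegrable_sub_rpow_mul_rpow ha one_pos hx

theorem integral_sub_rpow {a x : ℝ} (ha : 0 < a) (hx : 0 < x) :
    ∫ s in (0 : ℝ)..x, (x - s) ^ (a - 1) = x ^ a / a := by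
  have := integral_sub_rpow_mul_rpow ha one_pos hx
  simp only [sub_self, Real.rpow_zero, mul_one, Real.Gamma_one, add_sub_cancel_right] at this
  rw [this, Real.Gamma_add_one ha.ne']
  have := (Real.Gamma_pos_of_pos ha).ne'
  field_simp

theorem fracInt_rpow {γ b x : ℝ} (hγ : 0 < γ) (hb : 0 < b) (hx : 0 < x) :
    fracInt γ (fun s => s ^ (b - 1) / Real.Gamma b) x
      = x ^ (b + γ - 1) / Real.Gamma (b + γ) := by
  have h : ∀ s : ℝ, (x - s) ^ (γ - 1) * (s ^ (b - 1) / Real.Gamma b)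
      = (Real.Gamma b)⁻¹ * ((x - s) ^ (γ - 1) * s ^ (b - 1)) := fun s => by ring
  simp only [fracInt, h]
  rw [intervalIntegral.integral_const_mul, integral_sub_rpow_mul_rpow hγ hb hx, add_comm γ b]
  have := (Real.Gamma_pos_of_pos hγ).ne'
  have := (Real.Gamma_pos_of_pos hb).ne'
  field_simp

theorem fracInt_congr {γ x : ℝ} {f g : ℝ → ℝ} (hx : 0 ≤ x) (h : ∀ s ∈ Ioo 0 x, f s = g s) :
    fracInt γ f x = fracInt γ g x := by
  unfold fracInt
  congr 1
  rw [intervalIntegral.integral_of_le hx, intervalIntegral.integral_of_le hx,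
    integral_Ioc_eq_integral_Ioo, integral_Ioc_eq_integral_Ioo]
  exact setIntegral_congr_fun measurableSet_Ioo fun s hs => by simp only [h s hs]

theorem intervalIntegrable_congr_Ioo {x y : ℝ} {f g : ℝ → ℝ} (hx : x ≤ y)
    (h : ∀ s ∈ Ioo x y, f s = g s) (hf : IntervalIntegrable f volume x y) :
    IntervalIntegrable g volume x y := by
  rw [intervalIntegrable_iff_integrableOn_Ioo_of_le hx] at hf ⊢
  exact hf.congr_fun h measurableSet_Ioo

theorem fracInt_one (f : ℝ → ℝ) (x : ℝ) : fracInt 1 f x = ∫ s in (0 : ℝ)..x, f s := by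
  simp [fracInt]

/-- The integrand of the iterated fractional integral is integrable on the square. -/
theorem integrable_fracInt_kernel {a b x : ℝ} (ha : 0 < a) (hb : 0 < b)
    {f : ℝ → ℝ} (hm : AEStronglyMeasurable f (volume.restrict (Ioc 0 x)))
    (hf : IntegrableOn (fun s => (x - s) ^ (a + b - 1) * f s) (Ioc 0 x)) :
    Integrable (fun p : ℝ × ℝ => {p : ℝ × ℝ | p.2 < p.1}.indicator
      (fun p => (x - p.1) ^ (a - 1) * (p.1 - p.2) ^ (b - 1) * f p.2) p)
      ((volume.restrict (Ioc 0 x)).prod (volume.restrict (Ioc 0 x))) := by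
  have hset : MeasurableSet {p : ℝ × ℝ | p.2 < p.1} :=
    measurableSet_lt measurable_snd measurable_fst
  have hslice : ∀ r ∈ Ioo 0 x, ∀ s, {p : ℝ × ℝ | p.2 < p.1}.indicator
      (fun p => (x - p.1) ^ (a - 1) * (p.1 - p.2) ^ (b - 1) * f p.2) (s, r)
      = (Ioi r).indicator (fun s => (x - s) ^ (a - 1) * (s - r) ^ (b - 1) * f r) s := by
    intro r _ s
    simp [indicator]
  have hae : ∀ᵐ r ∂(volume.restrict (Ioc 0 x)), r ∈ Ioo 0 x := by
    rw [← restrict_Ioo_eq_restrict_Ioc]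
    exact ae_restrict_mem measurableSet_Ioo
  have hinter : ∀ r ∈ Ioo 0 x, Ioc 0 x ∩ Ioi r = Ioc r x := by
    intro r hr
    ext s
    simp only [mem_inter_iff, mem_Ioc, mem_Ioi]
    constructor
    · rintro ⟨⟨_, h1⟩, h2⟩; exact ⟨h2, h1⟩
    · rintro ⟨h1, h2⟩; exact ⟨⟨hr.1.trans h1, h2⟩, h1⟩
  -- For fixed r the slice is a Beta integrand, and the integral of its norm over s is a constant
  -- times the integrand of `hf`.
  rw [integrable_prod_iff']
  · constructor
    · filter_upwards [hae] with r hr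
      simp only [hslice r hr]
      rw [integrable_indicator_iff measurableSet_Ioi, IntegrableOn,
        Measure.restrict_restrict measurableSet_Ioi, inter_comm, hinter r hr]
      have := (intervalIntegrable_sub_rpow_mul_sub_rpow ha hb hr.2).mul_const (f r)
      rwa [intervalIntegrable_iff_integrableOn_Ioc_of_le hr.2.le] at this
    · refine Integrable.congr (hf.norm.const_mul
        (Real.Gamma a * Real.Gamma b / Real.Gamma (a + b))) ?_
      filter_upwards [hae] with r hr
      simp only [hslice r hr]
      have h1 : ∀ s, ‖(Ioi r).indicator
          (fun s => (x - s) ^ (a - 1) * (s - r) ^ (b - 1) * f r) s‖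
          = (Ioi r).indicator (fun s => ‖(x - s) ^ (a - 1) * (s - r) ^ (b - 1) * f r‖) s := by
        intro s; rw [norm_indicator_eq_indicator_norm]
      simp only [h1]
      rw [integral_indicator measurableSet_Ioi, Measure.restrict_restrict measurableSet_Ioi,
        inter_comm, hinter r hr]
      have h2 : ∫ s in Ioc r x, ‖(x - s) ^ (a - 1) * (s - r) ^ (b - 1) * f r‖
          = ∫ s in Ioc r x, ((x - s) ^ (a - 1) * (s - r) ^ (b - 1)) * |f r| := by
        refine setIntegral_congr_fun measurableSet_Ioc fun s hs => ?_
        have h3 : 0 ≤ x - s := by linarith [hs.2]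
        have h4 : 0 ≤ s - r := by linarith [hs.1]
        simp only [norm_mul, Real.norm_eq_abs]
        rw [abs_of_nonneg (Real.rpow_nonneg h3 _), abs_of_nonneg (Real.rpow_nonneg h4 _)]
      rw [h2, ← intervalIntegral.integral_of_le hr.2.le, intervalIntegral.integral_mul_const,
        integral_sub_rpow_mul_sub_rpow ha hb hr.2, norm_mul, Real.norm_eq_abs, Real.norm_eq_abs,
        abs_of_nonneg (Real.rpow_nonneg (by linarith [hr.2]) _)]
      ring
  · refine AEStronglyMeasurable.indicator ?_ hset
    refine AEStronglyMeasurable.mul ?_ hm.comp_snd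
    exact (Measurable.aestronglyMeasurable (by fun_prop))

theorem fracInt_fracInt_aux {a b x : ℝ}
    {f : ℝ → ℝ} {s : ℝ} (hs : s ∈ Ioc 0 x) :
    ∫ r in Ioc 0 x, {p : ℝ × ℝ | p.2 < p.1}.indicator
      (fun p => (x - p.1) ^ (a - 1) * (p.1 - p.2) ^ (b - 1) * f p.2) (s, r)
      = (x - s) ^ (a - 1) * ∫ r in (0 : ℝ)..s, (s - r) ^ (b - 1) * f r := by
  have h1 : ∀ r, {p : ℝ × ℝ | p.2 < p.1}.indicator
      (fun p => (x - p.1) ^ (a - 1) * (p.1 - p.2) ^ (b - 1) * f p.2) (s, r)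
      = (Iio s).indicator (fun r => (x - s) ^ (a - 1) * ((s - r) ^ (b - 1) * f r)) r := by
    intro r
    simp [indicator, mul_assoc]
  simp only [h1]
  rw [integral_indicator measurableSet_Iio, Measure.restrict_restrict measurableSet_Iio]
  have h2 : Iio s ∩ Ioc 0 x = Ioo 0 s := by
    ext r
    simp only [mem_inter_iff, mem_Ioc, mem_Iio, mem_Ioo]
    constructor
    · rintro ⟨h1, h2, _⟩; exact ⟨h2, h1⟩
    · rintro ⟨h1, h2⟩; exact ⟨h2, h1, h2.le.trans hs.2⟩
  rw [h2, ← integral_Ioc_eq_integral_Ioo, ← intervalIntegral.integral_of_le hs.1.le,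
    intervalIntegral.integral_const_mul]

theorem intervalIntegrable_sub_rpow_mul_fracInt {a b x : ℝ} (ha : 0 < a) (hb : 0 < b) (hx : 0 < x)
    {f : ℝ → ℝ} (hm : AEStronglyMeasurable f (volume.restrict (Ioc 0 x)))
    (hf : IntervalIntegrable (fun s => (x - s) ^ (a + b - 1) * f s) volume 0 x) :
    IntervalIntegrable (fun s => (x - s) ^ (a - 1) * fracInt b f s) volume 0 x := by
  rw [intervalIntegrable_iff_integrableOn_Ioc_of_le hx.le] at hf ⊢
  have h := (integrable_fracInt_kernel ha hb hm hf).integral_prod_left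
  refine (h.const_mul (Real.Gamma b)⁻¹).congr ?_
  filter_upwards [ae_restrict_mem measurableSet_Ioc] with s hs
  rw [fracInt_fracInt_aux hs, fracInt]
  ring

/-- The semigroup law of fractional integration. -/
theorem fracInt_fracInt {a b x : ℝ} (ha : 0 < a) (hb : 0 < b) (hx : 0 < x)
    {f : ℝ → ℝ} (hm : AEStronglyMeasurable f (volume.restrict (Ioc 0 x)))
    (hf : IntervalIntegrable (fun s => (x - s) ^ (a + b - 1) * f s) volume 0 x) :
    fracInt a (fracInt b f) x = fracInt (a + b) f x := by
  rw [intervalIntegrable_iff_integrableOn_Ioc_of_le hx.le] at hf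
  -- Fubini on the triangle r < s < x: integrating first in r gives the iterated fractional
  -- integral, integrating first in s gives a Beta integral that merges the two kernels.
  have hswap := integral_integral_swap
    (f := fun s r => {p : ℝ × ℝ | p.2 < p.1}.indicator
      (fun p => (x - p.1) ^ (a - 1) * (p.1 - p.2) ^ (b - 1) * f p.2) (s, r))
    (integrable_fracInt_kernel ha hb hm hf)
  have hL : ∫ s in Ioc 0 x, ∫ r in Ioc 0 x, {p : ℝ × ℝ | p.2 < p.1}.indicator
      (fun p => (x - p.1) ^ (a - 1) * (p.1 - p.2) ^ (b - 1) * f p.2) (s, r)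
      = Real.Gamma a * Real.Gamma b * fracInt a (fracInt b f) x := by
    rw [setIntegral_congr_fun measurableSet_Ioc fun s hs => fracInt_fracInt_aux hs,
      ← intervalIntegral.integral_of_le hx.le, fracInt]
    have h1 := (Real.Gamma_pos_of_pos ha).ne'
    have h2 := (Real.Gamma_pos_of_pos hb).ne'
    have h3 : ∀ s, (x - s) ^ (a - 1) * fracInt b f s = (Real.Gamma b)⁻¹ *
        ((x - s) ^ (a - 1) * ∫ r in (0 : ℝ)..s, (s - r) ^ (b - 1) * f r) := by
      intro s; rw [fracInt]; ring
    simp only [h3]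
    rw [intervalIntegral.integral_const_mul]
    field_simp
  have hR : ∫ r in Ioc 0 x, ∫ s in Ioc 0 x, {p : ℝ × ℝ | p.2 < p.1}.indicator
      (fun p => (x - p.1) ^ (a - 1) * (p.1 - p.2) ^ (b - 1) * f p.2) (s, r)
      = Real.Gamma a * Real.Gamma b * fracInt (a + b) f x := by
    have h0 : ∀ r ∈ Ioo 0 x, ∫ s in Ioc 0 x, {p : ℝ × ℝ | p.2 < p.1}.indicator
      (fun p => (x - p.1) ^ (a - 1) * (p.1 - p.2) ^ (b - 1) * f p.2) (s, r)
      = (Real.Gamma a * Real.Gamma b / Real.Gamma (a + b)) * ((x - r) ^ (a + b - 1) * f r) := by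
      intro r hr
      have h1 : ∀ s, {p : ℝ × ℝ | p.2 < p.1}.indicator
          (fun p => (x - p.1) ^ (a - 1) * (p.1 - p.2) ^ (b - 1) * f p.2) (s, r)
          = (Ioi r).indicator (fun s => (x - s) ^ (a - 1) * (s - r) ^ (b - 1) * f r) s := by
        intro s; simp [indicator]
      simp only [h1]
      rw [integral_indicator measurableSet_Ioi, Measure.restrict_restrict measurableSet_Ioi]
      have h2 : Ioi r ∩ Ioc 0 x = Ioc r x := by
        ext s
        simp only [mem_inter_iff, mem_Ioc, mem_Ioi]
        constructor
        · rintro ⟨h2, _, h1⟩; exact ⟨h2, h1⟩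
        · rintro ⟨h1, h2⟩; exact ⟨h1, hr.1.trans h1, h2⟩
      rw [h2, ← intervalIntegral.integral_of_le hr.2.le, intervalIntegral.integral_mul_const,
        integral_sub_rpow_mul_sub_rpow ha hb hr.2]
      ring
    rw [integral_Ioc_eq_integral_Ioo, setIntegral_congr_fun measurableSet_Ioo h0,
      ← integral_Ioc_eq_integral_Ioo, ← intervalIntegral.integral_of_le hx.le,
      intervalIntegral.integral_const_mul, fracInt]
    ring
  rw [hL, hR] at hswap
  have h1 := Real.Gamma_pos_of_pos ha
  have h2 := Real.Gamma_pos_of_pos hb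
  exact mul_left_cancel₀ (mul_pos h1 h2).ne' hswap


/-! ### Convergence and elementary properties of the Mittag-Leffler series. -/

/-- Euler's integral restricted to t > R, where t^(x-1) ≥ R^(x-1). As R is free, Γ(ρk+β) outgrows
every geometric sequence. -/
theorem rpow_mul_exp_neg_le_Gamma {x R : ℝ} (hx : 1 ≤ x) (hR : 0 < R) :
    R ^ (x - 1) * Real.exp (-R) ≤ Real.Gamma x := by
  rw [Real.Gamma_eq_integral (by linarith)]
  have hint := Real.GammaIntegral_convergent (s := x) (by linarith)
  calc R ^ (x - 1) * Real.exp (-R) = ∫ t in Ioi R, R ^ (x - 1) * Real.exp (-t) := by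
        rw [integral_const_mul, integral_exp_neg_Ioi]
    _ ≤ ∫ t in Ioi R, Real.exp (-t) * t ^ (x - 1) := by
        refine setIntegral_mono_on ((integrableOn_exp_neg_Ioi R).const_mul _)
          (hint.mono_set (Ioi_subset_Ioi hR.le)) measurableSet_Ioi fun t ht => ?_
        rw [mul_comm]
        exact mul_le_mul_of_nonneg_left
          (Real.rpow_le_rpow hR.le (le_of_lt ht) (by linarith)) (Real.exp_pos _).le
    _ ≤ _ := by
        refine setIntegral_mono_set hint ?_ (Ioi_subset_Ioi hR.le).eventuallyLE
        filter_upwards [ae_restrict_mem measurableSet_Ioi] with t ht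
        exact mul_nonneg (Real.exp_pos _).le (Real.rpow_nonneg (le_of_lt ht) _)

theorem Gamma_mul_add_pos {ρ β : ℝ} (hρ : 0 < ρ) (hβ : 0 < β) (k : ℕ) :
    0 < Real.Gamma (ρ * k + β) := Real.Gamma_pos_of_pos (by positivity)

theorem summable_pow_div_Gamma {ρ β : ℝ} (hρ : 0 < ρ) (hβ : 0 < β) (z : ℝ) :
    Summable fun k : ℕ => z ^ k / Real.Gamma (ρ * k + β) := by
  -- With R^ρ = 2|z| + 1 the terms are dominated by a geometric series of ratio |z|/(2|z|+1).
  set R : ℝ := (2 * |z| + 1) ^ (1 / ρ) with hR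
  have hR0 : 0 < R := by positivity
  have hRρ : R ^ ρ = 2 * |z| + 1 := by
    rw [hR, ← Real.rpow_mul (by positivity)]
    simp [hρ.ne']
  have hq : |z| / (2 * |z| + 1) < 1 := by
    rw [div_lt_one (by positivity)]; linarith [abs_nonneg z]
  have hs : Summable fun k : ℕ => Real.exp R * R ^ (1 - β) * (|z| / (2 * |z| + 1)) ^ k :=
    (summable_geometric_of_lt_one (by positivity) hq).mul_left _
  refine Summable.of_norm_bounded_eventually_nat hs ?_
  have hev : ∀ᶠ k : ℕ in Filter.atTop, 1 ≤ ρ * k + β := by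
    obtain ⟨n, hn⟩ := exists_nat_gt (1 / ρ)
    filter_upwards [Filter.eventually_ge_atTop n] with k hk
    have h1 : 1 / ρ < k := hn.trans_le (by exact_mod_cast hk)
    rw [div_lt_iff₀ hρ] at h1
    linarith
  filter_upwards [hev] with k hk
  have hG := rpow_mul_exp_neg_le_Gamma hk hR0
  have hpos := Gamma_mul_add_pos hρ hβ k
  rw [norm_div, norm_pow, Real.norm_eq_abs, Real.norm_eq_abs, abs_of_pos hpos,
    div_le_iff₀ hpos]
  have h2 : R ^ (ρ * k + β - 1) = (2 * |z| + 1) ^ k * (R ^ (1 - β))⁻¹ := by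
    rw [← Real.rpow_neg hR0.le, ← hRρ, ← Real.rpow_natCast, ← Real.rpow_mul hR0.le,
      ← Real.rpow_add hR0]
    congr 1; ring
  have hRb : 0 < R ^ (1 - β) := by positivity
  calc |z| ^ k = Real.exp R * R ^ (1 - β) * (|z| / (2 * |z| + 1)) ^ k *
        (R ^ (ρ * k + β - 1) * Real.exp (-R)) := by
          rw [h2, Real.exp_neg, div_pow]
          have : (2 * |z| + 1) ^ k ≠ 0 := by positivity
          field_simp
    _ ≤ _ := mul_le_mul_of_nonneg_left hG (by positivity)

theorem continuous_mittagLeffler {ρ β : ℝ} (hρ : 0 < ρ) (hβ : 0 < β) :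
    Continuous (mittagLeffler ρ β) := by
  rw [continuous_iff_continuousAt]
  intro z
  have h : ContinuousOn (mittagLeffler ρ β) (Icc (z - 1) (z + 1)) := by
    refine continuousOn_tsum (u := fun k : ℕ => (|z| + 1) ^ k / Real.Gamma (ρ * k + β))
      (fun k => by fun_prop) (summable_pow_div_Gamma hρ hβ _) fun k w hw => ?_
    rw [norm_div, norm_pow, Real.norm_eq_abs, Real.norm_eq_abs,
      abs_of_pos (Gamma_mul_add_pos hρ hβ k)]
    have : |w| ≤ |z| + 1 := by
      have : |w - z| ≤ 1 := abs_le.2 ⟨by linarith [hw.1], by linarith [hw.2]⟩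
      linarith [abs_sub_abs_le_abs_sub w z]
    have := Gamma_mul_add_pos hρ hβ k
    gcongr
  exact h.continuousAt (Icc_mem_nhds (by linarith) (by linarith))

theorem mittagLeffler_zero (ρ β : ℝ) : mittagLeffler ρ β 0 = 1 / Real.Gamma β := by
  rw [mittagLeffler, tsum_eq_single 0]
  · simp
  · intro k hk; simp [hk]

/-- Split off the first term and shift the index. For the kernels below this recurrence becomes a
Volterra integral equation. -/
theorem mittagLeffler_eq_add {ρ β : ℝ} (hρ : 0 < ρ) (hβ : 0 < β) (z : ℝ) :
    mittagLeffler ρ β z = 1 / Real.Gamma β + z * mittagLeffler ρ (β + ρ) z := by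
  rw [mittagLeffler, (summable_pow_div_Gamma hρ hβ z).tsum_eq_zero_add, mittagLeffler,
    ← tsum_mul_left]
  congr 1
  · simp
  · refine tsum_congr fun k => ?_
    rw [pow_succ, show ρ * ((k + 1 : ℕ) : ℝ) + β = ρ * k + (β + ρ) by push_cast; ring]
    ring

theorem mittagLeffler_pos {ρ β z : ℝ} (hρ : 0 < ρ) (hβ : 0 < β) (hz : 0 ≤ z) :
    0 < mittagLeffler ρ β z := by
  refine (summable_pow_div_Gamma hρ hβ z).tsum_pos (fun k => ?_) 0 ?_
  · have := Gamma_mul_add_pos hρ hβ k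
    positivity
  · have := Real.Gamma_pos_of_pos hβ
    simpa

theorem mittagLeffler_mono {ρ β z w : ℝ} (hρ : 0 < ρ) (hβ : 0 < β) (hz : 0 ≤ z) (hzw : z ≤ w) :
    mittagLeffler ρ β z ≤ mittagLeffler ρ β w := by
  refine (summable_pow_div_Gamma hρ hβ z).tsum_le_tsum (fun k => ?_)
    (summable_pow_div_Gamma hρ hβ w)
  have := Gamma_mul_add_pos hρ hβ k
  gcongr

/-! ### Mittag-Leffler kernels under fractional integration and differentiation. -/

/-- `x ^ (β - 1) E_{ρ,β}(l x ^ ρ)`. -/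
noncomputable def mlKernel (ρ β l x : ℝ) : ℝ := x ^ (β - 1) * mittagLeffler ρ β (l * x ^ ρ)

theorem hasSum_mlKernel {ρ β : ℝ} (hρ : 0 < ρ) (hβ : 0 < β) (l : ℝ) {x : ℝ} (hx : 0 < x) :
    HasSum (fun k : ℕ => l ^ k * (x ^ (ρ * k + β - 1) / Real.Gamma (ρ * k + β)))
      (mlKernel ρ β l x) := by
  have h := (summable_pow_div_Gamma hρ hβ (l * x ^ ρ)).hasSum.mul_left (x ^ (β - 1))
  refine h.congr_fun fun k => ?_
  rw [mul_pow, ← Real.rpow_natCast (x ^ ρ), ← Real.rpow_mul hx.le,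
    show ρ * k + β - 1 = (β - 1) + ρ * k by ring, Real.rpow_add hx]
  ring

theorem continuousOn_mlKernel {ρ β : ℝ} (hρ : 0 < ρ) (hβ : 0 < β) (l : ℝ) :
    ContinuousOn (mlKernel ρ β l) (Ioi 0) := by
  unfold mlKernel
  refine ContinuousOn.mul ?_ ((continuous_mittagLeffler hρ hβ).comp_continuousOn ?_)
  · exact fun x hx => (Real.continuousAt_rpow_const x _ (Or.inl (ne_of_gt hx))).continuousWithinAt
  · exact continuousOn_const.mul fun x hx =>
      (Real.continuousAt_rpow_const x _ (Or.inl (ne_of_gt hx))).continuousWithinAt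

theorem continuous_mlKernel {ρ β : ℝ} (hρ : 0 < ρ) (hβ : 1 ≤ β) (l : ℝ) :
    Continuous (mlKernel ρ β l) := by
  unfold mlKernel
  refine Continuous.mul (Real.continuous_rpow_const (by linarith))
    ((continuous_mittagLeffler hρ (by linarith)).comp ?_)
  exact continuous_const.mul (Real.continuous_rpow_const hρ.le)

theorem mlKernel_eq_add {ρ β : ℝ} (hρ : 0 < ρ) (hβ : 0 < β) (l : ℝ) {x : ℝ} (hx : 0 < x) :
    mlKernel ρ β l x = x ^ (β - 1) / Real.Gamma β + l * mlKernel ρ (β + ρ) l x := by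
  rw [mlKernel, mittagLeffler_eq_add hρ hβ, mlKernel,
    show β + ρ - 1 = (β - 1) + ρ by ring, Real.rpow_add hx]
  ring

theorem intervalIntegrable_sub_rpow_mul_mlKernel {ρ β γ : ℝ} (hρ : 0 < ρ) (hβ : 0 < β) (hγ : 0 < γ)
    (l : ℝ) {x : ℝ} (hx : 0 < x) :
    IntervalIntegrable (fun s => (x - s) ^ (γ - 1) * mlKernel ρ β l s) volume 0 x := by
  have h := (intervalIntegrable_sub_rpow_mul_rpow hγ hβ hx).mul_continuousOn
    (g := fun s => mittagLeffler ρ β (l * s ^ ρ))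
    (((continuous_mittagLeffler hρ hβ).comp
      (continuous_const.mul (Real.continuous_rpow_const hρ.le))).continuousOn)
  exact h.congr fun s _ => by simp only [mlKernel]; ring

/-- Fractional integration raises the exponent of every power in the series by γ. Sum and integral
may be exchanged because the integrals of the absolute values form the same series with |l| in place
of l. -/
theorem fracInt_mlKernel {ρ β γ : ℝ} (hρ : 0 < ρ) (hβ : 0 < β) (hγ : 0 < γ)
    (l : ℝ) {x : ℝ} (hx : 0 < x) :
    fracInt γ (mlKernel ρ β l) x = mlKernel ρ (β + γ) l x := by
  have hΓ := Real.Gamma_pos_of_pos hγ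
  have hterm : ∀ k : ℕ, ∀ m : ℝ, ∫ s in Ioc 0 x, (x - s) ^ (γ - 1) *
      (m * (s ^ (ρ * k + β - 1) / Real.Gamma (ρ * k + β)))
      = Real.Gamma γ * (m * (x ^ (ρ * k + (β + γ) - 1) / Real.Gamma (ρ * k + (β + γ)))) := by
    intro k m
    have h1 := fracInt_rpow hγ (b := ρ * k + β) (by positivity) hx
    have h2 : ∀ s : ℝ, (x - s) ^ (γ - 1) * (m * (s ^ (ρ * k + β - 1) / Real.Gamma (ρ * k + β)))
      = m * ((x - s) ^ (γ - 1) * (s ^ (ρ * k + β - 1) / Real.Gamma (ρ * k + β))) := fun s => by ring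
    simp only [h2]
    rw [← intervalIntegral.integral_of_le hx.le, intervalIntegral.integral_const_mul, ← add_assoc,
      ← h1, fracInt]
    field_simp
  have hint : ∀ k : ℕ, ∀ m : ℝ, IntegrableOn (fun s => (x - s) ^ (γ - 1) *
      (m * (s ^ (ρ * k + β - 1) / Real.Gamma (ρ * k + β)))) (Ioc 0 x) := by
    intro k m
    have h := (intervalIntegrable_sub_rpow_mul_rpow hγ (b := ρ * k + β) (by positivity) hx).const_mul
      (m / Real.Gamma (ρ * k + β))
    rw [intervalIntegrable_iff_integrableOn_Ioc_of_le hx.le] at h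
    refine h.congr (Filter.Eventually.of_forall fun s => ?_)
    simp only; ring
  have hsum := hasSum_integral_of_summable_integral_norm (μ := volume.restrict (Ioc 0 x))
    (F := fun (k : ℕ) s => (x - s) ^ (γ - 1) *
      (l ^ k * (s ^ (ρ * k + β - 1) / Real.Gamma (ρ * k + β)))) (fun k => hint k _) ?_
  · have h1 : ∫ s in Ioc 0 x, ∑' k : ℕ, (x - s) ^ (γ - 1) *
        (l ^ k * (s ^ (ρ * k + β - 1) / Real.Gamma (ρ * k + β)))
        = ∫ s in Ioc 0 x, (x - s) ^ (γ - 1) * mlKernel ρ β l s := by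
      refine setIntegral_congr_fun measurableSet_Ioc fun s hs => ?_
      rw [tsum_mul_left, (hasSum_mlKernel hρ hβ l hs.1).tsum_eq]
    rw [h1, ← intervalIntegral.integral_of_le hx.le] at hsum
    simp only [hterm] at hsum
    have h2 := (hasSum_mlKernel hρ (add_pos hβ hγ) l hx).mul_left (Real.Gamma γ)
    rw [fracInt, hsum.unique h2]
    field_simp
  · have h1 : ∀ k : ℕ, ∫ s in Ioc 0 x, ‖(x - s) ^ (γ - 1) *
        (l ^ k * (s ^ (ρ * k + β - 1) / Real.Gamma (ρ * k + β)))‖ =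
        ∫ s in Ioc 0 x, (x - s) ^ (γ - 1) *
        (|l| ^ k * (s ^ (ρ * k + β - 1) / Real.Gamma (ρ * k + β))) := by
      intro k
      refine setIntegral_congr_fun measurableSet_Ioc fun s hs => ?_
      rw [norm_mul, norm_mul, norm_pow, Real.norm_eq_abs, Real.norm_eq_abs, Real.norm_eq_abs,
        abs_of_nonneg (Real.rpow_nonneg (by linarith [hs.2]) _), abs_of_nonneg (div_nonneg
          (Real.rpow_nonneg hs.1.le _) (Gamma_mul_add_pos hρ hβ k).le)]
    simp only [h1, hterm]
    exact ((hasSum_mlKernel hρ (add_pos hβ hγ) |l| hx).mul_left (Real.Gamma γ)).summable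

/-- The case γ = 1 of `fracInt_mlKernel` with the fundamental theorem of calculus; no termwise
differentiation is needed. -/
theorem hasDerivAt_mlKernel {ρ β : ℝ} (hρ : 0 < ρ) (hβ : 0 < β) (l : ℝ) {x : ℝ} (hx : 0 < x) :
    HasDerivAt (mlKernel ρ (β + 1) l) (mlKernel ρ β l x) x := by
  have hint := intervalIntegrable_sub_rpow_mul_mlKernel hρ hβ one_pos l hx
  simp only [sub_self, Real.rpow_zero, one_mul] at hint
  have hc := (continuousOn_mlKernel hρ hβ l).continuousAt (Ioi_mem_nhds hx)
  have h := intervalIntegral.integral_hasDerivAt_right hint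
    ((continuousOn_mlKernel hρ hβ l).stronglyMeasurableAtFilter isOpen_Ioi x hx) hc
  refine h.congr_of_eventuallyEq ?_
  filter_upwards [Ioi_mem_nhds hx] with y hy
  rw [← fracInt_mlKernel hρ hβ one_pos l hy, fracInt_one]


/-! ### Sign and decay of Mittag-Leffler functions at negative arguments. -/

/-- The resolvent equation e + J^α e = x^(α-1)/Γ(α) for e = x^(α-1) E_{α,α}(-x^α), the source of the
sign and of the bounds of e below. -/
theorem integral_sub_rpow_mul_mlKernel {α x : ℝ} (hα : 0 < α) (hx : 0 < x) :
    ∫ s in (0 : ℝ)..x, (x - s) ^ (α - 1) * mlKernel α α (-1) s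
      = x ^ (α - 1) - Real.Gamma α * mlKernel α α (-1) x := by
  have h1 := mlKernel_eq_add hα hα (-1) hx
  rw [← fracInt_mlKernel hα hα hα (-1) hx, fracInt] at h1
  have := (Real.Gamma_pos_of_pos hα).ne'
  rw [h1]
  field_simp
  ring

/-- Positivity of the resolvent kernel `x ^ (α - 1) E_{α,α}(-x ^ α)`. -/
theorem mlKernel_neg_one_pos {α : ℝ} (hα : 0 < α) (hα1 : α ≤ 1) {x : ℝ} (hx : 0 < x) :
    0 < mlKernel α α (-1) x := by
  set e := mlKernel α α (-1) with he
  have hΓ := Real.Gamma_pos_of_pos hα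
  by_contra! hneg
  obtain ⟨η, hη, hηpos⟩ : ∃ η > 0, ∀ y, 0 < y → y < η → 0 < e y := by
    have hc : Continuous fun y : ℝ => mittagLeffler α α (-1 * y ^ α) :=
      (continuous_mittagLeffler hα hα).comp
        (continuous_const.mul (Real.continuous_rpow_const hα.le))
    have h0 : 0 < mittagLeffler α α (-1 * (0 : ℝ) ^ α) := by
      rw [Real.zero_rpow hα.ne', mul_zero, mittagLeffler_zero]; positivity
    obtain ⟨η, hη, h⟩ := Metric.eventually_nhds_iff.1 (hc.continuousAt.eventually_const_lt h0)
    refine ⟨η, hη, fun y hy hyη => mul_pos (Real.rpow_pos_of_pos hy _) (h ?_)⟩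
    rw [Real.dist_eq, sub_zero, abs_of_pos hy]; exact hyη
  have hηx : η ≤ x := by
    by_contra! h; exact absurd (hηpos x hx h) (not_lt.2 hneg)
  have hcont : ContinuousOn e (Ioi 0) := continuousOn_mlKernel hα hα (-1)
  -- The first point where e is not positive; such a point exists away from 0 because E_{α,α}(0) >
  -- 0. The resolvent equation at x0 will be compared with the one at a nearby y < x0.
  obtain ⟨x0, ⟨hx0mem, hx0e⟩, hleast⟩ :
      ∃ x0, IsLeast (Icc η x ∩ {y | e y ≤ 0}) x0 := by
    refine IsCompact.exists_isLeast ?_ ⟨x, ⟨hηx, le_rfl⟩, hneg⟩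
    have hcl : IsClosed (Icc η x ∩ e ⁻¹' Iic 0) :=
      (hcont.mono fun y hy => hη.trans_le hy.1).preimage_isClosed_of_isClosed isClosed_Icc
        isClosed_Iic
    exact isCompact_Icc.of_isClosed_subset hcl inter_subset_left
  have hx0 : 0 < x0 := hη.trans_le hx0mem.1
  have hpos : ∀ y, 0 < y → y < x0 → 0 < e y := by
    intro y hy hyx0
    by_contra! h
    rcases lt_or_ge y η with h1 | h1
    · exact absurd (hηpos y hy h1) (not_lt.2 h)
    · exact absurd (hleast ⟨⟨h1, hyx0.le.trans hx0mem.2⟩, h⟩) (not_le.2 hyx0)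
  -- The first bound gives y ≥ x0/2, hence q ≤ 2; the second makes the tail between y and x0 at most
  -- Γ(α) e(y)/4.
  set d : ℝ := min (x0 / 2) ((α * Real.Gamma α / 4) ^ (1 / α)) with hd
  have hd0 : 0 < d := lt_min (by positivity) (by positivity)
  have hd1 : d ≤ x0 / 2 := min_le_left _ _
  have hdα : d ^ α ≤ α * Real.Gamma α / 4 := by
    calc d ^ α ≤ ((α * Real.Gamma α / 4) ^ (1 / α)) ^ α :=
          Real.rpow_le_rpow hd0.le (min_le_right _ _) hα.le
      _ = _ := by rw [← Real.rpow_mul (by positivity)]; simp [hα.ne']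
  -- Choosing y as a maximum point bounds e on [y, x0] by e(y), so the tail is absorbed by the left
  -- side Γ(α) e(y).
  obtain ⟨y, hy, hymax⟩ := isCompact_Icc.exists_isMaxOn
    (nonempty_Icc.2 (by linarith : x0 - d ≤ x0))
    (hcont.mono (fun y hy => show 0 < y by linarith [hy.1] : Icc (x0 - d) x0 ⊆ Ioi 0))
  have hy0 : 0 < y := by linarith [hy.1]
  have hey : 0 < e y := (hpos (x0 - d) (by linarith) (by linarith)).trans_le
    (hymax ⟨le_rfl, by linarith⟩)
  have hyx0 : y < x0 := by
    refine lt_of_le_of_ne hy.2 fun h => ?_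
    rw [h] at hey; exact absurd hx0e (not_le.2 hey)
  have hVx0 := integral_sub_rpow_mul_mlKernel hα hx0
  have hVy := integral_sub_rpow_mul_mlKernel hα hy0
  have hI0 := intervalIntegrable_sub_rpow_mul_mlKernel hα hα hα (-1) hx0
  have hIy := intervalIntegrable_sub_rpow_mul_mlKernel hα hα hα (-1) hy0
  rw [← he] at hVx0 hVy hI0 hIy
  have hI1 : IntervalIntegrable (fun s => (x0 - s) ^ (α - 1) * e s) volume 0 y :=
    hI0.mono_set (by rw [uIcc_of_le hx0.le, uIcc_of_le hy0.le]; exact Icc_subset_Icc_right hy.2)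
  have hI2 : IntervalIntegrable (fun s => (x0 - s) ^ (α - 1) * e s) volume y x0 :=
    hI0.mono_set (by rw [uIcc_of_le hx0.le, uIcc_of_le hy.2]; exact Icc_subset_Icc_left hy0.le)
  set q : ℝ := (y / x0) ^ (α - 1) with hq
  have hq0 : 0 < q := by positivity
  have hq2 : q ≤ 2 := by
    have h1 : 1 / 2 ≤ y / x0 := by rw [le_div_iff₀ hx0]; linarith [hy.1]
    calc q ≤ (1 / 2 : ℝ) ^ (α - 1) :=
          Real.rpow_le_rpow_of_nonpos (by norm_num) h1 (by linarith)
      _ ≤ (1 / 2 : ℝ) ^ (-1 : ℝ) :=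
          Real.rpow_le_rpow_of_exponent_ge (by norm_num) (by norm_num) (by linarith)
      _ = 2 := by rw [Real.rpow_neg_one]; norm_num
  -- Since y - s ≤ (y/x0)(x0 - s) and α - 1 ≤ 0, the kernel at y dominates q times the kernel at x0;
  -- q is also the ratio of the right-hand sides y^(α-1) and x0^(α-1).
  have hcmp : q * ∫ s in (0 : ℝ)..y, (x0 - s) ^ (α - 1) * e s
      ≤ ∫ s in (0 : ℝ)..y, (y - s) ^ (α - 1) * e s := by
    rw [← intervalIntegral.integral_const_mul]
    refine intervalIntegral.integral_mono_on_of_le_Ioo hy0.le (hI1.const_mul q) hIy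
      fun s hs => ?_
    rw [← mul_assoc]
    refine mul_le_mul_of_nonneg_right ?_ (hpos s hs.1 (hs.2.trans hyx0)).le
    rw [hq, ← Real.mul_rpow (by positivity) (by linarith [hs.2])]
    refine Real.rpow_le_rpow_of_nonpos (by linarith [hs.2]) ?_ (by linarith)
    rw [div_mul_eq_mul_div, le_div_iff₀ hx0]
    nlinarith [hs.1]
  have htail : ∫ s in y..x0, (x0 - s) ^ (α - 1) * e s ≤ (x0 - y) ^ α / α * e y := by
    have hI3 : IntervalIntegrable (fun s => (x0 - s) ^ (α - 1)) volume y x0 :=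
      (intervalIntegrable_sub_rpow hα hx0).mono_set (by
        rw [uIcc_of_le hx0.le, uIcc_of_le hy.2]; exact Icc_subset_Icc_left hy0.le)
    calc ∫ s in y..x0, (x0 - s) ^ (α - 1) * e s ≤ ∫ s in y..x0, (x0 - s) ^ (α - 1) * e y := by
          refine intervalIntegral.integral_mono_on hy.2 hI2 (hI3.mul_const _) fun s hs => ?_
          exact mul_le_mul_of_nonneg_left (hymax ⟨by linarith [hy.1, hs.1], hs.2⟩)
            (Real.rpow_nonneg (by linarith [hs.2]) _)
      _ = _ := by
          rw [intervalIntegral.integral_mul_const]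
          congr 1
          have h := integral_sub_rpow_mul_sub_rpow hα one_pos hyx0
          simp only [sub_self, Real.rpow_zero, mul_one, Real.Gamma_one, add_sub_cancel_right] at h
          rw [h, Real.Gamma_add_one hα.ne']
          field_simp
  have hsplit := intervalIntegral.integral_add_adjacent_intervals hI1 hI2
  have hlow : x0 ^ (α - 1) ≤ ∫ s in (0 : ℝ)..x0, (x0 - s) ^ (α - 1) * e s := by
    have hx0' : Real.Gamma α * e x0 ≤ 0 := mul_nonpos_of_nonneg_of_nonpos hΓ.le hx0e
    rw [hVx0]; linarith
  have hyq : y ^ (α - 1) = q * x0 ^ (α - 1) := by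
    rw [hq, ← Real.mul_rpow (by positivity) hx0.le]; congr 1; field_simp
  have h1 : (x0 - y) ^ α ≤ d ^ α :=
    Real.rpow_le_rpow (by linarith) (by linarith [hy.1]) hα.le
  have h2 : Real.Gamma α * e y ≤ q * ((x0 - y) ^ α / α * e y) := by
    have h3 : q * x0 ^ (α - 1) ≤ q * ∫ s in (0 : ℝ)..x0, (x0 - s) ^ (α - 1) * e s :=
      mul_le_mul_of_nonneg_left hlow hq0.le
    have h4 := mul_le_mul_of_nonneg_left htail hq0.le
    rw [← hsplit, mul_add] at h3
    linarith
  have h5 : q * ((x0 - y) ^ α / α * e y) ≤ 2 * ((α * Real.Gamma α / 4) / α * e y) := by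
    gcongr
    exact h1.trans hdα
  have h6 : 2 * ((α * Real.Gamma α / 4) / α * e y) = Real.Gamma α * e y / 2 := by
    field_simp; ring
  nlinarith [mul_pos hΓ hey]

/-- In the resolvent equation the integral is nonnegative. -/
theorem mlKernel_neg_one_le {α : ℝ} (hα : 0 < α) (hα1 : α ≤ 1) {x : ℝ} (hx : 0 < x) :
    mlKernel α α (-1) x ≤ x ^ (α - 1) / Real.Gamma α := by
  have hΓ := Real.Gamma_pos_of_pos hα
  have h := integral_sub_rpow_mul_mlKernel hα hx
  have h0 : 0 ≤ ∫ s in (0 : ℝ)..x, (x - s) ^ (α - 1) * mlKernel α α (-1) s := by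
    rw [intervalIntegral.integral_of_le hx.le]
    refine setIntegral_nonneg measurableSet_Ioc fun s hs => ?_
    exact mul_nonneg (Real.rpow_nonneg (by linarith [hs.2]) _)
      (mlKernel_neg_one_pos hα hα1 hs.1).le
  rw [le_div_iff₀ hΓ]; linarith

theorem mlKernel_one_eq {α : ℝ} (hα : 0 < α) {x : ℝ} (hx : 0 < x) :
    mlKernel α 1 (-1) x = 1 - mlKernel α (α + 1) (-1) x := by
  rw [mlKernel_eq_add hα one_pos (-1) hx, add_comm 1 α]
  simp; ring

/-- E_{α,1}(-x^α) is J^(1-α) of the positive resolvent kernel; for α = 1 it is that kernel. -/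
theorem mlKernel_one_nonneg {α : ℝ} (hα : 0 < α) (hα1 : α ≤ 1) {x : ℝ} (hx : 0 < x) :
    0 ≤ mlKernel α 1 (-1) x := by
  rcases hα1.lt_or_eq with h | h
  · have h1 := fracInt_mlKernel hα hα (γ := 1 - α) (by linarith) (-1) hx
    rw [add_sub_cancel] at h1
    rw [← h1, fracInt, intervalIntegral.integral_of_le hx.le]
    refine mul_nonneg (inv_nonneg.2 (Real.Gamma_pos_of_pos (by linarith)).le) ?_
    refine setIntegral_nonneg measurableSet_Ioc fun s hs => ?_
    exact mul_nonneg (Real.rpow_nonneg (by linarith [hs.2]) _)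
      (mlKernel_neg_one_pos hα hα1 hs.1).le
  · subst h; exact (mlKernel_neg_one_pos hα hα1 hx).le

/-- Let I be the integral of (x-s)^α e(s). From (x-s)^α ≤ x (x-s)^(α-1) and the resolvent equation,
I ≤ x^α - Γ(α) x e(x). On the other hand, expanding E_{α,1}(-x^α) ≥ 0 by two steps of the recurrence
gives x^α - I ≤ α Γ(α). -/
theorem mul_mlKernel_neg_one_le {α : ℝ} (hα : 0 < α) (hα1 : α ≤ 1) {x : ℝ} (hx : 0 < x) :
    x * mlKernel α α (-1) x ≤ α := by
  have hΓ := Real.Gamma_pos_of_pos hα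
  have h1 := integral_sub_rpow_mul_mlKernel hα hx
  have h2 := fracInt_mlKernel hα hα (γ := α + 1) (by linarith) (-1) hx
  have h3 := mlKernel_eq_add hα (β := α + 1) (by linarith) (-1) hx
  rw [show α + 1 + α = α + (α + 1) by ring, ← h2, fracInt, add_sub_cancel_right,
    Real.Gamma_add_one hα.ne'] at h3
  have hI1 := intervalIntegrable_sub_rpow_mul_mlKernel hα hα hα (-1) hx
  have hI2 := intervalIntegrable_sub_rpow_mul_mlKernel hα hα (γ := α + 1) (by linarith) (-1) hx
  rw [add_sub_cancel_right] at hI2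
  have h4 : ∫ s in (0 : ℝ)..x, (x - s) ^ α * mlKernel α α (-1) s
      ≤ x * ∫ s in (0 : ℝ)..x, (x - s) ^ (α - 1) * mlKernel α α (-1) s := by
    rw [← intervalIntegral.integral_const_mul]
    refine intervalIntegral.integral_mono_on_of_le_Ioo hx.le hI2 (hI1.const_mul x) fun s hs => ?_
    rw [← mul_assoc]
    refine mul_le_mul_of_nonneg_right ?_ (mlKernel_neg_one_pos hα hα1 hs.1).le
    have h5 : 0 < x - s := by linarith [hs.2]
    rw [show α = 1 + (α - 1) by ring, Real.rpow_add h5, Real.rpow_one, add_sub_cancel]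
    exact mul_le_mul_of_nonneg_right (by linarith [hs.1]) (Real.rpow_nonneg h5.le _)
  rw [h1] at h4
  have h6 := mlKernel_one_nonneg hα hα1 hx
  rw [mlKernel_one_eq hα hx, h3] at h6
  have h7 : x ^ α = x * x ^ (α - 1) := by
    rw [show α = 1 + (α - 1) by ring, Real.rpow_add hx, Real.rpow_one, add_sub_cancel]
  set I := ∫ s in (0 : ℝ)..x, (x - s) ^ α * mlKernel α α (-1) s
  have h8 : (x ^ α - I) ≤ α * Real.Gamma α := by
    have : x ^ α / (α * Real.Gamma α) + -1 * ((α * Real.Gamma α)⁻¹ * I)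
        = (x ^ α - I) / (α * Real.Gamma α) := by field_simp; ring
    rw [this] at h6
    have h9 : (x ^ α - I) / (α * Real.Gamma α) ≤ 1 := by linarith
    rwa [div_le_one (by positivity)] at h9
  have h10 : Real.Gamma α * (x * mlKernel α α (-1) x) ≤ Real.Gamma α * α := by nlinarith
  exact le_of_mul_le_mul_left h10 hΓ

theorem antitoneOn_mlKernel_one {α : ℝ} (hα : 0 < α) (hα1 : α ≤ 1) :
    AntitoneOn (mlKernel α 1 (-1)) (Ioi 0) := by
  have hd : ∀ x ∈ Ioi (0 : ℝ), HasDerivAt (mlKernel α 1 (-1)) (-mlKernel α α (-1) x) x := by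
    intro x hx
    refine ((hasDerivAt_mlKernel hα hα (-1) hx).const_sub 1).congr_of_eventuallyEq ?_
    filter_upwards [Ioi_mem_nhds hx] with y hy
    exact mlKernel_one_eq hα hy
  refine antitoneOn_of_deriv_nonpos (convex_Ioi 0)
    (continuousOn_mlKernel hα one_pos (-1)) ?_ ?_
  · rw [interior_Ioi]
    exact fun x hx => (hd x hx).differentiableAt.differentiableWithinAt
  · rw [interior_Ioi]
    intro x hx
    rw [(hd x hx).deriv]
    linarith [mlKernel_neg_one_pos hα hα1 hx]

/-- For E = E_{α,1}(-x^α) one has J^α E = 1 - E ≤ 1, while J^α E is at least x^α E(x)/Γ(α+1) because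
E decreases. -/
theorem rpow_mul_mlKernel_one_le {α : ℝ} (hα : 0 < α) (hα1 : α ≤ 1) {x : ℝ} (hx : 0 < x) :
    x ^ α * mlKernel α 1 (-1) x ≤ Real.Gamma (α + 1) := by
  have hΓ := Real.Gamma_pos_of_pos hα
  have h1 := fracInt_mlKernel hα one_pos hα (-1) hx
  have h2 := mlKernel_one_eq hα hx
  rw [add_comm α 1, ← h1, fracInt] at h2
  have h3 : x ^ α / α * mlKernel α 1 (-1) x
      ≤ ∫ s in (0 : ℝ)..x, (x - s) ^ (α - 1) * mlKernel α 1 (-1) s := by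
    rw [← integral_sub_rpow hα hx, ← intervalIntegral.integral_mul_const]
    refine intervalIntegral.integral_mono_on_of_le_Ioo hx.le
      ((intervalIntegrable_sub_rpow hα hx).mul_const _)
      (intervalIntegrable_sub_rpow_mul_mlKernel hα one_pos hα (-1) hx) fun s hs => ?_
    exact mul_le_mul_of_nonneg_left (antitoneOn_mlKernel_one hα hα1 hs.1 hx hs.2.le)
      (Real.rpow_nonneg (by linarith [hs.2]) _)
  have h4 := mlKernel_one_nonneg hα hα1 hx
  rw [h2] at h4
  set I := ∫ s in (0 : ℝ)..x, (x - s) ^ (α - 1) * mlKernel α 1 (-1) s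
  have h5 : I ≤ Real.Gamma α := by
    have h6 : (Real.Gamma α)⁻¹ * I ≤ 1 := by linarith
    rwa [inv_mul_le_iff₀ hΓ, mul_one] at h6
  rw [Real.Gamma_add_one hα.ne']
  have h7 : x ^ α / α * mlKernel α 1 (-1) x ≤ Real.Gamma α := h3.trans h5
  rw [div_mul_eq_mul_div, div_le_iff₀ hα] at h7
  linarith

theorem mlKernel_one_le_one {α : ℝ} (hα : 0 < α) (hα1 : α ≤ 1) {x : ℝ} (hx : 0 < x) :
    mlKernel α 1 (-1) x ≤ 1 := by
  rw [mlKernel_one_eq hα hx, ← fracInt_mlKernel hα hα one_pos (-1) hx, fracInt_one,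
    intervalIntegral.integral_of_le hx.le]
  have : 0 ≤ ∫ s in Ioc 0 x, mlKernel α α (-1) s :=
    setIntegral_nonneg measurableSet_Ioc fun s hs => (mlKernel_neg_one_pos hα hα1 hs.1).le
  linarith

theorem rpow_inv_rpow_mul {α z : ℝ} (hα : 0 < α) (hz : 0 < z) : (z ^ (1 / α)) ^ α = z := by
  rw [← Real.rpow_mul hz.le]; simp [hα.ne']

/-- The substitution x = z^(1/α) turns the kernel estimates into estimates of functions of z,
uniform in all products z = μ x^α. -/
theorem mittagLeffler_one_neg_eq {α z : ℝ} (hα : 0 < α) (hz : 0 < z) :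
    mittagLeffler α 1 (-z) = mlKernel α 1 (-1) (z ^ (1 / α)) := by
  rw [mlKernel, rpow_inv_rpow_mul hα hz]; simp

theorem mittagLeffler_one_neg_nonneg {α z : ℝ} (hα : 0 < α) (hα1 : α ≤ 1) (hz : 0 ≤ z) :
    0 ≤ mittagLeffler α 1 (-z) := by
  rcases hz.lt_or_eq with hz | rfl
  · rw [mittagLeffler_one_neg_eq hα hz]
    exact mlKernel_one_nonneg hα hα1 (by positivity)
  · simp [mittagLeffler_zero]

theorem mittagLeffler_one_neg_le_one {α z : ℝ} (hα : 0 < α) (hα1 : α ≤ 1) (hz : 0 ≤ z) :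
    mittagLeffler α 1 (-z) ≤ 1 := by
  rcases hz.lt_or_eq with hz | rfl
  · rw [mittagLeffler_one_neg_eq hα hz]
    exact mlKernel_one_le_one hα hα1 (by positivity)
  · simp [mittagLeffler_zero]

theorem mul_mittagLeffler_one_neg_le {α z : ℝ} (hα : 0 < α) (hα1 : α ≤ 1) (hz : 0 < z) :
    z * mittagLeffler α 1 (-z) ≤ Real.Gamma (α + 1) := by
  have h := rpow_mul_mlKernel_one_le hα hα1 (x := z ^ (1 / α)) (by positivity)
  rwa [rpow_inv_rpow_mul hα hz, ← mittagLeffler_one_neg_eq hα hz] at h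

theorem mittagLeffler_self_neg_eq {α z : ℝ} (hα : 0 < α) (hz : 0 < z) :
    mlKernel α α (-1) (z ^ (1 / α)) = (z ^ (1 / α)) ^ (α - 1) * mittagLeffler α α (-z) := by
  rw [mlKernel, rpow_inv_rpow_mul hα hz, neg_one_mul]

theorem mittagLeffler_self_neg_nonneg {α z : ℝ} (hα : 0 < α) (hα1 : α ≤ 1) (hz : 0 < z) :
    0 ≤ mittagLeffler α α (-z) := by
  have h := mlKernel_neg_one_pos hα hα1 (x := z ^ (1 / α)) (by positivity)
  rw [mittagLeffler_self_neg_eq hα hz] at h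
  exact (pos_of_mul_pos_right h (by positivity)).le

theorem mittagLeffler_self_neg_le {α z : ℝ} (hα : 0 < α) (hα1 : α ≤ 1) (hz : 0 < z) :
    mittagLeffler α α (-z) ≤ (Real.Gamma α)⁻¹ := by
  have h := mlKernel_neg_one_le hα hα1 (x := z ^ (1 / α)) (by positivity)
  rw [mittagLeffler_self_neg_eq hα hz, div_eq_mul_inv] at h
  exact le_of_mul_le_mul_left h (by positivity)

theorem mul_mittagLeffler_self_neg_le {α z : ℝ} (hα : 0 < α) (hα1 : α ≤ 1) (hz : 0 < z) :
    z * mittagLeffler α α (-z) ≤ α := by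
  have h := mul_mlKernel_neg_one_le hα hα1 (x := z ^ (1 / α)) (by positivity)
  rw [mittagLeffler_self_neg_eq hα hz, ← mul_assoc] at h
  have h2 : z ^ (1 / α) * (z ^ (1 / α)) ^ (α - 1) = z := by
    nth_rewrite 1 [← Real.rpow_one (z ^ (1 / α))]
    rw [← Real.rpow_add (by positivity), add_sub_cancel, rpow_inv_rpow_mul hα hz]
  rwa [h2] at h

/-- A decay rate between the two bounds on `E_{α,α}(-z)`. -/
theorem mittagLeffler_self_neg_le_rpow {α : ℝ} (hα : 0 < α) (hα1 : α ≤ 1) :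
    ∃ C > 0, ∀ z > 0, mittagLeffler α α (-z) ≤ C * z ^ (-(3 / 4) : ℝ) := by
  have hΓ := Real.Gamma_pos_of_pos hα
  -- The exponent 3/4 interpolates between the exponents 0 and 1 of the two known bounds. Below 1 it
  -- leaves an integrable singularity x^(α/4-1) in the series; above 1/2 it leaves coefficients that
  -- are summable against square summable data.
  refine ⟨(Real.Gamma α)⁻¹ + α, by positivity, fun z hz => ?_⟩
  rcases le_or_gt z 1 with h | h
  · calc _ ≤ (Real.Gamma α)⁻¹ * 1 := by simpa using mittagLeffler_self_neg_le hα hα1 hz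
      _ ≤ ((Real.Gamma α)⁻¹ + α) * z ^ (-(3 / 4) : ℝ) := by
        gcongr
        · linarith
        · exact Real.one_le_rpow_of_pos_of_le_one_of_nonpos hz h (by norm_num)
  · calc mittagLeffler α α (-z) ≤ α * z ^ (-1 : ℝ) := by
          rw [Real.rpow_neg_one, ← div_eq_mul_inv, le_div_iff₀ hz, mul_comm]
          exact mul_mittagLeffler_self_neg_le hα hα1 hz
      _ ≤ ((Real.Gamma α)⁻¹ + α) * z ^ (-(3 / 4) : ℝ) := by
        gcongr
        · have : 0 < (Real.Gamma α)⁻¹ := by positivity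
          linarith
        · exact h.le
        · norm_num


/-! ### Quotients of Mittag-Leffler functions at positive arguments. -/

theorem Gamma_add_nat_le {x : ℝ} (hx : 0 < x) (n : ℕ) :
    Real.Gamma (x + n) ≤ (x + n) ^ n * Real.Gamma x := by
  induction n with
  | zero => simp
  | succ n ih =>
    have h : x + n ≠ 0 := by positivity
    have hΓ := Real.Gamma_pos_of_pos hx
    rw [Nat.cast_succ, ← add_assoc, Real.Gamma_add_one h]
    calc (x + n) * Real.Gamma (x + n) ≤ (x + n) * ((x + n) ^ n * Real.Gamma x) := by gcongr
      _ = (x + n) ^ (n + 1) * Real.Gamma x := by ring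
      _ ≤ (x + n + 1) ^ (n + 1) * Real.Gamma x :=
        mul_le_mul_of_nonneg_right (pow_le_pow_left₀ (by positivity) (by linarith) _) hΓ.le

theorem exists_pow_mul_geometric_le (c q : ℝ) (hc : 0 ≤ c) (hq0 : 0 ≤ q) (hq : q < 1) (n : ℕ) :
    ∃ C > 0, ∀ j : ℕ, (c * (j + 1)) ^ n * q ^ j ≤ C := by
  -- As q may be 0, it is replaced by a positive ratio, by which one can divide.
  set p := max q (1 / 2) with hp
  have hp0 : 0 < p := lt_max_of_lt_right (by norm_num)
  have hp1 : p < 1 := max_lt hq (by norm_num)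
  have h := tendsto_pow_const_mul_const_pow_of_abs_lt_one n (r := p) (by rwa [abs_of_pos hp0])
  obtain ⟨B, hB⟩ := h.bddAbove_range
  refine ⟨c ^ n * (|B| + 1) / p + 1, by positivity, fun j => ?_⟩
  have hj := hB ⟨j + 1, rfl⟩
  have h1 : ((j : ℝ) + 1) ^ n * p ^ (j + 1) ≤ |B| + 1 := by
    have : ((j : ℝ) + 1) ^ n * p ^ (j + 1) ≤ B := by exact_mod_cast hj
    linarith [le_abs_self B]
  calc (c * (j + 1)) ^ n * q ^ j ≤ (c * (j + 1)) ^ n * p ^ j := by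
        gcongr; exact le_max_left _ _
    _ = c ^ n * (((j : ℝ) + 1) ^ n * p ^ (j + 1)) / p := by
        rw [mul_pow, pow_succ]; field_simp
    _ ≤ c ^ n * (|B| + 1) / p := by gcongr
    _ ≤ _ := by linarith

/-- Compare coefficients after a shift by N: the quotient of the Gamma values is polynomial in j,
and q^j beats any polynomial. -/
theorem exists_pow_mul_mittagLeffler_le {ρ β β' q z₀ : ℝ} (hρ : 0 < ρ) (hβ : 0 < β) (hβ' : 0 < β')
    (hq0 : 0 ≤ q) (hq : q < 1) (hz₀ : 0 < z₀) (M : ℕ) :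
    ∃ C > 0, ∀ z ≥ z₀, z ^ M * mittagLeffler ρ β (q * z) ≤ C * mittagLeffler ρ β' z := by
  -- The extra N1 powers push the argument of Γ beyond 2, where Γ is monotone; they are removed at
  -- the end with z ≥ z₀.
  obtain ⟨N1, hN1⟩ := exists_nat_ge (2 / ρ)
  set N := M + N1 with hN
  have hN2 : 2 ≤ ρ * N := by
    rw [div_le_iff₀ hρ] at hN1
    rw [hN]; push_cast
    nlinarith [Nat.cast_nonneg (α := ℝ) M]
  obtain ⟨n, hn⟩ := exists_nat_ge (ρ * N + β')
  obtain ⟨C, hC, hCj⟩ := exists_pow_mul_geometric_le (ρ + β + n) q (by positivity) hq0 hq n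
  have hcoef : ∀ j : ℕ, q ^ j / Real.Gamma (ρ * j + β)
      ≤ C / Real.Gamma (ρ * ((j + N : ℕ) : ℝ) + β') := by
    intro j
    have h1 := Gamma_mul_add_pos hρ hβ j
    have h2 := Gamma_mul_add_pos hρ hβ' (j + N)
    rw [div_le_div_iff₀ h1 h2]
    have h3 : Real.Gamma (ρ * ((j + N : ℕ) : ℝ) + β') ≤ Real.Gamma (ρ * j + β + n) := by
      have h5 : 0 ≤ ρ * j := by positivity
      have h6 : ρ * ((j + N : ℕ) : ℝ) = ρ * j + ρ * N := by push_cast; ring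
      refine Real.Gamma_strictMonoOn_Ici.monotoneOn ?_ ?_ ?_
      · simp only [mem_Ici]; linarith
      · simp only [mem_Ici]; linarith
      · linarith
    have h4 := Gamma_add_nat_le (x := ρ * j + β) (by positivity) n
    have h5 : (ρ * j + β + n) ≤ (ρ + β + n) * (j + 1) := by
      have : (0 : ℝ) ≤ j := by positivity
      have : (0 : ℝ) ≤ n := by positivity
      nlinarith [mul_nonneg hβ.le (Nat.cast_nonneg (α := ℝ) j),
        mul_nonneg (Nat.cast_nonneg (α := ℝ) n) (Nat.cast_nonneg (α := ℝ) j)]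
    calc q ^ j * Real.Gamma (ρ * ((j + N : ℕ) : ℝ) + β')
        ≤ q ^ j * ((ρ * j + β + n) ^ n * Real.Gamma (ρ * j + β)) := by gcongr; exact h3.trans h4
      _ ≤ q ^ j * (((ρ + β + n) * (j + 1)) ^ n * Real.Gamma (ρ * j + β)) := by gcongr
      _ = (((ρ + β + n) * (j + 1)) ^ n * q ^ j) * Real.Gamma (ρ * j + β) := by ring
      _ ≤ C * Real.Gamma (ρ * j + β) := by gcongr; exact hCj j
  refine ⟨C / z₀ ^ N1, by positivity, fun z hz => ?_⟩
  have hz0 : 0 < z := hz₀.trans_le hz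
  have hmain : z ^ N * mittagLeffler ρ β (q * z) ≤ C * mittagLeffler ρ β' z := by
    rw [mittagLeffler, ← tsum_mul_left]
    have hs := summable_pow_div_Gamma hρ hβ' z
    have hs2 : Summable fun j : ℕ => C * (z ^ (j + N) / Real.Gamma (ρ * ((j + N : ℕ) : ℝ) + β')) :=
      ((summable_nat_add_iff N).2 hs).mul_left C
    calc ∑' k : ℕ, z ^ N * ((q * z) ^ k / Real.Gamma (ρ * k + β))
        ≤ ∑' k : ℕ, C * (z ^ (k + N) / Real.Gamma (ρ * ((k + N : ℕ) : ℝ) + β')) := by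
          refine ((summable_pow_div_Gamma hρ hβ (q * z)).mul_left _).tsum_le_tsum
            (fun k => ?_) hs2
          calc z ^ N * ((q * z) ^ k / Real.Gamma (ρ * k + β))
              = z ^ (k + N) * (q ^ k / Real.Gamma (ρ * k + β)) := by rw [mul_pow, pow_add]; ring
            _ ≤ z ^ (k + N) * (C / Real.Gamma (ρ * ((k + N : ℕ) : ℝ) + β')) :=
                mul_le_mul_of_nonneg_left (hcoef k) (by positivity)
            _ = _ := by ring
      _ = C * ∑' k : ℕ, z ^ (k + N) / Real.Gamma (ρ * ((k + N : ℕ) : ℝ) + β') := tsum_mul_left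
      _ ≤ C * mittagLeffler ρ β' z := by
          refine mul_le_mul_of_nonneg_left ?_ hC.le
          rw [mittagLeffler, ← hs.sum_add_tsum_nat_add N]
          refine le_add_of_nonneg_left (Finset.sum_nonneg fun k _ => ?_)
          have := Gamma_mul_add_pos hρ hβ' k
          positivity
  have hE := mittagLeffler_pos hρ hβ (mul_nonneg hq0 hz0.le)
  rw [div_mul_eq_mul_div, le_div_iff₀ (by positivity)]
  calc z ^ M * mittagLeffler ρ β (q * z) * z₀ ^ N1
      ≤ z ^ M * mittagLeffler ρ β (q * z) * z ^ N1 := by gcongr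
    _ = z ^ N * mittagLeffler ρ β (q * z) := by rw [hN, pow_add]; ring
    _ ≤ _ := hmain

/-- Away from `x = 1` the kernels of the boundary data at `x = 1` decay faster than any power. -/
theorem exists_pow_mul_mlKernel_div_le {ρ β β' X z₀ : ℝ} (hρ : 0 < ρ) (hβ : 0 < β) (hβ' : 0 < β')
    (hX0 : 0 < X) (hX : X < 1) (hz₀ : 0 < z₀) (M : ℕ) :
    ∃ C > 0, ∀ z ≥ z₀, ∀ x ∈ Ioc 0 X,
      z ^ M * (mlKernel ρ β z x / mittagLeffler ρ β' z) ≤ C * x ^ (β - 1) := by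
  obtain ⟨C, hC, h⟩ := exists_pow_mul_mittagLeffler_le hρ hβ hβ' (q := X ^ ρ) (by positivity)
    (Real.rpow_lt_one hX0.le hX hρ) hz₀ M
  refine ⟨C, hC, fun z hz x hx => ?_⟩
  have hz0 : 0 < z := hz₀.trans_le hz
  have hD := mittagLeffler_pos hρ hβ' hz0.le
  have hx0 : 0 < x := hx.1
  rw [mul_div_assoc', div_le_iff₀ hD, mlKernel]
  have h1 : mittagLeffler ρ β (z * x ^ ρ) ≤ mittagLeffler ρ β (X ^ ρ * z) := by
    refine mittagLeffler_mono hρ hβ (by positivity) ?_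
    rw [mul_comm]
    have := Real.rpow_le_rpow hx0.le hx.2 hρ.le
    gcongr
  calc z ^ M * (x ^ (β - 1) * mittagLeffler ρ β (z * x ^ ρ))
      ≤ z ^ M * (x ^ (β - 1) * mittagLeffler ρ β (X ^ ρ * z)) := by gcongr
    _ = x ^ (β - 1) * (z ^ M * mittagLeffler ρ β (X ^ ρ * z)) := by ring
    _ ≤ x ^ (β - 1) * (C * mittagLeffler ρ β' z) :=
        mul_le_mul_of_nonneg_left (h z hz) (by positivity)
    _ = _ := by ring


/-! ### Termwise Caputo differentiation and regularity of separated series. -/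

theorem caputoDeriv_eq_fracInt {α : ℝ} (hα : α < 1) (f : ℝ → ℝ) (x : ℝ) :
    caputoDeriv α f x = fracInt (1 - α) (deriv f) x := by
  rw [caputoDeriv, if_neg hα.ne, fracInt, show 1 - α - 1 = -α by ring]

theorem deriv_congr_Ioo {f g : ℝ → ℝ} (h : ∀ s ∈ Ioo (0 : ℝ) 1, f s = g s) {x : ℝ}
    (hx : x ∈ Ioo (0 : ℝ) 1) : deriv f x = deriv g x := by
  apply Filter.EventuallyEq.deriv_eq
  filter_upwards [Ioo_mem_nhds hx.1 hx.2] with y hy using h y hy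

theorem caputoDeriv_congr {α : ℝ} {f g : ℝ → ℝ} (h : ∀ s ∈ Ioo (0 : ℝ) 1, f s = g s) {x : ℝ}
    (hx : x ∈ Ioo (0 : ℝ) 1) : caputoDeriv α f x = caputoDeriv α g x := by
  unfold caputoDeriv
  split_ifs with hα
  · exact deriv_congr_Ioo h hx
  · congr 1
    rw [intervalIntegral.integral_of_le hx.1.le, intervalIntegral.integral_of_le hx.1.le,
      integral_Ioc_eq_integral_Ioo, integral_Ioc_eq_integral_Ioo]
    refine setIntegral_congr_fun measurableSet_Ioo fun s hs => ?_
    simp only [deriv_congr_Ioo h ⟨hs.1, hs.2.trans hx.2⟩]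

theorem CaputoDifferentiable.congr {α : ℝ} {f g : ℝ → ℝ} (hf : CaputoDifferentiable α f)
    (h : ∀ s ∈ Ioo (0 : ℝ) 1, f s = g s) : CaputoDifferentiable α g := by
  intro x hx
  refine ⟨(hf x hx).1.congr_of_eventuallyEq ?_, fun hα => ?_⟩
  · filter_upwards [Ioo_mem_nhds hx.1 hx.2] with y hy using (h y hy).symm
  · refine intervalIntegrable_congr_Ioo hx.1.le (fun s hs => ?_) ((hf x hx).2 hα)
    rw [deriv_congr_Ioo h ⟨hs.1, hs.2.trans hx.2⟩]

/-- Termwise Caputo differentiation of a series. -/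
theorem caputo_tsum {ι : Type*} [Countable ι] {α : ℝ} {f f1 g : ι → ℝ → ℝ}
    (hder : ∀ k, ∀ x ∈ Ioo (0 : ℝ) 1, HasDerivAt (f k) (f1 k x) x)
    (hcont : ∀ k, ContinuousOn (f1 k) (Ioo 0 1))
    (hsum : ∀ x ∈ Ioo (0 : ℝ) 1, Summable fun k => f k x)
    (hb : ∀ X ∈ Ioo (0 : ℝ) 1, ∃ θ ∈ Ioc (0 : ℝ) 1, ∃ P : ι → ℝ, Summable P ∧
      ∀ k, ∀ x ∈ Ioc 0 X, |f1 k x| ≤ P k * x ^ (θ - 1))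
    (hlt : α < 1 → ∀ k, ∀ x ∈ Ioo (0 : ℝ) 1, fracInt (1 - α) (f1 k) x = g k x)
    (heq : α = 1 → ∀ k, ∀ x ∈ Ioo (0 : ℝ) 1, f1 k x = g k x) (hα1 : α ≤ 1) :
    CaputoDifferentiable α (fun x => ∑' k, f k x) ∧
      ∀ x ∈ Ioo (0 : ℝ) 1, caputoDeriv α (fun x => ∑' k, f k x) x = ∑' k, g k x := by
  have hD : ∀ x ∈ Ioo (0 : ℝ) 1, HasDerivAt (fun x => ∑' k, f k x) (∑' k, f1 k x) x := by
    intro x hx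
    -- The majorants hold on (0, X] with X < 1 and are singular at 0, so the derivative is taken on
    -- (x/2, (1+x)/2).
    have hX : (1 + x) / 2 ∈ Ioo (0 : ℝ) 1 := ⟨by linarith [hx.1], by linarith [hx.2]⟩
    obtain ⟨θ, hθ, P, hP, hPb⟩ := hb _ hX
    have hx2 : 0 < x / 2 := by linarith [hx.1]
    have hsub : ∀ y ∈ Ioo (x / 2) ((1 + x) / 2), y ∈ Ioo (0 : ℝ) 1 :=
      fun y hy => ⟨hx2.trans hy.1, hy.2.trans hX.2⟩
    have hxm : x ∈ Ioo (x / 2) ((1 + x) / 2) := ⟨by linarith [hx.1], by linarith [hx.2]⟩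
    refine hasDerivAt_tsum_of_isPreconnected (hP.mul_right ((x / 2) ^ (θ - 1))) isOpen_Ioo
      isPreconnected_Ioo (fun k y hy => hder k y (hsub y hy)) (fun k y hy => ?_) hxm
      (hsum x hx) hxm
    have h1 := hPb k y ⟨hx2.trans hy.1, hy.2.le⟩
    have hP0 : 0 ≤ P k := by
      have := Real.rpow_pos_of_pos (hx2.trans hy.1) (θ - 1)
      exact nonneg_of_mul_nonneg_left ((abs_nonneg _).trans h1) this
    rw [Real.norm_eq_abs]
    refine h1.trans (mul_le_mul_of_nonneg_left ?_ hP0)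
    exact Real.rpow_le_rpow_of_nonpos hx2 hy.1.le (by linarith [hθ.2])
  rcases hα1.lt_or_eq with hα | hα
  swap
  · subst hα
    refine ⟨fun x hx => ⟨(hD x hx).differentiableAt, fun h => absurd h (lt_irrefl _)⟩,
      fun x hx => ?_⟩
    rw [caputoDeriv, if_pos rfl, (hD x hx).deriv]
    exact tsum_congr fun k => heq rfl k x hx
  have hα' : 0 < 1 - α := by linarith
  have key : ∀ x ∈ Ioo (0 : ℝ) 1,
      IntervalIntegrable (fun s => (x - s) ^ (-α) * deriv (fun x => ∑' k, f k x) s) volume 0 x ∧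
      fracInt (1 - α) (deriv (fun x => ∑' k, f k x)) x = ∑' k, g k x := by
    intro x hx
    obtain ⟨θ, hθ, P, hP, hPb⟩ := hb x hx
    have hP0 : ∀ k, 0 ≤ P k := by
      intro k
      have := Real.rpow_pos_of_pos hx.1 (θ - 1)
      exact nonneg_of_mul_nonneg_left ((abs_nonneg _).trans (hPb k x ⟨hx.1, le_rfl⟩)) this
    -- All integrands are dominated by P k times the Beta integrand (x-s)^(-α) s^(θ-1), so both
    -- integrability and the exchange of sum and integral reduce to the summability of P.
    have hbeta := intervalIntegrable_sub_rpow_mul_rpow hα' hθ.1 hx.1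
    rw [intervalIntegrable_iff_integrableOn_Ioc_of_le hx.1.le, show 1 - α - 1 = -α by ring] at hbeta
    have hsub : Ioc 0 x ⊆ Ioo (0 : ℝ) 1 := fun s hs => ⟨hs.1, hs.2.trans_lt hx.2⟩
    have hbd : ∀ k, ∀ s ∈ Ioc 0 x, ‖(x - s) ^ (-α) * f1 k s‖
        ≤ P k * ((x - s) ^ (-α) * s ^ (θ - 1)) := by
      intro k s hs
      have h0 : 0 ≤ (x - s) ^ (-α) := Real.rpow_nonneg (by linarith [hs.2]) _
      rw [norm_mul, Real.norm_eq_abs, Real.norm_eq_abs, abs_of_nonneg h0]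
      calc _ ≤ (x - s) ^ (-α) * (P k * s ^ (θ - 1)) :=
            mul_le_mul_of_nonneg_left (hPb k s hs) h0
        _ = _ := by ring
    have hmeas : Measurable fun s : ℝ => (x - s) ^ (-α) := by fun_prop
    have hint : ∀ k, IntegrableOn (fun s => (x - s) ^ (-α) * f1 k s) (Ioc 0 x) := by
      intro k
      refine (hbeta.const_mul (P k)).mono' ?_ ?_
      · exact hmeas.aestronglyMeasurable.mul
          (((hcont k).mono hsub).aestronglyMeasurable measurableSet_Ioc)
      · filter_upwards [ae_restrict_mem measurableSet_Ioc] with s hs using hbd k s hs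
    have hnorm : ∀ k, ∫ s in Ioc 0 x, ‖(x - s) ^ (-α) * f1 k s‖
        ≤ P k * ∫ s in Ioc 0 x, (x - s) ^ (-α) * s ^ (θ - 1) := by
      intro k
      rw [← integral_const_mul]
      exact setIntegral_mono_on (hint k).norm (hbeta.const_mul _) measurableSet_Ioc (hbd k)
    have hs := hasSum_integral_of_summable_integral_norm hint
      (Summable.of_nonneg_of_le (fun k => integral_nonneg fun s => norm_nonneg _) hnorm
        (hP.mul_right _))
    have hsw : ∫ s in Ioc 0 x, ∑' k, (x - s) ^ (-α) * f1 k s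
        = ∫ s in Ioc 0 x, (x - s) ^ (-α) * deriv (fun x => ∑' k, f k x) s := by
      refine setIntegral_congr_fun measurableSet_Ioc fun s hs => ?_
      rw [tsum_mul_left, (hD s (hsub hs)).deriv]
    rw [hsw] at hs
    constructor
    · rw [intervalIntegrable_iff_integrableOn_Ioc_of_le hx.1.le]
      refine (hbeta.const_mul (∑' k, P k)).mono' ?_ ?_
      · exact hmeas.aestronglyMeasurable.mul (measurable_deriv _).aestronglyMeasurable
      · filter_upwards [ae_restrict_mem measurableSet_Ioc] with s hs
        have h0 : 0 ≤ (x - s) ^ (-α) := Real.rpow_nonneg (by linarith [hs.2]) _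
        rw [norm_mul, (hD s (hsub hs)).deriv, Real.norm_eq_abs ((x - s) ^ (-α)),
          abs_of_nonneg h0]
        have h1 : ‖∑' k, f1 k s‖ ≤ (∑' k, P k) * s ^ (θ - 1) := by
          rw [← tsum_mul_right]
          exact tsum_of_norm_bounded (hP.mul_right _).hasSum fun k => hPb k s hs
        calc _ ≤ (x - s) ^ (-α) * ((∑' k, P k) * s ^ (θ - 1)) :=
              mul_le_mul_of_nonneg_left h1 h0
          _ = _ := by ring
    · rw [fracInt, show 1 - α - 1 = -α by ring, intervalIntegral.integral_of_le hx.1.le,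
        ← hs.tsum_eq, ← tsum_mul_left]
      refine tsum_congr fun k => ?_
      rw [← hlt hα k x hx, fracInt, show 1 - α - 1 = -α by ring,
        intervalIntegral.integral_of_le hx.1.le]
  exact ⟨fun x hx => ⟨(hD x hx).differentiableAt, fun _ => (key x hx).1⟩,
    fun x hx => by rw [caputoDeriv_eq_fracInt hα, (key x hx).2]⟩

/-- Profiles `f k`, with Caputo derivatives `g k`, and modes `Y k` whose products form a regular
series; `f1`, `g1`, `Y1` are the ordinary derivatives. -/
structure SeparatedSeries {ι : Type*} (α : ℝ) (f f1 g g1 Y Y1 : ι → ℝ → ℝ) (m w : ι → ℝ) :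
    Prop where
  f_cont : ∀ k, ContinuousOn (f k) (Icc 0 1)
  f_bound : ∃ P : ι → ℝ, Summable P ∧ ∀ k, ∀ x ∈ Icc (0 : ℝ) 1, |f k x| ≤ P k
  f_deriv : ∀ k, ∀ x ∈ Ioo (0 : ℝ) 1, HasDerivAt (f k) (f1 k x) x
  g_deriv : ∀ k, ∀ x ∈ Ioo (0 : ℝ) 1, HasDerivAt (g k) (g1 k x) x
  f1_cont : ∀ k, ContinuousOn (f1 k) (Ioo 0 1)
  g1_cont : ∀ k, ContinuousOn (g1 k) (Ioo 0 1)
  f_caputo : α < 1 → ∀ k, ∀ x ∈ Ioo (0 : ℝ) 1, fracInt (1 - α) (f1 k) x = g k x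
  g_caputo : α < 1 → ∀ k, ∀ x ∈ Ioo (0 : ℝ) 1, fracInt (1 - α) (g1 k) x = m k * f k x
  f_eq : α = 1 → ∀ k, ∀ x ∈ Ioo (0 : ℝ) 1, f1 k x = g k x
  g_eq : α = 1 → ∀ k, ∀ x ∈ Ioo (0 : ℝ) 1, g1 k x = m k * f k x
  -- The derivatives enter Caputo integrals that start at x = 0 and need an integrable majorant
  -- there; second order quantities are needed only for x in compact subsets of (0,1).
  singular_bound : ∀ X ∈ Ioo (0 : ℝ) 1, ∃ θ ∈ Ioc (0 : ℝ) 1, ∃ P : ι → ℝ, Summable P ∧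
    ∀ k, ∀ x ∈ Ioc 0 X, |f1 k x| ≤ P k * x ^ (θ - 1) ∧ |g1 k x| ≤ P k * x ^ (θ - 1) ∧
      |g k x| ≤ P k
  interior_bound : ∀ x₀ ∈ Ioo (0 : ℝ) 1, ∀ X ∈ Ioo (0 : ℝ) 1, ∃ P : ι → ℝ, Summable P ∧
    ∀ k, ∀ x ∈ Icc x₀ X, |m k * f k x| ≤ P k ∧ w k ^ 2 * |f k x| ≤ P k
  Y_deriv : ∀ k y, HasDerivAt (Y k) (Y1 k y) y
  Y1_deriv : ∀ k y, HasDerivAt (Y1 k) (-(w k ^ 2) * Y k y) y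
  Y_bound : ∀ k y, |Y k y| ≤ 1
  Y1_bound : ∀ k y, |Y1 k y| ≤ w k

namespace SeparatedSeries

variable {ι : Type*} {α : ℝ} {f f1 g g1 Y Y1 : ι → ℝ → ℝ} {m w : ι → ℝ}

theorem abs_mul_le {a b P : ℝ} (ha : |a| ≤ P) (hb : |b| ≤ 1) : |a * b| ≤ P := by
  rw [abs_mul]
  calc |a| * |b| ≤ |a| * 1 := by gcongr
    _ ≤ P := by simpa

theorem summable (h : SeparatedSeries α f f1 g g1 Y Y1 m w) {x : ℝ} (hx : x ∈ Icc (0 : ℝ) 1)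
    (y : ℝ) : Summable fun k => f k x * Y k y := by
  obtain ⟨P, hP, hb⟩ := h.f_bound
  exact Summable.of_norm_bounded hP fun k => abs_mul_le (hb k x hx) (h.Y_bound k y)

theorem Y_cont (h : SeparatedSeries α f f1 g g1 Y Y1 m w) (k : ι) : Continuous (Y k) :=
  continuous_iff_continuousAt.2 fun y => (h.Y_deriv k y).continuousAt

/-- By 2w ≤ 1 + w², the first order terms are controlled by those of orders zero and two. -/
theorem exists_abs_mul_Y1_le (h : SeparatedSeries α f f1 g g1 Y Y1 m w) {x : ℝ}
    (hx : x ∈ Ioo (0 : ℝ) 1) :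
    ∃ P : ι → ℝ, Summable P ∧ ∀ k y, ‖f k x * Y1 k y‖ ≤ P k := by
  obtain ⟨P, hP, hb⟩ := h.interior_bound x hx x hx
  obtain ⟨Q, hQ, hbQ⟩ := h.f_bound
  refine ⟨_, hP.add hQ, fun k y => ?_⟩
  have h1 := (hb k x ⟨le_rfl, le_rfl⟩).2
  have h2 := hbQ k x (Ioo_subset_Icc_self hx)
  have h3 := h.Y1_bound k y
  rw [norm_mul, Real.norm_eq_abs, Real.norm_eq_abs]
  nlinarith [abs_nonneg (f k x), mul_nonneg (abs_nonneg (f k x)) (sq_nonneg (w k - 1)),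
    mul_le_mul_of_nonneg_left h3 (abs_nonneg (f k x))]

theorem hasDerivAt_y (h : SeparatedSeries α f f1 g g1 Y Y1 m w) {x : ℝ}
    (hx : x ∈ Ioo (0 : ℝ) 1) (y : ℝ) :
    HasDerivAt (fun y => ∑' k, f k x * Y k y) (∑' k, f k x * Y1 k y) y := by
  obtain ⟨P, hP, hb⟩ := h.exists_abs_mul_Y1_le hx
  exact hasDerivAt_tsum hP (fun k y => (h.Y_deriv k y).const_mul _)
    hb (h.summable (Ioo_subset_Icc_self hx) 0) y

theorem hasDerivAt_yy (h : SeparatedSeries α f f1 g g1 Y Y1 m w) {x : ℝ}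
    (hx : x ∈ Ioo (0 : ℝ) 1) (y : ℝ) :
    HasDerivAt (fun y => ∑' k, f k x * Y1 k y) (∑' k, -(w k ^ 2 * f k x) * Y k y) y := by
  obtain ⟨P, hP, hb⟩ := h.interior_bound x hx x hx
  obtain ⟨Q, hQ, hbQ⟩ := h.exists_abs_mul_Y1_le hx
  have hder : ∀ k y, HasDerivAt (fun y => f k x * Y1 k y) (-(w k ^ 2 * f k x) * Y k y) y :=
    fun k y => ((h.Y1_deriv k y).const_mul (f k x)).congr_deriv (by ring)
  have hbd : ∀ k y, ‖-(w k ^ 2 * f k x) * Y k y‖ ≤ P k := by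
    intro k y
    refine abs_mul_le ?_ (h.Y_bound k y)
    rw [abs_neg, abs_mul, abs_of_nonneg (sq_nonneg _)]
    exact (hb k x ⟨le_rfl, le_rfl⟩).2
  exact hasDerivAt_tsum hP hder hbd (Summable.of_norm_bounded hQ fun k => hbQ k 0) y

theorem partialYY_eq (h : SeparatedSeries α f f1 g g1 Y Y1 m w) {x : ℝ}
    (hx : x ∈ Ioo (0 : ℝ) 1) (y : ℝ) :
    partialYY (fun x y => ∑' k, f k x * Y k y) x y = ∑' k, -(w k ^ 2 * f k x) * Y k y := by
  have h1 : deriv (fun y => ∑' k, f k x * Y k y) = fun y => ∑' k, f k x * Y1 k y :=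
    funext fun y => (h.hasDerivAt_y hx y).deriv
  rw [partialYY, h1, (h.hasDerivAt_yy hx y).deriv]

theorem continuousOn_tsum_mul (hY : ∀ k, Continuous (Y k)) (hYb : ∀ k y, |Y k y| ≤ 1)
    {F : ι → ℝ → ℝ} (hF : ∀ k, ContinuousOn (F k) (Ioo 0 1))
    (hb : ∀ x₀ ∈ Ioo (0 : ℝ) 1, ∀ X ∈ Ioo (0 : ℝ) 1, ∃ P : ι → ℝ, Summable P ∧
      ∀ k, ∀ x ∈ Icc x₀ X, |F k x| ≤ P k) :
    ContinuousOn (fun p : ℝ × ℝ => ∑' k, F k p.1 * Y k p.2) rect := by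
  intro p hp
  have hx := hp.1
  have h0 : p.1 / 2 ∈ Ioo (0 : ℝ) 1 := ⟨by linarith [hx.1], by linarith [hx.2, hx.1]⟩
  have hX : (1 + p.1) / 2 ∈ Ioo (0 : ℝ) 1 := ⟨by linarith [hx.1], by linarith [hx.2]⟩
  obtain ⟨P, hP, hPb⟩ := hb _ h0 _ hX
  have hc : ContinuousOn (fun p : ℝ × ℝ => ∑' k, F k p.1 * Y k p.2)
      (Icc (p.1 / 2) ((1 + p.1) / 2) ×ˢ univ) := by
    refine continuousOn_tsum (fun k => ?_) hP fun k q hq => ?_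
    · refine ContinuousOn.mul ?_ ((hY k).comp_continuousOn continuousOn_snd)
      exact (hF k).comp continuousOn_fst fun q hq =>
        ⟨h0.1.trans_le hq.1.1, hq.1.2.trans_lt hX.2⟩
    · exact abs_mul_le (hPb k _ hq.1) (hYb k _)
  refine (hc.continuousAt ?_).continuousWithinAt
  exact prod_mem_nhds (Icc_mem_nhds (by linarith [hx.1]) (by linarith [hx.2])) Filter.univ_mem

variable [Countable ι]

theorem caputo_first (h : SeparatedSeries α f f1 g g1 Y Y1 m w) (hα1 : α ≤ 1) (y : ℝ) :
    CaputoDifferentiable α (fun x => ∑' k, f k x * Y k y) ∧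
      ∀ x ∈ Ioo (0 : ℝ) 1,
        caputoDeriv α (fun x => ∑' k, f k x * Y k y) x = ∑' k, g k x * Y k y := by
  refine caputo_tsum (f1 := fun k x => f1 k x * Y k y)
    (fun k x hx => (h.f_deriv k x hx).mul_const _)
    (fun k => (h.f1_cont k).mul continuousOn_const)
    (fun x hx => h.summable (Ioo_subset_Icc_self hx) y) (fun X hX => ?_)
    (fun hα k x hx => ?_) (fun hα k x hx => by rw [h.f_eq hα k x hx]) hα1
  · obtain ⟨θ, hθ, P, hP, hb⟩ := h.singular_bound X hX
    exact ⟨θ, hθ, P, hP, fun k x hx => abs_mul_le (hb k x hx).1 (h.Y_bound k y)⟩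
  · rw [← h.f_caputo hα k x hx, fracInt, fracInt]
    simp only [← mul_assoc]
    rw [intervalIntegral.integral_mul_const]
    ring

theorem caputo_second (h : SeparatedSeries α f f1 g g1 Y Y1 m w) (hα1 : α ≤ 1) (y : ℝ) :
    CaputoDifferentiable α (fun x => ∑' k, g k x * Y k y) ∧
      ∀ x ∈ Ioo (0 : ℝ) 1,
        caputoDeriv α (fun x => ∑' k, g k x * Y k y) x = ∑' k, m k * f k x * Y k y := by
  refine caputo_tsum (f1 := fun k x => g1 k x * Y k y)
    (fun k x hx => (h.g_deriv k x hx).mul_const _)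
    (fun k => (h.g1_cont k).mul continuousOn_const)
    (fun x hx => ?_) (fun X hX => ?_)
    (fun hα k x hx => ?_) (fun hα k x hx => by rw [h.g_eq hα k x hx]) hα1
  · obtain ⟨θ, hθ, P, hP, hb⟩ := h.singular_bound x hx
    exact Summable.of_norm_bounded hP fun k =>
      abs_mul_le (hb k x ⟨hx.1, le_rfl⟩).2.2 (h.Y_bound k y)
  · obtain ⟨θ, hθ, P, hP, hb⟩ := h.singular_bound X hX
    exact ⟨θ, hθ, P, hP, fun k x hx => abs_mul_le (hb k x hx).2.1 (h.Y_bound k y)⟩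
  · rw [← h.g_caputo hα k x hx, fracInt, fracInt]
    simp only [← mul_assoc]
    rw [intervalIntegral.integral_mul_const]
    ring

theorem caputoX_eq (h : SeparatedSeries α f f1 g g1 Y Y1 m w) (hα1 : α ≤ 1) {x : ℝ}
    (hx : x ∈ Ioo (0 : ℝ) 1) (y : ℝ) :
    caputoX α (fun x y => ∑' k, f k x * Y k y) x y = ∑' k, g k x * Y k y :=
  (h.caputo_first hα1 y).2 x hx

theorem caputoX_caputoX_eq (h : SeparatedSeries α f f1 g g1 Y Y1 m w) (hα1 : α ≤ 1) {x : ℝ}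
    (hx : x ∈ Ioo (0 : ℝ) 1) (y : ℝ) :
    caputoX α (caputoX α (fun x y => ∑' k, f k x * Y k y)) x y = ∑' k, m k * f k x * Y k y := by
  rw [← (h.caputo_second hα1 y).2 x hx]
  exact caputoDeriv_congr (fun s hs => h.caputoX_eq hα1 hs y) hx

theorem isRegularFunction (h : SeparatedSeries α f f1 g g1 Y Y1 m w) (hα1 : α ≤ 1) :
    IsRegularFunction α (fun x y => ∑' k, f k x * Y k y) where
  continuousOn := by
    obtain ⟨P, hP, hb⟩ := h.f_bound
    refine continuousOn_tsum (f := fun k (p : ℝ × ℝ) => f k p.1 * Y k p.2) (fun k => ?_) hP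
      fun k p hp => abs_mul_le (hb k _ hp.1) (h.Y_bound k _)
    exact ((h.f_cont k).comp continuousOn_fst fun p hp => hp.1).mul
      ((h.Y_cont k).comp_continuousOn continuousOn_snd)
  caputo_exists := fun y _ => (h.caputo_first hα1 y).1
  caputo_continuousOn := by
    refine (continuousOn_tsum_mul (F := g) h.Y_cont h.Y_bound (fun k x hx =>
      (h.g_deriv k x hx).continuousAt.continuousWithinAt) fun x₀ hx₀ X hX => ?_).congr
      fun p hp => h.caputoX_eq hα1 hp.1 p.2
    obtain ⟨θ, hθ, P, hP, hb⟩ := h.singular_bound X hX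
    exact ⟨P, hP, fun k x hx => (hb k x ⟨hx₀.1.trans_le hx.1, hx.2⟩).2.2⟩
  caputo_caputo_exists := fun y _ =>
    (h.caputo_second hα1 y).1.congr fun s hs => (h.caputoX_eq hα1 hs y).symm
  caputo_caputo_continuousOn := by
    refine (continuousOn_tsum_mul (F := fun k x => m k * f k x) h.Y_cont h.Y_bound (fun k x hx =>
      ((h.f_deriv k x hx).continuousAt.const_mul _).continuousWithinAt) fun x₀ hx₀ X hX => ?_).congr
      fun p hp => h.caputoX_caputoX_eq hα1 hp.1 p.2
    obtain ⟨P, hP, hb⟩ := h.interior_bound x₀ hx₀ X hX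
    exact ⟨P, hP, fun k x hx => (hb k x hx).1⟩
  yy_exists := fun x hx y _ => by
    have h1 : deriv (fun y => ∑' k, f k x * Y k y) = fun y => ∑' k, f k x * Y1 k y :=
      funext fun y => (h.hasDerivAt_y hx y).deriv
    exact ⟨(h.hasDerivAt_y hx y).differentiableAt, by
      rw [h1]; exact (h.hasDerivAt_yy hx y).differentiableAt⟩
  yy_continuousOn := by
    refine (continuousOn_tsum_mul (F := fun k x => -(w k ^ 2 * f k x)) h.Y_cont h.Y_bound
      (fun k x hx => ((h.f_deriv k x hx).continuousAt.const_mul _).neg.continuousWithinAt)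
      fun x₀ hx₀ X hX => ?_).congr fun p hp => h.partialYY_eq hp.1 p.2
    obtain ⟨P, hP, hb⟩ := h.interior_bound x₀ hx₀ X hX
    refine ⟨P, hP, fun k x hx => ?_⟩
    rw [abs_neg, abs_mul, abs_of_nonneg (sq_nonneg _)]
    exact (hb k x hx).2

end SeparatedSeries


/-! ### Trigonometric modes and the size of Fourier coefficients. -/

theorem neg_pi_le_pi : -Real.pi ≤ Real.pi := by linarith [Real.pi_pos]

theorem integral_cos_int_mul {n : ℤ} (hn : n ≠ 0) :
    ∫ y in (-Real.pi)..Real.pi, Real.cos (n * y) = 0 := by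
  have hn' : (n : ℝ) ≠ 0 := by exact_mod_cast hn
  rw [intervalIntegral.integral_comp_mul_left _ hn', integral_cos]
  simp [Real.sin_int_mul_pi]

theorem integral_cos_mul_cos {a b : ℝ} {m n : ℤ} (hm : a - b = m) (hn : a + b = n) (hn0 : n ≠ 0) :
    ∫ y in (-Real.pi)..Real.pi, Real.cos (a * y) * Real.cos (b * y)
      = if m = 0 then Real.pi else 0 := by
  have h : ∀ y, Real.cos (a * y) * Real.cos (b * y)
      = (1 / 2) * (Real.cos (m * y) + Real.cos (n * y)) := by
    intro y
    rw [← hm, ← hn, sub_mul, add_mul, Real.cos_sub, Real.cos_add]; ring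
  have hc : ∀ l : ℤ, IntervalIntegrable (fun y => Real.cos (l * y)) volume (-Real.pi) Real.pi :=
    fun l => (by fun_prop : Continuous fun y => Real.cos (l * y)).intervalIntegrable _ _
  simp only [h]
  rw [intervalIntegral.integral_const_mul, intervalIntegral.integral_add
    (hc m) (hc n), integral_cos_int_mul hn0]
  split_ifs with h0
  · subst h0; simp; ring
  · rw [integral_cos_int_mul h0]; simp

theorem integral_sin_mul_sin {a b : ℝ} {m n : ℤ} (hm : a - b = m) (hn : a + b = n) (hn0 : n ≠ 0) :
    ∫ y in (-Real.pi)..Real.pi, Real.sin (a * y) * Real.sin (b * y)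
      = if m = 0 then Real.pi else 0 := by
  have h : ∀ y, Real.sin (a * y) * Real.sin (b * y)
      = (1 / 2) * (Real.cos (m * y) - Real.cos (n * y)) := by
    intro y
    rw [← hm, ← hn, sub_mul, add_mul, Real.cos_sub, Real.cos_add]; ring
  have hc : ∀ l : ℤ, IntervalIntegrable (fun y => Real.cos (l * y)) volume (-Real.pi) Real.pi :=
    fun l => (by fun_prop : Continuous fun y => Real.cos (l * y)).intervalIntegrable _ _
  simp only [h]
  rw [intervalIntegral.integral_const_mul, intervalIntegral.integral_sub
    (hc m) (hc n), integral_cos_int_mul hn0]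
  split_ifs with h0
  · subst h0; simp; ring
  · rw [integral_cos_int_mul h0]; simp

/-- Bessel's inequality on `[-π,π]`. -/
theorem summable_sq_integral_mul {Y : ℕ → ℝ → ℝ} (hY : ∀ k, Continuous (Y k))
    (horth : ∀ j k, ∫ y in (-Real.pi)..Real.pi, Y j y * Y k y = if j = k then Real.pi else 0)
    {f : ℝ → ℝ} (hf : ContinuousOn f (Icc (-Real.pi) Real.pi)) :
    Summable fun k => (∫ y in (-Real.pi)..Real.pi, f y * Y k y) ^ 2 := by
  rw [← uIcc_of_le neg_pi_le_pi] at hf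
  have hπ := Real.pi_pos
  refine summable_of_sum_le (c := Real.pi * ∫ y in (-Real.pi)..Real.pi, f y ^ 2)
    (fun k => sq_nonneg _) fun s => ?_
  set a : ℕ → ℝ := fun k => ∫ y in (-Real.pi)..Real.pi, f y * Y k y with ha
  set g : ℝ → ℝ := fun y => ∑ k ∈ s, a k / Real.pi * Y k y with hg
  have hgc : Continuous g := by
    rw [hg]; exact continuous_finsetSum _ fun k _ => continuous_const.mul (hY k)
  have hfg : ∫ y in (-Real.pi)..Real.pi, f y * g y = (∑ k ∈ s, a k ^ 2) / Real.pi := by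
    simp only [hg, Finset.mul_sum]
    rw [intervalIntegral.integral_finsetSum, Finset.sum_div]
    · refine Finset.sum_congr rfl fun k _ => ?_
      have : ∀ y, f y * (a k / Real.pi * Y k y) = a k / Real.pi * (f y * Y k y) :=
        fun y => by ring
      simp only [this]
      rw [intervalIntegral.integral_const_mul]
      simp only [ha]; ring
    · intro k _
      exact (hf.mul (continuous_const.mul (hY k)).continuousOn).intervalIntegrable
  have hYg : ∀ k ∈ s, ∫ y in (-Real.pi)..Real.pi, Y k y * g y = a k := by
    intro k hk
    simp only [hg, Finset.mul_sum]
    rw [intervalIntegral.integral_finsetSum]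
    · have : ∀ j ∈ s, ∫ y in (-Real.pi)..Real.pi, Y k y * (a j / Real.pi * Y j y)
          = if k = j then a j else 0 := by
        intro j _
        have h1 : ∀ y, Y k y * (a j / Real.pi * Y j y) = a j / Real.pi * (Y k y * Y j y) :=
          fun y => by ring
        simp only [h1]
        rw [intervalIntegral.integral_const_mul, horth]
        split_ifs
        · field_simp
        · simp
      rw [Finset.sum_congr rfl this, Finset.sum_ite_eq, if_pos hk]
    · intro j _
      exact ((hY k).mul (continuous_const.mul (hY j))).intervalIntegrable _ _
  have hgg : ∫ y in (-Real.pi)..Real.pi, g y * g y = (∑ k ∈ s, a k ^ 2) / Real.pi := by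
    have h1 : ∀ y, g y * g y = ∑ k ∈ s, a k / Real.pi * (Y k y * g y) := by
      intro y
      conv_lhs => rw [hg]
      simp only [Finset.sum_mul, mul_assoc]
      rfl
    simp only [h1]
    rw [intervalIntegral.integral_finsetSum, Finset.sum_div]
    · refine Finset.sum_congr rfl fun k hk => ?_
      rw [intervalIntegral.integral_const_mul, hYg k hk]; ring
    · intro k _
      exact (continuous_const.mul ((hY k).mul hgc)).intervalIntegrable _ _
  have hff : IntervalIntegrable (fun y => f y ^ 2) volume (-Real.pi) Real.pi :=
    (hf.pow 2).intervalIntegrable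
  have hfgi : IntervalIntegrable (fun y => 2 * (f y * g y)) volume (-Real.pi) Real.pi :=
    ((hf.mul hgc.continuousOn).const_smul (2 : ℝ)).intervalIntegrable
  have hggi : IntervalIntegrable (fun y => g y * g y) volume (-Real.pi) Real.pi :=
    (hgc.mul hgc).intervalIntegrable _ _
  -- Here g is the orthogonal projection of f on the span of the chosen modes; expanding the square
  -- gives the inequality.
  have hpos : 0 ≤ ∫ y in (-Real.pi)..Real.pi, (f y - g y) ^ 2 :=
    intervalIntegral.integral_nonneg neg_pi_le_pi fun y _ => sq_nonneg _
  have hexp : ∀ y, (f y - g y) ^ 2 = f y ^ 2 - 2 * (f y * g y) + g y * g y := fun y => by ring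
  simp only [hexp] at hpos
  rw [intervalIntegral.integral_add (hff.sub hfgi) hggi, intervalIntegral.integral_sub hff hfgi,
    intervalIntegral.integral_const_mul, hfg, hgg] at hpos
  have : (∑ k ∈ s, a k ^ 2) / Real.pi ≤ ∫ y in (-Real.pi)..Real.pi, f y ^ 2 := by linarith
  rw [div_le_iff₀ hπ] at this
  linarith

theorem exists_deriv_of_contDiffOn_one {f : ℝ → ℝ} {a b : ℝ} (hab : a < b)
    (hf : ContDiffOn ℝ 1 f (Icc a b)) :
    ∃ f1 : ℝ → ℝ, ContinuousOn f1 (Icc a b) ∧ ∀ y ∈ Ioo a b, HasDerivAt f (f1 y) y := by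
  refine ⟨derivWithin f (Icc a b), hf.continuousOn_derivWithin (uniqueDiffOn_Icc hab) le_rfl,
    fun y hy => ?_⟩
  have h := (hf.differentiableOn one_ne_zero).hasDerivAt (Icc_mem_nhds hy.1 hy.2)
  rwa [← derivWithin_of_mem_nhds (Icc_mem_nhds hy.1 hy.2)] at h

theorem exists_deriv_of_contDiffOn_two {f : ℝ → ℝ} {a b : ℝ} (hab : a < b)
    (hf : ContDiffOn ℝ 2 f (Icc a b)) :
    ∃ f1 f2 : ℝ → ℝ, ContinuousOn f1 (Icc a b) ∧ ContinuousOn f2 (Icc a b) ∧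
      (∀ y ∈ Ioo a b, HasDerivAt f (f1 y) y) ∧ ∀ y ∈ Ioo a b, HasDerivAt f1 (f2 y) y := by
  have h1 : ContDiffOn ℝ 1 (derivWithin f (Icc a b)) (Icc a b) :=
    hf.derivWithin (uniqueDiffOn_Icc hab) (by norm_num)
  obtain ⟨f2, hf2, hd2⟩ := exists_deriv_of_contDiffOn_one hab h1
  refine ⟨derivWithin f (Icc a b), f2, h1.continuousOn, hf2, fun y hy => ?_, hd2⟩
  have h := (hf.differentiableOn two_ne_zero).hasDerivAt (Icc_mem_nhds hy.1 hy.2)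
  rwa [← derivWithin_of_mem_nhds (Icc_mem_nhds hy.1 hy.2)] at h

/-- An orthogonal family of trigonometric modes on `[-π,π]` that vanish at the end points,
with conjugate family `W`. -/
structure TrigFamily (Y W : ℕ → ℝ → ℝ) (w : ℕ → ℝ) : Prop where
  W_deriv : ∀ k y, HasDerivAt (W k) (w k * Y k y) y
  Y_deriv : ∀ k y, HasDerivAt (Y k) (-(w k) * W k y) y
  Y_left : ∀ k, Y k (-Real.pi) = 0
  Y_right : ∀ k, Y k Real.pi = 0
  Y_bound : ∀ k y, |Y k y| ≤ 1
  W_bound : ∀ k y, |W k y| ≤ 1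
  w_ge : ∀ k : ℕ, ((k : ℝ) + 1) / 2 ≤ w k
  Y_orth : ∀ j k, ∫ y in (-Real.pi)..Real.pi, Y j y * Y k y = if j = k then Real.pi else 0
  W_orth : ∀ j k, ∫ y in (-Real.pi)..Real.pi, W j y * W k y = if j = k then Real.pi else 0

namespace TrigFamily

variable {Y W : ℕ → ℝ → ℝ} {w : ℕ → ℝ}

theorem Y_cont (h : TrigFamily Y W w) (k : ℕ) : Continuous (Y k) :=
  continuous_iff_continuousAt.2 fun y => (h.Y_deriv k y).continuousAt

theorem W_cont (h : TrigFamily Y W w) (k : ℕ) : Continuous (W k) :=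
  continuous_iff_continuousAt.2 fun y => (h.W_deriv k y).continuousAt

theorem w_pos (h : TrigFamily Y W w) (k : ℕ) : 0 < w k :=
  lt_of_lt_of_le (by positivity) (h.w_ge k)

/-- One integration by parts; the boundary terms vanish because f does at ±π. -/
theorem mul_integral_eq (h : TrigFamily Y W w) {f f1 : ℝ → ℝ}
    (hf : ContinuousOn f (Icc (-Real.pi) Real.pi)) (hf1 : ContinuousOn f1 (Icc (-Real.pi) Real.pi))
    (hd : ∀ y ∈ Ioo (-Real.pi) Real.pi, HasDerivAt f (f1 y) y)
    (hl : f (-Real.pi) = 0) (hr : f Real.pi = 0) (k : ℕ) :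
    w k * ∫ y in (-Real.pi)..Real.pi, f y * Y k y
      = -∫ y in (-Real.pi)..Real.pi, f1 y * W k y := by
  rw [← uIcc_of_le neg_pi_le_pi] at hf hf1
  have := intervalIntegral.integral_mul_deriv_eq_deriv_mul_of_hasDerivAt hf
    (h.W_cont k).continuousOn (by rwa [min_eq_left neg_pi_le_pi, max_eq_right neg_pi_le_pi])
    (fun y _ => h.W_deriv k y) hf1.intervalIntegrable
    ((continuous_const.mul (h.Y_cont k)).intervalIntegrable _ _)
  rw [hl, hr, zero_mul, zero_mul, sub_zero, zero_sub] at this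
  rw [← this, ← intervalIntegral.integral_const_mul]
  refine intervalIntegral.integral_congr fun y _ => ?_
  ring

/-- In the second integration by parts the mode itself vanishes at ±π, so no boundary condition on
f' is needed. -/
theorem sq_mul_integral_eq (h : TrigFamily Y W w) {f f1 f2 : ℝ → ℝ}
    (hf : ContinuousOn f (Icc (-Real.pi) Real.pi)) (hf1 : ContinuousOn f1 (Icc (-Real.pi) Real.pi))
    (hf2 : ContinuousOn f2 (Icc (-Real.pi) Real.pi))
    (hd : ∀ y ∈ Ioo (-Real.pi) Real.pi, HasDerivAt f (f1 y) y)
    (hd1 : ∀ y ∈ Ioo (-Real.pi) Real.pi, HasDerivAt f1 (f2 y) y)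
    (hl : f (-Real.pi) = 0) (hr : f Real.pi = 0) (k : ℕ) :
    w k ^ 2 * ∫ y in (-Real.pi)..Real.pi, f y * Y k y
      = -∫ y in (-Real.pi)..Real.pi, f2 y * Y k y := by
  have h1 := h.mul_integral_eq hf hf1 hd hl hr k
  rw [← uIcc_of_le neg_pi_le_pi] at hf hf1 hf2
  have := intervalIntegral.integral_mul_deriv_eq_deriv_mul_of_hasDerivAt hf1
    (h.Y_cont k).continuousOn (by rwa [min_eq_left neg_pi_le_pi, max_eq_right neg_pi_le_pi])
    (fun y _ => h.Y_deriv k y) hf2.intervalIntegrable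
    ((continuous_const.mul (h.W_cont k)).intervalIntegrable _ _)
  rw [h.Y_left, h.Y_right, mul_zero, mul_zero, sub_zero, zero_sub] at this
  rw [sq, mul_assoc, h1, ← this, mul_neg, ← intervalIntegral.integral_const_mul,
    ← intervalIntegral.integral_neg]
  refine intervalIntegral.integral_congr fun y _ => ?_
  ring

theorem summable_sq_coefficient_one (h : TrigFamily Y W w) {f : ℝ → ℝ}
    (hf : ContDiffOn ℝ 1 f (Icc (-Real.pi) Real.pi))
    (hl : f (-Real.pi) = 0) (hr : f Real.pi = 0) :
    Summable fun k => (w k * fourierCoefficient f (Y k)) ^ 2 := by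
  obtain ⟨f1, hf1, hd⟩ := exists_deriv_of_contDiffOn_one (by linarith [Real.pi_pos]) hf
  refine ((summable_sq_integral_mul h.W_cont h.W_orth hf1).mul_left (Real.pi⁻¹ ^ 2)).congr
    fun k => ?_
  have := h.mul_integral_eq hf.continuousOn hf1 hd hl hr k
  rw [fourierCoefficient, mul_left_comm, this]; ring

theorem summable_sq_coefficient_two (h : TrigFamily Y W w) {f : ℝ → ℝ}
    (hf : ContDiffOn ℝ 2 f (Icc (-Real.pi) Real.pi))
    (hl : f (-Real.pi) = 0) (hr : f Real.pi = 0) :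
    Summable fun k => (w k ^ 2 * fourierCoefficient f (Y k)) ^ 2 := by
  obtain ⟨f1, f2, hf1, hf2, hd, hd1⟩ := exists_deriv_of_contDiffOn_two (by linarith [Real.pi_pos]) hf
  refine ((summable_sq_integral_mul h.Y_cont h.Y_orth hf2).mul_left (Real.pi⁻¹ ^ 2)).congr
    fun k => ?_
  have := h.sq_mul_integral_eq hf.continuousOn hf1 hf2 hd hd1 hl hr k
  rw [fourierCoefficient, mul_left_comm, this]; ring

/-- Negative powers of the frequencies beyond `1/2` pair with square summable sequences. -/
theorem summable_mul_rpow (h : TrigFamily Y W w) {d : ℕ → ℝ} (hd : Summable fun k => d k ^ 2)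
    {p : ℝ} (hp : 1 / 2 < p) : Summable fun k => |d k| * w k ^ (-p) := by
  have h1 : Summable fun k : ℕ => (((k : ℝ) + 1) / 2) ^ (-(2 * p)) := by
    have h2 : Summable fun k : ℕ => ((k + 1 : ℕ) : ℝ) ^ (-(2 * p)) :=
      (summable_nat_add_iff 1).2 (Real.summable_nat_rpow.2 (by linarith))
    refine (h2.mul_right ((1 / 2 : ℝ) ^ (-(2 * p)))).congr fun k => ?_
    rw [← Real.mul_rpow (by positivity) (by positivity)]
    congr 1; push_cast; ring
  refine Summable.of_nonneg_of_le (fun k => ?_) (fun k => ?_) (hd.add h1)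
  · exact mul_nonneg (abs_nonneg _) (Real.rpow_nonneg (h.w_pos k).le _)
  · have h3 : w k ^ (-p) ≤ (((k : ℝ) + 1) / 2) ^ (-p) :=
      Real.rpow_le_rpow_of_nonpos (by positivity) (h.w_ge k) (by linarith)
    have h4 : ((((k : ℝ) + 1) / 2) ^ (-p)) ^ 2 = (((k : ℝ) + 1) / 2) ^ (-(2 * p)) := by
      rw [← Real.rpow_natCast, ← Real.rpow_mul (by positivity)]; congr 1; push_cast; ring
    rw [← h4]
    have h5 : 0 ≤ w k ^ (-p) := Real.rpow_nonneg (h.w_pos k).le _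
    calc |d k| * w k ^ (-p) ≤ |d k| * (((k : ℝ) + 1) / 2) ^ (-p) := by gcongr
      _ ≤ _ := by
        rw [← sq_abs (d k)]
        nlinarith [sq_nonneg (|d k| - (((k : ℝ) + 1) / 2) ^ (-p)), sq_nonneg (|d k|),
          sq_nonneg ((((k : ℝ) + 1) / 2) ^ (-p))]

end TrigFamily

theorem trigFamily_sin : TrigFamily (fun k => sinMode (k + 1))
    (fun k y => -Real.cos (((k + 1 : ℕ) : ℝ) * y)) (fun k => ((k + 1 : ℕ) : ℝ)) where
  W_deriv k y := by
    have h := ((hasDerivAt_id y).const_mul ((k + 1 : ℕ) : ℝ)).cos.neg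
    exact h.congr_deriv (by simp [sinMode]; ring)
  Y_deriv k y := by
    have h := ((hasDerivAt_id y).const_mul ((k + 1 : ℕ) : ℝ)).sin
    exact h.congr_deriv (by simp; ring)
  Y_left k := by
    rw [sinMode, mul_neg, Real.sin_neg, Real.sin_nat_mul_pi, neg_zero]
  Y_right k := by rw [sinMode, Real.sin_nat_mul_pi]
  Y_bound k y := Real.abs_sin_le_one _
  W_bound k y := by rw [abs_neg]; exact Real.abs_cos_le_one _
  w_ge k := by push_cast; linarith [Nat.cast_nonneg (α := ℝ) k]
  Y_orth j k := by
    have h := integral_sin_mul_sin (a := ((j + 1 : ℕ) : ℝ)) (b := ((k + 1 : ℕ) : ℝ))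
      (m := (j : ℤ) - k) (n := (j : ℤ) + k + 2) (by push_cast; ring) (by push_cast; ring) (by omega)
    simp only [sinMode]
    rw [h]
    simp [sub_eq_zero]
  W_orth j k := by
    have h := integral_cos_mul_cos (a := ((j + 1 : ℕ) : ℝ)) (b := ((k + 1 : ℕ) : ℝ))
      (m := (j : ℤ) - k) (n := (j : ℤ) + k + 2) (by push_cast; ring) (by push_cast; ring) (by omega)
    simp only [neg_mul_neg]
    rw [h]
    simp [sub_eq_zero]

theorem trigFamily_cos : TrigFamily (fun k => cosMode (k + 1))
    (fun k y => Real.sin ((((k + 1 : ℕ) : ℝ) - 1 / 2) * y))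
    (fun k => ((k + 1 : ℕ) : ℝ) - 1 / 2) where
  W_deriv k y := by
    have h := ((hasDerivAt_id y).const_mul (((k + 1 : ℕ) : ℝ) - 1 / 2)).sin
    exact h.congr_deriv (by simp [cosMode]; ring)
  Y_deriv k y := by
    have h := ((hasDerivAt_id y).const_mul (((k + 1 : ℕ) : ℝ) - 1 / 2)).cos
    exact h.congr_deriv (by simp; ring)
  Y_left k := by
    rw [cosMode, mul_neg, Real.cos_neg]
    have : (((k + 1 : ℕ) : ℝ) - 1 / 2) * Real.pi = k * Real.pi + Real.pi / 2 := by push_cast; ring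
    rw [this, Real.cos_add_pi_div_two, Real.sin_nat_mul_pi, neg_zero]
  Y_right k := by
    rw [cosMode]
    have : (((k + 1 : ℕ) : ℝ) - 1 / 2) * Real.pi = k * Real.pi + Real.pi / 2 := by push_cast; ring
    rw [this, Real.cos_add_pi_div_two, Real.sin_nat_mul_pi, neg_zero]
  Y_bound k y := Real.abs_cos_le_one _
  W_bound k y := Real.abs_sin_le_one _
  w_ge k := by push_cast; linarith [Nat.cast_nonneg (α := ℝ) k]
  Y_orth j k := by
    have h := integral_cos_mul_cos (a := ((j + 1 : ℕ) : ℝ) - 1 / 2)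
      (b := ((k + 1 : ℕ) : ℝ) - 1 / 2)
      (m := (j : ℤ) - k) (n := (j : ℤ) + k + 1) (by push_cast; ring) (by push_cast; ring) (by omega)
    simp only [cosMode]
    rw [h]
    simp [sub_eq_zero]
  W_orth j k := by
    have h := integral_sin_mul_sin (a := ((j + 1 : ℕ) : ℝ) - 1 / 2)
      (b := ((k + 1 : ℕ) : ℝ) - 1 / 2)
      (m := (j : ℤ) - k) (n := (j : ℤ) + k + 1) (by push_cast; ring) (by push_cast; ring) (by omega)
    rw [h]
    simp [sub_eq_zero]


/-! ### The profiles in x and their estimates. -/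

/-- The even parts of the series at z and -z agree and the odd parts are opposite; this is the
analogue of exp z = exp(-z) + 2 sinh z. -/
theorem mittagLeffler_eq_neg_add {α : ℝ} (hα : 0 < α) (z : ℝ) :
    mittagLeffler α 1 z
      = mittagLeffler α 1 (-z) + 2 * z * mittagLeffler (2 * α) (α + 1) (z ^ 2) := by
  have h2α : 0 < 2 * α := by linarith
  have he := summable_pow_div_Gamma h2α one_pos (z ^ 2)
  have ho := (summable_pow_div_Gamma h2α (β := α + 1) (by linarith) (z ^ 2)).mul_left z
  have heven : ∀ (s : ℝ), s ^ 2 = z ^ 2 → ∀ k : ℕ,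
      s ^ (2 * k) / Real.Gamma (α * ((2 * k : ℕ) : ℝ) + 1)
        = (z ^ 2) ^ k / Real.Gamma (2 * α * k + 1) := by
    intro s hs k
    rw [pow_mul, hs]; congr 2; push_cast; ring
  have hodd : ∀ (s : ℝ), s ^ 2 = z ^ 2 → ∀ k : ℕ,
      s ^ (2 * k + 1) / Real.Gamma (α * ((2 * k + 1 : ℕ) : ℝ) + 1)
        = s * ((z ^ 2) ^ k / Real.Gamma (2 * α * k + (α + 1))) := by
    intro s hs k
    rw [pow_succ, pow_mul, hs, mul_comm _ s, mul_div_assoc]; congr 3; push_cast; ring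
  have hsplit : ∀ (s : ℝ), s ^ 2 = z ^ 2 → mittagLeffler α 1 s
      = mittagLeffler (2 * α) 1 (z ^ 2) + s * mittagLeffler (2 * α) (α + 1) (z ^ 2) := by
    intro s hs
    rw [mittagLeffler, ← tsum_even_add_odd]
    · simp only [heven s hs, hodd s hs]
      rw [tsum_mul_left, mittagLeffler, mittagLeffler]
    · simp only [heven s hs]; exact he
    · simp only [hodd s hs]
      exact (summable_pow_div_Gamma h2α (β := α + 1) (by linarith) (z ^ 2)).mul_left s
  rw [hsplit z rfl, hsplit (-z) (neg_sq z)]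
  ring

theorem mlKernel_one {ρ l : ℝ} (x : ℝ) : mlKernel ρ 1 l x = mittagLeffler ρ 1 (l * x ^ ρ) := by
  simp [mlKernel]

theorem profileS_eq (α μ x : ℝ) :
    profileS α μ x = mlKernel (2 * α) (α + 1) (μ ^ 2) x
      / mittagLeffler (2 * α) (α + 1) (μ ^ 2) := by
  rw [profileS, mlKernel, add_sub_cancel_right]

/-- Eliminating E_{α,1} at positive arguments with `mittagLeffler_eq_neg_add` cancels the products
of growing and decaying factors and leaves two bounded pieces. -/
theorem profileC_eq {α μ x : ℝ} (hα : 0 < α) (hμ : 0 < μ) (hx : 0 ≤ x) :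
    profileC α μ x = mlKernel α 1 (-μ) x - mittagLeffler α 1 (-μ) * profileS α μ x := by
  have hD := mittagLeffler_pos (ρ := 2 * α) (β := α + 1) (by linarith) (by linarith)
    (sq_nonneg μ)
  have h1 := mittagLeffler_eq_neg_add hα μ
  have h2 := mittagLeffler_eq_neg_add hα (μ * x ^ α)
  have h3 : (μ * x ^ α) ^ 2 = μ ^ 2 * x ^ (2 * α) := by
    rw [mul_pow, ← Real.rpow_natCast (x ^ α), ← Real.rpow_mul hx]
    congr 2; push_cast; ring
  rw [h3] at h2
  rw [profileC, profileS, mlKernel_one, neg_mul, h1, h2]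
  field_simp
  ring

/-- A is the power of μ lost in estimating the decaying part; T collects the weighted coefficients,
so that one summable sequence serves every bound. -/
theorem abs_add_mul_le {p q a b A T C D : ℝ} (h1 : |p| * A ≤ T) (h2 : |q| ≤ T)
    (ha : |a| ≤ C * A) (hb : |b| ≤ D) (hC : 0 ≤ C) : |p * a + q * b| ≤ (C + D) * T := by
  have hD : 0 ≤ D := (abs_nonneg b).trans hb
  calc |p * a + q * b| ≤ |p| * |a| + |q| * |b| := by
        simpa only [abs_mul] using abs_add_le (p * a) (q * b)
    _ ≤ |p| * (C * A) + |q| * D := by gcongr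
    _ = C * (|p| * A) + D * |q| := by ring
    _ ≤ C * T + D * T := by gcongr
    _ = _ := by ring

/-- The profile `p E_{α,1}(-μ x ^ α) + q S(μ x)`. -/
noncomputable def profile (α μ p q x : ℝ) : ℝ :=
  p * mlKernel α 1 (-μ) x
    + q * (mlKernel (2 * α) (α + 1) (μ ^ 2) x / mittagLeffler (2 * α) (α + 1) (μ ^ 2))

/-- The four weights in `hT` are the losses of the decaying part: none for f, μ for its derivative,
its Caputo derivative and the interior bounds, μ^(5/4) for the derivative of its Caputo derivative;
the part with q loses nothing. The lower bound z₀ makes the constants of the quotient estimates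
uniform in k. -/
theorem separatedSeries_profile {α B z₀ : ℝ} (hα : 0 < α) (hα1 : α ≤ 1) {Y W : ℕ → ℝ → ℝ}
    {w : ℕ → ℝ} (hY : TrigFamily Y W w) {μ p q : ℕ → ℝ} (hz₀ : 0 < z₀) (hμ0 : ∀ k, 0 < μ k)
    (hμ : ∀ k, z₀ ≤ μ k ^ 2) (hB : 0 ≤ B) (hw : ∀ k, w k ^ 2 ≤ B * μ k ^ 2)
    (hT : Summable fun k => |p k| + |p k| * μ k + |p k| * μ k ^ (5 / 4 : ℝ) + |q k|) :
    SeparatedSeries α (fun k => profile α (μ k) (p k) (q k))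
      (fun k x => p k * (-(μ k) * mlKernel α α (-(μ k)) x)
        + q k * (mlKernel (2 * α) α (μ k ^ 2) x / mittagLeffler (2 * α) (α + 1) (μ k ^ 2)))
      (fun k x => p k * (-(μ k) * mlKernel α 1 (-(μ k)) x)
        + q k * (mlKernel (2 * α) 1 (μ k ^ 2) x / mittagLeffler (2 * α) (α + 1) (μ k ^ 2)))
      (fun k x => p k * (μ k ^ 2 * mlKernel α α (-(μ k)) x)
        + q k * (μ k ^ 2 * (mlKernel (2 * α) (2 * α) (μ k ^ 2) x
          / mittagLeffler (2 * α) (α + 1) (μ k ^ 2))))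
      Y (fun k y => -(w k) * W k y) (fun k => μ k ^ 2) w := by
  have h2α : 0 < 2 * α := by linarith
  have hα1' : 0 < α + 1 := by linarith
  have hD : ∀ k, 0 < mittagLeffler (2 * α) (α + 1) (μ k ^ 2) := fun k =>
    mittagLeffler_pos h2α hα1' (sq_nonneg _)
  set T : ℕ → ℝ := fun k => |p k| + |p k| * μ k + |p k| * μ k ^ (5 / 4 : ℝ) + |q k| with hTdef
  have hp0 : ∀ k, 0 ≤ |p k| := fun k => abs_nonneg _
  have hp1 : ∀ k, 0 ≤ |p k| * μ k := fun k => mul_nonneg (hp0 k) (hμ0 k).le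
  have hp2 : ∀ k, 0 ≤ |p k| * μ k ^ (5 / 4 : ℝ) := fun k =>
    mul_nonneg (hp0 k) (Real.rpow_nonneg (hμ0 k).le _)
  have hT0 : ∀ k, |p k| * 1 ≤ T k := fun k => by
    simp only [hTdef]; linarith [hp1 k, hp2 k, abs_nonneg (q k)]
  have hT1 : ∀ k, |p k| * μ k ≤ T k := fun k => by
    simp only [hTdef]; linarith [hp0 k, hp2 k, abs_nonneg (q k)]
  have hT2 : ∀ k, |p k| * μ k ^ (5 / 4 : ℝ) ≤ T k := fun k => by
    simp only [hTdef]; linarith [hp0 k, hp1 k, abs_nonneg (q k)]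
  have hTq : ∀ k, |q k| ≤ T k := fun k => by
    simp only [hTdef]; linarith [hp0 k, hp1 k, hp2 k]
  have hTnn : ∀ k, 0 ≤ T k := fun k => (abs_nonneg _).trans (hTq k)
  have hSnn : ∀ β > 0, ∀ k, ∀ x > 0,
      0 ≤ mlKernel (2 * α) β (μ k ^ 2) x / mittagLeffler (2 * α) (α + 1) (μ k ^ 2) := by
    intro β hβ k x hx
    have h1 : 0 < mittagLeffler (2 * α) β (μ k ^ 2 * x ^ (2 * α)) :=
      mittagLeffler_pos h2α hβ (mul_nonneg (sq_nonneg _) (Real.rpow_nonneg hx.le _))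
    exact div_nonneg (mul_nonneg (Real.rpow_nonneg hx.le _) h1.le) (hD k).le
  have hSle : ∀ k, ∀ x ∈ Icc (0 : ℝ) 1,
      |mlKernel (2 * α) (α + 1) (μ k ^ 2) x / mittagLeffler (2 * α) (α + 1) (μ k ^ 2)| ≤ 1 := by
    intro k x hx
    have h1 : 0 < mittagLeffler (2 * α) (α + 1) (μ k ^ 2 * x ^ (2 * α)) :=
      mittagLeffler_pos h2α hα1' (mul_nonneg (sq_nonneg _) (Real.rpow_nonneg hx.1 _))
    rw [mlKernel, abs_of_nonneg (div_nonneg (mul_nonneg (Real.rpow_nonneg hx.1 _) h1.le) (hD k).le),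
      div_le_one (hD k)]
    calc _ ≤ 1 * mittagLeffler (2 * α) (α + 1) (μ k ^ 2 * x ^ (2 * α)) := by
          gcongr
          exact Real.rpow_le_one hx.1 hx.2 (by linarith)
      _ ≤ _ := by
          rw [one_mul]
          refine mittagLeffler_mono h2α hα1'
            (mul_nonneg (sq_nonneg _) (Real.rpow_nonneg hx.1 _)) ?_
          exact mul_le_of_le_one_right (sq_nonneg _) (Real.rpow_le_one hx.1 hx.2 h2α.le)
  have hz : ∀ k x, 0 ≤ x → 0 ≤ μ k * x ^ α := fun k x hx =>
    mul_nonneg (hμ0 k).le (Real.rpow_nonneg hx _)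
  have hz' : ∀ k x, 0 < x → 0 < μ k * x ^ α := fun k x hx =>
    mul_pos (hμ0 k) (Real.rpow_pos_of_pos hx _)
  have hEle : ∀ k, ∀ x, 0 ≤ x → |mlKernel α 1 (-(μ k)) x| ≤ 1 := by
    intro k x hx
    rw [mlKernel_one, neg_mul, abs_of_nonneg (mittagLeffler_one_neg_nonneg hα hα1 (hz k x hx))]
    exact mittagLeffler_one_neg_le_one hα hα1 (hz k x hx)
  have hE1 : ∀ k, ∀ x > 0, HasDerivAt (mlKernel α 1 (-(μ k)))
      (-(μ k) * mlKernel α α (-(μ k)) x) x := by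
    intro k x hx
    refine (((hasDerivAt_mlKernel hα hα (-(μ k)) hx).const_mul (-(μ k))).const_add 1
      ).congr_of_eventuallyEq ?_
    filter_upwards [Ioi_mem_nhds hx] with y hy
    rw [mlKernel_eq_add hα one_pos _ hy, add_comm 1 α]
    simp
  have hS1 : ∀ k, ∀ x > 0, HasDerivAt (mlKernel (2 * α) 1 (μ k ^ 2))
      (μ k ^ 2 * mlKernel (2 * α) (2 * α) (μ k ^ 2) x) x := by
    intro k x hx
    refine (((hasDerivAt_mlKernel h2α h2α (μ k ^ 2) hx).const_mul (μ k ^ 2)).const_add 1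
      ).congr_of_eventuallyEq ?_
    filter_upwards [Ioi_mem_nhds hx] with y hy
    rw [mlKernel_eq_add h2α one_pos _ hy, add_comm 1 (2 * α)]
    simp
  have hsubIoi : Ioo (0 : ℝ) 1 ⊆ Ioi 0 := fun x hx => hx.1
  have hfrac : ∀ {γ : ℝ} (_ : 0 < γ) {x : ℝ} (_ : 0 < x) (a b l ρ β l' ρ' β' D : ℝ)
      (_ : 0 < ρ) (_ : 0 < β) (_ : 0 < ρ') (_ : 0 < β'),
      fracInt γ (fun s => a * mlKernel ρ β l s + b * (mlKernel ρ' β' l' s / D)) x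
        = a * mlKernel ρ (β + γ) l x + b * (mlKernel ρ' (β' + γ) l' x / D) := by
    intro γ hγ x hx a b l ρ β l' ρ' β' D hρ hβ hρ' hβ'
    have h1 := (intervalIntegrable_sub_rpow_mul_mlKernel hρ hβ hγ l hx).const_mul a
    have h2 := (intervalIntegrable_sub_rpow_mul_mlKernel hρ' hβ' hγ l' hx).const_mul (b / D)
    have h3 : ∀ s, (x - s) ^ (γ - 1) * (a * mlKernel ρ β l s + b * (mlKernel ρ' β' l' s / D))
        = a * ((x - s) ^ (γ - 1) * mlKernel ρ β l s)
          + b / D * ((x - s) ^ (γ - 1) * mlKernel ρ' β' l' s) := fun s => by ring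
    rw [← fracInt_mlKernel hρ hβ hγ l hx, ← fracInt_mlKernel hρ' hβ' hγ l' hx]
    simp only [fracInt, h3]
    rw [intervalIntegral.integral_add h1 h2, intervalIntegral.integral_const_mul,
      intervalIntegral.integral_const_mul]
    ring
  exact {
    f_cont := fun k => by
      refine (Continuous.continuousOn ?_)
      exact (continuous_const.mul (continuous_mlKernel hα le_rfl _)).add
        (continuous_const.mul ((continuous_mlKernel h2α (by linarith) _).div_const _))
    f_bound := ⟨fun k => (1 + 1) * T k, hT.mul_left _, fun k x hx =>
      abs_add_mul_le (hT0 k) (hTq k) (by simpa using hEle k x hx.1) (hSle k x hx) zero_le_one⟩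
    f_deriv := fun k x hx =>
      ((hE1 k x hx.1).const_mul _).add
        (((hasDerivAt_mlKernel h2α hα _ hx.1).div_const _).const_mul _)
    g_deriv := fun k x hx =>
      ((((hE1 k x hx.1).const_mul _).const_mul _).add
        (((hS1 k x hx.1).div_const _).const_mul _)).congr_deriv (by ring)
    f1_cont := fun k =>
      (continuousOn_const.mul (continuousOn_const.mul
        ((continuousOn_mlKernel hα hα _).mono hsubIoi))).add
        (continuousOn_const.mul (((continuousOn_mlKernel h2α hα _).mono hsubIoi).div_const _))
    g1_cont := fun k =>
      (continuousOn_const.mul (continuousOn_const.mul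
        ((continuousOn_mlKernel hα hα _).mono hsubIoi))).add
        (continuousOn_const.mul (continuousOn_const.mul
          (((continuousOn_mlKernel h2α h2α _).mono hsubIoi).div_const _)))
    f_caputo := fun hlt k x hx => by
      have h := hfrac (γ := 1 - α) (by linarith) hx.1 (p k * -(μ k)) (q k) (-(μ k)) α α
        (μ k ^ 2) (2 * α) α (mittagLeffler (2 * α) (α + 1) (μ k ^ 2)) hα hα h2α hα
      rw [add_sub_cancel] at h
      simp only [← mul_assoc] at h ⊢
      exact h
    g_caputo := fun hlt k x hx => by
      have h := hfrac (γ := 1 - α) (by linarith) hx.1 (p k * μ k ^ 2) (q k * μ k ^ 2) (-(μ k)) α α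
        (μ k ^ 2) (2 * α) (2 * α) (mittagLeffler (2 * α) (α + 1) (μ k ^ 2)) hα hα h2α h2α
      rw [add_sub_cancel, show 2 * α + (1 - α) = α + 1 by ring] at h
      simp only [← mul_assoc] at h ⊢
      rw [h, profile]; ring
    f_eq := fun hα k x hx => by subst hα; rfl
    g_eq := fun hα k x hx => by
      subst hα
      rw [profile, show (1 : ℝ) + 1 = 2 * 1 by norm_num]; ring
    singular_bound := fun X hX => by
      obtain ⟨C0, hC0, hb0⟩ := exists_pow_mul_mlKernel_div_le h2α hα hα1' hX.1 hX.2 hz₀ 0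
      obtain ⟨C1, hC1, hb1⟩ := exists_pow_mul_mlKernel_div_le h2α one_pos hα1' hX.1 hX.2 hz₀ 0
      obtain ⟨C2, hC2, hb2⟩ := exists_pow_mul_mlKernel_div_le h2α h2α hα1' hX.1 hX.2 hz₀ 1
      obtain ⟨C3, hC3, hb3⟩ := mittagLeffler_self_neg_le_rpow hα hα1
      have hΓ := Real.Gamma_pos_of_pos hα
      set K : ℝ := 1 + (Real.Gamma α)⁻¹ + C0 + C1 + C2 + C3 with hK
      have hΓi : 0 < (Real.Gamma α)⁻¹ := by positivity
      -- The worst singularity is x^(α-1) (x^α)^(-3/4) = x^(α/4-1), which comes from the decay rate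
      -- 3/4 of E_{α,α}; the milder powers x^(α-1) and x^(2α-1) are dominated by it on (0,1].
      refine ⟨α / 4, ⟨by linarith, by linarith⟩, fun k => K * T k, hT.mul_left K,
        fun k x hx => ?_⟩
      have hx0 : 0 < x := hx.1
      have hx1 : x ≤ 1 := hx.2.trans hX.2.le
      have hxa : x ^ (α - 1) ≤ x ^ (α / 4 - 1) :=
        Real.rpow_le_rpow_of_exponent_ge hx0 hx1 (by linarith)
      have hx2a : x ^ (2 * α - 1) ≤ x ^ (α / 4 - 1) :=
        Real.rpow_le_rpow_of_exponent_ge hx0 hx1 (by linarith)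
      have hxpos : 0 < x ^ (α / 4 - 1) := Real.rpow_pos_of_pos hx0 _
      have hxpos' : 0 < x ^ (α - 1) := Real.rpow_pos_of_pos hx0 _
      have hEn : 0 ≤ mittagLeffler α α (-(μ k * x ^ α)) :=
        mittagLeffler_self_neg_nonneg hα hα1 (hz' k x hx0)
      have hEab : |mlKernel α α (-(μ k)) x|
          = x ^ (α - 1) * mittagLeffler α α (-(μ k * x ^ α)) := by
        rw [mlKernel, neg_mul, abs_of_nonneg (mul_nonneg hxpos'.le hEn)]
      refine ⟨?_, ?_, ?_⟩
      · refine (abs_add_mul_le (C := (Real.Gamma α)⁻¹ * x ^ (α / 4 - 1))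
          (D := C0 * x ^ (α / 4 - 1)) (hT1 k) (hTq k) ?_ ?_ (by positivity)).trans ?_
        · rw [abs_mul, abs_neg, abs_of_pos (hμ0 k), hEab]
          have h1 := mittagLeffler_self_neg_le hα hα1 (hz' k x hx0)
          calc μ k * (x ^ (α - 1) * mittagLeffler α α (-(μ k * x ^ α)))
              ≤ μ k * (x ^ (α / 4 - 1) * (Real.Gamma α)⁻¹) := by
                have := (hμ0 k).le
                gcongr
            _ = _ := by ring
        · have h1 := hb0 _ (hμ k) x hx
          rw [pow_zero, one_mul] at h1
          rw [abs_of_nonneg (hSnn α hα k x hx0)]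
          exact h1.trans (by gcongr)
        · show _ ≤ K * T k * x ^ (α / 4 - 1)
          rw [← add_mul, mul_right_comm]
          have := hTnn k
          gcongr
          linarith
      · refine (abs_add_mul_le (C := C3 * x ^ (α / 4 - 1))
          (D := C2 * x ^ (α / 4 - 1)) (hT2 k) (hTq k) ?_ ?_ (by positivity)).trans ?_
        · rw [abs_mul, abs_of_nonneg (sq_nonneg _), hEab]
          have h1 := hb3 _ (hz' k x hx0)
          have h2 : (μ k * x ^ α) ^ (-(3 / 4) : ℝ) = μ k ^ (-(3 / 4) : ℝ) * x ^ (-(3 / 4) * α) := by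
            rw [Real.mul_rpow (hμ0 k).le (Real.rpow_nonneg hx0.le _), ← Real.rpow_mul hx0.le,
              mul_comm α]
          have h3 : x ^ (α - 1) * x ^ (-(3 / 4) * α) = x ^ (α / 4 - 1) := by
            rw [← Real.rpow_add hx0]; congr 1; ring
          have h4 : μ k ^ 2 * μ k ^ (-(3 / 4) : ℝ) = μ k ^ (5 / 4 : ℝ) := by
            rw [← Real.rpow_natCast, ← Real.rpow_add (hμ0 k)]; congr 1; norm_num
          rw [h2] at h1
          calc μ k ^ 2 * (x ^ (α - 1) * mittagLeffler α α (-(μ k * x ^ α)))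
              ≤ μ k ^ 2 * (x ^ (α - 1) * (C3 * (μ k ^ (-(3 / 4) : ℝ) * x ^ (-(3 / 4) * α)))) := by
                gcongr
            _ = C3 * (x ^ (α - 1) * x ^ (-(3 / 4) * α)) * (μ k ^ 2 * μ k ^ (-(3 / 4) : ℝ)) := by
                ring
            _ = _ := by rw [h3, h4]
        · have h1 := hb2 _ (hμ k) x hx
          rw [pow_one] at h1
          rw [abs_of_nonneg (mul_nonneg (sq_nonneg _) (hSnn _ h2α k x hx0))]
          exact h1.trans (by gcongr)
        · show _ ≤ K * T k * x ^ (α / 4 - 1)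
          rw [← add_mul, mul_right_comm]
          have := hTnn k
          gcongr
          linarith
      · refine (abs_add_mul_le (C := 1) (D := C1) (hT1 k) (hTq k) ?_ ?_ zero_le_one).trans ?_
        · rw [abs_mul, abs_neg, abs_of_pos (hμ0 k), one_mul]
          exact mul_le_of_le_one_right (hμ0 k).le (hEle k x hx0.le)
        · have h1 := hb1 _ (hμ k) x hx
          rw [pow_zero, one_mul, sub_self, Real.rpow_zero, mul_one] at h1
          rwa [abs_of_nonneg (hSnn 1 one_pos k x hx0)]
        · show _ ≤ K * T k
          have := hTnn k
          gcongr
          linarith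
    interior_bound := fun x₀ hx₀ X hX => by
      obtain ⟨C1, hC1, hb1⟩ := exists_pow_mul_mlKernel_div_le h2α hα1' hα1' hX.1 hX.2 hz₀ 1
      have hΓ := Real.Gamma_pos_of_pos hα1'
      have hx0α := Real.rpow_pos_of_pos hx₀.1 α
      set K : ℝ := Real.Gamma (α + 1) / x₀ ^ α + C1 with hK
      -- For x ≥ x₀ the decay E_{α,1}(-z) ≤ Γ(α+1)/z gains one power of μ, so μ² costs only |p| μ;
      -- the other summand uses the rapid decay for x ≤ X < 1.
      have hmain : ∀ k, ∀ x ∈ Icc x₀ X, |μ k ^ 2 * profile α (μ k) (p k) (q k) x| ≤ K * T k := by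
        intro k x hx
        have hx0 : 0 < x := hx₀.1.trans_le hx.1
        have hx1 : x ≤ 1 := hx.2.trans hX.2.le
        rw [profile, mul_add, mul_left_comm _ (p k), mul_left_comm _ (q k)]
        refine abs_add_mul_le (hT1 k) (hTq k) ?_ ?_ (by positivity)
        · rw [abs_mul, abs_of_nonneg (sq_nonneg _), mlKernel_one, neg_mul,
            abs_of_nonneg (mittagLeffler_one_neg_nonneg hα hα1 (hz k x hx0.le))]
          have h1 := mul_mittagLeffler_one_neg_le hα hα1 (hz' k x hx0)
          have h2 : x₀ ^ α ≤ x ^ α := Real.rpow_le_rpow hx₀.1.le hx.1 hα.le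
          have h3 := mittagLeffler_one_neg_nonneg hα hα1 (hz k x hx0.le)
          rw [div_mul_eq_mul_div, le_div_iff₀ hx0α]
          have h4 : μ k * x₀ ^ α * mittagLeffler α 1 (-(μ k * x ^ α)) ≤ Real.Gamma (α + 1) := by
            refine le_trans ?_ h1
            have := (hμ0 k).le
            gcongr
          calc _ = μ k * (μ k * x₀ ^ α * mittagLeffler α 1 (-(μ k * x ^ α))) := by ring
            _ ≤ μ k * Real.Gamma (α + 1) := mul_le_mul_of_nonneg_left h4 (hμ0 k).le
            _ = _ := by ring
        · have h1 := hb1 _ (hμ k) x ⟨hx0, hx.2⟩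
          rw [pow_one] at h1
          rw [abs_of_nonneg (mul_nonneg (sq_nonneg _) (hSnn _ hα1' k x hx0))]
          refine h1.trans (mul_le_of_le_one_right hC1.le ?_)
          exact Real.rpow_le_one hx0.le hx1 (by linarith)
      refine ⟨fun k => (1 + B) * (K * T k), (hT.mul_left K).mul_left _, fun k x hx => ?_⟩
      have h0 := hmain k x hx
      have h1 : 0 ≤ K * T k := (abs_nonneg _).trans h0
      constructor
      · nlinarith
      · rw [abs_mul, abs_of_nonneg (sq_nonneg (μ k))] at h0
        calc w k ^ 2 * |profile α (μ k) (p k) (q k) x|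
            ≤ B * μ k ^ 2 * |profile α (μ k) (p k) (q k) x| :=
              mul_le_mul_of_nonneg_right (hw k) (abs_nonneg _)
          _ = B * (μ k ^ 2 * |profile α (μ k) (p k) (q k) x|) := by ring
          _ ≤ B * (K * T k) := mul_le_mul_of_nonneg_left h0 hB
          _ ≤ _ := by nlinarith
    Y_deriv := hY.Y_deriv
    Y1_deriv := fun k y =>
      ((hY.W_deriv k y).const_mul (-(w k))).congr_deriv (by ring)
    Y_bound := hY.Y_bound
    Y1_bound := fun k y => by
      rw [abs_mul, abs_neg, abs_of_pos (hY.w_pos k)]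
      exact mul_le_of_le_one_right (hY.w_pos k).le (hY.W_bound k y) }


/-! ### Completeness of the modes. -/

/-- Induction on m with 2 sin((n+1)z) cos z = sin((n+2)z) + sin(nz). The case n = 1 yields
orthogonality to sin z times every polynomial in cos z. -/
theorem integral_mul_sin_mul_cos_pow_eq_zero {f : ℝ → ℝ} (hf : ContinuousOn f (Icc 0 Real.pi))
    (h : ∀ n : ℕ, ∫ z in (0 : ℝ)..Real.pi, f z * Real.sin ((n + 1 : ℕ) * z) = 0) (m n : ℕ) :
    ∫ z in (0 : ℝ)..Real.pi, f z * (Real.sin (n * z) * Real.cos z ^ m) = 0 := by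
  rw [← uIcc_of_le Real.pi_pos.le] at hf
  induction m generalizing n with
  | zero =>
    cases n with
    | zero => simp
    | succ n => simpa using h n
  | succ m ih =>
    cases n with
    | zero => simp
    | succ n =>
      have hi : ∀ l : ℕ, IntervalIntegrable
          (fun z => f z * (Real.sin (l * z) * Real.cos z ^ m)) volume 0 Real.pi := fun l =>
        (hf.mul (by fun_prop : Continuous fun z : ℝ =>
          Real.sin (l * z) * Real.cos z ^ m).continuousOn).intervalIntegrable
      have h1 : ∀ z, f z * (Real.sin ((n + 1 : ℕ) * z) * Real.cos z ^ (m + 1))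
          = 1 / 2 * (f z * (Real.sin ((n + 2 : ℕ) * z) * Real.cos z ^ m)
            + f z * (Real.sin (n * z) * Real.cos z ^ m)) := by
        intro z
        have e1 : ((n + 2 : ℕ) : ℝ) * z = (n + 1 : ℕ) * z + z := by push_cast; ring
        have e2 : (n : ℝ) * z = (n + 1 : ℕ) * z - z := by push_cast; ring
        rw [e1, e2, Real.sin_add, Real.sin_sub]; ring
      simp only [h1]
      rw [intervalIntegral.integral_const_mul, intervalIntegral.integral_add (hi _) (hi _),
        ih, ih]
      simp

theorem integral_mul_sin_mul_eval_cos_eq_zero {f : ℝ → ℝ} (hf : ContinuousOn f (Icc 0 Real.pi))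
    (h : ∀ n : ℕ, ∫ z in (0 : ℝ)..Real.pi, f z * Real.sin ((n + 1 : ℕ) * z) = 0)
    (P : Polynomial ℝ) :
    ∫ z in (0 : ℝ)..Real.pi, f z * (Real.sin z * P.eval (Real.cos z)) = 0 := by
  have hf' := hf
  rw [← uIcc_of_le Real.pi_pos.le] at hf'
  induction P using Polynomial.induction_on' with
  | add p q hp hq =>
    simp only [Polynomial.eval_add, mul_add]
    rw [intervalIntegral.integral_add, hp, hq, add_zero]
    · exact (hf'.mul (by fun_prop : Continuous fun z : ℝ =>
        Real.sin z * p.eval (Real.cos z)).continuousOn).intervalIntegrable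
    · exact (hf'.mul (by fun_prop : Continuous fun z : ℝ =>
        Real.sin z * q.eval (Real.cos z)).continuousOn).intervalIntegrable
  | monomial n a =>
    have h1 := integral_mul_sin_mul_cos_pow_eq_zero hf h n 1
    have h2 : ∀ z, f z * (Real.sin z * (Polynomial.monomial n a).eval (Real.cos z))
        = a * (f z * (Real.sin ((1 : ℕ) * z) * Real.cos z ^ n)) := by
      intro z; simp; ring
    simp only [h2, intervalIntegral.integral_const_mul, h1, mul_zero]

/-- The system `sin nz`, `n ≥ 1`, is complete in `C[0,π]`. -/
theorem eq_zero_of_integral_mul_sin_eq_zero {f : ℝ → ℝ} (hf : ContinuousOn f (Icc 0 Real.pi))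
    (h : ∀ n : ℕ, ∫ z in (0 : ℝ)..Real.pi, f z * Real.sin ((n + 1 : ℕ) * z) = 0) :
    ∀ z ∈ Icc 0 Real.pi, f z = 0 := by
  have hπ := Real.pi_pos
  have hf' := hf
  rw [← uIcc_of_le hπ.le] at hf'
  obtain ⟨M, hM⟩ := isCompact_Icc.exists_bound_of_continuousOn hf
  have hM0 : 0 ≤ M := (norm_nonneg _).trans (hM 0 ⟨le_rfl, hπ.le⟩)
  have hc : ContinuousOn (fun z => f z * (Real.sin z * f z)) (uIcc 0 Real.pi) :=
    hf'.mul (Real.continuous_sin.continuousOn.mul hf')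
  have hle : ∀ e > 0, ∫ z in (0 : ℝ)..Real.pi, f z * (Real.sin z * f z) ≤ M * e * Real.pi := by
    intro e he
    -- In the variable t = cos z the Weierstrass theorem provides P with P(cos z) close to f(z).
    -- Hence the integral of f² sin z is arbitrarily small, and f = 0 where sin z > 0.
    have hg : ContinuousOn (fun t => f (Real.arccos t)) (Icc (-1) 1) :=
      hf.comp Real.continuous_arccos.continuousOn fun t _ =>
        ⟨Real.arccos_nonneg t, Real.arccos_le_pi t⟩
    obtain ⟨P, hP⟩ := exists_polynomial_near_of_continuousOn (-1) 1 _ hg e he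
    have hcP : ContinuousOn (fun z => f z * (Real.sin z * P.eval (Real.cos z)))
        (uIcc 0 Real.pi) :=
      hf'.mul (by fun_prop : Continuous fun z : ℝ =>
        Real.sin z * P.eval (Real.cos z)).continuousOn
    have h1 : ∫ z in (0 : ℝ)..Real.pi, f z * (Real.sin z * f z)
        = ∫ z in (0 : ℝ)..Real.pi, (f z * (Real.sin z * f z)
          - f z * (Real.sin z * P.eval (Real.cos z))) := by
      rw [intervalIntegral.integral_sub hc.intervalIntegrable hcP.intervalIntegrable,
        integral_mul_sin_mul_eval_cos_eq_zero hf h, sub_zero]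
    have h2 : M * e * Real.pi = ∫ z in (0 : ℝ)..Real.pi, M * e := by simp; ring
    rw [h1, h2]
    refine intervalIntegral.integral_mono_on hπ.le (hc.sub hcP).intervalIntegrable
      (continuous_const.intervalIntegrable _ _) fun z hz => ?_
    have h3 := hP (Real.cos z) ⟨Real.neg_one_le_cos z, Real.cos_le_one z⟩
    rw [Real.arccos_cos hz.1 hz.2] at h3
    have h4 := hM z hz
    rw [Real.norm_eq_abs] at h4
    calc _ = f z * (Real.sin z * -(P.eval (Real.cos z) - f z)) := by ring
      _ ≤ |f z * (Real.sin z * -(P.eval (Real.cos z) - f z))| := le_abs_self _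
      _ = |f z| * (|Real.sin z| * |P.eval (Real.cos z) - f z|) := by
          rw [abs_mul, abs_mul, abs_neg]
      _ ≤ M * (1 * e) := by
          gcongr
          exact Real.abs_sin_le_one z
      _ = M * e := by ring
  have hz0 : ∫ z in (0 : ℝ)..Real.pi, f z * (Real.sin z * f z) ≤ 0 := by
    refine le_of_forall_pos_le_add fun e he => ?_
    refine (hle (e / (M * Real.pi + 1)) (by positivity)).trans ?_
    rw [zero_add, mul_right_comm, mul_div_assoc', div_le_iff₀ (by positivity)]
    nlinarith
  have hopen : ∀ z ∈ Ioo 0 Real.pi, f z = 0 := by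
    intro z hz
    by_contra hne
    have hpos : 0 < ∫ z in (0 : ℝ)..Real.pi, f z * (Real.sin z * f z) := by
      refine intervalIntegral.integral_pos hπ (by rwa [uIcc_of_le hπ.le] at hc) (fun t ht => ?_)
        ⟨z, Ioo_subset_Icc_self hz, ?_⟩
      · have := Real.sin_nonneg_of_nonneg_of_le_pi ht.1.le ht.2
        nlinarith [mul_nonneg this (sq_nonneg (f t))]
      · have := Real.sin_pos_of_pos_of_lt_pi hz.1 hz.2
        have h2 : 0 < f z ^ 2 := by positivity
        nlinarith [mul_pos this h2]
    linarith
  have hcl : closure (Ioo 0 Real.pi) = Icc 0 Real.pi := closure_Ioo hπ.ne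
  intro z hz
  have hEq : EqOn f (fun _ => 0) (closure (Ioo 0 Real.pi)) :=
    EqOn.of_subset_closure (s := Ioo 0 Real.pi) (fun z hz => hopen z hz) (by rwa [hcl])
      continuousOn_const subset_closure le_rfl
  exact hEq (by rwa [hcl])

/-- The modes `sin ky` and `cos (k - 1/2)y`, `k ≥ 1`, as one family. -/
noncomputable def combinedMode : ℕ ⊕ ℕ → ℝ → ℝ :=
  Sum.elim (fun k => sinMode (k + 1)) (fun k => cosMode (k + 1))

theorem continuous_combinedMode (i : ℕ ⊕ ℕ) : Continuous (combinedMode i) := by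
  rcases i with k | k
  · exact trigFamily_sin.Y_cont k
  · exact trigFamily_cos.Y_cont k

theorem abs_combinedMode_le (i : ℕ ⊕ ℕ) (y : ℝ) : |combinedMode i y| ≤ 1 := by
  rcases i with k | k
  · exact trigFamily_sin.Y_bound k y
  · exact trigFamily_cos.Y_bound k y

theorem integral_symm_eq_zero_of_odd {f : ℝ → ℝ} (hf : ∀ y, f (-y) = -f y) (a : ℝ) :
    ∫ y in (-a)..a, f y = 0 := by
  have h1 := intervalIntegral.integral_comp_neg (f := f) (a := -a) (b := a)
  simp only [hf, neg_neg, intervalIntegral.integral_neg] at h1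
  linarith

theorem sinMode_neg (k : ℕ) (y : ℝ) : sinMode k (-y) = -sinMode k y := by
  rw [sinMode, mul_neg, Real.sin_neg, sinMode]

theorem cosMode_neg (k : ℕ) (y : ℝ) : cosMode k (-y) = cosMode k y := by
  rw [cosMode, mul_neg, Real.cos_neg, cosMode]

theorem combinedMode_orth (i j : ℕ ⊕ ℕ) :
    ∫ y in (-Real.pi)..Real.pi, combinedMode i y * combinedMode j y
      = if i = j then Real.pi else 0 := by
  rcases i with i | i <;> rcases j with j | j
  · simpa [combinedMode] using trigFamily_sin.Y_orth i j
  · simp only [combinedMode, Sum.elim_inl, Sum.elim_inr, reduceCtorEq, if_false]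
    exact integral_symm_eq_zero_of_odd (fun y => by rw [sinMode_neg, cosMode_neg]; ring) _
  · simp only [combinedMode, Sum.elim_inl, Sum.elim_inr, reduceCtorEq, if_false]
    exact integral_symm_eq_zero_of_odd (fun y => by rw [sinMode_neg, cosMode_neg]; ring) _
  · simpa [combinedMode] using trigFamily_cos.Y_orth i j

/-- Up to sign, `sin n(y + π)/2` is one of the modes. -/
theorem exists_sin_half_eq (n : ℕ) : ∃ (s : ℝ) (i : ℕ ⊕ ℕ), ∀ z,
    Real.sin ((n + 1 : ℕ) * z) = s * combinedMode i (2 * z - Real.pi) := by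
  rcases Nat.even_or_odd' n with ⟨k, rfl | rfl⟩
  · refine ⟨(-1) ^ k, Sum.inr k, fun z => ?_⟩
    simp only [combinedMode, Sum.elim_inr, cosMode]
    have h1 : (((k + 1 : ℕ) : ℝ) - 1 / 2) * (2 * z - Real.pi)
        = ((2 * k + 1 : ℕ) : ℝ) * z - Real.pi / 2 - k * Real.pi := by push_cast; ring
    rw [h1, Real.cos_sub_nat_mul_pi, Real.cos_sub_pi_div_two, ← mul_assoc, ← mul_pow]
    simp
  · refine ⟨(-1) ^ (k + 1), Sum.inl k, fun z => ?_⟩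
    simp only [combinedMode, Sum.elim_inl, sinMode]
    have h1 : ((k + 1 : ℕ) : ℝ) * (2 * z - Real.pi)
        = ((2 * k + 1 + 1 : ℕ) : ℝ) * z - (k + 1 : ℕ) * Real.pi := by push_cast; ring
    rw [h1, Real.sin_sub_nat_mul_pi, ← mul_assoc, ← mul_pow]
    simp

/-- The modes are complete in `C[-π,π]`. -/
theorem eq_zero_of_fourierCoefficient_eq_zero {f : ℝ → ℝ}
    (hf : ContinuousOn f (Icc (-Real.pi) Real.pi))
    (h : ∀ i, fourierCoefficient f (combinedMode i) = 0) :
    ∀ y ∈ Icc (-Real.pi) Real.pi, f y = 0 := by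
  have hπ := Real.pi_pos
  -- The substitution y = 2z - π carries both kinds of modes, up to sign, to the single system sin
  -- nz on [0,π].
  have key := eq_zero_of_integral_mul_sin_eq_zero (f := fun z => f (2 * z - Real.pi))
    (hf.comp (by fun_prop) fun z hz => ⟨by linarith [hz.1], by linarith [hz.2]⟩) fun n => by
      obtain ⟨s, i, hs⟩ := exists_sin_half_eq n
      simp only [hs]
      have h1 := intervalIntegral.integral_comp_mul_sub (a := 0) (b := Real.pi)
        (fun y => f y * (s * combinedMode i y)) two_ne_zero Real.pi
      have h2 : ∫ y in (-Real.pi)..Real.pi, f y * (s * combinedMode i y) = 0 := by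
        have h3 := h i
        rw [fourierCoefficient, mul_eq_zero, inv_eq_zero] at h3
        simp only [mul_left_comm _ s]
        rw [intervalIntegral.integral_const_mul, h3.resolve_left hπ.ne', mul_zero]
      rw [h1, mul_zero, zero_sub, two_mul, add_sub_cancel_right, h2, smul_zero]
  intro y hy
  have := key ((y + Real.pi) / 2) ⟨by linarith [hy.1], by linarith [hy.2]⟩
  simpa [mul_div_cancel₀] using this

/-- An absolutely convergent Fourier series in the modes converges to its function. -/
theorem tsum_fourierCoefficient_mul {f : ℝ → ℝ} (hf : ContinuousOn f (Icc (-Real.pi) Real.pi))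
    (hs : Summable fun i => |fourierCoefficient f (combinedMode i)|) :
    ∀ y ∈ Icc (-Real.pi) Real.pi,
      ∑' i, fourierCoefficient f (combinedMode i) * combinedMode i y = f y := by
  have hπ := Real.pi_pos
  set a : ℕ ⊕ ℕ → ℝ := fun i => fourierCoefficient f (combinedMode i) with ha
  have hb : ∀ i y, ‖a i * combinedMode i y‖ ≤ |a i| := fun i y => by
    rw [norm_mul]
    exact mul_le_of_le_one_right (norm_nonneg _) (abs_combinedMode_le i y)
  have hFc : Continuous fun y => ∑' i, a i * combinedMode i y :=
    continuous_tsum (fun i => continuous_const.mul (continuous_combinedMode i)) hs hb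
  have hcoef : ∀ j, ∫ y in (-Real.pi)..Real.pi, (∑' i, a i * combinedMode i y) * combinedMode j y
      = Real.pi * a j := by
    intro j
    have h1 := intervalIntegral.hasSum_integral_of_dominated_convergence
      (μ := volume) (a := -Real.pi) (b := Real.pi)
      (F := fun i y => a i * combinedMode i y * combinedMode j y)
      (f := fun y => (∑' i, a i * combinedMode i y) * combinedMode j y) (fun i _ => |a i|)
      (fun i => ((continuous_const.mul (continuous_combinedMode i)).mul
        (continuous_combinedMode j)).aestronglyMeasurable)
      (fun i => Filter.Eventually.of_forall fun y _ => by
        rw [norm_mul]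
        exact (mul_le_of_le_one_right (norm_nonneg _) (abs_combinedMode_le j y)).trans (hb i y))
      (Filter.Eventually.of_forall fun y _ => hs)
      intervalIntegrable_const
      (Filter.Eventually.of_forall fun y _ =>
        (Summable.of_norm_bounded hs fun i => hb i y).hasSum.mul_right _)
    rw [← h1.tsum_eq]
    simp only [mul_assoc, intervalIntegral.integral_const_mul, combinedMode_orth]
    rw [tsum_eq_single j]
    · simp [mul_comm]
    · intro i hi; simp [hi]
  intro y hy
  have key := eq_zero_of_fourierCoefficient_eq_zero (hFc.continuousOn.sub hf) (fun j => by
    have hf' := hf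
    rw [← uIcc_of_le neg_pi_le_pi] at hf'
    have h1 := intervalIntegral.integral_sub
      ((hFc.mul (continuous_combinedMode j)).intervalIntegrable (μ := volume)
        (-Real.pi) Real.pi)
      (hf'.mul (continuous_combinedMode j).continuousOn).intervalIntegrable
    simp only [Pi.mul_apply, ← sub_mul, hcoef] at h1
    rw [fourierCoefficient]
    simp only [Pi.sub_apply]
    rw [h1, mul_sub, inv_mul_cancel_left₀ hπ.ne']
    simp [ha, fourierCoefficient]) y hy
  simp only [Pi.sub_apply] at key
  linarith


/-! ### Existence of the solution and its series. -/

namespace SeparatedSeries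

variable {ι κ : Type*} {α : ℝ} {f f1 g g1 Y Y1 : ι → ℝ → ℝ} {m w : ι → ℝ}
  {f' f1' g' g1' Y' Y1' : κ → ℝ → ℝ} {m' w' : κ → ℝ}

theorem sum (h : SeparatedSeries α f f1 g g1 Y Y1 m w)
    (h' : SeparatedSeries α f' f1' g' g1' Y' Y1' m' w') :
    SeparatedSeries α (Sum.elim f f') (Sum.elim f1 f1') (Sum.elim g g') (Sum.elim g1 g1')
      (Sum.elim Y Y') (Sum.elim Y1 Y1') (Sum.elim m m') (Sum.elim w w') where
  f_cont := by rintro (k | k); exacts [h.f_cont k, h'.f_cont k]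
  f_bound := by
    obtain ⟨P, hP, hb⟩ := h.f_bound
    obtain ⟨P', hP', hb'⟩ := h'.f_bound
    exact ⟨Sum.elim P P', Summable.sum (Sum.elim P P') hP hP', by rintro (k | k); exacts [hb k, hb' k]⟩
  f_deriv := by rintro (k | k); exacts [h.f_deriv k, h'.f_deriv k]
  g_deriv := by rintro (k | k); exacts [h.g_deriv k, h'.g_deriv k]
  f1_cont := by rintro (k | k); exacts [h.f1_cont k, h'.f1_cont k]
  g1_cont := by rintro (k | k); exacts [h.g1_cont k, h'.g1_cont k]
  f_caputo := fun hα => by rintro (k | k); exacts [h.f_caputo hα k, h'.f_caputo hα k]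
  g_caputo := fun hα => by rintro (k | k); exacts [h.g_caputo hα k, h'.g_caputo hα k]
  f_eq := fun hα => by rintro (k | k); exacts [h.f_eq hα k, h'.f_eq hα k]
  g_eq := fun hα => by rintro (k | k); exacts [h.g_eq hα k, h'.g_eq hα k]
  singular_bound := fun X hX => by
    obtain ⟨θ, hθ, P, hP, hb⟩ := h.singular_bound X hX
    obtain ⟨θ', hθ', P', hP', hb'⟩ := h'.singular_bound X hX
    have hmono : ∀ x ∈ Ioc 0 X, ∀ τ, min θ θ' ≤ τ → ∀ a B : ℝ, |a| ≤ B * x ^ (τ - 1) →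
        |a| ≤ B * x ^ (min θ θ' - 1) := by
      intro x hx τ hτ a B hab
      have h1 : x ^ (τ - 1) ≤ x ^ (min θ θ' - 1) :=
        Real.rpow_le_rpow_of_exponent_ge hx.1 (hx.2.trans hX.2.le) (by linarith)
      have h2 := Real.rpow_pos_of_pos hx.1 (τ - 1)
      have h3 : 0 ≤ B := by
        by_contra hB
        nlinarith [abs_nonneg a, mul_pos_of_neg_of_neg (not_le.1 hB) (neg_neg_of_pos h2)]
      exact hab.trans (mul_le_mul_of_nonneg_left h1 h3)
    refine ⟨min θ θ', ⟨lt_min hθ.1 hθ'.1, (min_le_left _ _).trans hθ.2⟩, Sum.elim P P',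
      Summable.sum (Sum.elim P P') hP hP', ?_⟩
    rintro (k | k) x hx
    · obtain ⟨h1, h2, h3⟩ := hb k x hx
      exact ⟨hmono x hx θ (min_le_left _ _) _ _ h1, hmono x hx θ (min_le_left _ _) _ _ h2, h3⟩
    · obtain ⟨h1, h2, h3⟩ := hb' k x hx
      exact ⟨hmono x hx θ' (min_le_right _ _) _ _ h1, hmono x hx θ' (min_le_right _ _) _ _ h2, h3⟩
  interior_bound := fun x₀ hx₀ X hX => by
    obtain ⟨P, hP, hb⟩ := h.interior_bound x₀ hx₀ X hX
    obtain ⟨P', hP', hb'⟩ := h'.interior_bound x₀ hx₀ X hX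
    exact ⟨Sum.elim P P', Summable.sum (Sum.elim P P') hP hP', by rintro (k | k); exacts [hb k, hb' k]⟩
  Y_deriv := by rintro (k | k); exacts [h.Y_deriv k, h'.Y_deriv k]
  Y1_deriv := by rintro (k | k); exacts [h.Y1_deriv k, h'.Y1_deriv k]
  Y_bound := by rintro (k | k); exacts [h.Y_bound k, h'.Y_bound k]
  Y1_bound := by rintro (k | k); exacts [h.Y1_bound k, h'.Y1_bound k]

theorem summable_mul_mul (h : SeparatedSeries α f f1 g g1 Y Y1 m w) {x : ℝ}
    (hx : x ∈ Ioo (0 : ℝ) 1) (y : ℝ) : Summable fun k => m k * f k x * Y k y := by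
  obtain ⟨P, hP, hb⟩ := h.interior_bound x hx x hx
  exact Summable.of_norm_bounded hP fun k =>
    abs_mul_le (hb k x ⟨le_rfl, le_rfl⟩).1 (h.Y_bound k y)

theorem summable_sq_mul_mul (h : SeparatedSeries α f f1 g g1 Y Y1 m w) {x : ℝ}
    (hx : x ∈ Ioo (0 : ℝ) 1) (y : ℝ) : Summable fun k => -(w k ^ 2 * f k x) * Y k y := by
  obtain ⟨P, hP, hb⟩ := h.interior_bound x hx x hx
  refine Summable.of_norm_bounded hP fun k => abs_mul_le ?_ (h.Y_bound k y)
  rw [abs_neg, abs_mul, abs_of_nonneg (sq_nonneg _)]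
  exact (hb k x ⟨le_rfl, le_rfl⟩).2

end SeparatedSeries

theorem TrigFamily.half_le {Y W : ℕ → ℝ → ℝ} {w : ℕ → ℝ} (hY : TrigFamily Y W w) (k : ℕ) :
    1 / 2 ≤ w k := by
  have := hY.w_ge k
  have h2 : (0 : ℝ) ≤ k := Nat.cast_nonneg k
  linarith

/-- The coefficients of φ and ψ are square summable sequences divided by w² and by w. As μ is at
most a multiple of w, the four weights leave the powers w^(-2), w^(-1), w^(-3/4) and, from ψ,
w^(-1), all with exponent beyond 1/2. -/
theorem TrigFamily.summable_coefficients {Y W : ℕ → ℝ → ℝ} {w : ℕ → ℝ} (hY : TrigFamily Y W w)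
    {α A c : ℝ} (hα : 0 < α) (hα1 : α ≤ 1) {φ ψ : ℝ → ℝ}
    (hφ : ContDiffOn ℝ 2 φ (Icc (-Real.pi) Real.pi))
    (hψ : ContDiffOn ℝ 1 ψ (Icc (-Real.pi) Real.pi))
    (hφl : φ (-Real.pi) = 0) (hφr : φ Real.pi = 0)
    (hψl : ψ (-Real.pi) = 0) (hψr : ψ Real.pi = 0) {μ : ℕ → ℝ} (hA : 0 < A)
    (hμ : ∀ k, μ k = √(A * w k ^ 2 + c ^ 2)) :
    Summable fun k => |fourierCoefficient φ (Y k)| + |fourierCoefficient φ (Y k)| * μ k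
      + |fourierCoefficient φ (Y k)| * μ k ^ (5 / 4 : ℝ)
      + |fourierCoefficient ψ (Y k) - fourierCoefficient φ (Y k) * mittagLeffler α 1 (-(μ k))| := by
  have hd := hY.summable_sq_coefficient_two hφ hφl hφr
  have he := hY.summable_sq_coefficient_one hψ hψl hψr
  -- From w ≥ 1/2 one has c² ≤ 4 c² w², hence μ ≤ κ w.
  set κ := √(A + 4 * c ^ 2) with hκ
  have hκ0 : 0 ≤ κ := Real.sqrt_nonneg _
  have hμ0 : ∀ k, 0 ≤ μ k := fun k => by rw [hμ]; exact Real.sqrt_nonneg _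
  have hμw : ∀ k, μ k ≤ κ * w k := by
    intro k
    have h1 := hY.half_le k
    rw [hμ, hκ, ← Real.sqrt_sq (hY.w_pos k).le, ← Real.sqrt_mul (by positivity)]
    refine Real.sqrt_le_sqrt ?_
    rw [Real.sqrt_sq (hY.w_pos k).le]
    nlinarith [mul_nonneg (sq_nonneg c) (by nlinarith : 0 ≤ 4 * w k ^ 2 - 1)]
  set p : ℕ → ℝ := fun k => fourierCoefficient φ (Y k) with hp
  have hpd : ∀ k, |w k ^ 2 * p k| = w k ^ 2 * |p k| := fun k => by
    rw [abs_mul, abs_of_nonneg (sq_nonneg _)]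
  have h2 := hY.summable_mul_rpow hd (p := 2) (by norm_num)
  have h1 := (hY.summable_mul_rpow hd (p := 1) (by norm_num)).mul_left κ
  have h3 := (hY.summable_mul_rpow hd (p := 3 / 4) (by norm_num)).mul_left (κ ^ (5 / 4 : ℝ))
  have h4 := hY.summable_mul_rpow he (p := 1) (by norm_num)
  have hE : ∀ k, |w k ^ 2 * p k| * w k ^ (-2 : ℝ) = |p k| := fun k => by
    rw [hpd, Real.rpow_neg (hY.w_pos k).le, Real.rpow_two]
    field_simp [(hY.w_pos k).ne']
  refine Summable.of_nonneg_of_le (fun k => ?_) (fun k => ?_)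
    (((h2.add h1).add h3).add (h4.add h2))
  · have := Real.rpow_nonneg (hμ0 k) (5 / 4)
    have := hμ0 k
    positivity
  · have hw := hY.w_pos k
    refine add_le_add (add_le_add (add_le_add (hE k).ge ?_) ?_) ?_
    · rw [hpd, Real.rpow_neg_one]
      calc |p k| * μ k ≤ |p k| * (κ * w k) := by gcongr; exact hμw k
        _ = _ := by field_simp
    · have h5 : μ k ^ (5 / 4 : ℝ) ≤ κ ^ (5 / 4 : ℝ) * w k ^ (5 / 4 : ℝ) := by
        rw [← Real.mul_rpow hκ0 hw.le]
        exact Real.rpow_le_rpow (hμ0 k) (hμw k) (by norm_num)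
      have h6 : w k ^ 2 * w k ^ (-(3 / 4) : ℝ) = w k ^ (5 / 4 : ℝ) := by
        rw [← Real.rpow_natCast, ← Real.rpow_add hw]; congr 1; norm_num
      rw [hpd, mul_right_comm, h6]
      calc |p k| * μ k ^ (5 / 4 : ℝ) ≤ |p k| * (κ ^ (5 / 4 : ℝ) * w k ^ (5 / 4 : ℝ)) := by gcongr
        _ = _ := by ring
    · have h7 : |w k * fourierCoefficient ψ (Y k)| * w k ^ (-1 : ℝ)
          = |fourierCoefficient ψ (Y k)| := by
        rw [abs_mul, abs_of_pos hw, Real.rpow_neg_one]; field_simp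
      rw [h7, hE]
      refine (abs_sub _ _).trans (add_le_add le_rfl ?_)
      rw [abs_mul, abs_of_nonneg (mittagLeffler_one_neg_nonneg hα hα1 (hμ0 k))]
      exact mul_le_of_le_one_right (abs_nonneg _) (mittagLeffler_one_neg_le_one hα hα1 (hμ0 k))

/-- The coefficient of the growing part is what remains of the datum at x = 1 after the decaying
part is subtracted. -/
theorem profile_eq {α μ x : ℝ} (hα : 0 < α) (hμ : 0 < μ) (hx : 0 ≤ x) (a b : ℝ) :
    profile α μ a (b - a * mittagLeffler α 1 (-μ)) x = a * profileC α μ x + b * profileS α μ x := by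
  rw [profileC_eq hα hμ hx, profile, ← profileS_eq]; ring

theorem profile_zero {α μ : ℝ} (hα : 0 < α) (a b : ℝ) : profile α μ a b 0 = a := by
  rw [profile, mlKernel_one, mlKernel, Real.zero_rpow hα.ne', mul_zero, mittagLeffler_zero,
    add_sub_cancel_right, Real.zero_rpow hα.ne']
  simp

theorem profile_one {α μ : ℝ} (hα : 0 < α) (a b : ℝ) :
    profile α μ a (b - a * mittagLeffler α 1 (-μ)) 1 = b := by
  have hD := mittagLeffler_pos (ρ := 2 * α) (β := α + 1) (by linarith) (by linarith)
    (sq_nonneg μ)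
  rw [profile, mlKernel_one, mlKernel]
  simp only [Real.one_rpow, mul_one, one_mul]
  rw [div_self hD.ne']; ring

theorem TrigFamily.separatedSeries {Y W : ℕ → ℝ → ℝ} {w : ℕ → ℝ} (hY : TrigFamily Y W w)
    {α A c : ℝ} (hα : 0 < α) (hα1 : α ≤ 1) {φ ψ : ℝ → ℝ}
    (hφ : ContDiffOn ℝ 2 φ (Icc (-Real.pi) Real.pi))
    (hψ : ContDiffOn ℝ 1 ψ (Icc (-Real.pi) Real.pi))
    (hφl : φ (-Real.pi) = 0) (hφr : φ Real.pi = 0)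
    (hψl : ψ (-Real.pi) = 0) (hψr : ψ Real.pi = 0) {μ : ℕ → ℝ} (hA : 0 < A)
    (hμ : ∀ k, μ k = √(A * w k ^ 2 + c ^ 2)) :
    ∃ f1 g g1 Y1, SeparatedSeries α (fun k => profile α (μ k) (fourierCoefficient φ (Y k))
      (fourierCoefficient ψ (Y k) - fourierCoefficient φ (Y k) * mittagLeffler α 1 (-(μ k))))
      f1 g g1 Y Y1 (fun k => μ k ^ 2) w := by
  have hsq : ∀ k, μ k ^ 2 = A * w k ^ 2 + c ^ 2 := fun k => by
    rw [hμ, Real.sq_sqrt (by positivity)]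
  have hw2 : ∀ k, 1 / 4 ≤ w k ^ 2 := fun k => by nlinarith [hY.half_le k]
  refine ⟨_, _, _, _, separatedSeries_profile (B := A⁻¹) (z₀ := A / 4) hα hα1 hY (by positivity)
    (fun k => ?_) (fun k => ?_) (by positivity) (fun k => ?_)
    (hY.summable_coefficients hα hα1 hφ hψ hφl hφr hψl hψr hA hμ)⟩
  · rw [hμ]
    have := hY.w_pos k
    positivity
  · rw [hsq]; nlinarith [hw2 k, sq_nonneg c]
  · rw [hsq, mul_add, inv_mul_cancel_left₀ hA.ne']
    have : 0 ≤ A⁻¹ * c ^ 2 := by positivity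
    linarith

/-- The sine and cosine series are joined over a sum type, so that regularity is proved once and the
combined family is complete. -/
theorem exists_solution {α ε c : ℝ} (hα : 0 < α) (hα1 : α ≤ 1) (hε : |ε| < 1) {φ ψ : ℝ → ℝ}
    (hφ : ContDiffOn ℝ 2 φ (Icc (-Real.pi) Real.pi))
    (hψ : ContDiffOn ℝ 1 ψ (Icc (-Real.pi) Real.pi))
    (hφl : φ (-Real.pi) = 0) (hφr : φ Real.pi = 0)
    (hψl : ψ (-Real.pi) = 0) (hψr : ψ Real.pi = 0) :
    ∃ u : ℝ → ℝ → ℝ, IsSolutionProblemD α ε c φ ψ u ∧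
      ∀ x ∈ Icc (0 : ℝ) 1, ∀ y,
        Summable (fun n : ℕ => sinTerm α ε c φ ψ (n + 1) x y) ∧
        Summable (fun n : ℕ => cosTerm α ε c φ ψ (n + 1) x y) ∧
        u x y = (∑' n : ℕ, sinTerm α ε c φ ψ (n + 1) x y)
          + ∑' n : ℕ, cosTerm α ε c φ ψ (n + 1) x y := by
  obtain ⟨he1, he2⟩ := abs_lt.1 hε
  have hAs : 0 < 1 + ε := by linarith
  have hAc : 0 < 1 - ε := by linarith
  have hμs : ∀ k, sinMu ε c (k + 1) = √((1 + ε) * ((k + 1 : ℕ) : ℝ) ^ 2 + c ^ 2) := fun k => rfl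
  have hμc : ∀ k, cosMu ε c (k + 1) = √((1 - ε) * (((k + 1 : ℕ) : ℝ) - 1 / 2) ^ 2 + c ^ 2) :=
    fun k => rfl
  have hμs0 : ∀ k, 0 < sinMu ε c (k + 1) := fun k => by rw [hμs]; positivity
  have hμc0 : ∀ k, 0 < cosMu ε c (k + 1) := fun k => by
    have := trigFamily_cos.w_pos k
    rw [hμc]; positivity
  obtain ⟨f1, g, g1, Y1, hs⟩ :=
    trigFamily_sin.separatedSeries hα hα1 hφ hψ hφl hφr hψl hψr hAs hμs
  obtain ⟨f1', g', g1', Y1', hc⟩ :=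
    trigFamily_cos.separatedSeries hα hα1 hφ hψ hφl hφr hψl hψr hAc hμc
  have h := hs.sum hc
  set F := Sum.elim (fun k => profile α (sinMu ε c (k + 1))
      (fourierCoefficient φ (sinMode (k + 1))) (fourierCoefficient ψ (sinMode (k + 1))
        - fourierCoefficient φ (sinMode (k + 1)) * mittagLeffler α 1 (-(sinMu ε c (k + 1)))))
    (fun k => profile α (cosMu ε c (k + 1))
      (fourierCoefficient φ (cosMode (k + 1))) (fourierCoefficient ψ (cosMode (k + 1))
        - fourierCoefficient φ (cosMode (k + 1)) * mittagLeffler α 1 (-(cosMu ε c (k + 1)))))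
    with hF
  change SeparatedSeries α F _ _ _ combinedMode _ _ _ at h
  have hF0 : ∀ i, F i 0 = fourierCoefficient φ (combinedMode i) := by
    rintro (k | k) <;> exact profile_zero hα _ _
  have hF1 : ∀ i, F i 1 = fourierCoefficient ψ (combinedMode i) := by
    rintro (k | k) <;> exact profile_one hα _ _
  have habs : ∀ x ∈ Icc (0 : ℝ) 1, Summable fun i => |F i x| := fun x hx => by
    obtain ⟨P, hP, hb⟩ := h.f_bound
    exact Summable.of_nonneg_of_le (fun i => abs_nonneg _) (fun i => hb i x hx) hP
  have hends : ∀ i, combinedMode i (-Real.pi) = 0 ∧ combinedMode i Real.pi = 0 := by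
    rintro (k | k)
    · exact ⟨trigFamily_sin.Y_left k, trigFamily_sin.Y_right k⟩
    · exact ⟨trigFamily_cos.Y_left k, trigFamily_cos.Y_right k⟩
  have h0 : (0 : ℝ) ∈ Icc (0 : ℝ) 1 := by simp
  have h1 : (1 : ℝ) ∈ Icc (0 : ℝ) 1 := by simp
  refine ⟨fun x y => ∑' i, F i x * combinedMode i y, ⟨h.isRegularFunction hα1, ?_, ?_, ?_, ?_, ?_⟩,
    ?_⟩
  · intro x hx y hy
    rw [h.caputoX_caputoX_eq hα1 hx, h.partialYY_eq hx, h.partialYY_eq hx,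
      ← tsum_mul_left (a := ε), ← tsum_mul_left (a := c ^ 2),
      ← (h.summable_mul_mul hx y).tsum_add (h.summable_sq_mul_mul hx y),
      ← ((h.summable_mul_mul hx y).add (h.summable_sq_mul_mul hx y)).tsum_sub
        ((h.summable_sq_mul_mul hx (-y)).mul_left ε),
      ← (((h.summable_mul_mul hx y).add (h.summable_sq_mul_mul hx y)).sub
        ((h.summable_sq_mul_mul hx (-y)).mul_left ε)).tsum_sub
        ((h.summable (Ioo_subset_Icc_self hx) y).mul_left (c ^ 2))]
    -- The reflection changes the sign of the sine modes and fixes the cosine modes, so -ε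
    -- u_yy(x,-y) contributes the factors 1 + ε and 1 - ε that occur in μ².
    refine (tsum_congr ?_).trans tsum_zero
    rintro (k | k)
    · simp only [combinedMode, Sum.elim_inl, sinMode_neg]
      rw [hμs, Real.sq_sqrt (by positivity)]; ring
    · simp only [combinedMode, Sum.elim_inr, cosMode_neg]
      rw [hμc, Real.sq_sqrt (by positivity)]; ring
  · intro y hy
    have h2 := habs 0 h0
    simp only [hF0] at h2 ⊢
    exact tsum_fourierCoefficient_mul hφ.continuousOn h2 y hy
  · intro y hy
    have h2 := habs 1 h1
    simp only [hF1] at h2 ⊢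
    exact tsum_fourierCoefficient_mul hψ.continuousOn h2 y hy
  · intro x hx
    simp [(hends _).1]
  · intro x hx
    simp [(hends _).2]
  · intro x hx y
    have hS : ∀ n : ℕ, profile α (sinMu ε c (n + 1))
      (fourierCoefficient φ (sinMode (n + 1))) (fourierCoefficient ψ (sinMode (n + 1))
        - fourierCoefficient φ (sinMode (n + 1)) * mittagLeffler α 1 (-(sinMu ε c (n + 1)))) x
          * sinMode (n + 1) y = sinTerm α ε c φ ψ (n + 1) x y := fun n => by
      rw [profile_eq hα (hμs0 n) hx.1, sinTerm]
    have hC : ∀ n : ℕ, profile α (cosMu ε c (n + 1))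
      (fourierCoefficient φ (cosMode (n + 1))) (fourierCoefficient ψ (cosMode (n + 1))
        - fourierCoefficient φ (cosMode (n + 1)) * mittagLeffler α 1 (-(cosMu ε c (n + 1)))) x
          * cosMode (n + 1) y = cosTerm α ε c φ ψ (n + 1) x y := fun n => by
      rw [profile_eq hα (hμc0 n) hx.1, cosTerm]
    have h2 := hs.summable hx y
    have h3 := hc.summable hx y
    have h4 := Summable.tsum_sum (f := fun i => F i x * combinedMode i y) h2 h3
    simp only [hF, combinedMode, Sum.elim_inl, Sum.elim_inr, hS, hC] at h2 h3 h4 ⊢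
    exact ⟨h2, h3, h4⟩


/-! ### Second differences and hat averages, a substitute for second derivatives. -/

/-- The symmetric second difference. -/
def secondDiff (t : ℝ) (f : ℝ → ℝ) (z : ℝ) : ℝ := f (z + t) + f (z - t) - 2 * f z

/-- The hat-weighted integral `∫ (t - |s|) f(z + s) ds` over `[-t,t]`. -/
noncomputable def hatAvg (t : ℝ) (f : ℝ → ℝ) (z : ℝ) : ℝ :=
  ∫ s in (0 : ℝ)..t, (t - s) * (f (z + s) + f (z - s))

/-- A continuous function on a rectangle extends to a bounded continuous function. -/
theorem exists_continuous_extension {h : ℝ → ℝ → ℝ} {a b p q : ℝ} (hab : a ≤ b) (hpq : p ≤ q)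
    (hh : ContinuousOn (Function.uncurry h) (Icc a b ×ˢ Icc p q)) :
    Continuous (fun v : ℝ × ℝ => h (max a (min b v.1)) (max p (min q v.2))) ∧
      ∃ M, ∀ x z, |h (max a (min b x)) (max p (min q z))| ≤ M := by
  have hmem : ∀ x z, (max a (min b x), max p (min q z)) ∈ Icc a b ×ˢ Icc p q := fun x z =>
    ⟨⟨le_max_left _ _, max_le hab (min_le_left _ _)⟩, ⟨le_max_left _ _, max_le hpq (min_le_left _ _)⟩⟩
  constructor
  · exact hh.comp_continuous (f := fun v : ℝ × ℝ => (max a (min b v.1), max p (min q v.2)))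
      (by fun_prop) fun v => hmem v.1 v.2
  · obtain ⟨M, hM⟩ := (isCompact_Icc.prod isCompact_Icc).exists_bound_of_continuousOn hh
    exact ⟨M, fun x z => hM _ (hmem x z)⟩

theorem clamp_eq {a b x : ℝ} (hx : x ∈ Icc a b) : max a (min b x) = x := by
  rw [min_eq_right hx.2, max_eq_right hx.1]

section hatAvg

variable {f g : ℝ → ℝ} {t z : ℝ}

theorem continuousOn_hatAvg_integrand (ht : 0 ≤ t) (hf : ContinuousOn f (Icc (z - t) (z + t))) :
    ContinuousOn (fun s => (t - s) * (f (z + s) + f (z - s))) (uIcc 0 t) := by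
  rw [uIcc_of_le ht]
  have h1 : ContinuousOn (fun s => f (z + s)) (Icc 0 t) :=
    hf.comp (by fun_prop) fun s hs => ⟨by linarith [hs.1], by linarith [hs.2]⟩
  have h2 : ContinuousOn (fun s => f (z - s)) (Icc 0 t) :=
    hf.comp (by fun_prop) fun s hs => ⟨by linarith [hs.2], by linarith [hs.1]⟩
  exact (by fun_prop : Continuous fun s : ℝ => t - s).continuousOn.mul (h1.add h2)

theorem hatAvg_congr (ht : 0 ≤ t) (h : ∀ y ∈ Icc (z - t) (z + t), f y = g y) :
    hatAvg t f z = hatAvg t g z := by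
  refine intervalIntegral.integral_congr fun s hs => ?_
  rw [uIcc_of_le ht] at hs
  rw [h _ ⟨by linarith [hs.1], by linarith [hs.2]⟩, h _ ⟨by linarith [hs.2], by linarith [hs.1]⟩]

theorem hatAvg_add (ht : 0 ≤ t) (hf : ContinuousOn f (Icc (z - t) (z + t)))
    (hg : ContinuousOn g (Icc (z - t) (z + t))) :
    hatAvg t (fun y => f y + g y) z = hatAvg t f z + hatAvg t g z := by
  simp only [hatAvg]
  rw [← intervalIntegral.integral_add (continuousOn_hatAvg_integrand ht hf).intervalIntegrable
    (continuousOn_hatAvg_integrand ht hg).intervalIntegrable]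
  congr 1; ext s; ring

theorem hatAvg_const_mul (a : ℝ) : hatAvg t (fun y => a * f y) z = a * hatAvg t f z := by
  simp only [hatAvg]
  rw [← intervalIntegral.integral_const_mul]
  congr 1; ext s; ring

theorem abs_hatAvg_le (ht : 0 ≤ t) {M : ℝ} (h : ∀ y ∈ Icc (z - t) (z + t), |f y| ≤ M) :
    |hatAvg t f z| ≤ M * t ^ 2 := by
  have h1 : ∫ s in (0 : ℝ)..t, (t - s) * (2 * M) = M * t ^ 2 := by
    rw [intervalIntegral.integral_mul_const, intervalIntegral.integral_sub (by simp) (by simp)]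
    simp; ring
  rw [hatAvg, ← h1]
  refine intervalIntegral.norm_integral_le_of_norm_le (μ := volume)
    (f := fun s => (t - s) * (f (z + s) + f (z - s))) (g := fun s => (t - s) * (2 * M)) ht ?_
    ((by fun_prop : Continuous fun s : ℝ => (t - s) * (2 * M)).intervalIntegrable _ _)
  refine Filter.Eventually.of_forall fun s hs => ?_
  rw [norm_mul, Real.norm_eq_abs, Real.norm_eq_abs, abs_of_nonneg (by linarith [hs.2])]
  have h2 := h (z + s) ⟨by linarith [hs.1], by linarith [hs.2]⟩
  have h3 := h (z - s) ⟨by linarith [hs.2], by linarith [hs.1]⟩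
  have h4 := abs_add_le (f (z + s)) (f (z - s))
  exact mul_le_mul_of_nonneg_left (by linarith) (by linarith [hs.2])

/-- Taylor's formula for the second difference. -/
theorem secondDiff_eq_hatAvg {f1 f2 : ℝ → ℝ} (ht : 0 ≤ t)
    (h1 : ∀ y ∈ Icc (z - t) (z + t), HasDerivAt f (f1 y) y)
    (h2 : ∀ y ∈ Icc (z - t) (z + t), HasDerivAt f1 (f2 y) y)
    (hc : ContinuousOn f2 (Icc (z - t) (z + t))) :
    secondDiff t f z = hatAvg t f2 z := by
  -- An explicit primitive of the integrand; its values at t and 0 give the second difference.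
  have hd : ∀ s ∈ uIcc 0 t, HasDerivAt
      (fun s => (t - s) * (f1 (z + s) - f1 (z - s)) + (f (z + s) + f (z - s)))
      ((t - s) * (f2 (z + s) + f2 (z - s))) s := by
    intro s hs
    rw [uIcc_of_le ht] at hs
    have m1 : z + s ∈ Icc (z - t) (z + t) := ⟨by linarith [hs.1], by linarith [hs.2]⟩
    have m2 : z - s ∈ Icc (z - t) (z + t) := ⟨by linarith [hs.2], by linarith [hs.1]⟩
    have e1 := (h1 _ m1).comp_const_add z s
    have e2 := (h1 _ m2).comp_const_sub z s
    have e3 := (h2 _ m1).comp_const_add z s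
    have e4 := (h2 _ m2).comp_const_sub z s
    exact ((((hasDerivAt_id s).const_sub t).mul (e3.sub e4)).add (e1.add e2)).congr_deriv
      (by simp; ring)
  rw [hatAvg, intervalIntegral.integral_eq_sub_of_hasDerivAt hd
    (continuousOn_hatAvg_integrand ht hc).intervalIntegrable, secondDiff]
  simp; ring

theorem continuous_hatAvg_param {X : Type*} [TopologicalSpace X] [FirstCountableTopology X]
    {h : X → ℝ → ℝ} (hh : Continuous (Function.uncurry h)) (t z : ℝ) :
    Continuous fun x => hatAvg t (h x) z := by
  refine intervalIntegral.continuous_parametric_intervalIntegral_of_continuous' ?_ 0 t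
  have h1 : Continuous fun v : X × ℝ => h v.1 (z + v.2) :=
    hh.comp (by fun_prop : Continuous fun v : X × ℝ => (v.1, z + v.2))
  have h2 : Continuous fun v : X × ℝ => h v.1 (z - v.2) :=
    hh.comp (by fun_prop : Continuous fun v : X × ℝ => (v.1, z - v.2))
  exact (by fun_prop : Continuous fun v : X × ℝ => t - v.2).mul (h1.add h2)

theorem hatAvg_comm_of_continuous {h : ℝ → ℝ → ℝ} (hh : Continuous (Function.uncurry h))
    (r t x z : ℝ) :
    hatAvg r (fun x' => hatAvg t (h x') z) x = hatAvg t (fun z' => hatAvg r (fun x' => h x' z') x) z := by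
  have hc : ∀ a b : ℝ → ℝ → ℝ, Continuous (Function.uncurry a) → Continuous (Function.uncurry b) →
      Continuous fun v : ℝ × ℝ => h (a v.1 v.2) (b v.1 v.2) := fun a b ha hb =>
    hh.comp (ha.prodMk hb)
  have c1 := hc (fun ρ _ => x + ρ) (fun _ s => z + s) (by fun_prop) (by fun_prop)
  have c2 := hc (fun ρ _ => x + ρ) (fun _ s => z - s) (by fun_prop) (by fun_prop)
  have c3 := hc (fun ρ _ => x - ρ) (fun _ s => z + s) (by fun_prop) (by fun_prop)
  have c4 := hc (fun ρ _ => x - ρ) (fun _ s => z - s) (by fun_prop) (by fun_prop)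
  have cy : ∀ x', Continuous fun y => h x' y := fun x' =>
    hh.comp (by fun_prop : Continuous fun y => (x', y))
  have cx : ∀ y, Continuous fun x' => h x' y := fun y =>
    hh.comp (by fun_prop : Continuous fun x' => (x', y))
  have hL : hatAvg r (fun x' => hatAvg t (h x') z) x
      = ∫ ρ in (0 : ℝ)..r, ∫ s in (0 : ℝ)..t, (r - ρ) * (t - s)
        * (h (x + ρ) (z + s) + h (x + ρ) (z - s) + h (x - ρ) (z + s) + h (x - ρ) (z - s)) := by
    simp only [hatAvg]
    congr 1; ext ρ
    rw [← intervalIntegral.integral_add, ← intervalIntegral.integral_const_mul]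
    · congr 1; ext s; ring
    all_goals
      refine Continuous.intervalIntegrable ?_ _ _
      exact (by fun_prop : Continuous fun s : ℝ => t - s).mul
        (((cy _).comp (by fun_prop)).add ((cy _).comp (by fun_prop)))
  have hR : hatAvg t (fun z' => hatAvg r (fun x' => h x' z') x) z
      = ∫ s in (0 : ℝ)..t, ∫ ρ in (0 : ℝ)..r, (r - ρ) * (t - s)
        * (h (x + ρ) (z + s) + h (x + ρ) (z - s) + h (x - ρ) (z + s) + h (x - ρ) (z - s)) := by
    simp only [hatAvg]
    congr 1; ext s
    rw [← intervalIntegral.integral_add, ← intervalIntegral.integral_const_mul]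
    · congr 1; ext ρ; ring
    all_goals
      refine Continuous.intervalIntegrable ?_ _ _
      exact (by fun_prop : Continuous fun s : ℝ => r - s).mul
        (((cx _).comp (by fun_prop : Continuous fun s : ℝ => x + s)).add
          ((cx _).comp (by fun_prop : Continuous fun s : ℝ => x - s)))
  rw [hL, hR]
  refine intervalIntegral_intervalIntegral_swap ?_
  refine IntegrableOn.mono_set ?_ (prod_mono uIoc_subset_uIcc uIoc_subset_uIcc)
  refine ContinuousOn.integrableOn_compact (isCompact_uIcc.prod isCompact_uIcc) ?_
  refine Continuous.continuousOn ?_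
  exact (by fun_prop : Continuous fun v : ℝ × ℝ => (r - v.1) * (t - v.2)).mul
    (((c1.add c2).add c3).add c4)

/-- Hat averages in the two variables commute. -/
theorem hatAvg_comm {h : ℝ → ℝ → ℝ} {r t x z : ℝ} (hr : 0 ≤ r) (ht : 0 ≤ t)
    (hh : ContinuousOn (Function.uncurry h) (Icc (x - r) (x + r) ×ˢ Icc (z - t) (z + t))) :
    hatAvg r (fun x' => hatAvg t (h x') z) x
      = hatAvg t (fun z' => hatAvg r (fun x' => h x' z') x) z := by
  obtain ⟨hc, -⟩ := exists_continuous_extension (by linarith) (by linarith) hh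
  -- The averages see h only on the rectangle, so h may be replaced by its continuous extension by
  -- clamping.
  have key := hatAvg_comm_of_continuous (h := fun x' z' => h (max (x - r) (min (x + r) x'))
    (max (z - t) (min (z + t) z'))) hc r t x z
  calc _ = _ := hatAvg_congr hr fun x' hx' => hatAvg_congr ht fun z' hz' => by
        rw [clamp_eq hx', clamp_eq hz']
    _ = _ := key
    _ = _ := hatAvg_congr ht fun z' hz' => hatAvg_congr hr fun x' hx' => by
        rw [clamp_eq hx', clamp_eq hz']

/-- The hat average in the first variable of a function that is continuous near the segment. -/
theorem continuousOn_hatAvg_left {h : ℝ → ℝ → ℝ} {r x p q : ℝ} (hr : 0 ≤ r)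
    (hh : ContinuousOn (Function.uncurry h) (Icc (x - r) (x + r) ×ˢ Icc p q)) :
    ContinuousOn (fun z => hatAvg r (fun x' => h x' z) x) (Icc p q) := by
  rcases lt_or_ge q p with hpq | hpq
  · simp [Icc_eq_empty (not_le.2 hpq)]
  obtain ⟨hc, -⟩ := exists_continuous_extension (by linarith) hpq hh
  have key := continuous_hatAvg_param (h := fun z' x' => h (max (x - r) (min (x + r) x'))
    (max p (min q z'))) (hc.comp continuous_swap) r x
  exact key.continuousOn.congr fun z hz => hatAvg_congr hr fun x' hx' => by
    rw [clamp_eq hx', clamp_eq hz]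

end hatAvg

/-- At the leftmost point of a positive maximum the left neighbour is strictly smaller, so the
second difference there is negative. No differentiability is required. -/
theorem le_zero_of_secondDiff_eq_zero {F : ℝ → ℝ} {a b : ℝ} (hF : ContinuousOn F (Icc a b))
    (ha : F a = 0) (hb : F b = 0)
    (h : ∀ z t, 0 < t → a < z - t → z + t < b → secondDiff t F z = 0) :
    ∀ z ∈ Icc a b, F z ≤ 0 := by
  intro z hz
  obtain ⟨m, hm, hmax⟩ := isCompact_Icc.exists_isMaxOn ⟨z, hz⟩ hF
  refine (hmax hz : F z ≤ F m).trans ?_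
  by_contra hpos
  push Not at hpos
  have hS : IsCompact (Icc a b ∩ F ⁻¹' {F m}) := by
    refine isCompact_Icc.of_isClosed_subset ?_ inter_subset_left
    exact hF.preimage_isClosed_of_isClosed isClosed_Icc isClosed_singleton
  obtain ⟨y, ⟨hy, hyF⟩, hmin⟩ := hS.exists_isLeast ⟨m, hm, rfl⟩
  simp only [mem_preimage, mem_singleton_iff] at hyF
  have hya : a < y := lt_of_le_of_ne hy.1 fun e => by rw [← e, ha] at hyF; linarith
  have hyb : y < b := lt_of_le_of_ne hy.2 fun e => by rw [e, hb] at hyF; linarith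
  set t := min (y - a) (b - y) / 2 with ht
  have ht0 : 0 < t := by have := lt_min (sub_pos.2 hya) (sub_pos.2 hyb); positivity
  have h1 : t < y - a := by
    have := min_le_left (y - a) (b - y); linarith
  have h2 : t < b - y := by
    have := min_le_right (y - a) (b - y); linarith
  have h3 := h y t ht0 (by linarith) (by linarith)
  have m1 : y - t ∈ Icc a b := ⟨by linarith, by linarith⟩
  have m2 : y + t ∈ Icc a b := ⟨by linarith, by linarith⟩
  have h4 : F (y - t) ≤ F m := hmax m1
  have h5 : F (y + t) ≤ F m := hmax m2
  have h6 : F (y - t) ≠ F m := fun e => by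
    have : y ≤ y - t := hmin ⟨m1, e⟩
    linarith
  have h7 := lt_of_le_of_ne h4 h6
  rw [secondDiff, hyF] at h3
  linarith

/-- A continuous function with vanishing second differences and boundary values is zero. -/
theorem eq_zero_of_secondDiff_eq_zero {F : ℝ → ℝ} {a b : ℝ} (hF : ContinuousOn F (Icc a b))
    (ha : F a = 0) (hb : F b = 0)
    (h : ∀ z t, 0 < t → a < z - t → z + t < b → secondDiff t F z = 0) :
    ∀ z ∈ Icc a b, F z = 0 := by
  intro z hz
  refine le_antisymm (le_zero_of_secondDiff_eq_zero hF ha hb h z hz) ?_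
  have := le_zero_of_secondDiff_eq_zero (F := fun z => -F z) hF.neg (by simp [ha]) (by simp [hb])
    (fun z t h1 h2 h3 => by have := h z t h1 h2 h3; simp only [secondDiff] at this ⊢; linarith) z hz
  linarith

/-! ### The Green operator and sine coefficients on [0,π]. -/

/-- The solution of `f'' = F`, `f(0) = f(π) = 0`. -/
noncomputable def greenOp (F : ℝ → ℝ) (z : ℝ) : ℝ :=
  (∫ s in (0 : ℝ)..z, (z - s) * F s)
    - z / Real.pi * ∫ s in (0 : ℝ)..Real.pi, (Real.pi - s) * F s

section greenOp

variable {F : ℝ → ℝ}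

theorem greenOp_zero (F : ℝ → ℝ) : greenOp F 0 = 0 := by simp [greenOp]

theorem greenOp_pi (F : ℝ → ℝ) : greenOp F Real.pi = 0 := by
  simp [greenOp]

theorem hasDerivAt_integral_sub_mul (hF : Continuous F) (z : ℝ) :
    HasDerivAt (fun z => ∫ s in (0 : ℝ)..z, (z - s) * F s) (∫ s in (0 : ℝ)..z, F s) z := by
  have h1 : ∀ z, ∫ s in (0 : ℝ)..z, (z - s) * F s
      = z * (∫ s in (0 : ℝ)..z, F s) - ∫ s in (0 : ℝ)..z, s * F s := by
    intro z
    rw [← intervalIntegral.integral_const_mul, ← intervalIntegral.integral_sub]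
    · congr 1; ext s; ring
    · exact (continuous_const.mul hF).intervalIntegrable _ _
    · exact (continuous_id.mul hF).intervalIntegrable _ _
  simp only [h1]
  have h2 := intervalIntegral.integral_hasDerivAt_right (hF.intervalIntegrable 0 z)
    hF.aestronglyMeasurable.stronglyMeasurableAtFilter hF.continuousAt
  have h3 := intervalIntegral.integral_hasDerivAt_right
    ((continuous_id.mul hF).intervalIntegrable 0 z)
    (continuous_id.mul hF).aestronglyMeasurable.stronglyMeasurableAtFilter
    (continuous_id.mul hF).continuousAt
  exact (((hasDerivAt_id z).mul h2).sub h3).congr_deriv (by simp)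

theorem hasDerivAt_greenOp (hF : Continuous F) (z : ℝ) :
    HasDerivAt (greenOp F) ((∫ s in (0 : ℝ)..z, F s)
      - 1 / Real.pi * ∫ s in (0 : ℝ)..Real.pi, (Real.pi - s) * F s) z :=
  (hasDerivAt_integral_sub_mul hF z).sub (((hasDerivAt_id z).div_const _).mul_const _)

theorem hasDerivAt_deriv_greenOp (hF : Continuous F) (z : ℝ) :
    HasDerivAt (fun z => (∫ s in (0 : ℝ)..z, F s)
      - 1 / Real.pi * ∫ s in (0 : ℝ)..Real.pi, (Real.pi - s) * F s) (F z) z :=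
  (intervalIntegral.integral_hasDerivAt_right (hF.intervalIntegrable 0 z)
    hF.aestronglyMeasurable.stronglyMeasurableAtFilter hF.continuousAt).sub_const _

theorem continuous_greenOp (hF : Continuous F) : Continuous (greenOp F) :=
  continuous_iff_continuousAt.2 fun z => (hasDerivAt_greenOp hF z).continuousAt

theorem secondDiff_greenOp (hF : Continuous F) {t : ℝ} (ht : 0 ≤ t) (z : ℝ) :
    secondDiff t (greenOp F) z = hatAvg t F z :=
  secondDiff_eq_hatAvg ht (fun y _ => hasDerivAt_greenOp hF y)
    (fun y _ => hasDerivAt_deriv_greenOp hF y) hF.continuousOn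

end greenOp

/-- The (unnormalized) sine coefficient on `[0,π]`. -/
noncomputable def sineCoeff (k : ℕ) (f : ℝ → ℝ) : ℝ :=
  ∫ z in (0 : ℝ)..Real.pi, f z * Real.sin (k * z)

/-- The expression f' sin kz - f k cos kz is a primitive of f'' sin kz + k² f sin kz and vanishes at
both ends. -/
theorem sineCoeff_deriv_deriv {f f1 f2 : ℝ → ℝ} (h1 : ∀ z, HasDerivAt f (f1 z) z)
    (h2 : ∀ z, HasDerivAt f1 (f2 z) z) (hc : Continuous f2) (h0 : f 0 = 0) (hπ : f Real.pi = 0)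
    (k : ℕ) : sineCoeff k f2 = -(k : ℝ) ^ 2 * sineCoeff k f := by
  have hs : ∀ z : ℝ, HasDerivAt (fun z => Real.sin (k * z)) (k * Real.cos (k * z)) z := fun z =>
    (((hasDerivAt_id z).const_mul (k : ℝ)).sin).congr_deriv (by simp; ring)
  have hcs : ∀ z : ℝ, HasDerivAt (fun z => k * Real.cos (k * z)) (-(k : ℝ) ^ 2 * Real.sin (k * z)) z :=
    fun z => ((((hasDerivAt_id z).const_mul (k : ℝ)).cos).const_mul (k : ℝ)).congr_deriv
      (by simp; ring)
  have hd : ∀ z ∈ uIcc 0 Real.pi, HasDerivAt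
      (fun z => f1 z * Real.sin (k * z) - f z * (k * Real.cos (k * z)))
      (f2 z * Real.sin (k * z) + (k : ℝ) ^ 2 * (f z * Real.sin (k * z))) z := fun z _ =>
    (((h2 z).mul (hs z)).sub ((h1 z).mul (hcs z))).congr_deriv (by ring)
  have hf : Continuous f := continuous_iff_continuousAt.2 fun z => (h1 z).continuousAt
  have i1 : IntervalIntegrable (fun z => f2 z * Real.sin (k * z)) volume 0 Real.pi :=
    (hc.mul (by fun_prop)).intervalIntegrable _ _
  have i2 : IntervalIntegrable (fun z => (k : ℝ) ^ 2 * (f z * Real.sin (k * z))) volume 0 Real.pi :=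
    (continuous_const.mul (hf.mul (by fun_prop))).intervalIntegrable _ _
  have := intervalIntegral.integral_eq_sub_of_hasDerivAt hd (i1.add i2)
  rw [intervalIntegral.integral_add i1 i2, intervalIntegral.integral_const_mul, h0, hπ,
    mul_zero, Real.sin_nat_mul_pi, Real.sin_zero] at this
  simp only [sineCoeff]
  linarith

theorem sineCoeff_greenOp {F : ℝ → ℝ} (hF : Continuous F) (k : ℕ) :
    sineCoeff k F = -(k : ℝ) ^ 2 * sineCoeff k (greenOp F) :=
  sineCoeff_deriv_deriv (hasDerivAt_greenOp hF) (hasDerivAt_deriv_greenOp hF) hF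
    (greenOp_zero F) (greenOp_pi F) k

theorem abs_sineCoeff_le {f : ℝ → ℝ} {M : ℝ} (h : ∀ z ∈ Icc 0 Real.pi, |f z| ≤ M) (k : ℕ) :
    |sineCoeff k f| ≤ M * Real.pi := by
  have := intervalIntegral.norm_integral_le_of_norm_le_const (a := 0) (b := Real.pi)
    (f := fun z => f z * Real.sin (k * z)) (C := M) fun z hz => by
      rw [uIoc_of_le Real.pi_pos.le] at hz
      rw [norm_mul]
      have h1 := h z ⟨hz.1.le, hz.2⟩
      have h2 := Real.abs_sin_le_one (k * z)
      exact (mul_le_of_le_one_right (norm_nonneg _) h2).trans h1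
  rwa [sub_zero, abs_of_pos Real.pi_pos] at this


/-! ### Fractional integrals depending on a parameter. -/

theorem intervalIntegrable_one_sub_rpow {γ : ℝ} (hγ : 0 < γ) :
    IntervalIntegrable (fun r : ℝ => (1 - r) ^ (γ - 1)) volume 0 1 := by
  simpa using intervalIntegrable_sub_rpow_mul_rpow hγ one_pos one_pos

/-- The substitution s = x r. On a fixed interval joint continuity in x and z follows by dominated
convergence, and the factor x^γ becomes visible. -/
theorem fracInt_eq_scaled {γ : ℝ} (hγ : 0 < γ) (f : ℝ → ℝ) {x : ℝ} (hx : 0 ≤ x) :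
    fracInt γ f x
      = (Real.Gamma γ)⁻¹ * (x ^ γ * ∫ r in (0 : ℝ)..1, (1 - r) ^ (γ - 1) * f (x * r)) := by
  rcases hx.eq_or_lt with rfl | hx
  · simp [fracInt, Real.zero_rpow hγ.ne']
  have h1 := intervalIntegral.mul_integral_comp_mul_left (a := 0) (b := 1)
    (f := fun s => (x - s) ^ (γ - 1) * f s) x
  rw [mul_zero, mul_one] at h1
  have h2 : x ^ γ = x * x ^ (γ - 1) := by
    rw [← Real.rpow_one_add' hx.le (by linarith)]; congr 1; ring
  have h3 : ∫ r in (0 : ℝ)..1, (x - x * r) ^ (γ - 1) * f (x * r)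
      = ∫ r in (0 : ℝ)..1, x ^ (γ - 1) * ((1 - r) ^ (γ - 1) * f (x * r)) := by
    refine intervalIntegral.integral_congr fun r hr => ?_
    rw [uIcc_of_le zero_le_one] at hr
    have h4 : x - x * r = x * (1 - r) := by ring
    simp only [h4]
    rw [Real.mul_rpow hx.le (by linarith [hr.2])]; ring
  rw [fracInt, ← h1, h3, h2, mul_assoc, intervalIntegral.integral_const_mul]

/-- The fractional integral in the first variable, rescaled to a fixed interval. -/
noncomputable def fracMean (γ : ℝ) (w : ℝ → ℝ → ℝ) (x z : ℝ) : ℝ :=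
  (Real.Gamma γ)⁻¹ * (x ^ γ * ∫ r in (0 : ℝ)..1, (1 - r) ^ (γ - 1) * w (x * r) z)

theorem fracMean_eq {γ : ℝ} (hγ : 0 < γ) (w : ℝ → ℝ → ℝ) {x : ℝ} (hx : 0 ≤ x) (z : ℝ) :
    fracMean γ w x z = fracInt γ (fun s => w s z) x :=
  (fracInt_eq_scaled hγ (fun s => w s z) hx).symm

theorem continuous_integral_scaled {γ : ℝ} (hγ : 0 < γ) {w : ℝ → ℝ → ℝ}
    (hw : Continuous (Function.uncurry w)) {M : ℝ} (hM : ∀ x z, |w x z| ≤ M) :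
    Continuous fun p : ℝ × ℝ => ∫ r in (0 : ℝ)..1, (1 - r) ^ (γ - 1) * w (p.1 * r) p.2 := by
  refine intervalIntegral.continuous_of_dominated_interval
    (bound := fun r => |(1 - r) ^ (γ - 1)| * M) (fun p => ?_) (fun p => ?_)
    ((intervalIntegrable_one_sub_rpow hγ).abs.mul_const M) ?_
  · refine AEStronglyMeasurable.mul ?_ ?_
    · exact (by fun_prop : Measurable fun r : ℝ => (1 - r) ^ (γ - 1)).aestronglyMeasurable
    · exact (hw.comp (by fun_prop : Continuous fun r : ℝ => (p.1 * r, p.2))).aestronglyMeasurable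
  · refine Filter.Eventually.of_forall fun r _ => ?_
    rw [norm_mul]
    exact mul_le_mul_of_nonneg_left (hM _ _) (norm_nonneg _)
  · refine Filter.Eventually.of_forall fun r _ => ?_
    exact continuous_const.mul (hw.comp (by fun_prop : Continuous fun p : ℝ × ℝ => (p.1 * r, p.2)))

theorem continuous_fracMean {γ : ℝ} (hγ : 0 < γ) {w : ℝ → ℝ → ℝ}
    (hw : Continuous (Function.uncurry w)) {M : ℝ} (hM : ∀ x z, |w x z| ≤ M) :
    Continuous (Function.uncurry (fracMean γ w)) := by
  have h2 : Continuous fun p : ℝ × ℝ => p.1 ^ γ :=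
    (Real.continuous_rpow_const hγ.le).comp continuous_fst
  exact continuous_const.mul (h2.mul (continuous_integral_scaled hγ hw hM))

theorem abs_fracInt_le {γ : ℝ} (hγ : 0 < γ) {f : ℝ → ℝ} {M x : ℝ} (hx : 0 ≤ x)
    (hM : ∀ s ∈ Icc 0 x, |f s| ≤ M) : |fracInt γ f x| ≤ M * (x ^ γ / Real.Gamma (γ + 1)) := by
  rcases hx.eq_or_lt with rfl | hx
  · simp [fracInt, Real.zero_rpow hγ.ne']
  have hΓ := Real.Gamma_pos_of_pos hγ
  rw [fracInt, abs_mul, abs_inv, abs_of_pos hΓ]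
  have h1 : |∫ s in (0 : ℝ)..x, (x - s) ^ (γ - 1) * f s| ≤ M * (x ^ γ / γ) := by
    have h2 : ∫ s in (0 : ℝ)..x, (x - s) ^ (γ - 1) * M = M * (x ^ γ / γ) := by
      rw [intervalIntegral.integral_mul_const, integral_sub_rpow hγ hx, mul_comm]
    rw [← h2]
    refine intervalIntegral.norm_integral_le_of_norm_le (μ := volume)
      (f := fun s => (x - s) ^ (γ - 1) * f s) (g := fun s => (x - s) ^ (γ - 1) * M) hx.le ?_
      ((intervalIntegrable_sub_rpow hγ hx).mul_const M)
    refine Filter.Eventually.of_forall fun s hs => ?_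
    have h0 : 0 ≤ (x - s) ^ (γ - 1) := Real.rpow_nonneg (by linarith [hs.2]) _
    rw [norm_mul, Real.norm_eq_abs, abs_of_nonneg h0]
    exact mul_le_mul_of_nonneg_left (hM s ⟨hs.1.le, hs.2⟩) h0
  calc _ ≤ (Real.Gamma γ)⁻¹ * (M * (x ^ γ / γ)) := by gcongr
    _ = _ := by rw [Real.Gamma_add_one hγ.ne']; field_simp

theorem integral_mul_integral_swap {K : ℝ → ℝ} {a b p q : ℝ} {W : ℝ → ℝ → ℝ}
    (hK : IntervalIntegrable K volume a b) (hW : Continuous (Function.uncurry W)) {M : ℝ}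
    (hM : ∀ x z, |W x z| ≤ M) :
    ∫ s in a..b, K s * ∫ z in p..q, W s z = ∫ z in p..q, ∫ s in a..b, K s * W s z := by
  simp only [← intervalIntegral.integral_const_mul]
  refine intervalIntegral_intervalIntegral_swap ?_
  rw [IntegrableOn, Measure.volume_eq_prod, ← Measure.prod_restrict]
  have h1 : Integrable (fun v : ℝ × ℝ => K v.1 * (1 : ℝ))
      ((volume.restrict (uIoc a b)).prod (volume.restrict (uIoc p q))) :=
    (intervalIntegrable_iff.1 hK).mul_prod (intervalIntegrable_iff.1 intervalIntegrable_const)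
  refine (h1.norm.mul_const M).mono' ?_ (Filter.Eventually.of_forall fun v => ?_)
  · refine AEStronglyMeasurable.mul ?_ hW.aestronglyMeasurable
    simpa using h1.aestronglyMeasurable
  · rw [Function.uncurry_def, norm_mul, mul_one]
    exact mul_le_mul_of_nonneg_left (hM _ _) (norm_nonneg _)

theorem sineCoeff_fracInt {γ : ℝ} (hγ : 0 < γ) {w : ℝ → ℝ → ℝ}
    (hw : Continuous (Function.uncurry w)) {M : ℝ} (hM : ∀ x z, |w x z| ≤ M) {x : ℝ} (hx : 0 < x)
    (k : ℕ) :
    sineCoeff k (fun z => fracInt γ (fun s => w s z) x) = fracInt γ (fun s => sineCoeff k (w s)) x := by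
  have h1 := integral_mul_integral_swap (p := 0) (q := Real.pi)
    (W := fun s z => w s z * Real.sin (k * z)) (intervalIntegrable_sub_rpow hγ hx)
    (hw.mul (by fun_prop : Continuous fun v : ℝ × ℝ => Real.sin (k * v.2))) (M := M) fun s z => by
      rw [abs_mul]
      exact (mul_le_of_le_one_right (abs_nonneg _) (Real.abs_sin_le_one _)).trans (hM s z)
  simp only [sineCoeff, fracInt]
  rw [h1, ← intervalIntegral.integral_const_mul]
  congr 1; ext z
  rw [mul_assoc, ← intervalIntegral.integral_mul_const]
  congr 2; ext s; ring

theorem fracInt_two (f : ℝ → ℝ) (x : ℝ) : fracInt 2 f x = ∫ s in (0 : ℝ)..x, (x - s) * f s := by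
  rw [fracInt, Real.Gamma_two, inv_one, one_mul]
  norm_num

theorem secondDiff_fracInt_two {f : ℝ → ℝ} (hf : Continuous f) {r : ℝ} (hr : 0 ≤ r) (x : ℝ) :
    secondDiff r (fracInt 2 f) x = hatAvg r f x := by
  have h : fracInt 2 f = fun x => ∫ s in (0 : ℝ)..x, (x - s) * f s := funext (fracInt_two f)
  rw [h]
  exact secondDiff_eq_hatAvg hr (fun y _ => hasDerivAt_integral_sub_mul hf y)
    (fun y _ => intervalIntegral.integral_hasDerivAt_right (hf.intervalIntegrable 0 y)
      hf.aestronglyMeasurable.stronglyMeasurableAtFilter hf.continuousAt) hf.continuousOn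

/-- The interior version of `secondDiff_fracInt_two` for f that may be unbounded near 0 and is only
integrable there. -/
theorem secondDiff_integral_sub_mul {f : ℝ → ℝ} (hf : ContinuousOn f (Ioo 0 1))
    (hi : ∀ x ∈ Ioo (0 : ℝ) 1, IntervalIntegrable f volume 0 x) {r x : ℝ} (hr : 0 ≤ r)
    (h0 : 0 < x - r) (h1 : x + r < 1) :
    secondDiff r (fun x => ∫ s in (0 : ℝ)..x, (x - s) * f s) x = hatAvg r f x := by
  have hsub : Icc (x - r) (x + r) ⊆ Ioo 0 1 := fun y hy =>
    ⟨h0.trans_le hy.1, hy.2.trans_lt h1⟩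
  have his : ∀ x ∈ Ioo (0 : ℝ) 1, IntervalIntegrable (fun s => s * f s) volume 0 x := fun x hx =>
    (hi x hx).continuousOn_mul continuousOn_id
  have e1 : ∀ y ∈ Ioo (0 : ℝ) 1, ∫ s in (0 : ℝ)..y, (y - s) * f s
      = y * (∫ s in (0 : ℝ)..y, f s) - ∫ s in (0 : ℝ)..y, s * f s := by
    intro y hy
    rw [← intervalIntegral.integral_const_mul, ← intervalIntegral.integral_sub
      ((hi y hy).const_mul y) (his y hy)]
    congr 1; ext s; ring
  have hfs : ContinuousOn (fun s => s * f s) (Ioo 0 1) := continuousOn_id.mul hf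
  have d1 : ∀ y ∈ Ioo (0 : ℝ) 1, HasDerivAt (fun y => ∫ s in (0 : ℝ)..y, f s) (f y) y :=
    fun y hy => intervalIntegral.integral_hasDerivAt_right (hi y hy)
      (hf.stronglyMeasurableAtFilter isOpen_Ioo y hy) (hf.continuousAt (isOpen_Ioo.mem_nhds hy))
  have d2 : ∀ y ∈ Ioo (0 : ℝ) 1, HasDerivAt (fun y => ∫ s in (0 : ℝ)..y, s * f s) (y * f y) y :=
    fun y hy => intervalIntegral.integral_hasDerivAt_right (his y hy)
      (hfs.stronglyMeasurableAtFilter isOpen_Ioo y hy) (hfs.continuousAt (isOpen_Ioo.mem_nhds hy))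
  refine secondDiff_eq_hatAvg (f1 := fun y => ∫ s in (0 : ℝ)..y, f s) hr (fun y hy => ?_)
    (fun y hy => d1 y (hsub hy)) (hf.mono hsub)
  have := ((hasDerivAt_id y).mul (d1 y (hsub hy))).sub (d2 y (hsub hy))
  refine (this.congr_deriv (by simp)).congr_of_eventuallyEq ?_
  filter_upwards [isOpen_Ioo.mem_nhds (hsub hy)] with y' hy' using e1 y' hy'


/-! ### The strip problem and the splitting of its potential. -/

theorem hatAvg_mul_add_mul {f g : ℝ → ℝ} {t z : ℝ} (ht : 0 ≤ t)
    (hf : ContinuousOn f (Icc (z - t) (z + t))) (hg : ContinuousOn g (Icc (z - t) (z + t)))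
    (a b : ℝ) : hatAvg t (fun y => a * f y + b * g y) z = a * hatAvg t f z + b * hatAvg t g z := by
  rw [← hatAvg_const_mul, ← hatAvg_const_mul]
  exact hatAvg_add ht (continuousOn_const.mul hf) (continuousOn_const.mul hg)

theorem secondDiff_hatAvg {F : ℝ → ℝ → ℝ} {t z : ℝ} (ht : 0 ≤ t)
    (hF : ∀ x, ContinuousOn (F x) (Icc (z - t) (z + t))) (r x : ℝ) :
    secondDiff r (fun x => hatAvg t (F x) z) x
      = hatAvg t (fun z => secondDiff r (fun x => F x z) x) z := by
  have h1 := hatAvg_mul_add_mul ht ((hF (x + r)).add (hF (x - r))) (hF x) 1 (-2)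
  have h2 := hatAvg_add ht (hF (x + r)) (hF (x - r))
  have h3 : ∀ y, secondDiff r (fun x => F x y) x
      = 1 * (F (x + r) y + F (x - r) y) + -2 * F x y := fun y => by simp only [secondDiff]; ring
  simp only [h3]
  refine Eq.trans ?_ h1.symm
  refine Eq.trans ?_ (congrArg (fun v => 1 * v + -2 * hatAvg t (F x) z) h2.symm)
  simp only [secondDiff]; ring

/-- Integrated form of the homogeneous equation `D^α D^α w + a w_zz - c² w = 0` in
`(0,1) × (0,π)` with zero boundary values, where `h = D^α D^α w` and `g₀` is the limit of
`D^α w` at `x = 0`. -/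
structure DirichletStrip (α a c : ℝ) (w h : ℝ → ℝ → ℝ) (g₀ : ℝ → ℝ) : Prop where
  α_pos : 0 < α
  α_lt : α < 1
  a_pos : 0 < a
  cont : Continuous (Function.uncurry w)
  bdd : ∃ M, ∀ x z, |w x z| ≤ M
  left : ∀ z, w 0 z = 0
  right : ∀ z, w 1 z = 0
  bottom : ∀ x, w x 0 = 0
  top : ∀ x, w x Real.pi = 0
  h_cont : ContinuousOn (Function.uncurry h) (Ioo 0 1 ×ˢ Ioo 0 Real.pi)
  h_int : ∀ z ∈ Ioo 0 Real.pi, ∀ x ∈ Ioo (0 : ℝ) 1,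
    IntervalIntegrable (fun s => h s z) volume 0 x
  identity : ∀ z ∈ Ioo 0 Real.pi, ∀ x ∈ Ioo (0 : ℝ) 1,
    fracInt (2 - 2 * α) (fun s => w s z) x
      = g₀ z * (x ^ (2 - α) / Real.Gamma (3 - α)) + ∫ s in (0 : ℝ)..x, (x - s) * h s z
  zz : ∀ x ∈ Ioo (0 : ℝ) 1, ∃ w1 : ℝ → ℝ, ∀ z ∈ Ioo 0 Real.pi,
    HasDerivAt (w x) (w1 z) z ∧ HasDerivAt w1 ((c ^ 2 * w x z - h x z) / a) z

/-- The fractional integral of order `2 - α` of the constant `1`. -/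
noncomputable def startProfile (α x : ℝ) : ℝ := x ^ (2 - α) / Real.Gamma (3 - α)

/-- The doubly integrated equation. -/
noncomputable def stripPotential (α a c : ℝ) (w : ℝ → ℝ → ℝ) (x z : ℝ) : ℝ :=
  greenOp (fun z => fracMean (2 - 2 * α) w x z - c ^ 2 * fracMean 2 w x z) z + a * fracMean 2 w x z

/-- Strict convexity of x^(2-α), as 2 - α > 1. Dividing by this number recovers the factor of the
start profile from values at x = 1/4, 1/2, 3/4. -/
theorem secondDiff_startProfile_pos {α : ℝ} (hα : α < 1) :
    0 < secondDiff (1 / 4) (startProfile α) (1 / 2) := by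
  have hΓ : 0 < Real.Gamma (3 - α) := Real.Gamma_pos_of_pos (by linarith)
  have h := (strictConvexOn_rpow (p := 2 - α) (by linarith)).2
    (show (1 / 4 : ℝ) ∈ Ici 0 by norm_num) (show (3 / 4 : ℝ) ∈ Ici 0 by norm_num) (by norm_num)
    (show (0 : ℝ) < 1 / 2 by norm_num) (show (0 : ℝ) < 1 / 2 by norm_num) (by norm_num)
  simp only [smul_eq_mul] at h
  norm_num at h
  simp only [secondDiff, startProfile]
  norm_num
  rw [← add_div, ← mul_div_assoc]
  exact (div_lt_div_iff_of_pos_right hΓ).2 (by linarith)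

theorem continuous_startProfile {α : ℝ} (hα : α < 1) : Continuous (startProfile α) :=
  (Real.continuous_rpow_const (by linarith)).div_const _

theorem startProfile_zero {α : ℝ} (hα : α < 1) : startProfile α 0 = 0 := by
  rw [startProfile, Real.zero_rpow (by linarith), zero_div]

namespace DirichletStrip

variable {α a c : ℝ} {w h : ℝ → ℝ → ℝ} {g₀ : ℝ → ℝ}

theorem order_pos (S : DirichletStrip α a c w h g₀) : 0 < 2 - 2 * α := by linarith [S.α_lt]

theorem continuous_fracMean (S : DirichletStrip α a c w h g₀) {γ : ℝ} (hγ : 0 < γ) :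
    Continuous (Function.uncurry (fracMean γ w)) := by
  obtain ⟨M, hM⟩ := S.bdd
  exact _root_.continuous_fracMean hγ S.cont hM

theorem cont_left (S : DirichletStrip α a c w h g₀) (z : ℝ) : Continuous fun x => w x z :=
  S.cont.comp (by fun_prop : Continuous fun x : ℝ => (x, z))

theorem cont_right (S : DirichletStrip α a c w h g₀) (x : ℝ) : Continuous (w x) :=
  S.cont.comp (by fun_prop : Continuous fun z : ℝ => (x, z))

theorem continuous_source (S : DirichletStrip α a c w h g₀) :
    Continuous fun v : ℝ × ℝ =>
      fracMean (2 - 2 * α) w v.1 v.2 - c ^ 2 * fracMean 2 w v.1 v.2 :=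
  (S.continuous_fracMean S.order_pos).sub
    (continuous_const.mul (S.continuous_fracMean two_pos))

theorem continuous_source_right (S : DirichletStrip α a c w h g₀) (x : ℝ) :
    Continuous fun z => fracMean (2 - 2 * α) w x z - c ^ 2 * fracMean 2 w x z :=
  S.continuous_source.comp (by fun_prop : Continuous fun z : ℝ => (x, z))

theorem continuous_fracMean_right (S : DirichletStrip α a c w h g₀) {γ : ℝ} (hγ : 0 < γ) (x : ℝ) :
    Continuous fun z => fracMean γ w x z :=
  (S.continuous_fracMean hγ).comp (by fun_prop : Continuous fun z : ℝ => (x, z))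

theorem continuous_fracMean_left (S : DirichletStrip α a c w h g₀) {γ : ℝ} (hγ : 0 < γ) (z : ℝ) :
    Continuous fun x => fracMean γ w x z :=
  (S.continuous_fracMean hγ).comp (by fun_prop : Continuous fun x : ℝ => (x, z))

theorem continuous_potential_right (S : DirichletStrip α a c w h g₀) (x : ℝ) :
    Continuous (stripPotential α a c w x) :=
  (continuous_greenOp (S.continuous_source_right x)).add
    (continuous_const.mul (S.continuous_fracMean_right two_pos x))

theorem continuous_potential_left (S : DirichletStrip α a c w h g₀) (z : ℝ) :
    Continuous fun x => stripPotential α a c w x z := by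
  have hs := S.continuous_source
  have key : ∀ p b : ℝ, Continuous fun x => ∫ s in (0 : ℝ)..b, (p - s)
      * (fracMean (2 - 2 * α) w x s - c ^ 2 * fracMean 2 w x s) := fun p b =>
    intervalIntegral.continuous_parametric_intervalIntegral_of_continuous'
      ((by fun_prop : Continuous fun v : ℝ × ℝ => p - v.2).mul hs) 0 b
  exact ((key z z).sub (continuous_const.mul (key Real.pi Real.pi))).add
    (continuous_const.mul (S.continuous_fracMean_left two_pos z))

theorem fracMean_bottom (S : DirichletStrip α a c w h g₀) (γ x : ℝ) : fracMean γ w x 0 = 0 := by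
  simp [fracMean, S.bottom]

theorem fracMean_top (S : DirichletStrip α a c w h g₀) (γ x : ℝ) :
    fracMean γ w x Real.pi = 0 := by
  simp [fracMean, S.top]

theorem potential_bottom (S : DirichletStrip α a c w h g₀) (x : ℝ) :
    stripPotential α a c w x 0 = 0 := by
  rw [stripPotential, greenOp_zero, S.fracMean_bottom]; simp

theorem potential_top (S : DirichletStrip α a c w h g₀) (x : ℝ) :
    stripPotential α a c w x Real.pi = 0 := by
  rw [stripPotential, greenOp_pi, S.fracMean_top]; simp

theorem potential_left (S : DirichletStrip α a c w h g₀) (z : ℝ) :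
    stripPotential α a c w 0 z = 0 := by
  have h0 : ∀ γ > 0, ∀ z, fracMean γ w 0 z = 0 := fun γ hγ z => by
    simp [fracMean, Real.zero_rpow hγ.ne']
  simp [stripPotential, h0 _ S.order_pos, h0 _ two_pos, greenOp]

theorem secondDiff_potential (S : DirichletStrip α a c w h g₀) {t : ℝ} (ht : 0 ≤ t) (x z : ℝ) :
    secondDiff t (stripPotential α a c w x) z
      = hatAvg t (fun z => fracMean (2 - 2 * α) w x z - c ^ 2 * fracMean 2 w x z) z
        + a * secondDiff t (fracMean 2 w x) z := by
  rw [← secondDiff_greenOp (S.continuous_source_right x) ht]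
  simp only [secondDiff, stripPotential]; ring

/-- The integrated identity differenced twice in x: J² h becomes a hat average of h over an interior
segment, which involves no behaviour at x = 0. -/
theorem secondDiff_order (S : DirichletStrip α a c w h g₀) {z r x : ℝ} (hz : z ∈ Ioo 0 Real.pi)
    (hr : 0 ≤ r) (h0 : 0 < x - r) (h1 : x + r < 1) :
    secondDiff r (fun x => fracMean (2 - 2 * α) w x z) x
      = g₀ z * secondDiff r (startProfile α) x + hatAvg r (fun x => h x z) x := by
  have hc : ContinuousOn (fun x => h x z) (Ioo 0 1) :=
    S.h_cont.comp (by fun_prop : ContinuousOn (fun x : ℝ => (x, z)) _) fun x hx => ⟨hx, hz⟩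
  rw [← secondDiff_integral_sub_mul hc (S.h_int z hz) hr h0 h1]
  have e : ∀ y, 0 < y → y < 1 → fracMean (2 - 2 * α) w y z
      = g₀ z * startProfile α y + ∫ s in (0 : ℝ)..y, (y - s) * h s z := fun y hy0 hy1 => by
    rw [fracMean_eq S.order_pos w hy0.le, S.identity z hz y ⟨hy0, hy1⟩, startProfile]
  simp only [secondDiff]
  rw [e _ (by linarith) h1, e _ h0 (by linarith), e x (by linarith) (by linarith)]
  ring

theorem secondDiff_two (S : DirichletStrip α a c w h g₀) {z r x : ℝ}
    (hr : 0 ≤ r) (h0 : 0 ≤ x - r) :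
    secondDiff r (fun x => fracMean 2 w x z) x = hatAvg r (fun x => w x z) x := by
  rw [← secondDiff_fracInt_two (S.cont_left z) hr]
  simp only [secondDiff]
  rw [fracMean_eq two_pos _ (by linarith), fracMean_eq two_pos _ h0,
    fracMean_eq two_pos _ (by linarith)]

theorem rect_subset {r x t z : ℝ} (h0 : 0 < x - r) (h1 : x + r < 1) (hz0 : 0 < z - t)
    (hz1 : z + t < Real.pi) :
    Icc (x - r) (x + r) ×ˢ Icc (z - t) (z + t) ⊆ Ioo (0 : ℝ) 1 ×ˢ Ioo 0 Real.pi := fun _ hv =>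
  ⟨⟨h0.trans_le hv.1.1, hv.1.2.trans_lt h1⟩, ⟨hz0.trans_le hv.2.1, hv.2.2.trans_lt hz1⟩⟩

/-- `secondDiff_order` is solved for g₀ with centre 1/2 and step 1/4; all other terms are continuous
in z. -/
theorem continuousOn_start (S : DirichletStrip α a c w h g₀) : ContinuousOn g₀ (Ioo 0 Real.pi) := by
  have hD := secondDiff_startProfile_pos S.α_lt
  have hg : ∀ z ∈ Ioo 0 Real.pi, g₀ z = (secondDiff (1 / 4) (fun x => fracMean (2 - 2 * α) w x z)
      (1 / 2) - hatAvg (1 / 4) (fun x => h x z) (1 / 2))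
        / secondDiff (1 / 4) (startProfile α) (1 / 2) := by
    intro z hz
    have := S.secondDiff_order hz (r := 1 / 4) (x := 1 / 2) (by norm_num) (by norm_num)
      (by norm_num)
    rw [this]; field_simp; ring
  intro z hz
  refine ContinuousAt.continuousWithinAt ?_
  obtain ⟨p, hp0, hpz⟩ := exists_between hz.1
  obtain ⟨q, hzq, hq1⟩ := exists_between hz.2
  have hsub : Icc p q ⊆ Ioo 0 Real.pi := fun y hy => ⟨hp0.trans_le hy.1, hy.2.trans_lt hq1⟩
  refine ContinuousOn.continuousAt (s := Icc p q) ?_ (Icc_mem_nhds hpz hzq)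
  refine ContinuousOn.congr ?_ fun y hy => hg y (hsub hy)
  refine ContinuousOn.div_const (ContinuousOn.sub (Continuous.continuousOn ?_) ?_) _
  · have := fun x => S.continuous_fracMean_right S.order_pos x
    simp only [secondDiff]
    exact ((this _).add (this _)).sub (continuous_const.mul (this _))
  · refine continuousOn_hatAvg_left (by norm_num) (S.h_cont.mono ?_)
    refine prod_mono (fun x hx => ⟨?_, ?_⟩) hsub
    · have := hx.1; norm_num at this; linarith
    · have := hx.2; norm_num at this; linarith

/-- Formally, the second z-derivative of the potential is J^(2-2α) w - c² J² w + a J² w_zz, and two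
x-derivatives of it leave g₀ times the second derivative of the start profile plus h - c² w + a w_zz
= 0. In integrated form only values in an interior rectangle are used. -/
theorem secondDiff_secondDiff_potential (S : DirichletStrip α a c w h g₀) {r x t z : ℝ}
    (hr : 0 ≤ r) (h0 : 0 < x - r) (h1 : x + r < 1) (ht : 0 ≤ t) (hz0 : 0 < z - t)
    (hz1 : z + t < Real.pi) :
    secondDiff r (fun x => secondDiff t (stripPotential α a c w x) z) x
      = secondDiff r (startProfile α) x * hatAvg t g₀ z := by
  have hrect := rect_subset h0 h1 hz0 hz1
  have hzs : Icc (z - t) (z + t) ⊆ Ioo 0 Real.pi := fun y hy =>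
    ⟨hz0.trans_le hy.1, hy.2.trans_lt hz1⟩
  have hxs : Icc (x - r) (x + r) ⊆ Ioo 0 1 := fun y hy => ⟨h0.trans_le hy.1, hy.2.trans_lt h1⟩
  have hch := S.h_cont.mono hrect
  have hcw : ContinuousOn (Function.uncurry w) (Icc (x - r) (x + r) ×ˢ Icc (z - t) (z + t)) :=
    S.cont.continuousOn
  have hg := S.continuousOn_start.mono hzs
  have cH : ContinuousOn (fun z => hatAvg r (fun x => h x z) x) (Icc (z - t) (z + t)) :=
    continuousOn_hatAvg_left hr hch
  have cW : ContinuousOn (fun z => hatAvg r (fun x => w x z) x) (Icc (z - t) (z + t)) :=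
    continuousOn_hatAvg_left hr hcw
  have e1 : secondDiff r (fun x => hatAvg t
      (fun z => fracMean (2 - 2 * α) w x z - c ^ 2 * fracMean 2 w x z) z) x
      = hatAvg t (fun z => secondDiff r (fun x => fracMean (2 - 2 * α) w x z) x
        + -c ^ 2 * secondDiff r (fun x => fracMean 2 w x z) x) z := by
    refine (secondDiff_hatAvg ht (fun y => (S.continuous_source_right y).continuousOn) r x).trans ?_
    refine hatAvg_congr ht fun y _ => ?_
    simp only [secondDiff]; ring
  -- The two differences commute, so J² is removed first; then, at each fixed interior x', Taylor's
  -- formula in z uses the equation for w_zz.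
  have e2 : secondDiff r (fun x => secondDiff t (fracMean 2 w x) z) x
      = hatAvg r (fun x => hatAvg t (fun z => (c ^ 2 * w x z - h x z) / a) z) x := by
    have h2 : secondDiff r (fun x => secondDiff t (fracMean 2 w x) z) x
        = secondDiff t (fun z => secondDiff r (fun x => fracMean 2 w x z) x) z := by
      simp only [secondDiff]; ring
    have h3 : ∀ z, secondDiff r (fun x => fracMean 2 w x z) x = hatAvg r (fun x => w x z) x :=
      fun z => S.secondDiff_two hr h0.le
    have h4 : secondDiff t (fun z => hatAvg r (fun x => w x z) x) z
        = hatAvg r (fun x => secondDiff t (w x) z) x := by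
      exact secondDiff_hatAvg hr (F := fun z x => w x z) (fun y => (S.cont_left y).continuousOn) t z
    rw [h2]
    simp only [h3]
    rw [h4]
    refine hatAvg_congr hr fun x' hx' => ?_
    obtain ⟨w1, hw1⟩ := S.zz x' (hxs hx')
    refine secondDiff_eq_hatAvg ht (fun y hy => (hw1 y (hzs hy)).1)
      (fun y hy => (hw1 y (hzs hy)).2) ?_
    refine ContinuousOn.div_const (ContinuousOn.sub (continuousOn_const.mul
      (S.cont_right x').continuousOn) ?_) _
    exact S.h_cont.comp (by fun_prop : ContinuousOn (fun z : ℝ => (x', z)) _)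
      fun y hy => ⟨hxs hx', hzs hy⟩
  have e3 : hatAvg r (fun x => hatAvg t (fun z => (c ^ 2 * w x z - h x z) / a) z) x
      = a⁻¹ * (c ^ 2 * hatAvg t (fun z => hatAvg r (fun x => w x z) x) z
        - hatAvg t (fun z => hatAvg r (fun x => h x z) x) z) := by
    rw [hatAvg_comm (h := fun x z => (c ^ 2 * w x z - h x z) / a) hr ht
      (((continuousOn_const.mul hcw).sub hch).div_const _)]
    have e5 := hatAvg_mul_add_mul ht cW cH (a⁻¹ * c ^ 2) (-a⁻¹)
    refine Eq.trans (hatAvg_congr ht fun y hy => ?_) (e5.trans (by ring))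
    have c1 : ContinuousOn (fun x => w x y) (Icc (x - r) (x + r)) := (S.cont_left y).continuousOn
    have c2 : ContinuousOn (fun x => h x y) (Icc (x - r) (x + r)) :=
      S.h_cont.comp (by fun_prop : ContinuousOn (fun x : ℝ => (x, y)) _)
        fun x' hx' => ⟨hxs hx', hzs hy⟩
    rw [← hatAvg_mul_add_mul hr c1 c2]
    congr 1; ext x'; ring
  have e0 : secondDiff r (fun x => secondDiff t (stripPotential α a c w x) z) x
      = secondDiff r (fun x => hatAvg t
        (fun z => fracMean (2 - 2 * α) w x z - c ^ 2 * fracMean 2 w x z) z) x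
        + a * secondDiff r (fun x => secondDiff t (fracMean 2 w x) z) x := by
    simp only [S.secondDiff_potential ht]
    simp only [secondDiff]; ring
  have e4 : hatAvg t (fun z => secondDiff r (fun x => fracMean (2 - 2 * α) w x z) x
        + -c ^ 2 * secondDiff r (fun x => fracMean 2 w x z) x) z
      = secondDiff r (startProfile α) x * hatAvg t g₀ z
        + hatAvg t (fun z => hatAvg r (fun x => h x z) x) z
        + -c ^ 2 * hatAvg t (fun z => hatAvg r (fun x => w x z) x) z := by
    rw [← hatAvg_const_mul, ← hatAvg_const_mul]
    have c1 : ContinuousOn (fun y => secondDiff r (startProfile α) x * g₀ y)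
      (Icc (z - t) (z + t)) := continuousOn_const.mul hg
    have c2 : ContinuousOn (fun y => -c ^ 2 * hatAvg r (fun x => w x y) x)
      (Icc (z - t) (z + t)) := continuousOn_const.mul cW
    have c3 : ContinuousOn (fun y => secondDiff r (startProfile α) x * g₀ y
      + hatAvg r (fun x => h x y) x) (Icc (z - t) (z + t)) := c1.add cH
    rw [← hatAvg_add ht c1 cH, ← hatAvg_add ht c3 c2]
    refine hatAvg_congr ht fun y hy => ?_
    rw [S.secondDiff_order (hzs hy) hr h0 h1, S.secondDiff_two hr h0.le]; ring
  rw [e0, e1, e2, e3, e4, ← mul_assoc a, mul_inv_cancel₀ S.a_pos.ne']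
  ring

/-- The potential splits into the two singular profiles `x ^ (2 - α)` and `x`. -/
theorem exists_potential_eq (S : DirichletStrip α a c w h g₀) :
    ∃ Γ Ψ : ℝ → ℝ, Continuous Γ ∧ Continuous Ψ ∧ Γ 0 = 0 ∧ Γ Real.pi = 0 ∧ Ψ 0 = 0 ∧
      Ψ Real.pi = 0 ∧
      (∀ z t, 0 < t → 0 < z - t → z + t < Real.pi → secondDiff t Γ z = hatAvg t g₀ z) ∧
      ∀ x ∈ Icc (0 : ℝ) 1, ∀ z ∈ Icc 0 Real.pi,
        stripPotential α a c w x z = startProfile α x * Γ z + x * Ψ z := by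
  have hD := secondDiff_startProfile_pos S.α_lt
  set D := secondDiff (1 / 4) (startProfile α) (1 / 2) with hDdef
  set Φ := stripPotential α a c w with hΦ
  -- A second difference in x annihilates the linear profile and isolates the factor of the start
  -- profile; Ψ is then read off at x = 1.
  set Γ : ℝ → ℝ := fun z => secondDiff (1 / 4) (fun x => Φ x z) (1 / 2) / D with hΓ
  set Ψ : ℝ → ℝ := fun z => Φ 1 z - startProfile α 1 * Γ z with hΨ
  have cΦ := S.continuous_potential_right
  have cΓ : Continuous Γ := by
    simp only [hΓ, secondDiff]
    exact (((cΦ _).add (cΦ _)).sub (continuous_const.mul (cΦ _))).div_const _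
  have cΨ : Continuous Ψ := (cΦ 1).sub (continuous_const.mul cΓ)
  have Γ0 : Γ 0 = 0 := by simp [hΓ, secondDiff, hΦ, S.potential_bottom]
  have Γπ : Γ Real.pi = 0 := by simp [hΓ, secondDiff, hΦ, S.potential_top]
  have Ψ0 : Ψ 0 = 0 := by simp [hΨ, Γ0, hΦ, S.potential_bottom]
  have Ψπ : Ψ Real.pi = 0 := by simp [hΨ, Γπ, hΦ, S.potential_top]
  have sΓ : ∀ z t, 0 < t → 0 < z - t → z + t < Real.pi → secondDiff t Γ z = hatAvg t g₀ z := by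
    intro z t ht h0 h1
    have := S.secondDiff_secondDiff_potential (r := 1 / 4) (x := 1 / 2) (by norm_num)
      (by norm_num) (by norm_num) ht.le h0 h1
    have h2 : secondDiff t Γ z
        = secondDiff (1 / 4) (fun x => secondDiff t (Φ x) z) (1 / 2) / D := by
      simp only [hΓ, secondDiff]; ring
    rw [h2, this, mul_div_cancel_left₀ _ hD.ne']
  refine ⟨Γ, Ψ, cΓ, cΨ, Γ0, Γπ, Ψ0, Ψπ, sΓ, ?_⟩
  -- For a fixed z-difference the remainder has vanishing second differences in x and vanishes at x
  -- = 0 and x = 1. The same argument in z then removes the z-difference.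
  have hx : ∀ z t, 0 < t → 0 < z - t → z + t < Real.pi → ∀ x ∈ Icc (0 : ℝ) 1,
      secondDiff t (Φ x) z - startProfile α x * secondDiff t Γ z - x * secondDiff t Ψ z = 0 := by
    intro z t ht h0 h1
    have cs : Continuous fun x => secondDiff t (Φ x) z := by
      simp only [secondDiff]
      exact ((S.continuous_potential_left _).add (S.continuous_potential_left _)).sub
        (continuous_const.mul (S.continuous_potential_left _))
    refine eq_zero_of_secondDiff_eq_zero ?_ ?_ ?_ fun x r hr hx0 hx1 => ?_
    · exact ((cs.sub ((continuous_startProfile S.α_lt).mul continuous_const)).sub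
        (continuous_id.mul continuous_const)).continuousOn
    · simp only [hΦ, secondDiff, S.potential_left, startProfile_zero S.α_lt]; ring
    · simp only [hΨ, secondDiff]; ring
    · have := S.secondDiff_secondDiff_potential hr.le hx0 hx1 ht.le h0 h1
      rw [← sΓ z t ht h0 h1] at this
      have h2 : ∀ A B : ℝ, secondDiff r (fun x => secondDiff t (Φ x) z - startProfile α x * A
          - x * B) x = secondDiff r (fun x => secondDiff t (Φ x) z) x
            - secondDiff r (startProfile α) x * A := by
        intro A B; simp only [secondDiff]; ring
      rw [h2, this, sub_self]
  intro x hx01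
  have := eq_zero_of_secondDiff_eq_zero (a := 0) (b := Real.pi)
    (F := fun z => Φ x z - startProfile α x * Γ z - x * Ψ z)
    (((cΦ x).sub (continuous_const.mul cΓ)).sub (continuous_const.mul cΨ)).continuousOn
    (by simp [hΦ, S.potential_bottom, Γ0, Ψ0]) (by simp [hΦ, S.potential_top, Γπ, Ψπ])
    fun z t ht h0 h1 => by
      rw [← hx z t ht h0 h1 x hx01]; simp only [secondDiff]; ring
  intro z hz
  have := this z hz
  linarith

end DirichletStrip


/-! ### Uniqueness for the scalar integral equations of the sine coefficients. -/

theorem hatAvg_const {t : ℝ} (b z : ℝ) : hatAvg t (fun _ => b) z = b * t ^ 2 := by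
  rw [hatAvg, intervalIntegral.integral_mul_const, intervalIntegral.integral_sub (by simp) (by simp)]
  simp; ring

/-- Hat averages determine a continuous function. -/
theorem eq_zero_of_hatAvg_eq_zero {F : ℝ → ℝ} {p q z δ : ℝ} (hF : ContinuousOn F (Ioo p q))
    (hz : z ∈ Ioo p q) (hδ : 0 < δ) (h : ∀ t, 0 < t → t < δ → hatAvg t F z = 0) : F z = 0 := by
  by_contra hne
  have hpos : 0 < |F z| := abs_pos.2 hne
  have hca := hF.continuousAt (isOpen_Ioo.mem_nhds hz)
  obtain ⟨η, hη, hb⟩ := Metric.continuousAt_iff.1 hca (|F z| / 2) (by positivity)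
  obtain ⟨ρ, hρ, hsub⟩ := Metric.isOpen_iff.1 isOpen_Ioo z hz
  set t := min δ (min η ρ) / 2 with ht
  have hm : 0 < min δ (min η ρ) := lt_min hδ (lt_min hη hρ)
  have ht0 : 0 < t := by positivity
  have htδ : t < δ := by have := min_le_left δ (min η ρ); linarith
  have htη : t < η := by
    have := (min_le_right δ (min η ρ)).trans (min_le_left η ρ); linarith
  have htρ : t < ρ := by
    have := (min_le_right δ (min η ρ)).trans (min_le_right η ρ); linarith
  have hdist : ∀ y ∈ Icc (z - t) (z + t), |y - z| ≤ t := fun y hy =>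
    abs_le.2 ⟨by linarith [hy.1], by linarith [hy.2]⟩
  have hc : ContinuousOn F (Icc (z - t) (z + t)) := hF.mono fun y hy =>
    hsub (by rw [Metric.mem_ball, Real.dist_eq]; exact (hdist y hy).trans_lt htρ)
  have h1 := hatAvg_mul_add_mul ht0.le hc (continuousOn_const (c := F z)) 1 (-1)
  rw [h t ht0 htδ, hatAvg_const] at h1
  have h2 : |hatAvg t (fun y => 1 * F y + -1 * F z) z| ≤ |F z| / 2 * t ^ 2 := by
    refine abs_hatAvg_le ht0.le fun y hy => ?_
    have := hb (x := y) (by rw [Real.dist_eq]; exact (hdist y hy).trans_lt htη)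
    rw [Real.dist_eq] at this
    rw [one_mul, neg_one_mul, ← sub_eq_add_neg]
    exact this.le
  rw [h1, mul_zero, zero_add, neg_one_mul, abs_neg, abs_mul, abs_of_nonneg (sq_nonneg t)] at h2
  have : 0 < |F z| * t ^ 2 := by positivity
  linarith

/-- Second differences of J² d are hat averages of d, and vanishing averages force d = 0. -/
theorem eq_zero_of_fracInt_two_eq_zero {d : ℝ → ℝ} (hd : Continuous d)
    (h : ∀ x ∈ Icc (0 : ℝ) 1, fracInt 2 d x = 0) : ∀ x ∈ Icc (0 : ℝ) 1, d x = 0 := by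
  have hI : ∀ x ∈ Ioo (0 : ℝ) 1, d x = 0 := fun x hx =>
    eq_zero_of_hatAvg_eq_zero hd.continuousOn hx (lt_min hx.1 (sub_pos.2 hx.2)) fun t ht htd => by
      have h1 : t < x := htd.trans_le (min_le_left _ _)
      have h2 : t < 1 - x := htd.trans_le (min_le_right _ _)
      rw [← secondDiff_fracInt_two hd ht.le, secondDiff, h _ ⟨by linarith, by linarith⟩,
        h _ ⟨by linarith, by linarith⟩, h _ ⟨hx.1.le, hx.2.le⟩]
      ring
  have hcl : closure (Ioo (0 : ℝ) 1) = Icc 0 1 := closure_Ioo zero_ne_one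
  intro x hx
  have hEq : EqOn d (fun _ => 0) (closure (Ioo (0 : ℝ) 1)) :=
    EqOn.closure (fun x hx => hI x hx) hd continuous_const
  exact hEq (by rwa [hcl])

theorem intervalIntegrable_sub_rpow_mul_continuousOn {γ x : ℝ} (hγ : 0 < γ) (hx : 0 < x)
    {f : ℝ → ℝ} (hf : ContinuousOn f (Icc 0 x)) :
    IntervalIntegrable (fun s => (x - s) ^ (γ - 1) * f s) volume 0 x :=
  (intervalIntegrable_sub_rpow hγ hx).mul_continuousOn (by rwa [uIcc_of_le hx.le])

theorem continuousOn_fracInt {γ : ℝ} (hγ : 0 < γ) {f : ℝ → ℝ} (hf : Continuous f) {X : ℝ}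
    (hX : 0 ≤ X) : ContinuousOn (fracInt γ f) (Icc 0 X) := by
  obtain ⟨hc, M, hM⟩ := exists_continuous_extension (h := fun x _ => f x) hX (le_refl (0 : ℝ))
    (hf.comp continuous_fst).continuousOn
  have h1 := continuous_fracMean hγ (w := fun x _ => f (max 0 (min X x))) hc (M := M)
    fun x z => hM x z
  have h2 : Continuous fun x => fracMean γ (fun x _ => f (max 0 (min X x))) x 0 :=
    h1.comp (by fun_prop : Continuous fun x : ℝ => (x, (0 : ℝ)))
  refine h2.continuousOn.congr fun x hx => ?_
  refine Eq.trans ?_ (fracMean_eq hγ (fun x _ => f (max 0 (min X x))) hx.1 0).symm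
  exact fracInt_congr hx.1 fun s hs => by
    rw [clamp_eq (show s ∈ Icc 0 X from ⟨hs.1.le, hs.2.le.trans hx.2⟩)]

theorem fracInt_mul_add_mul {γ x : ℝ} {f g : ℝ → ℝ}
    (hf : IntervalIntegrable (fun s => (x - s) ^ (γ - 1) * f s) volume 0 x)
    (hg : IntervalIntegrable (fun s => (x - s) ^ (γ - 1) * g s) volume 0 x) (a b : ℝ) :
    fracInt γ (fun s => a * f s + b * g s) x = a * fracInt γ f x + b * fracInt γ g x := by
  have h := intervalIntegral.integral_add (hf.const_mul a) (hg.const_mul b)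
  rw [intervalIntegral.integral_const_mul, intervalIntegral.integral_const_mul] at h
  have e : ∀ s, (x - s) ^ (γ - 1) * (a * f s + b * g s)
      = a * ((x - s) ^ (γ - 1) * f s) + b * ((x - s) ^ (γ - 1) * g s) := fun s => by ring
  simp only [fracInt, e]
  rw [h]; ring

theorem fracInt_const_mul (γ a : ℝ) (f : ℝ → ℝ) (x : ℝ) :
    fracInt γ (fun s => a * f s) x = a * fracInt γ f x := by
  simp only [fracInt, mul_left_comm _ a, intervalIntegral.integral_const_mul]

/-- A homogeneous Volterra equation has only the zero solution. -/
theorem eq_zero_of_eq_mul_fracInt {β l : ℝ} (hβ : 0 < β) {y : ℝ → ℝ} {X : ℝ} (hX : 0 ≤ X)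
    (hy : ContinuousOn y (Icc 0 X)) (h : ∀ x ∈ Ioc 0 X, y x = l * fracInt β y x) :
    ∀ x ∈ Ioc 0 X, y x = 0 := by
  obtain ⟨M, hM⟩ := isCompact_Icc.exists_bound_of_continuousOn hy
  have hM0 : 0 ≤ M := (norm_nonneg _).trans (hM 0 ⟨le_rfl, hX⟩)
  -- Iterating the equation n times bounds y by the n-th term of a Mittag-Leffler series, which
  -- tends to 0.
  have hb : ∀ n : ℕ, ∀ x ∈ Ioc 0 X, |y x| ≤ M * |l| ^ n * (x ^ (β * n) / Real.Gamma (β * n + 1)) := by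
    intro n
    induction n with
    | zero => intro x hx; simpa using hM x ⟨hx.1.le, hx.2⟩
    | succ n ih =>
      intro x hx
      have hβn : 0 < β * n + 1 := by positivity
      have hg := fracInt_rpow (γ := β) (b := β * n + 1) hβ hβn hx.1
      have hi : IntervalIntegrable (fun s => (x - s) ^ (β - 1)
          * (M * |l| ^ n * (s ^ (β * n) / Real.Gamma (β * n + 1)))) volume 0 x := by
        have := (intervalIntegrable_sub_rpow_mul_rpow hβ hβn hx.1).const_mul
          (M * |l| ^ n / Real.Gamma (β * n + 1))
        refine this.congr fun s _ => ?_
        simp only [add_sub_cancel_right]; ring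
      rw [h x hx, abs_mul]
      have h1 : |fracInt β y x|
          ≤ fracInt β (fun s => M * |l| ^ n * (s ^ (β * n) / Real.Gamma (β * n + 1))) x := by
        have hΓ := Real.Gamma_pos_of_pos hβ
        rw [fracInt, fracInt, abs_mul, abs_inv, abs_of_pos hΓ]
        refine mul_le_mul_of_nonneg_left ?_ (by positivity)
        refine intervalIntegral.norm_integral_le_of_norm_le (μ := volume)
          (f := fun s => (x - s) ^ (β - 1) * y s) hx.1.le ?_ hi
        refine Filter.Eventually.of_forall fun s hs => ?_
        have h0 : 0 ≤ (x - s) ^ (β - 1) := Real.rpow_nonneg (by linarith [hs.2]) _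
        rw [norm_mul, Real.norm_eq_abs, abs_of_nonneg h0]
        exact mul_le_mul_of_nonneg_left (ih s ⟨hs.1, hs.2.trans hx.2⟩) h0
      have h2 : fracInt β (fun s => M * |l| ^ n * (s ^ (β * n) / Real.Gamma (β * n + 1))) x
          = M * |l| ^ n * (x ^ (β * (n + 1 : ℕ)) / Real.Gamma (β * (n + 1 : ℕ) + 1)) := by
        have e1 : β * n + 1 + β - 1 = β * (n + 1 : ℕ) := by push_cast; ring
        have e2 : β * n + 1 + β = β * (n + 1 : ℕ) + 1 := by push_cast; ring
        rw [e1, e2, add_sub_cancel_right] at hg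
        rw [fracInt_const_mul, hg]
      calc |l| * |fracInt β y x| ≤ |l| * _ := mul_le_mul_of_nonneg_left (h1.trans_eq h2) (abs_nonneg l)
        _ = _ := by ring
  intro x hx
  have hlim : Filter.Tendsto
      (fun n : ℕ => M * ((|l| * x ^ β) ^ n / Real.Gamma (β * n + 1))) Filter.atTop (nhds 0) := by
    simpa using (summable_pow_div_Gamma hβ one_pos (|l| * x ^ β)).tendsto_atTop_zero.const_mul M
  have hle : |y x| ≤ 0 := by
    refine ge_of_tendsto' hlim fun n => (hb n x hx).trans_eq ?_
    rw [mul_pow, ← Real.rpow_natCast (x ^ β), ← Real.rpow_mul hx.1.le]; ring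
  exact abs_eq_zero.1 (le_antisymm hle (abs_nonneg _))

/-- The integrated equation for one Fourier coefficient has only the zero solution. -/
theorem eq_zero_of_fracInt_sub_eq {α l g : ℝ} (hα : 0 < α) (hα1 : α < 1) (hl : 0 ≤ l)
    {f : ℝ → ℝ} (hf : Continuous f) (hf1 : f 1 = 0)
    (h : ∀ x ∈ Ioc (0 : ℝ) 1, fracInt (2 - 2 * α) f x - l * fracInt 2 f x = startProfile α x * g) :
    ∀ x ∈ Icc (0 : ℝ) 1, f x = 0 := by
  have h2α : 0 < 2 * α := by linarith
  have hγ : 0 < 2 - 2 * α := by linarith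
  have hβ : 0 < α + 1 := by linarith
  set K := mlKernel (2 * α) (α + 1) l with hK
  have cK : Continuous K := continuous_mlKernel h2α (by linarith) l
  -- K solves the same equation with unit coefficient, so d solves J^(2-2α) d = l J² d = l J^(2α)
  -- (J^(2-2α) d), a homogeneous Volterra equation for J^(2-2α) d.
  set d : ℝ → ℝ := fun x => f x - g * K x with hd
  have cd : Continuous d := hf.sub (continuous_const.mul cK)
  have hsub : ∀ γ > 0, ∀ x > 0, fracInt γ d x = fracInt γ f x - g * fracInt γ K x := by
    intro γ hγ x hx
    have h1 := intervalIntegrable_sub_rpow_mul_continuousOn hγ hx hf.continuousOn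
    have h2 := intervalIntegrable_sub_rpow_mul_continuousOn hγ hx cK.continuousOn
    have h3 := fracInt_mul_add_mul h1 h2 1 (-g)
    rw [one_mul, neg_mul, ← sub_eq_add_neg] at h3
    rw [← h3]
    congr 1; ext s; simp only [hd]; ring
  have hdeq : ∀ x ∈ Ioc (0 : ℝ) 1, fracInt (2 - 2 * α) d x = l * fracInt 2 d x := by
    intro x hx
    have h1 := h x hx
    rw [hsub _ hγ x hx.1, hsub _ two_pos x hx.1, hK, fracInt_mlKernel h2α hβ hγ l hx.1,
      fracInt_mlKernel h2α hβ two_pos l hx.1, show α + 1 + (2 - 2 * α) = 3 - α by ring,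
      mlKernel_eq_add h2α (by linarith) l hx.1, show 3 - α - 1 = 2 - α by ring,
      show 3 - α + 2 * α = α + 1 + 2 by ring]
    rw [startProfile] at h1
    linarith
  have hsemi : ∀ x ∈ Ioc (0 : ℝ) 1, fracInt (2 * α) (fracInt (2 - 2 * α) d) x = fracInt 2 d x := by
    intro x hx
    have := fracInt_fracInt h2α hγ hx.1 (f := d) cd.aestronglyMeasurable
      (intervalIntegrable_sub_rpow_mul_continuousOn (by linarith) hx.1 cd.continuousOn)
    rwa [add_sub_cancel] at this
  have hy := eq_zero_of_eq_mul_fracInt h2α zero_le_one (continuousOn_fracInt hγ cd zero_le_one)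
    (l := l) fun x hx => by rw [hsemi x hx, hdeq x hx]
  have hd0 := eq_zero_of_fracInt_two_eq_zero cd fun x hx => by
    rcases hx.1.eq_or_lt with rfl | hx0
    · simp [fracInt]
    rw [← hsemi x ⟨hx0, hx.2⟩]
    have : fracInt (2 * α) (fracInt (2 - 2 * α) d) x = fracInt (2 * α) (fun _ => 0) x :=
      fracInt_congr hx.1 fun s hs => hy s ⟨hs.1, hs.2.le.trans hx.2⟩
    rw [this]; simp [fracInt]
  -- Now f = g K, while f(1) = 0 and K(1) > 0.
  have hg : g = 0 := by
    have h1 := hd0 1 (by simp)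
    simp only [hd, hf1, hK, mlKernel, Real.one_rpow, mul_one, one_mul, zero_sub, neg_eq_zero] at h1
    exact (mul_eq_zero.1 h1).resolve_right (mittagLeffler_pos h2α hβ hl).ne'
  intro x hx
  simpa [hd, hg] using hd0 x hx

theorem sineCoeff_mul_add_mul {f g : ℝ → ℝ} (hf : Continuous f) (hg : Continuous g) (a b : ℝ)
    (k : ℕ) : sineCoeff k (fun z => a * f z + b * g z) = a * sineCoeff k f + b * sineCoeff k g := by
  have hs : Continuous fun z : ℝ => Real.sin (k * z) := by fun_prop
  have h := intervalIntegral.integral_add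
    (((hf.mul hs).intervalIntegrable (μ := volume) 0 Real.pi).const_mul a)
    (((hg.mul hs).intervalIntegrable (μ := volume) 0 Real.pi).const_mul b)
  rw [intervalIntegral.integral_const_mul, intervalIntegral.integral_const_mul] at h
  refine Eq.trans ?_ h
  simp only [sineCoeff, Pi.mul_apply]
  congr 1; ext z; ring

theorem sineCoeff_congr {f g : ℝ → ℝ} (h : ∀ z ∈ Icc 0 Real.pi, f z = g z) (k : ℕ) :
    sineCoeff k f = sineCoeff k g :=
  intervalIntegral.integral_congr fun z hz => by
    rw [uIcc_of_le Real.pi_pos.le] at hz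
    simp only [h z hz]

theorem continuous_sineCoeff {w : ℝ → ℝ → ℝ} (hw : Continuous (Function.uncurry w)) (k : ℕ) :
    Continuous fun x => sineCoeff k (w x) :=
  intervalIntegral.continuous_parametric_intervalIntegral_of_continuous'
    (hw.mul (by fun_prop : Continuous fun v : ℝ × ℝ => Real.sin (k * v.2))) 0 Real.pi

/-- On sine coefficients the Green operator divides by -k². Multiplying the splitting of the
potential by -k² thus gives the equation with eigenvalue a k² + c², without differentiating w in z.
-/
theorem DirichletStrip.sineCoeff_identity {α a c : ℝ} {w h : ℝ → ℝ → ℝ} {g₀ Γ Ψ : ℝ → ℝ}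
    (S : DirichletStrip α a c w h g₀) (hΓ : Continuous Γ) (hΨ : Continuous Ψ)
    (hΦ : ∀ x ∈ Icc (0 : ℝ) 1, ∀ z ∈ Icc 0 Real.pi,
      stripPotential α a c w x z = startProfile α x * Γ z + x * Ψ z) (k : ℕ) {x : ℝ}
    (hx : x ∈ Ioc (0 : ℝ) 1) :
    fracInt (2 - 2 * α) (fun s => sineCoeff k (w s)) x
        - (a * k ^ 2 + c ^ 2) * fracInt 2 (fun s => sineCoeff k (w s)) x
      = startProfile α x * (-(k : ℝ) ^ 2 * sineCoeff k Γ) + x * (-(k : ℝ) ^ 2 * sineCoeff k Ψ) := by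
  obtain ⟨M, hM⟩ := S.bdd
  have e1 := sineCoeff_congr (hΦ x ⟨hx.1.le, hx.2⟩) k
  rw [sineCoeff_mul_add_mul hΓ hΨ] at e1
  have hJ : ∀ γ > 0, sineCoeff k (fracMean γ w x) = fracInt γ (fun s => sineCoeff k (w s)) x := by
    intro γ hγ
    rw [← sineCoeff_fracInt hγ S.cont hM hx.1]
    exact sineCoeff_congr (fun z _ => fracMean_eq hγ w hx.1.le z) k
  have e2 : sineCoeff k (stripPotential α a c w x)
      = sineCoeff k (greenOp fun z => fracMean (2 - 2 * α) w x z - c ^ 2 * fracMean 2 w x z)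
        + a * sineCoeff k (fracMean 2 w x) := by
    have := sineCoeff_mul_add_mul (continuous_greenOp (S.continuous_source_right x))
      (S.continuous_fracMean_right two_pos x) 1 a k
    rw [one_mul] at this
    refine Eq.trans ?_ this
    congr 1; ext z; rw [stripPotential, one_mul]
  have e3 := sineCoeff_greenOp (S.continuous_source_right x) k
  have e4 : sineCoeff k (fun z => fracMean (2 - 2 * α) w x z - c ^ 2 * fracMean 2 w x z)
      = sineCoeff k (fracMean (2 - 2 * α) w x) - c ^ 2 * sineCoeff k (fracMean 2 w x) := by
    have := sineCoeff_mul_add_mul (S.continuous_fracMean_right S.order_pos x)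
      (S.continuous_fracMean_right two_pos x) 1 (-c ^ 2) k
    rw [one_mul] at this
    refine Eq.trans ?_ (this.trans (by ring))
    congr 1; ext z; ring
  rw [hJ _ S.order_pos, hJ _ two_pos] at e4
  rw [hJ _ two_pos] at e2
  linear_combination -e4 + e3 - (k : ℝ) ^ 2 * e1 + (k : ℝ) ^ 2 * e2


/-! ### The linear profile: small orders, and local vanishing by Baire's theorem. -/

/-- For `α ≤ 1/2` the profile `x` cannot occur. -/
theorem coeff_eq_zero_of_le_half {α l g B : ℝ} (hα : 0 < α) (hα2 : α ≤ 1 / 2) {f : ℝ → ℝ}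
    (hf : Continuous f) {M : ℝ} (hM : ∀ x, |f x| ≤ M) (hf0 : f 0 = 0)
    (h : ∀ x ∈ Ioc (0 : ℝ) 1, fracInt (2 - 2 * α) f x - l * fracInt 2 f x
      = startProfile α x * g + x * B) : B = 0 := by
  have hγ : 0 < 2 - 2 * α := by linarith
  have hI : ∀ γ : ℝ, 0 < γ → Continuous fun x : ℝ => ∫ r in (0 : ℝ)..1, (1 - r) ^ (γ - 1) * f (x * r) := by
    intro γ hγ
    exact (continuous_integral_scaled hγ (w := fun x _ => f x) (hf.comp continuous_fst)
      fun x z => hM x).comp (by fun_prop : Continuous fun x : ℝ => (x, (0 : ℝ)))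
  set I : ℝ → ℝ → ℝ := fun γ x => ∫ r in (0 : ℝ)..1, (1 - r) ^ (γ - 1) * f (x * r) with hIdef
  -- The equation divided by x, solved for B. Since 1 - 2α ≥ 0, E is continuous up to x = 0, and
  -- E(0) = 0 because f(0) = 0, also in the case α = 1/2.
  set E : ℝ → ℝ := fun x => (Real.Gamma (2 - 2 * α))⁻¹ * (x ^ (1 - 2 * α) * I (2 - 2 * α) x)
    - l * ((Real.Gamma 2)⁻¹ * (x * I 2 x)) - x ^ (1 - α) / Real.Gamma (3 - α) * g with hE
  have cE : Continuous E := by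
    have h1 := Real.continuous_rpow_const (q := 1 - 2 * α) (by linarith)
    have h2 := Real.continuous_rpow_const (q := 1 - α) (by linarith)
    exact ((continuous_const.mul (h1.mul (hI _ hγ))).sub (continuous_const.mul
      (continuous_const.mul (continuous_id.mul (hI 2 two_pos))))).sub
        ((h2.div_const _).mul continuous_const)
  have hEB : ∀ x ∈ Ioc (0 : ℝ) 1, E x = B := by
    intro x hx
    have h1 := h x hx
    have hx0 := hx.1
    rw [fracInt_eq_scaled hγ f hx0.le, fracInt_eq_scaled two_pos f hx0.le, startProfile] at h1
    have e1 : x ^ (2 - 2 * α) = x * x ^ (1 - 2 * α) := by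
      rw [← Real.rpow_one_add' hx0.le (by linarith)]; congr 1; ring
    have e2 : x ^ (2 - α) = x * x ^ (1 - α) := by
      rw [← Real.rpow_one_add' hx0.le (by linarith)]; congr 1; ring
    rw [e1, e2, Real.rpow_two] at h1
    have h3 : x * (E x - B) = 0 := by
      simp only [hE, hIdef]
      linear_combination h1
    linarith [(mul_eq_zero.1 h3).resolve_left hx0.ne']
  have hE0 : E 0 = 0 := by
    have h1 : ∀ γ, I γ 0 = 0 := fun γ => by simp [hIdef, hf0]
    simp [hE, h1, Real.zero_rpow (show 1 - α ≠ 0 by linarith)]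
  have hcl : (0 : ℝ) ∈ closure (Ioo (0 : ℝ) 1) := by
    rw [closure_Ioo zero_ne_one]; simp
  have hEq : EqOn E (fun _ => B) (closure (Ioo (0 : ℝ) 1)) :=
    EqOn.closure (fun x hx => hEB x ⟨hx.1, hx.2.le⟩) cE continuous_const
  rw [← hE0, hEq hcl]

/-- The quotient is at most the integral of |f| over (0,x). -/
theorem tendsto_integral_sub_mul_div {f : ℝ → ℝ} {X : ℝ} (hX : 0 < X)
    (hf : IntervalIntegrable f volume 0 X) :
    Filter.Tendsto (fun x => (∫ s in (0 : ℝ)..x, (x - s) * f s) / x) (nhdsWithin 0 (Ioi 0))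
      (nhds 0) := by
  have hc : ContinuousOn (fun x => ∫ s in (0 : ℝ)..x, |f s|) (Icc 0 X) := by
    have := intervalIntegral.continuousOn_primitive_interval (μ := volume) (a := 0) (b := X)
      (f := fun s => |f s|) (by
        rw [uIcc_of_le hX.le, ← intervalIntegrable_iff_integrableOn_Icc_of_le hX.le]; exact hf.abs)
    rwa [uIcc_of_le hX.le] at this
  have h0 : Filter.Tendsto (fun x => ∫ s in (0 : ℝ)..x, |f s|) (nhdsWithin 0 (Ioi 0)) (nhds 0) := by
    have := (hc 0 ⟨le_rfl, hX.le⟩).tendsto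
    rw [intervalIntegral.integral_same] at this
    refine this.mono_left ?_
    rw [← nhdsWithin_Ioc_eq_nhdsGT hX]
    exact nhdsWithin_mono _ Ioc_subset_Icc_self
  refine squeeze_zero_norm' ?_ h0
  filter_upwards [Ioc_mem_nhdsGT hX] with x hx
  rw [norm_div, Real.norm_eq_abs, Real.norm_eq_abs, abs_of_pos hx.1, div_le_iff₀ hx.1, mul_comm,
    ← intervalIntegral.integral_const_mul]
  have hfx : IntervalIntegrable f volume 0 x :=
    hf.mono_set (by rw [uIcc_of_le hx.1.le, uIcc_of_le hX.le]; exact Icc_subset_Icc_right hx.2)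
  refine intervalIntegral.norm_integral_le_of_norm_le (μ := volume)
    (f := fun s => (x - s) * f s) hx.1.le ?_ (hfx.abs.const_mul x)
  refine Filter.Eventually.of_forall fun s hs => ?_
  rw [norm_mul, Real.norm_eq_abs, Real.norm_eq_abs, abs_of_nonneg (by linarith [hs.2])]
  exact mul_le_mul_of_nonneg_right (by linarith [hs.1]) (abs_nonneg _)

namespace DirichletStrip

variable {α a c : ℝ} {w h : ℝ → ℝ → ℝ} {g₀ : ℝ → ℝ}

theorem tendsto_order_sub_div (S : DirichletStrip α a c w h g₀) {z : ℝ} (hz : z ∈ Ioo 0 Real.pi) :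
    Filter.Tendsto (fun x => (fracMean (2 - 2 * α) w x z - g₀ z * startProfile α x) / x)
      (nhdsWithin 0 (Ioi 0)) (nhds 0) := by
  refine (tendsto_integral_sub_mul_div (f := fun s => h s z) (X := 1 / 2) (by norm_num)
    (S.h_int z hz (1 / 2) (by norm_num))).congr' ?_
  filter_upwards [Ioo_mem_nhdsGT (show (0 : ℝ) < 1 by norm_num)] with x hx
  rw [fracMean_eq S.order_pos w hx.1.le, S.identity z hz x hx, startProfile, add_sub_cancel_left]

/-- The constant depends on z, since h has no uniform integrability in z. It is taken in ℕ so that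
countably many closed sets cover all z. -/
theorem exists_abs_order_sub_le (S : DirichletStrip α a c w h g₀) {z : ℝ}
    (hz : z ∈ Ioo 0 Real.pi) :
    ∃ n : ℕ, ∀ x ∈ Ioc (0 : ℝ) (1 / 2),
      |fracMean (2 - 2 * α) w x z - g₀ z * startProfile α x| ≤ n * x := by
  have h1 := S.tendsto_order_sub_div hz
  have h2 := (h1.eventually (Metric.ball_mem_nhds (0 : ℝ) one_pos))
  obtain ⟨η, hη, hb⟩ := mem_nhdsGT_iff_exists_Ioo_subset.1 h2
  have hη0 : 0 < η := hη
  have hc : Continuous fun x => fracMean (2 - 2 * α) w x z - g₀ z * startProfile α x :=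
    (S.continuous_fracMean_left S.order_pos z).sub
      (continuous_const.mul (continuous_startProfile S.α_lt))
  obtain ⟨M, hM⟩ := (isCompact_Icc (a := (0 : ℝ)) (b := 1 / 2)).exists_bound_of_continuousOn
    hc.continuousOn
  obtain ⟨n, hn⟩ := exists_nat_ge (max 1 (M / η))
  refine ⟨n, fun x hx => ?_⟩
  rcases lt_or_ge x η with hxη | hxη
  · have h3 : (fracMean (2 - 2 * α) w x z - g₀ z * startProfile α x) / x ∈ Metric.ball (0 : ℝ) 1 :=
      hb ⟨hx.1, hxη⟩
    rw [Metric.mem_ball, dist_zero_right, norm_div, Real.norm_eq_abs, Real.norm_eq_abs,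
      abs_of_pos hx.1, div_lt_one hx.1] at h3
    have h4 : (1 : ℝ) ≤ n := (le_max_left _ _).trans hn
    nlinarith [hx.1]
  · have h3 := hM x ⟨hx.1.le, hx.2⟩
    rw [Real.norm_eq_abs] at h3
    have h4 : M / η ≤ n := (le_max_right _ _).trans hn
    rw [div_le_iff₀ hη0] at h4
    have h5 : (0 : ℝ) ≤ n := Nat.cast_nonneg n
    nlinarith

/-- The second profile is affine near a dense set of points. -/
theorem exists_secondDiff_eq_zero (S : DirichletStrip α a c w h g₀) {Γ Ψ : ℝ → ℝ}
    (hΓ : ∀ z t, 0 < t → 0 < z - t → z + t < Real.pi → secondDiff t Γ z = hatAvg t g₀ z)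
    (hΦ : ∀ x ∈ Icc (0 : ℝ) 1, ∀ z ∈ Icc 0 Real.pi,
      stripPotential α a c w x z = startProfile α x * Γ z + x * Ψ z)
    {p q : ℝ} (hp : 0 < p) (hpq : p < q) (hq : q < Real.pi) :
    ∃ z ∈ Ioo p q, ∃ δ > 0, ∀ t, 0 < t → t < δ → secondDiff t Ψ z = 0 := by
  have hsub : Icc p q ⊆ Ioo 0 Real.pi := fun y hy => ⟨hp.trans_le hy.1, hy.2.trans_lt hq⟩
  set D : ℝ → ℝ → ℝ := fun x z => fracMean (2 - 2 * α) w x z - g₀ z * startProfile α x with hD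
  have hDc : ∀ x, ContinuousOn (D x) (Icc p q) := fun x =>
    (S.continuous_fracMean_right S.order_pos x).continuousOn.sub
      ((S.continuousOn_start.mono hsub).mul continuousOn_const)
  -- For `some n` this is the set of z in [p,q] where the constant n works, closed because `D x` is
  -- continuous in z. The index `none` covers the complement of (p,q), so that Baire's theorem
  -- applies on the whole line.
  set C : Option ℕ → Set ℝ := fun i => i.elim (Iic p ∪ Ici q) fun n =>
    Icc p q ∩ ⋂ x : Ioc (0 : ℝ) (1 / 2), Icc p q ∩ (fun z => |D x z|) ⁻¹' Iic (n * (x : ℝ)) with hC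
  have hclosed : ∀ i, IsClosed (C i) := by
    rintro (_ | n)
    · exact isClosed_Iic.union isClosed_Ici
    · exact isClosed_Icc.inter (isClosed_iInter fun x =>
        (hDc x).abs.preimage_isClosed_of_isClosed isClosed_Icc isClosed_Iic)
  have hcover : ⋃ i, C i = univ := by
    refine eq_univ_of_forall fun z => mem_iUnion.2 ?_
    by_cases hz : z ∈ Icc p q
    · obtain ⟨n, hn⟩ := S.exists_abs_order_sub_le (hsub hz)
      exact ⟨some n, hz, mem_iInter.2 fun x => ⟨hz, hn x x.2⟩⟩
    · refine ⟨none, ?_⟩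
      rw [mem_Icc, not_and_or, not_le, not_le] at hz
      exact hz.imp le_of_lt le_of_lt
  obtain ⟨z, hz, hzi⟩ := (dense_iUnion_interior_of_closed hclosed hcover).exists_mem_open
    isOpen_Ioo (nonempty_Ioo.2 hpq)
  obtain ⟨i, hi⟩ := mem_iUnion.1 hz
  rcases i with _ | n
  · exfalso
    rcases interior_subset hi with h1 | h1
    · exact absurd hzi.1 (not_lt.2 h1)
    · exact absurd hzi.2 (not_lt.2 h1)
  obtain ⟨δ, hδ, hball⟩ := Metric.isOpen_iff.1 isOpen_interior z hi
  refine ⟨z, hzi, δ, hδ, fun t ht htδ => ?_⟩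
  have hmem : ∀ y ∈ Icc (z - t) (z + t), y ∈ C (some n) := fun y hy =>
    interior_subset (hball (by
      rw [Metric.mem_ball, Real.dist_eq]
      exact (abs_le.2 ⟨by linarith [hy.1], by linarith [hy.2]⟩).trans_lt htδ))
  have hIcc : Icc (z - t) (z + t) ⊆ Icc p q := fun y hy => (hmem y hy).1
  have hbound : ∀ y ∈ Icc (z - t) (z + t), ∀ x ∈ Ioc (0 : ℝ) (1 / 2), |D x y| ≤ n * x :=
    fun y hy x hx => (mem_iInter.1 (hmem y hy).2 ⟨x, hx⟩).2
  have hl : z - t ∈ Icc (z - t) (z + t) := ⟨le_rfl, by linarith⟩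
  have hr : z + t ∈ Icc (z - t) (z + t) := ⟨by linarith, le_rfl⟩
  have hm : z ∈ Icc (z - t) (z + t) := ⟨by linarith, by linarith⟩
  -- Take the z-difference of the splitting, cancel the terms with g₀ and divide by x. The left side
  -- does not depend on x, and the right side will tend to 0.
  have hΨ : ∀ x ∈ Ioc (0 : ℝ) (1 / 2), secondDiff t Ψ z
      = hatAvg t (fun y => D x y / x) z + (-c ^ 2 * hatAvg t (fracMean 2 w x) z / x
        + a * secondDiff t (fracMean 2 w x) z / x) := by
    intro x hx
    have hx1 : x ∈ Icc (0 : ℝ) 1 := ⟨hx.1.le, hx.2.trans (by norm_num)⟩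
    have e1 := S.secondDiff_potential ht.le x z
    have e2 : secondDiff t (stripPotential α a c w x) z
        = startProfile α x * secondDiff t Γ z + x * secondDiff t Ψ z := by
      simp only [secondDiff]
      rw [hΦ x hx1 _ (Ioo_subset_Icc_self (hsub (hIcc hl))),
        hΦ x hx1 _ (Ioo_subset_Icc_self (hsub (hIcc hr))),
        hΦ x hx1 _ (Ioo_subset_Icc_self (hsub (hIcc hm)))]
      ring
    rw [hΓ z t ht (hsub (hIcc hl)).1 (hsub (hIcc hr)).2] at e2
    have cg := S.continuousOn_start.mono (hIcc.trans hsub)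
    have cJ := (S.continuous_fracMean_right two_pos x).continuousOn (s := Icc (z - t) (z + t))
    have e3 : hatAvg t (fun z => fracMean (2 - 2 * α) w x z - c ^ 2 * fracMean 2 w x z) z
        = x * hatAvg t (fun y => D x y / x) z + startProfile α x * hatAvg t g₀ z
          + -c ^ 2 * hatAvg t (fracMean 2 w x) z := by
      have c1 : ContinuousOn (fun y => D x y / x) (Icc (z - t) (z + t)) :=
        ((hDc x).mono hIcc).div_const x
      rw [← hatAvg_mul_add_mul ht.le c1 cg]
      have c2 : ContinuousOn (fun y => x * (D x y / x) + startProfile α x * g₀ y)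
        (Icc (z - t) (z + t)) := (continuousOn_const.mul c1).add (continuousOn_const.mul cg)
      have e4 := hatAvg_mul_add_mul ht.le c2 cJ 1 (-c ^ 2)
      rw [one_mul] at e4
      rw [← e4]
      congr 1; ext y
      rw [mul_div_cancel₀ _ hx.1.ne']
      simp only [hD]; ring
    rw [e2, e3] at e1
    have hx0 := hx.1.ne'
    have e5 : x * secondDiff t Ψ z = x * hatAvg t (fun y => D x y / x) z
        + (-c ^ 2 * hatAvg t (fracMean 2 w x) z + a * secondDiff t (fracMean 2 w x) z) := by
      linear_combination e1
    field_simp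
    linear_combination e5
  obtain ⟨M, hM⟩ := S.bdd
  have hM0 : 0 ≤ M := (abs_nonneg _).trans (hM 0 0)
  have hJ : ∀ x ∈ Ioc (0 : ℝ) (1 / 2), ∀ y, |fracMean 2 w x y| ≤ M * x * x := by
    intro x hx y
    rw [fracMean_eq two_pos w hx.1.le]
    refine (abs_fracInt_le two_pos hx.1.le fun s _ => hM s y).trans ?_
    have h3 : Real.Gamma (2 + 1) = 2 := by
      rw [Real.Gamma_add_one two_ne_zero, Real.Gamma_two]; norm_num
    rw [h3, Real.rpow_two]
    nlinarith [mul_nonneg hM0 (sq_nonneg x)]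
  set u : ℕ → ℝ := fun j => 1 / ((j : ℝ) + 2) with hu
  have hu2 : ∀ j, u j ∈ Ioc (0 : ℝ) (1 / 2) := fun j => by
    refine ⟨by simp only [hu]; positivity, ?_⟩
    simp only [hu]
    exact one_div_le_one_div_of_le two_pos (by linarith [Nat.cast_nonneg (α := ℝ) j])
  have hu0 : Filter.Tendsto u Filter.atTop (nhds 0) := by
    have := (tendsto_one_div_add_atTop_nhds_zero_nat (𝕜 := ℝ)).comp (Filter.tendsto_add_atTop_nat 1)
    refine this.congr fun j => ?_
    simp only [hu, Function.comp_apply]; push_cast; ring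
  have hu0' : Filter.Tendsto u Filter.atTop (nhdsWithin 0 (Ioi 0)) :=
    tendsto_nhdsWithin_iff.2 ⟨hu0, Filter.Eventually.of_forall fun j => (hu2 j).1⟩
  -- The quotients tend to 0 pointwise; the bound n from the Baire set makes the convergence
  -- dominated.
  have hlim1 : Filter.Tendsto (fun j => hatAvg t (fun y => D (u j) y / u j) z) Filter.atTop
      (nhds 0) := by
    have h0 : (0 : ℝ) = ∫ s in (0 : ℝ)..t, (t - s) * (0 + 0) := by simp
    rw [h0]
    refine intervalIntegral.tendsto_integral_filter_of_dominated_convergence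
      (fun _ => t * (n + n)) (Filter.Eventually.of_forall fun j => ?_)
      (Filter.Eventually.of_forall fun j => ?_) intervalIntegrable_const ?_
    · exact (intervalIntegrable_iff.1 (continuousOn_hatAvg_integrand ht.le
        (((hDc (u j)).mono hIcc).div_const (u j))).intervalIntegrable).aestronglyMeasurable
    · refine Filter.Eventually.of_forall fun s hs => ?_
      rw [uIoc_of_le ht.le] at hs
      have hb : ∀ y ∈ Icc (z - t) (z + t), |D (u j) y / u j| ≤ n := fun y hy => by
        rw [abs_div, abs_of_pos (hu2 j).1, div_le_iff₀ (hu2 j).1]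
        exact hbound y hy _ (hu2 j)
      have b1 := hb (z + s) ⟨by linarith [hs.1], by linarith [hs.2]⟩
      have b2 := hb (z - s) ⟨by linarith [hs.2], by linarith [hs.1]⟩
      rw [norm_mul, Real.norm_eq_abs, Real.norm_eq_abs, abs_of_nonneg (by linarith [hs.2])]
      have b3 := abs_add_le (D (u j) (z + s) / u j) (D (u j) (z - s) / u j)
      exact mul_le_mul (by linarith [hs.1]) (by linarith) (abs_nonneg _) ht.le
    · refine Filter.Eventually.of_forall fun s hs => ?_
      rw [uIoc_of_le ht.le] at hs
      have hb : ∀ y ∈ Icc (z - t) (z + t),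
          Filter.Tendsto (fun j => D (u j) y / u j) Filter.atTop (nhds 0) := fun y hy =>
        (S.tendsto_order_sub_div (hsub (hIcc hy))).comp hu0'
      exact ((hb (z + s) ⟨by linarith [hs.1], by linarith [hs.2]⟩).add
        (hb (z - s) ⟨by linarith [hs.2], by linarith [hs.1]⟩)).const_mul (t - s)
  have hlim2 : Filter.Tendsto (fun j => -c ^ 2 * hatAvg t (fracMean 2 w (u j)) z / u j
        + a * secondDiff t (fracMean 2 w (u j)) z / u j) Filter.atTop (nhds 0) := by
    refine squeeze_zero_norm (a := fun j => (c ^ 2 * (M * t ^ 2) + a * (4 * M)) * u j)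
      (fun j => ?_) (by simpa using hu0.const_mul (c ^ 2 * (M * t ^ 2) + a * (4 * M)))
    have hx := hu2 j
    have ha := S.a_pos
    have k1 : |hatAvg t (fracMean 2 w (u j)) z| ≤ M * u j * u j * t ^ 2 :=
      abs_hatAvg_le ht.le fun y _ => hJ _ hx y
    have k2 : |secondDiff t (fracMean 2 w (u j)) z| ≤ 4 * (M * u j * u j) := by
      have j1 := abs_le.1 (hJ _ hx (z + t))
      have j2 := abs_le.1 (hJ _ hx (z - t))
      have j3 := abs_le.1 (hJ _ hx z)
      rw [secondDiff]
      exact abs_le.2 ⟨by linarith, by linarith⟩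
    rw [← add_div, norm_div, Real.norm_eq_abs, Real.norm_eq_abs, abs_of_pos hx.1,
      div_le_iff₀ hx.1]
    calc _ ≤ |-c ^ 2 * hatAvg t (fracMean 2 w (u j)) z|
          + |a * secondDiff t (fracMean 2 w (u j)) z| := abs_add_le _ _
      _ = c ^ 2 * |hatAvg t (fracMean 2 w (u j)) z| + a * |secondDiff t (fracMean 2 w (u j)) z| := by
          rw [abs_mul, abs_mul, abs_neg, abs_of_nonneg (sq_nonneg c), abs_of_pos ha]
      _ ≤ c ^ 2 * (M * u j * u j * t ^ 2) + a * (4 * (M * u j * u j)) := by gcongr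
      _ = _ := by ring
  have hlim := hlim1.add hlim2
  rw [add_zero] at hlim
  exact tendsto_nhds_unique (tendsto_const_nhds.congr fun j => hΨ _ (hu2 j)) hlim

end DirichletStrip


/-! ### Truncated Laplace transforms and the balance of the two profiles. -/

theorem integrableOn_rpow_mul_exp_neg {β κ : ℝ} (hβ : 0 < β) (hκ : 0 < κ) :
    IntegrableOn (fun r : ℝ => r ^ (β - 1) * Real.exp (-(κ * r))) (Ioi 0) := by
  have := integrableOn_rpow_mul_exp_neg_mul_rpow (p := 1) (s := β - 1) (b := κ) (by linarith)
    one_pos hκ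
  simpa using this

/-- The Laplace transform of a power truncated to the unit interval. -/
theorem abs_integral_exp_mul_sub_rpow_sub_le {β κ s : ℝ} (hβ : 0 < β) (hκ : 0 < κ)
    (hs : s ∈ Ioo (0 : ℝ) 1) :
    |(∫ x in s..1, Real.exp (-(κ * x)) * (x - s) ^ (β - 1))
      - Real.Gamma β * (1 / κ) ^ β * Real.exp (-(κ * s))|
      ≤ Real.Gamma β * (1 / (κ / 2)) ^ β * Real.exp (-(κ / 2)) := by
  set φ : ℝ → ℝ := fun r => r ^ (β - 1) * Real.exp (-(κ * r)) with hφ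
  have hi := integrableOn_rpow_mul_exp_neg hβ hκ
  have hi2 := integrableOn_rpow_mul_exp_neg hβ (half_pos hκ)
  have hs1 : 0 ≤ 1 - s := by linarith [hs.2]
  have hsub : Ioi (1 - s) ⊆ Ioi (0 : ℝ) := Ioi_subset_Ioi hs1
  have e1 : ∫ x in s..1, Real.exp (-(κ * x)) * (x - s) ^ (β - 1)
      = Real.exp (-(κ * s)) * ∫ r in (0 : ℝ)..(1 - s), φ r := by
    have := intervalIntegral.integral_comp_sub_right (a := s) (b := 1) φ s
    rw [sub_self] at this
    rw [← this, ← intervalIntegral.integral_const_mul]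
    congr 1; ext x
    have : Real.exp (-(κ * x)) = Real.exp (-(κ * s)) * Real.exp (-(κ * (x - s))) := by
      rw [← Real.exp_add]; congr 1; ring
    simp only [hφ]
    rw [this]; ring
  have e2 : (∫ r in (0 : ℝ)..(1 - s), φ r) + ∫ r in Ioi (1 - s), φ r
      = Real.Gamma β * (1 / κ) ^ β := by
    rw [intervalIntegral.integral_of_le hs1,
      ← setIntegral_union (Ioc_disjoint_Ioi le_rfl) measurableSet_Ioi
        (hi.mono_set Ioc_subset_Ioi_self) (hi.mono_set hsub), Ioc_union_Ioi_eq_Ioi hs1,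
      Real.integral_rpow_mul_exp_neg_mul_Ioi hβ hκ, mul_comm]
  have e3 : (∫ x in s..1, Real.exp (-(κ * x)) * (x - s) ^ (β - 1))
      - Real.Gamma β * (1 / κ) ^ β * Real.exp (-(κ * s))
      = -∫ r in Ioi (1 - s), Real.exp (-(κ * s)) * φ r := by
    rw [e1, ← e2, integral_const_mul]; ring
  have hnn : ∀ r ∈ Ioi (0 : ℝ), 0 ≤ Real.exp (-(κ / 2)) * (r ^ (β - 1) * Real.exp (-(κ / 2 * r))) :=
    fun r hr => by have := Real.rpow_nonneg (le_of_lt hr) (β - 1); positivity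
  rw [e3, abs_neg]
  have hle : |∫ r in Ioi (1 - s), Real.exp (-(κ * s)) * φ r|
      ≤ ∫ r in Ioi (1 - s), Real.exp (-(κ / 2)) * (r ^ (β - 1) * Real.exp (-(κ / 2 * r))) := by
    refine norm_integral_le_of_norm_le (f := fun r => Real.exp (-(κ * s)) * φ r)
      (g := fun r => Real.exp (-(κ / 2)) * (r ^ (β - 1) * Real.exp (-(κ / 2 * r))))
      ((hi2.mono_set hsub).const_mul _) ?_
    filter_upwards [ae_restrict_mem measurableSet_Ioi] with r hr
    have hr1 : 1 - s < r := hr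
    have hr0 : 0 < r := hs1.trans_lt hr1
    have := Real.rpow_nonneg hr0.le (β - 1)
    rw [Real.norm_eq_abs, abs_of_nonneg (by simp only [hφ]; positivity)]
    -- From s + r ≥ 1 and s ≥ 0 one gets s + r ≥ 1/2 + r/2: half of the decay gives the small
    -- factor, the other half keeps the integral finite.
    have h5 : Real.exp (-(κ * s)) * Real.exp (-(κ * r))
        ≤ Real.exp (-(κ / 2)) * Real.exp (-(κ / 2 * r)) := by
      rw [← Real.exp_add, ← Real.exp_add, Real.exp_le_exp]
      nlinarith [hs.1]
    calc _ = r ^ (β - 1) * (Real.exp (-(κ * s)) * Real.exp (-(κ * r))) := by simp only [hφ]; ring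
      _ ≤ r ^ (β - 1) * (Real.exp (-(κ / 2)) * Real.exp (-(κ / 2 * r))) := by gcongr
      _ = _ := by ring
  refine hle.trans ?_
  calc _ ≤ ∫ r in Ioi 0, Real.exp (-(κ / 2)) * (r ^ (β - 1) * Real.exp (-(κ / 2 * r))) := by
        refine setIntegral_mono_set (hi2.const_mul _) ?_ hsub.eventuallyLE
        filter_upwards [ae_restrict_mem measurableSet_Ioi] with r hr using hnn r hr
    _ = _ := by
        rw [integral_const_mul, Real.integral_rpow_mul_exp_neg_mul_Ioi hβ (half_pos hκ)]; ring

/-- Up to an exponentially small error the Laplace transform over the unit interval turns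
fractional integration into multiplication by a power. -/
theorem abs_laplace_fracInt_sub_le {β κ M : ℝ} (hβ : 0 < β) (hκ : 0 < κ) {f : ℝ → ℝ}
    (hf : Continuous f) (hM : ∀ x ∈ Ioc (0 : ℝ) 1, |f x| ≤ M) :
    |(∫ x in (0 : ℝ)..1, Real.exp (-(κ * x)) * fracInt β f x)
      - (1 / κ) ^ β * ∫ x in (0 : ℝ)..1, Real.exp (-(κ * x)) * f x|
      ≤ M * ((1 / (κ / 2)) ^ β * Real.exp (-(κ / 2))) := by
  have hΓ := Real.Gamma_pos_of_pos hβ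
  -- The factor (1 - x)^(1-1) is 1; this shape makes `integrable_fracInt_kernel` applicable with a =
  -- 1.
  set T : ℝ × ℝ → ℝ := fun p => {p : ℝ × ℝ | p.2 < p.1}.indicator
      (fun p => (1 - p.1) ^ ((1 : ℝ) - 1) * (p.1 - p.2) ^ (β - 1) * f p.2) p with hT
  have hTi : Integrable T ((volume.restrict (Ioc 0 1)).prod (volume.restrict (Ioc 0 1))) := by
    refine integrable_fracInt_kernel one_pos hβ hf.aestronglyMeasurable ?_
    have := intervalIntegrable_sub_rpow_mul_continuousOn (γ := 1 + β) (by linarith) one_pos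
      hf.continuousOn
    rwa [intervalIntegrable_iff_integrableOn_Ioc_of_le zero_le_one] at this
  have hTe : Integrable (fun p : ℝ × ℝ => Real.exp (-(κ * p.1)) * T p)
      ((volume.restrict (Ioc 0 1)).prod (volume.restrict (Ioc 0 1))) := by
    refine (hTi.norm).mono' ?_ ?_
    · exact AEStronglyMeasurable.mul (by fun_prop) hTi.aestronglyMeasurable
    · rw [Measure.prod_restrict]
      filter_upwards [ae_restrict_mem (measurableSet_Ioc.prod measurableSet_Ioc)] with p hp
      rw [norm_mul, Real.norm_eq_abs, abs_of_pos (Real.exp_pos _)]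
      exact mul_le_of_le_one_left (norm_nonneg _)
        (Real.exp_le_one_iff.2 (by have := hp.1.1; nlinarith))
  have hswap := integral_integral_swap (f := fun x s => Real.exp (-(κ * x)) * T (x, s)) hTe
  have hL : ∫ x in Ioc 0 1, ∫ s in Ioc 0 1, Real.exp (-(κ * x)) * T (x, s)
      = Real.Gamma β * ∫ x in (0 : ℝ)..1, Real.exp (-(κ * x)) * fracInt β f x := by
    rw [intervalIntegral.integral_of_le zero_le_one, ← integral_const_mul]
    refine setIntegral_congr_fun measurableSet_Ioc fun x hx => ?_
    simp only [hT]
    rw [integral_const_mul, fracInt_fracInt_aux hx, fracInt, sub_self, Real.rpow_zero]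
    field_simp
  have hR : ∀ s ∈ Ioo (0 : ℝ) 1, ∫ x in Ioc 0 1, Real.exp (-(κ * x)) * T (x, s)
      = (∫ x in s..1, Real.exp (-(κ * x)) * (x - s) ^ (β - 1)) * f s := by
    intro s hs
    have h1 : ∀ x, Real.exp (-(κ * x)) * T (x, s)
        = (Ioi s).indicator (fun x => Real.exp (-(κ * x)) * (x - s) ^ (β - 1) * f s) x := by
      intro x
      by_cases h : s < x
      · simp [hT, h, mul_assoc]
      · simp [hT, h]
    simp only [h1]
    rw [integral_indicator measurableSet_Ioi, Measure.restrict_restrict measurableSet_Ioi]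
    have h2 : Ioi s ∩ Ioc 0 1 = Ioc s 1 := by
      ext x
      simp only [mem_inter_iff, mem_Ioc, mem_Ioi]
      exact ⟨fun h => ⟨h.1, h.2.2⟩, fun h => ⟨h.1, hs.1.trans h.1, h.2⟩⟩
    rw [h2, ← intervalIntegral.integral_of_le hs.2.le, intervalIntegral.integral_mul_const]
  rw [hL] at hswap
  have hae : ∀ᵐ s ∂(volume.restrict (Ioc (0 : ℝ) 1)), s ∈ Ioo (0 : ℝ) 1 := by
    rw [← restrict_Ioo_eq_restrict_Ioc]
    exact ae_restrict_mem measurableSet_Ioo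
  have hRi : Integrable (fun s => ∫ x in Ioc 0 1, Real.exp (-(κ * x)) * T (x, s))
      (volume.restrict (Ioc 0 1)) := hTe.integral_prod_right
  have hPi : Integrable (fun s => Real.Gamma β * (1 / κ) ^ β * (Real.exp (-(κ * s)) * f s))
      (volume.restrict (Ioc 0 1)) :=
    ((by fun_prop : Continuous fun s => Real.exp (-(κ * s)) * f s).integrableOn_Ioc).const_mul _
  have hdiff : Real.Gamma β * ((∫ x in (0 : ℝ)..1, Real.exp (-(κ * x)) * fracInt β f x)
      - (1 / κ) ^ β * ∫ x in (0 : ℝ)..1, Real.exp (-(κ * x)) * f x)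
      = ∫ s in Ioc 0 1, ((∫ x in Ioc 0 1, Real.exp (-(κ * x)) * T (x, s))
        - Real.Gamma β * (1 / κ) ^ β * (Real.exp (-(κ * s)) * f s)) := by
    rw [integral_sub hRi hPi, ← hswap, integral_const_mul,
      intervalIntegral.integral_of_le (zero_le_one' ℝ), intervalIntegral.integral_of_le (zero_le_one' ℝ)]
    ring
  have hbd : |∫ s in Ioc 0 1, ((∫ x in Ioc 0 1, Real.exp (-(κ * x)) * T (x, s))
        - Real.Gamma β * (1 / κ) ^ β * (Real.exp (-(κ * s)) * f s))|
      ≤ Real.Gamma β * (1 / (κ / 2)) ^ β * Real.exp (-(κ / 2)) * M := by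
    have := norm_integral_le_of_norm_le_const (μ := volume.restrict (Ioc (0 : ℝ) 1))
      (f := fun s => (∫ x in Ioc 0 1, Real.exp (-(κ * x)) * T (x, s))
        - Real.Gamma β * (1 / κ) ^ β * (Real.exp (-(κ * s)) * f s))
      (C := Real.Gamma β * (1 / (κ / 2)) ^ β * Real.exp (-(κ / 2)) * M) ?_
    · simpa using this
    · filter_upwards [hae] with s hs
      rw [hR s hs, ← mul_assoc, ← sub_mul, norm_mul]
      have h6 := abs_integral_exp_mul_sub_rpow_sub_le hβ hκ hs
      exact mul_le_mul h6 (hM s ⟨hs.1, hs.2.le⟩) (abs_nonneg _) ((abs_nonneg _).trans h6)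
  rw [← hdiff, abs_mul, abs_of_pos hΓ] at hbd
  refine le_of_mul_le_mul_left (hbd.trans_eq ?_) hΓ
  ring

/-- The two free coefficients of the integrated equation at frequency `κ` balance up to an error
that is small for large `κ`. -/
theorem laplace_balance {α c κ M g B : ℝ} (hα : 0 < α) (hα1 : α < 1) (hκ : 0 < κ)
    {f : ℝ → ℝ} (hf : Continuous f) (hM : ∀ x ∈ Ioc (0 : ℝ) 1, |f x| ≤ M)
    (h : ∀ x ∈ Ioc (0 : ℝ) 1, fracInt (2 - 2 * α) f x - (κ ^ (2 * α) + c ^ 2) * fracInt 2 f x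
      = startProfile α x * g + x * B) :
    (∫ x in (0 : ℝ)..1, Real.exp (-(κ * x))) * |B * (1 / κ) + g * (1 / κ) ^ (2 - α)|
      ≤ c ^ 2 * (1 / κ) ^ (2 : ℝ) * (M * ∫ x in (0 : ℝ)..1, Real.exp (-(κ * x)))
        + (M * (1 / (κ / 2)) ^ (2 - 2 * α) + (κ ^ (2 * α) + c ^ 2) * M * (1 / (κ / 2)) ^ (2 : ℝ)
          + |g| * (1 / (κ / 2)) ^ (2 - α) + |B| * (1 / (κ / 2)) ^ (1 : ℝ)) * Real.exp (-(κ / 2)) := by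
  have hγ : 0 < 2 - 2 * α := by linarith
  set e : ℝ → ℝ := fun x => Real.exp (-(κ * x)) with he
  have ce : Continuous e := by simp only [he]; fun_prop
  have hu : uIcc (0 : ℝ) 1 = Icc 0 1 := uIcc_of_le zero_le_one
  have hF : ∀ γ : ℝ, 0 < γ → ∀ f : ℝ → ℝ, Continuous f →
      IntervalIntegrable (fun x => e x * fracInt γ f x) volume 0 1 := fun γ hγ f hf =>
    ContinuousOn.intervalIntegrable (by
      rw [hu]; exact ce.continuousOn.mul (continuousOn_fracInt hγ hf zero_le_one))
  have b1 := abs_laplace_fracInt_sub_le hγ hκ hf hM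
  have b2 := abs_laplace_fracInt_sub_le two_pos hκ hf hM
  have one_le : ∀ x ∈ Ioc (0 : ℝ) 1, |(fun _ : ℝ => (1 : ℝ)) x| ≤ 1 := fun x _ => by simp
  have b3 := abs_laplace_fracInt_sub_le (β := 2 - α) (by linarith) hκ continuous_const one_le
  have b4 := abs_laplace_fracInt_sub_le (β := 1) one_pos hκ continuous_const one_le
  have hs : ∀ x ∈ Ioc (0 : ℝ) 1, startProfile α x = fracInt (2 - α) (fun _ => 1) x := by
    intro x hx
    have h1 := fracInt_rpow (γ := 2 - α) (b := 1) (by linarith) one_pos hx.1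
    simp only [sub_self, Real.rpow_zero, Real.Gamma_one, div_one] at h1
    rw [h1, startProfile]
    congr 2 <;> ring
  have h1 : (∫ x in (0 : ℝ)..1, e x * fracInt (2 - 2 * α) f x)
      - (κ ^ (2 * α) + c ^ 2) * ∫ x in (0 : ℝ)..1, e x * fracInt 2 f x
      = (g * ∫ x in (0 : ℝ)..1, e x * fracInt (2 - α) (fun _ => 1) x)
        + B * ∫ x in (0 : ℝ)..1, e x * fracInt 1 (fun _ => 1) x := by
    simp only [← intervalIntegral.integral_const_mul]
    rw [← intervalIntegral.integral_sub (hF _ hγ f hf) ((hF _ two_pos f hf).const_mul _),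
      ← intervalIntegral.integral_add ((hF (2 - α) (by linarith) _ continuous_const).const_mul _)
        ((hF 1 one_pos _ continuous_const).const_mul _)]
    refine intervalIntegral.integral_congr_ae (Filter.Eventually.of_forall fun x hx => ?_)
    rw [uIoc_of_le zero_le_one] at hx
    have h2 := h x hx
    have h3 : fracInt 1 (fun _ => (1 : ℝ)) x = x := by rw [fracInt_one]; simp
    rw [h3, ← hs x hx]
    linear_combination e x * h2
  have hLf : |∫ x in (0 : ℝ)..1, e x * f x| ≤ M * ∫ x in (0 : ℝ)..1, e x := by
    rw [← intervalIntegral.integral_const_mul]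
    refine intervalIntegral.norm_integral_le_of_norm_le (μ := volume) (f := fun x => e x * f x)
      (g := fun x => M * e x) zero_le_one (Filter.Eventually.of_forall fun x hx => ?_)
      ((ce.const_smul M).intervalIntegrable 0 1)
    have : 0 < e x := Real.exp_pos _
    rw [norm_mul, Real.norm_eq_abs, Real.norm_eq_abs, abs_of_pos this, mul_comm]
    exact mul_le_mul_of_nonneg_right (hM x hx) this.le
  have hL1 : 0 ≤ ∫ x in (0 : ℝ)..1, e x :=
    intervalIntegral.integral_nonneg zero_le_one fun x _ => (Real.exp_pos _).le
  -- At this κ the transforms of J^(2-2α) f and κ^(2α) J² f cancel. What survives of f is the c²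
  -- term and exponentially small truncation errors.
  have hpow : (1 / κ) ^ (2 - 2 * α) = κ ^ (2 * α) * (1 / κ) ^ (2 : ℝ) := by
    rw [one_div, Real.inv_rpow hκ.le, Real.inv_rpow hκ.le, ← Real.rpow_neg hκ.le,
      ← Real.rpow_neg hκ.le, ← Real.rpow_add hκ]
    congr 1; ring
  have hl : 0 ≤ κ ^ (2 * α) + c ^ 2 := by positivity
  simp only [mul_one] at b3 b4
  rw [Real.rpow_one] at b4
  set X1 := ∫ x in (0 : ℝ)..1, e x * fracInt (2 - 2 * α) f x
  set X2 := ∫ x in (0 : ℝ)..1, e x * fracInt 2 f x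
  set Y1 := ∫ x in (0 : ℝ)..1, e x * fracInt (2 - α) (fun _ => 1) x
  set Y2 := ∫ x in (0 : ℝ)..1, e x * fracInt 1 (fun _ => 1) x
  set F := ∫ x in (0 : ℝ)..1, e x * f x
  set L := ∫ x in (0 : ℝ)..1, e x
  have key : L * (B * (1 / κ) + g * (1 / κ) ^ (2 - α)) = -(c ^ 2 * (1 / κ) ^ (2 : ℝ) * F)
      + (X1 - (1 / κ) ^ (2 - 2 * α) * F) - (κ ^ (2 * α) + c ^ 2) * (X2 - (1 / κ) ^ (2 : ℝ) * F)
      - g * (Y1 - (1 / κ) ^ (2 - α) * L) - B * (Y2 - 1 / κ * L) := by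
    rw [hpow]; linear_combination -h1
  rw [← abs_of_nonneg hL1, ← abs_mul, abs_of_nonneg hL1, key]
  have k0 : |c ^ 2 * (1 / κ) ^ (2 : ℝ) * F| ≤ c ^ 2 * (1 / κ) ^ (2 : ℝ) * (M * L) := by
    rw [abs_mul, abs_of_nonneg (by positivity)]
    exact mul_le_mul_of_nonneg_left hLf (by positivity)
  have k2 : |(κ ^ (2 * α) + c ^ 2) * (X2 - (1 / κ) ^ (2 : ℝ) * F)|
      ≤ (κ ^ (2 * α) + c ^ 2) * (M * ((1 / (κ / 2)) ^ (2 : ℝ) * Real.exp (-(κ / 2)))) := by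
    rw [abs_mul, abs_of_nonneg hl]; exact mul_le_mul_of_nonneg_left b2 hl
  have k3 : |g * (Y1 - (1 / κ) ^ (2 - α) * L)|
      ≤ |g| * (1 * ((1 / (κ / 2)) ^ (2 - α) * Real.exp (-(κ / 2)))) := by
    rw [abs_mul]; exact mul_le_mul_of_nonneg_left (by simpa using b3) (abs_nonneg _)
  have k4 : |B * (Y2 - 1 / κ * L)|
      ≤ |B| * (1 * ((1 / (κ / 2)) ^ (1 : ℝ) * Real.exp (-(κ / 2)))) := by
    rw [abs_mul]; exact mul_le_mul_of_nonneg_left (by simpa using b4) (abs_nonneg _)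
  have a0 := abs_le.1 k0
  have a1 := abs_le.1 b1
  have a2 := abs_le.1 k2
  have a3 := abs_le.1 k3
  have a4 := abs_le.1 k4
  exact abs_le.2 ⟨by linarith, by linarith⟩

/-- Division by L, which is at least of order 1/κ. The c² term then gives order 1/κ, and the
exponential error is reduced to the same order by `hE`. -/
theorem abs_le_div_of_balance {κ L b G P M R η c E : ℝ} (hκ : 0 < κ) (hη : 0 < η) (hR : 0 ≤ R)
    (hL : η / κ ≤ L) (hE : κ ^ 3 * (1 + κ ^ 2) * E ≤ P)
    (h : L * (1 / κ * |b|) ≤ c ^ 2 * (1 / κ) ^ 2 * (M * L) + R * (1 + κ ^ 2) * E)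
    (hG : G = c ^ 2 * M + R * P / η) (hP : 0 ≤ P) : |b| ≤ G / κ := by
  have hL0 : 0 < L := lt_of_lt_of_le (div_pos hη hκ) hL
  have e3 : κ * (R * (1 + κ ^ 2) * E) ≤ L * ((R * P / η) / κ) := by
    calc κ * (R * (1 + κ ^ 2) * E) = R * (κ ^ 3 * (1 + κ ^ 2) * E) / κ ^ 2 := by field_simp
      _ ≤ R * P / κ ^ 2 := by gcongr
      _ = η / κ * ((R * P / η) / κ) := by field_simp
      _ ≤ _ := by gcongr
  refine le_of_mul_le_mul_left ?_ hL0
  have e4 : L * |b| = κ * (L * (1 / κ * |b|)) := by field_simp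
  have e5 : κ * (c ^ 2 * (1 / κ) ^ 2 * (M * L)) = L * (c ^ 2 * M / κ) := by field_simp
  have e6 := mul_le_mul_of_nonneg_left h hκ.le
  rw [← e4, mul_add, e5] at e6
  rw [hG, add_div, mul_add]
  linarith

/-- The terms of degrees 3 and 5 of the exponential series give κ³ ≤ 48 exp(κ/2) and κ⁵ ≤ 3840
exp(κ/2). -/
theorem pow_three_mul_exp_neg_half_le {κ : ℝ} (hκ : 0 ≤ κ) :
    κ ^ 3 * (1 + κ ^ 2) * Real.exp (-(κ / 2)) ≤ 3888 := by
  have h3 := Real.pow_div_factorial_le_exp (κ / 2) (by positivity) 3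
  have h5 := Real.pow_div_factorial_le_exp (κ / 2) (by positivity) 5
  rw [Real.exp_neg, ← div_eq_mul_inv, div_le_iff₀ (Real.exp_pos (κ / 2))]
  norm_num [Nat.factorial] at h3 h5
  linarith

set_option maxHeartbeats 800000 in
/-- Asymptotic balance of the two free coefficients for all frequencies. -/
theorem exists_coeff_balance {α a : ℝ} (hα : 0 < α) (hα1 : α < 1) (ha : 0 < a)
    (c : ℝ) {M G : ℝ} (hM0 : 0 ≤ M) (hG : 0 ≤ G) :
    ∃ C, ∀ k : ℕ, 1 ≤ k → ∀ (f : ℝ → ℝ) (g B : ℝ), Continuous f →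
      (∀ x ∈ Ioc (0 : ℝ) 1, |f x| ≤ M) → |g| ≤ G * (k : ℝ) ^ 2 → |B| ≤ G * (k : ℝ) ^ 2 →
      (∀ x ∈ Ioc (0 : ℝ) 1, fracInt (2 - 2 * α) f x - (a * (k : ℝ) ^ 2 + c ^ 2) * fracInt 2 f x
        = startProfile α x * g + x * B) →
      |B + a ^ ((α - 1) / (2 * α)) * (k : ℝ) ^ (1 - 1 / α) * g| ≤ C * (k : ℝ) ^ (-(1 / α)) := by
  set κ₁ : ℝ := a ^ (1 / (2 * α)) with hκ₁
  have hκ₁0 : 0 < κ₁ := Real.rpow_pos_of_pos ha _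
  -- Q bounds (2/κ)^β for 0 ≤ β ≤ 3 and all κ ≥ κ₁, hence for every k ≥ 1.
  set Q : ℝ := max 1 (2 / κ₁) ^ (3 : ℝ) with hQ
  have hQ1 : 1 ≤ max 1 (2 / κ₁) := le_max_left _ _
  set R : ℝ := Q * (M * 2 + M * c ^ 2 + 2 * (G / a)) with hR
  have hQ0 : 0 ≤ Q := by positivity
  have hR0 : 0 ≤ R := by positivity
  have hη : 0 < 1 - Real.exp (-κ₁) := by
    have := Real.exp_lt_exp.2 (neg_lt_zero.2 hκ₁0); rw [Real.exp_zero] at this; linarith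
  refine ⟨(c ^ 2 * M + R * 3888 / (1 - Real.exp (-κ₁))) / κ₁, fun k hk f g B hf hM hg hB h => ?_⟩
  have hk1 : (1 : ℝ) ≤ k := by exact_mod_cast hk
  have hk0 : (0 : ℝ) < k := by linarith
  -- Chosen so that κ^(2α) = a k², the leading part of the eigenvalue.
  set κ : ℝ := κ₁ * (k : ℝ) ^ (1 / α) with hκ
  have hkα : 1 ≤ (k : ℝ) ^ (1 / α) := Real.one_le_rpow hk1 (by positivity)
  have hκge : κ₁ ≤ κ := le_mul_of_one_le_right hκ₁0.le hkα
  have hκ0 : 0 < κ := hκ₁0.trans_le hκge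
  have hκα : κ ^ (2 * α) = a * (k : ℝ) ^ 2 := by
    rw [hκ, Real.mul_rpow hκ₁0.le (by positivity), hκ₁, ← Real.rpow_mul ha.le,
      ← Real.rpow_mul hk0.le]
    have e1 : 1 / (2 * α) * (2 * α) = 1 := by field_simp
    have e2 : 1 / α * (2 * α) = 2 := by field_simp
    rw [e1, e2, Real.rpow_one, Real.rpow_two]
  have hbal := laplace_balance (c := c) hα hα1 hκ0 hf hM (by rw [hκα]; exact h)
  have hL : ∫ x in (0 : ℝ)..1, Real.exp (-(κ * x)) = (1 - Real.exp (-κ)) / κ := by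
    have h2 := intervalIntegral.integral_comp_mul_left (a := 0) (b := 1) (c := -κ) Real.exp
      (neg_ne_zero.2 hκ0.ne')
    simp only [neg_mul] at h2
    rw [h2, integral_exp]
    simp only [mul_zero, neg_zero, Real.exp_zero, mul_one, smul_eq_mul]
    field_simp; ring
  have hLge : (1 - Real.exp (-κ₁)) / κ ≤ ∫ x in (0 : ℝ)..1, Real.exp (-(κ * x)) := by
    rw [hL]
    exact div_le_div_of_nonneg_right (by
      have := Real.exp_le_exp.2 (neg_le_neg hκge); linarith) hκ0.le
  have hLpos : 0 < ∫ x in (0 : ℝ)..1, Real.exp (-(κ * x)) :=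
    lt_of_lt_of_le (div_pos hη hκ0) hLge
  set L := ∫ x in (0 : ℝ)..1, Real.exp (-(κ * x)) with hLdef
  have hpw : ∀ β : ℝ, 0 ≤ β → β ≤ 3 → (1 / (κ / 2)) ^ β ≤ Q := by
    intro β hβ0 hβ3
    have h1 : 1 / (κ / 2) ≤ max 1 (2 / κ₁) := by
      refine le_trans ?_ (le_max_right _ _)
      rw [one_div_div]
      exact div_le_div_of_nonneg_left two_pos.le hκ₁0 hκge
    exact (Real.rpow_le_rpow (by positivity) h1 hβ0).trans
      (Real.rpow_le_rpow_of_exponent_le hQ1 hβ3)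
  have hκ2 : κ ^ (2 * α) ≤ 1 + κ ^ 2 := by
    rcases le_total κ 1 with h1 | h1
    · have := Real.rpow_le_one hκ0.le h1 (by linarith : 0 ≤ 2 * α)
      nlinarith [sq_nonneg κ]
    · have := Real.rpow_le_rpow_of_exponent_le h1 (by linarith : 2 * α ≤ 2)
      rw [Real.rpow_two] at this; linarith
  have hGk : G * (k : ℝ) ^ 2 ≤ G / a * (1 + κ ^ 2) := by
    rw [hκα] at hκ2
    have : G * (k : ℝ) ^ 2 = G / a * (a * (k : ℝ) ^ 2) := by field_simp
    rw [this]
    exact mul_le_mul_of_nonneg_left hκ2 (by positivity)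
  have herr : M * (1 / (κ / 2)) ^ (2 - 2 * α) + (κ ^ (2 * α) + c ^ 2) * M * (1 / (κ / 2)) ^ (2 : ℝ)
          + |g| * (1 / (κ / 2)) ^ (2 - α) + |B| * (1 / (κ / 2)) ^ (1 : ℝ) ≤ R * (1 + κ ^ 2) := by
    have p1 := hpw (2 - 2 * α) (by linarith) (by linarith)
    have p2 := hpw 2 (by norm_num) (by norm_num)
    have p3 := hpw (2 - α) (by linarith) (by linarith)
    have p4 := hpw 1 (by norm_num) (by norm_num)
    calc _ ≤ M * Q + (1 + κ ^ 2 + c ^ 2) * M * Q + G / a * (1 + κ ^ 2) * Q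
          + G / a * (1 + κ ^ 2) * Q := by
          gcongr
          · exact hg.trans hGk
          · exact hB.trans hGk
      _ ≤ R * (1 + κ ^ 2) := by
          have n1 : 0 ≤ M * Q * κ ^ 2 := by positivity
          have n2 : 0 ≤ c ^ 2 * M * Q * κ ^ 2 := by positivity
          simp only [hR]; linarith
  have hp2 : (1 / κ) ^ (2 - α) = 1 / κ * κ ^ (α - 1) := by
    rw [one_div, Real.inv_rpow hκ0.le, ← Real.rpow_neg hκ0.le, ← Real.rpow_neg_one,
      ← Real.rpow_add hκ0]
    congr 1; ring
  have hmain : |B + κ ^ (α - 1) * g| ≤ (c ^ 2 * M + R * 3888 / (1 - Real.exp (-κ₁))) / κ := by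
    have e1 : B * (1 / κ) + g * (1 / κ) ^ (2 - α) = 1 / κ * (B + κ ^ (α - 1) * g) := by
      rw [hp2]; ring
    rw [e1, abs_mul, abs_of_pos (by positivity : 0 < 1 / κ), Real.rpow_two] at hbal
    have e2 : L * (1 / κ * |B + κ ^ (α - 1) * g|) ≤ c ^ 2 * (1 / κ) ^ 2 * (M * L)
        + R * (1 + κ ^ 2) * Real.exp (-(κ / 2)) :=
      hbal.trans (by gcongr)
    exact abs_le_div_of_balance hκ0 hη hR0 hLge
      (pow_three_mul_exp_neg_half_le hκ0.le) e2 rfl (by norm_num)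
  have q1 : κ ^ (α - 1) = a ^ ((α - 1) / (2 * α)) * (k : ℝ) ^ (1 - 1 / α) := by
    rw [hκ, Real.mul_rpow hκ₁0.le (by positivity), hκ₁, ← Real.rpow_mul ha.le,
      ← Real.rpow_mul hk0.le]
    congr 2 <;> field_simp
  have q2 : ∀ K : ℝ, K / κ = K / κ₁ * (k : ℝ) ^ (-(1 / α)) := fun K => by
    rw [hκ, Real.rpow_neg hk0.le]; field_simp
  rw [q1, q2] at hmain
  exact hmain


/-! ### A nonlocal operator of order p in (1,2). -/

/-- The integral operator `∫₀^∞ u^(-1-p) (F(z+u) + F(z-u) - 2F(z)) du`, a multiple of a fractional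
power of the Laplacian. -/
noncomputable def nonlocalOp (p : ℝ) (F : ℝ → ℝ) (z : ℝ) : ℝ :=
  ∫ u in Ioi (0 : ℝ), u ^ (-1 - p) * secondDiff u F z

section nonlocalOp

variable {p : ℝ}

/-- Integrability at 0 needs p < 2. Hence bounds of second differences by a multiple of min(u²,1)
suffice throughout. -/
theorem integrableOn_rpow_mul_min (hp1 : 1 < p) (hp2 : p < 2) :
    IntegrableOn (fun u : ℝ => u ^ (-1 - p) * min (u ^ 2) 1) (Ioi 0) := by
  have hm : Measurable fun u : ℝ => u ^ (-1 - p) * min (u ^ 2) 1 := by fun_prop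
  rw [← Ioc_union_Ioi_eq_Ioi (zero_le_one' ℝ), integrableOn_union]
  constructor
  · have h1 : IntegrableOn (fun u : ℝ => u ^ (1 - p)) (Ioc 0 1) := by
      have := intervalIntegral.intervalIntegrable_rpow' (a := 0) (b := 1) (r := 1 - p) (by linarith)
      rwa [intervalIntegrable_iff_integrableOn_Ioc_of_le zero_le_one] at this
    refine h1.mono' hm.aestronglyMeasurable ?_
    filter_upwards [ae_restrict_mem measurableSet_Ioc] with u hu
    have h0 : 0 ≤ u ^ (-1 - p) := Real.rpow_nonneg hu.1.le _
    rw [Real.norm_eq_abs, abs_of_nonneg (mul_nonneg h0 (by positivity))]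
    have e : u ^ (1 - p) = u ^ (-1 - p) * u ^ 2 := by
      rw [← Real.rpow_two, ← Real.rpow_add hu.1]; congr 1; ring
    rw [e]
    exact mul_le_mul_of_nonneg_left (min_le_left _ _) h0
  · have h1 : IntegrableOn (fun u : ℝ => u ^ (-1 - p)) (Ioi 1) :=
      integrableOn_Ioi_rpow_of_lt (by linarith) one_pos
    refine h1.mono' hm.aestronglyMeasurable ?_
    filter_upwards [ae_restrict_mem measurableSet_Ioi] with u hu
    have hu0 : (0 : ℝ) < u := one_pos.trans hu
    have h0 : 0 ≤ u ^ (-1 - p) := Real.rpow_nonneg hu0.le _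
    rw [Real.norm_eq_abs, abs_of_nonneg (mul_nonneg h0 (by positivity))]
    exact mul_le_of_le_one_right h0 (min_le_right _ _)

theorem integrableOn_rpow_mul_of_abs_le (hp1 : 1 < p) (hp2 : p < 2) {f : ℝ → ℝ}
    (hf : Continuous f) {C : ℝ} (hC : ∀ u > 0, |f u| ≤ C * min (u ^ 2) 1) :
    IntegrableOn (fun u : ℝ => u ^ (-1 - p) * f u) (Ioi 0) := by
  refine ((integrableOn_rpow_mul_min hp1 hp2).const_mul C).mono'
    ((by fun_prop : Measurable fun u : ℝ => u ^ (-1 - p)).mul hf.measurable).aestronglyMeasurable ?_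
  filter_upwards [ae_restrict_mem measurableSet_Ioi] with u hu
  have h0 : 0 ≤ u ^ (-1 - p) := Real.rpow_nonneg (le_of_lt hu) _
  rw [norm_mul, Real.norm_eq_abs, Real.norm_eq_abs, abs_of_nonneg h0, mul_left_comm]
  exact mul_le_mul_of_nonneg_left (hC u hu) h0

theorem integral_integral_rpow_mul_swap (hp1 : 1 < p) (hp2 : p < 2) {f : ℝ → ℝ → ℝ}
    (hf : Continuous (Function.uncurry f)) {a b C : ℝ} (hab : a ≤ b)
    (hC : ∀ u > 0, ∀ z ∈ Icc a b, |f u z| ≤ C * min (u ^ 2) 1) :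
    ∫ z in a..b, ∫ u in Ioi (0 : ℝ), u ^ (-1 - p) * f u z
      = ∫ u in Ioi (0 : ℝ), u ^ (-1 - p) * ∫ z in a..b, f u z := by
  simp only [← intervalIntegral.integral_const_mul]
  simp only [intervalIntegral.integral_of_le hab]
  refine integral_integral_swap (f := fun z u => u ^ (-1 - p) * f u z) ?_
  have hi : Integrable (fun v : ℝ × ℝ => (1 : ℝ) * (v.2 ^ (-1 - p) * min (v.2 ^ 2) 1))
      ((volume.restrict (Ioc a b)).prod (volume.restrict (Ioi 0))) :=
    Integrable.mul_prod (f := fun _ => (1 : ℝ)) (integrable_const _) (integrableOn_rpow_mul_min hp1 hp2)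
  refine (hi.const_mul C).mono' ?_ ?_
  · refine AEStronglyMeasurable.mul ?_ ?_
    · exact (by fun_prop : Measurable fun v : ℝ × ℝ => v.2 ^ (-1 - p)).aestronglyMeasurable
    · exact (hf.comp continuous_swap).aestronglyMeasurable
  · rw [Measure.prod_restrict]
    filter_upwards [ae_restrict_mem (measurableSet_Ioc.prod measurableSet_Ioi)] with v hv
    have h0 : 0 ≤ v.2 ^ (-1 - p) := Real.rpow_nonneg (le_of_lt hv.2) _
    have h1 := hC v.2 hv.2 v.1 (Ioc_subset_Icc_self hv.1)
    rw [Function.uncurry_def, norm_mul, Real.norm_eq_abs, Real.norm_eq_abs, abs_of_nonneg h0, one_mul,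
      mul_left_comm]
    exact mul_le_mul_of_nonneg_left h1 h0

theorem continuous_secondDiff {F : ℝ → ℝ} (hF : Continuous F) :
    Continuous (Function.uncurry fun u z => secondDiff u F z) := by
  simp only [secondDiff, Function.uncurry_def]
  fun_prop

theorem continuousOn_nonlocalOp (hp1 : 1 < p) (hp2 : p < 2) {F : ℝ → ℝ} (hF : Continuous F)
    {S : Set ℝ} {C : ℝ} (hC : ∀ u > 0, ∀ z ∈ S, |secondDiff u F z| ≤ C * min (u ^ 2) 1) :
    ContinuousOn (nonlocalOp p F) S := by
  have hc := continuous_secondDiff hF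
  refine continuousOn_of_dominated (bound := fun u => C * (u ^ (-1 - p) * min (u ^ 2) 1))
    (fun z _ => ?_) (fun z hz => ?_) ((integrableOn_rpow_mul_min hp1 hp2).const_mul C) ?_
  · exact ((by fun_prop : Measurable fun u : ℝ => u ^ (-1 - p)).mul
      (hc.comp (by fun_prop : Continuous fun u : ℝ => (u, z))).measurable).aestronglyMeasurable
  · filter_upwards [ae_restrict_mem measurableSet_Ioi] with u hu
    have h0 : 0 ≤ u ^ (-1 - p) := Real.rpow_nonneg (le_of_lt hu) _
    rw [norm_mul, Real.norm_eq_abs, Real.norm_eq_abs, abs_of_nonneg h0, mul_left_comm]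
    exact mul_le_mul_of_nonneg_left (hC u hu z hz) h0
  · refine Filter.Eventually.of_forall fun u => ?_
    exact (continuous_const.mul (hc.comp (by fun_prop : Continuous fun z : ℝ => (u, z)))).continuousOn

/-- The operator commutes with second differences. -/
theorem secondDiff_nonlocalOp (hp1 : 1 < p) (hp2 : p < 2) {G F : ℝ → ℝ} (hG : Continuous G)
    (hF : Continuous F) (hGF : ∀ t, 0 ≤ t → ∀ z, secondDiff t G z = hatAvg t F z)
    {B C t z : ℝ} (ht : 0 ≤ t)
    (hB : ∀ u > 0, ∀ y, |secondDiff u G y| ≤ B * min (u ^ 2) 1)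
    (hC : ∀ u > 0, ∀ y ∈ Icc (z - t) (z + t), |secondDiff u F y| ≤ C * min (u ^ 2) 1) :
    secondDiff t (nonlocalOp p G) z = hatAvg t (nonlocalOp p F) z := by
  have hcG := continuous_secondDiff hG
  have hcF := continuous_secondDiff hF
  have cG : ∀ y, Continuous fun u => secondDiff u G y := fun y =>
    hcG.comp (by fun_prop : Continuous fun u : ℝ => (u, y))
  have cF : ∀ y, Continuous fun u => secondDiff u F y := fun y =>
    hcF.comp (by fun_prop : Continuous fun u : ℝ => (u, y))
  have iG : ∀ y, IntegrableOn (fun u => u ^ (-1 - p) * secondDiff u G y) (Ioi 0) := fun y =>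
    integrableOn_rpow_mul_of_abs_le hp1 hp2 (cG y) fun u hu => hB u hu y
  have iF : ∀ y ∈ Icc (z - t) (z + t), IntegrableOn (fun u => u ^ (-1 - p) * secondDiff u F y) (Ioi 0) :=
    fun y hy => integrableOn_rpow_mul_of_abs_le hp1 hp2 (cF y) fun u hu => hC u hu y hy
  have hcomm : ∀ u, 0 < u → secondDiff u G (z + t) + secondDiff u G (z - t) - 2 * secondDiff u G z
      = ∫ s in (0 : ℝ)..t, (t - s) * (secondDiff u F (z + s) + secondDiff u F (z - s)) := by
    intro u hu
    have h1 := secondDiff_hatAvg (F := fun x y => F (x + y)) (z := 0) ht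
      (fun x => (by fun_prop : Continuous fun y => F (x + y)).continuousOn) u z
    have h2 : ∀ x, hatAvg t (fun y => F (x + y)) 0 = secondDiff t G x := fun x => by
      rw [hGF t ht x, hatAvg, hatAvg]; congr 1; ext s; congr 2 <;> congr 1 <;> ring
    simp only [h2] at h1
    have h3 : secondDiff u (fun x => secondDiff t G x) z
        = secondDiff u G (z + t) + secondDiff u G (z - t) - 2 * secondDiff u G z := by
      have e1 : z + u + t = z + t + u := by ring
      have e2 : z + u - t = z - t + u := by ring
      have e3 : z - u + t = z + t - u := by ring
      have e4 : z - u - t = z - t - u := by ring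
      simp only [secondDiff, e1, e2, e3, e4]; ring
    rw [← h3, h1, hatAvg]
    congr 1; ext s
    have e1 : z + u + s = z + s + u := by ring
    have e2 : z - u + s = z + s - u := by ring
    have e3 : z + u + -s = z - s + u := by ring
    have e4 : z - u + -s = z - s - u := by ring
    simp only [secondDiff, zero_add, zero_sub, e1, e2, e3, e4, ← sub_eq_add_neg]
  have hL : secondDiff t (nonlocalOp p G) z
      = ∫ u in Ioi (0 : ℝ), u ^ (-1 - p)
        * ∫ s in (0 : ℝ)..t, (t - s) * (secondDiff u F (z + s) + secondDiff u F (z - s)) := by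
    have h1 := integral_sub ((iG (z + t)).add (iG (z - t))) ((iG z).const_mul 2)
    simp only [Pi.add_apply] at h1
    rw [integral_add (iG (z + t)) (iG (z - t)), integral_const_mul] at h1
    have h2 : secondDiff t (nonlocalOp p G) z = ∫ u in Ioi (0 : ℝ),
        (u ^ (-1 - p) * secondDiff u G (z + t) + u ^ (-1 - p) * secondDiff u G (z - t)
          - 2 * (u ^ (-1 - p) * secondDiff u G z)) := by
      rw [h1]; simp only [secondDiff, nonlocalOp]
    rw [h2]
    refine setIntegral_congr_fun measurableSet_Ioi fun u hu => ?_
    rw [← hcomm u hu]; ring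
  have hR : hatAvg t (nonlocalOp p F) z = ∫ s in (0 : ℝ)..t, ∫ u in Ioi (0 : ℝ), u ^ (-1 - p)
        * ((t - s) * (secondDiff u F (z + s) + secondDiff u F (z - s))) := by
    refine intervalIntegral.integral_congr fun s hs => ?_
    rw [uIcc_of_le ht] at hs
    have i1 := iF (z + s) ⟨by linarith [hs.1], by linarith [hs.2]⟩
    have i2 := iF (z - s) ⟨by linarith [hs.2], by linarith [hs.1]⟩
    simp only [nonlocalOp]
    rw [← integral_add i1 i2, ← integral_const_mul]
    congr 1; ext u; ring
  have hcont : Continuous (Function.uncurry fun u s =>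
      (t - s) * (secondDiff u F (z + s) + secondDiff u F (z - s))) := by
    simp only [secondDiff, Function.uncurry_def]
    fun_prop
  rw [hL, hR, integral_integral_rpow_mul_swap hp1 hp2 hcont (C := t * (C + C)) ht]
  intro u hu s hs
  have b1 := hC u hu (z + s) ⟨by linarith [hs.1], by linarith [hs.2]⟩
  have b2 := hC u hu (z - s) ⟨by linarith [hs.2], by linarith [hs.1]⟩
  rw [abs_mul, abs_of_nonneg (sub_nonneg.2 hs.2), mul_assoc, add_mul]
  exact mul_le_mul (by linarith [hs.1]) ((abs_add_le _ _).trans (add_le_add b1 b2)) (abs_nonneg _) ht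

/-- For odd periodic G both sides are integrals over a full period, where the shift can be moved to
the sine; the cosine part vanishes by oddness. -/
theorem sineCoeff_add_shift {G : ℝ → ℝ} (hG : Continuous G) (h0 : ∀ z, G (-z) = -G z)
    (hper : Function.Periodic G (2 * Real.pi)) (k : ℕ) (u : ℝ) :
    sineCoeff k (fun z => G (z + u) + G (z - u)) = 2 * Real.cos (k * u) * sineCoeff k G := by
  have hs : Continuous fun z : ℝ => Real.sin (k * z) := by fun_prop
  have hi : ∀ v a b : ℝ, IntervalIntegrable (fun z => G (z + v) * Real.sin (k * z)) volume a b :=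
    fun v a b => (by fun_prop : Continuous fun z => G (z + v) * Real.sin (k * z)).intervalIntegrable _ _
  have hfold : ∀ f : ℝ → ℝ, Continuous f → ∫ z in (-Real.pi)..Real.pi, f z
      = (∫ z in (0 : ℝ)..Real.pi, f z) + ∫ z in (0 : ℝ)..Real.pi, f (-z) := fun f hf => by
    rw [intervalIntegral.integral_comp_neg, neg_zero, add_comm,
      intervalIntegral.integral_add_adjacent_intervals (hf.intervalIntegrable _ _)
        (hf.intervalIntegrable _ _)]
  have e1 : sineCoeff k (fun z => G (z + u) + G (z - u))
      = ∫ z in (-Real.pi)..Real.pi, G (z + u) * Real.sin (k * z) := by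
    rw [hfold _ (by fun_prop), ← intervalIntegral.integral_add (hi u _ _)
      ((by fun_prop : Continuous fun z => G (-z + u) * Real.sin (k * -z)).intervalIntegrable _ _)]
    simp only [sineCoeff]
    congr 1; ext z
    have : G (z - u) = -G (-z + u) := by rw [← h0]; congr 1; ring
    rw [this, mul_neg, Real.sin_neg]; ring
  have hcos : ∀ z : ℝ, Real.sin (k * (z + 2 * Real.pi - u)) = Real.sin (k * (z - u)) := fun z => by
    rw [show (k : ℝ) * (z + 2 * Real.pi - u) = k * (z - u) + k * (2 * Real.pi) by ring,
      Real.sin_add_nat_mul_two_pi]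
  have e2 : ∫ z in (-Real.pi)..Real.pi, G (z + u) * Real.sin (k * z)
      = ∫ z in (-Real.pi)..Real.pi, G z * Real.sin (k * (z - u)) := by
    have p1 : Function.Periodic (fun z => G z * Real.sin (k * (z - u))) (2 * Real.pi) := fun z => by
      simp only [hper z, hcos z]
    have h1 := intervalIntegral.integral_comp_add_right (a := -Real.pi) (b := Real.pi)
      (fun z => G z * Real.sin (k * (z - u))) u
    simp only [add_sub_cancel_right] at h1
    have h2 := p1.intervalIntegral_add_eq (-Real.pi) (-Real.pi + u)
    rw [h1]
    convert h2.symm using 2 <;> ring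
  have e3 : ∫ z in (-Real.pi)..Real.pi, G z * Real.sin (k * (z - u))
      = Real.cos (k * u) * (∫ z in (-Real.pi)..Real.pi, G z * Real.sin (k * z))
        - Real.sin (k * u) * ∫ z in (-Real.pi)..Real.pi, G z * Real.cos (k * z) := by
    rw [← intervalIntegral.integral_const_mul, ← intervalIntegral.integral_const_mul,
      ← intervalIntegral.integral_sub
        ((by fun_prop : Continuous fun z => Real.cos (k * u) * (G z * Real.sin (k * z))).intervalIntegrable _ _)
        ((by fun_prop : Continuous fun z => Real.sin (k * u) * (G z * Real.cos (k * z))).intervalIntegrable _ _)]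
    congr 1; ext z
    rw [mul_sub, Real.sin_sub]; ring
  have e4 : ∫ z in (-Real.pi)..Real.pi, G z * Real.cos (k * z) = 0 :=
    integral_symm_eq_zero_of_odd (fun y => by rw [h0, mul_neg, Real.cos_neg]; ring) _
  have e5 : ∫ z in (-Real.pi)..Real.pi, G z * Real.sin (k * z) = 2 * sineCoeff k G := by
    rw [hfold _ (by fun_prop), two_mul]
    simp only [sineCoeff]
    congr 2; ext z
    rw [h0, mul_neg, Real.sin_neg]; ring
  rw [e1, e2, e3, e4, e5]; ring

/-- The constant in the symbol of the operator. -/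
noncomputable def symbolConst (p : ℝ) : ℝ :=
  ∫ u in Ioi (0 : ℝ), u ^ (-1 - p) * (2 - 2 * Real.cos u)

theorem two_sub_two_mul_cos_le (u : ℝ) : |2 - 2 * Real.cos u| ≤ 4 * min (u ^ 2) 1 := by
  have h1 := Real.one_sub_sq_div_two_le_cos (x := u)
  have h2 := Real.cos_le_one u
  have h3 := Real.neg_one_le_cos u
  rw [abs_of_nonneg (by linarith)]
  rcases le_total (u ^ 2) 1 with h | h
  · rw [min_eq_left h]; nlinarith [sq_nonneg u]
  · rw [min_eq_right h]; linarith

theorem symbolConst_pos (hp1 : 1 < p) (hp2 : p < 2) : 0 < symbolConst p := by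
  have hi := integrableOn_rpow_mul_of_abs_le hp1 hp2 (f := fun u => 2 - 2 * Real.cos u)
    (by fun_prop) fun u _ => two_sub_two_mul_cos_le u
  rw [symbolConst, setIntegral_pos_iff_support_of_nonneg_ae _ hi]
  · refine lt_of_lt_of_le ?_ (measure_mono (s := Ioo (0 : ℝ) 1) fun u hu => ⟨?_, hu.1⟩)
    · simp
    · have h1 : 0 < u ^ (-1 - p) := Real.rpow_pos_of_pos hu.1 _
      have h2 : Real.cos u < 1 := by
        have := Real.cos_lt_cos_of_nonneg_of_le_pi le_rfl (by linarith [Real.pi_gt_three, hu.2]) hu.1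
        rwa [Real.cos_zero] at this
      exact (mul_pos h1 (by linarith)).ne'
  · filter_upwards [ae_restrict_mem measurableSet_Ioi] with u hu
    have h1 : 0 ≤ u ^ (-1 - p) := Real.rpow_nonneg (le_of_lt hu) _
    exact mul_nonneg h1 (by linarith [Real.cos_le_one u])

/-- The homogeneity of the kernel under u ↦ k u produces the factor k^p. -/
theorem integral_rpow_mul_cos_mul {k : ℝ} (hk : 0 < k) :
    ∫ u in Ioi (0 : ℝ), u ^ (-1 - p) * (2 * Real.cos (k * u) - 2) = -(k ^ p * symbolConst p) := by
  have h1 := integral_comp_mul_left_Ioi (fun u => u ^ (-1 - p) * (2 - 2 * Real.cos u)) 0 hk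
  rw [mul_zero, smul_eq_mul] at h1
  have h2 : ∫ u in Ioi (0 : ℝ), (k * u) ^ (-1 - p) * (2 - 2 * Real.cos (k * u))
      = -(k ^ (-1 - p)) * ∫ u in Ioi (0 : ℝ), u ^ (-1 - p) * (2 * Real.cos (k * u) - 2) := by
    rw [← integral_const_mul]
    refine setIntegral_congr_fun measurableSet_Ioi fun u hu => ?_
    rw [Real.mul_rpow hk.le (le_of_lt hu)]; ring
  rw [h2] at h1
  have h3 : k ^ p * k ^ (-1 - p) = k⁻¹ := by
    rw [← Real.rpow_add hk, ← Real.rpow_neg_one]; congr 1; ring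
  have h4 : k * (k ^ p * k ^ (-1 - p)) = 1 := by rw [h3, mul_inv_cancel₀ hk.ne']
  rw [symbolConst]
  have h5 : k * k⁻¹ = 1 := mul_inv_cancel₀ hk.ne'
  linear_combination (-(k ^ p) * k) * h1 - (∫ u in Ioi (0 : ℝ), u ^ (-1 - p) * (2 * Real.cos (k * u) - 2)) * h4
    - k ^ p * (∫ u in Ioi (0 : ℝ), u ^ (-1 - p) * (2 - 2 * Real.cos u)) * h5

theorem sineCoeff_nonlocalOp (hp1 : 1 < p) (hp2 : p < 2) {G : ℝ → ℝ} (hG : Continuous G)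
    (h0 : ∀ z, G (-z) = -G z) (hper : Function.Periodic G (2 * Real.pi)) {B : ℝ}
    (hB : ∀ u > 0, ∀ y, |secondDiff u G y| ≤ B * min (u ^ 2) 1) {k : ℕ} (hk : 1 ≤ k) :
    sineCoeff k (nonlocalOp p G) = -((k : ℝ) ^ p * symbolConst p) * sineCoeff k G := by
  have hk0 : (0 : ℝ) < k := by exact_mod_cast hk
  have hc := continuous_secondDiff hG
  have e1 : sineCoeff k (nonlocalOp p G) = ∫ z in (0 : ℝ)..Real.pi, ∫ u in Ioi (0 : ℝ),
      u ^ (-1 - p) * (secondDiff u G z * Real.sin (k * z)) := by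
    simp only [sineCoeff, nonlocalOp, ← integral_mul_const, mul_assoc]
  have hcont : Continuous (Function.uncurry fun u z => secondDiff u G z * Real.sin (k * z)) :=
    hc.mul (by fun_prop : Continuous fun v : ℝ × ℝ => Real.sin (k * v.2))
  rw [e1, integral_integral_rpow_mul_swap hp1 hp2 hcont (C := B) Real.pi_pos.le,
    ← integral_rpow_mul_cos_mul hk0, ← integral_mul_const]
  · congr 1; ext u
    have e2 := sineCoeff_add_shift hG h0 hper k u
    have e3 := sineCoeff_mul_add_mul (f := fun z => G (z + u) + G (z - u)) (g := G) (by fun_prop) hG 1 (-2) k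
    rw [e2] at e3
    have e4 : ∫ z in (0 : ℝ)..Real.pi, secondDiff u G z * Real.sin (k * z)
        = sineCoeff k fun z => 1 * (G (z + u) + G (z - u)) + -2 * G z := by
      simp only [sineCoeff, secondDiff]
      congr 1; ext z; ring
    rw [e4, e3]; ring
  · intro u hu z _
    rw [abs_mul]
    exact (mul_le_of_le_one_right (abs_nonneg _) (Real.abs_sin_le_one _)).trans (hB u hu z)

end nonlocalOp


/-! ### Odd extensions and the vanishing of the coupled profile. -/

/-- The odd `2π`-periodic extension of a function on `[0,π]` vanishing at the end points. -/
noncomputable def oddExtension (f : ℝ → ℝ) (z : ℝ) : ℝ :=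
  if 0 ≤ Real.sin z then f (Real.arccos (Real.cos z)) else -f (Real.arccos (Real.cos z))

section oddExtension

variable {f : ℝ → ℝ}

theorem apply_arccos_cos_eq_zero (h0 : f 0 = 0) (hπ : f Real.pi = 0) {z : ℝ}
    (hz : Real.sin z = 0) : f (Real.arccos (Real.cos z)) = 0 := by
  rcases Real.sin_eq_zero_iff_cos_eq.1 hz with h | h <;> simp [h, h0, hπ]

theorem continuous_oddExtension (hf : Continuous f) (h0 : f 0 = 0) (hπ : f Real.pi = 0) :
    Continuous (oddExtension f) := by
  have hc : Continuous fun z => f (Real.arccos (Real.cos z)) :=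
    hf.comp (Real.continuous_arccos.comp Real.continuous_cos)
  refine Continuous.if_le hc hc.neg continuous_const Real.continuous_sin fun z hz => ?_
  rw [apply_arccos_cos_eq_zero h0 hπ hz.symm, neg_zero]

theorem oddExtension_eq {z : ℝ} (hz : z ∈ Icc 0 Real.pi) : oddExtension f z = f z := by
  rw [oddExtension, if_pos (Real.sin_nonneg_of_mem_Icc hz), Real.arccos_cos hz.1 hz.2]

theorem oddExtension_eq_neg (h0 : f 0 = 0) (hπ : f Real.pi = 0) {y z : ℝ}
    (hc : Real.cos y = Real.cos z) (hs : Real.sin y = -Real.sin z) :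
    oddExtension f y = -oddExtension f z := by
  simp only [oddExtension, hc, hs]
  rcases lt_trichotomy (Real.sin z) 0 with h | h | h
  · rw [if_pos (by linarith), if_neg (by linarith), neg_neg]
  · simp [h, apply_arccos_cos_eq_zero h0 hπ h]
  · rw [if_neg (by linarith), if_pos h.le]

theorem abs_oddExtension_le {M : ℝ} (hM : ∀ z ∈ Icc 0 Real.pi, |f z| ≤ M) (z : ℝ) :
    |oddExtension f z| ≤ M := by
  have := hM _ ⟨Real.arccos_nonneg (Real.cos z), Real.arccos_le_pi _⟩
  rw [oddExtension]
  split_ifs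
  · exact this
  · rwa [abs_neg]

end oddExtension

section greenOp

variable {F : ℝ → ℝ}

/-- The second difference centred at q equals a hat average of F, which is zero by symmetry; with a
zero at q this is oddness about q. -/
theorem greenOp_odd_about (hF : Continuous F) {q : ℝ} (hq : greenOp F q = 0)
    (h : ∀ s, F (q + s) = -F (q - s)) (z : ℝ) : greenOp F (q + z) = -greenOp F (q - z) := by
  have key : ∀ t, 0 ≤ t → greenOp F (q + t) = -greenOp F (q - t) := fun t ht => by
    have h1 := secondDiff_greenOp hF ht q
    have h2 : hatAvg t F q = 0 := by simp [hatAvg, h]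
    rw [h2, secondDiff, hq] at h1
    linarith
  rcases le_total 0 z with hz | hz
  · exact key z hz
  · have := key (-z) (by linarith)
    rw [sub_neg_eq_add, ← sub_eq_add_neg] at this
    linarith

theorem greenOp_neg (hF : Continuous F) (h : ∀ z, F (-z) = -F z) (z : ℝ) :
    greenOp F (-z) = -greenOp F z := by
  have := greenOp_odd_about hF (greenOp_zero F) (fun s => by rw [zero_add, zero_sub, h, neg_neg]) z
  rw [zero_add, zero_sub] at this
  linarith

theorem greenOp_periodic (hF : Continuous F) (h : ∀ z, F (-z) = -F z)
    (h' : ∀ s, F (Real.pi + s) = -F (Real.pi - s)) :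
    Function.Periodic (greenOp F) (2 * Real.pi) := fun z => by
  have h1 := greenOp_odd_about hF (greenOp_pi F) h' (Real.pi + z)
  have h2 := greenOp_neg hF h z
  rw [show Real.pi + (Real.pi + z) = z + 2 * Real.pi by ring,
    show Real.pi - (Real.pi + z) = -z by ring] at h1
  linarith

theorem exists_bound_of_periodic {G : ℝ → ℝ} (hG : Continuous G) {c : ℝ} (hc : 0 < c)
    (hper : Function.Periodic G c) : ∃ M, ∀ z, |G z| ≤ M := by
  obtain ⟨M, hM⟩ := (isCompact_Icc (a := 0) (b := c)).exists_bound_of_continuousOn hG.continuousOn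
  refine ⟨M, fun z => ?_⟩
  obtain ⟨y, hy, e⟩ := hper.exists_mem_Ico₀ hc z
  rw [e]
  exact hM y ⟨hy.1, hy.2.le⟩

end greenOp

theorem abs_secondDiff_le {F : ℝ → ℝ} {M : ℝ} (hM : ∀ z, |F z| ≤ M) (u z : ℝ) :
    |secondDiff u F z| ≤ 4 * M := by
  have j1 := abs_le.1 (hM (z + u))
  have j2 := abs_le.1 (hM (z - u))
  have j3 := abs_le.1 (hM z)
  rw [secondDiff]
  exact abs_le.2 ⟨by linarith, by linarith⟩

/-- A bound on second differences from a local quadratic bound. -/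
theorem abs_secondDiff_le_min {F : ℝ → ℝ} {M C r u z : ℝ} (hr : 0 < r)
    (hM : ∀ z, |F z| ≤ M) (hu : 0 < u) (hloc : u < r → |secondDiff u F z| ≤ C * u ^ 2) :
    |secondDiff u F z| ≤ max C (4 * M * max 1 (1 / r ^ 2)) * min (u ^ 2) 1 := by
  have hM0 : 0 ≤ M := (abs_nonneg _).trans (hM 0)
  have hb := abs_secondDiff_le hM u z
  have hm : 1 ≤ max 1 (1 / r ^ 2) := le_max_left _ _
  have hm' : 1 / r ^ 2 ≤ max 1 (1 / r ^ 2) := le_max_right _ _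
  have hK1 : C ≤ max C (4 * M * max 1 (1 / r ^ 2)) := le_max_left _ _
  have hK2 : 4 * M * max 1 (1 / r ^ 2) ≤ max C (4 * M * max 1 (1 / r ^ 2)) := le_max_right _ _
  have hu2 : 0 < u ^ 2 := by positivity
  rcases le_total (u ^ 2) 1 with h1 | h1
  · rw [min_eq_left h1]
    rcases lt_or_ge u r with h2 | h2
    · exact (hloc h2).trans (mul_le_mul_of_nonneg_right hK1 hu2.le)
    · refine le_trans ?_ (mul_le_mul_of_nonneg_right hK2 hu2.le)
      have h3 : 1 ≤ 1 / r ^ 2 * u ^ 2 := by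
        rw [one_div, inv_mul_eq_div, le_div_iff₀ (by positivity), one_mul]
        exact pow_le_pow_left₀ hr.le h2 2
      calc |secondDiff u F z| ≤ 4 * M * 1 := by linarith
        _ ≤ 4 * M * (1 / r ^ 2 * u ^ 2) := by gcongr
        _ ≤ 4 * M * (max 1 (1 / r ^ 2) * u ^ 2) := by gcongr
        _ = _ := by ring
  · rw [min_eq_right h1, mul_one]
    refine le_trans ?_ hK2
    calc |secondDiff u F z| ≤ 4 * M * 1 := by linarith
      _ ≤ _ := by gcongr

theorem integral_sin_mul_sin_half {j k : ℕ} (hk : 1 ≤ k) (hj : 1 ≤ j) :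
    ∫ z in (0 : ℝ)..Real.pi, Real.sin (j * z) * Real.sin (k * z) = if j = k then Real.pi / 2 else 0 := by
  have h1 : ∀ z : ℝ, Real.sin (j * z) * Real.sin (k * z)
      = (Real.cos (((j : ℤ) - k : ℤ) * z) - Real.cos (((j : ℤ) + k : ℤ) * z)) / 2 := fun z => by
    push_cast
    rw [sub_mul, add_mul, Real.cos_sub, Real.cos_add]; ring
  have h2 : ∀ n : ℤ, ∫ z in (0 : ℝ)..Real.pi, Real.cos (n * z) = if n = 0 then Real.pi else 0 := by
    intro n
    split_ifs with h
    · simp [h]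
    · have hn : (n : ℝ) ≠ 0 := by exact_mod_cast h
      rw [intervalIntegral.integral_comp_mul_left (fun z => Real.cos z) hn]
      simp [Real.sin_int_mul_pi]
  simp only [h1]
  rw [intervalIntegral.integral_div, intervalIntegral.integral_sub
    ((by fun_prop : Continuous fun z : ℝ => Real.cos (((j : ℤ) - k : ℤ) * z)).intervalIntegrable _ _)
    ((by fun_prop : Continuous fun z : ℝ => Real.cos (((j : ℤ) + k : ℤ) * z)).intervalIntegrable _ _),
    h2, h2, if_neg (show (j : ℤ) + k ≠ 0 by omega)]
  by_cases h : j = k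
  · simp [h]
  · rw [if_neg h, if_neg (show (j : ℤ) - k ≠ 0 by omega)]; simp

/-- Absolutely summable sequences are sine coefficients of continuous functions. -/
theorem exists_continuous_sineCoeff_eq {e : ℕ → ℝ} (he : Summable fun n => |e n|) :
    ∃ E : ℝ → ℝ, Continuous E ∧ ∀ k : ℕ, 1 ≤ k → sineCoeff k E = e k := by
  have hπ := Real.pi_pos
  set T : ℕ → ℝ → ℝ := fun n z => 2 / Real.pi * e (n + 1) * Real.sin ((n + 1 : ℕ) * z) with hT
  have hs : Summable fun n => 2 / Real.pi * |e (n + 1)| :=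
    ((summable_nat_add_iff 1).2 he).mul_left _
  have hb : ∀ n z, ‖T n z‖ ≤ 2 / Real.pi * |e (n + 1)| := fun n z => by
    simp only [hT]
    rw [norm_mul, norm_mul, Real.norm_eq_abs, Real.norm_eq_abs, Real.norm_eq_abs,
      abs_of_pos (by positivity : 0 < 2 / Real.pi)]
    exact mul_le_of_le_one_right (by positivity) (Real.abs_sin_le_one _)
  have hcT : ∀ n, Continuous (T n) := fun n => by simp only [hT]; fun_prop
  refine ⟨fun z => ∑' n, T n z, continuous_tsum hcT hs hb, fun k hk => ?_⟩
  have h1 := intervalIntegral.hasSum_integral_of_dominated_convergence (μ := volume) (a := 0)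
    (b := Real.pi) (F := fun n z => T n z * Real.sin (k * z))
    (f := fun z => (∑' n, T n z) * Real.sin (k * z))
    (fun n _ => 2 / Real.pi * |e (n + 1)|)
    (fun n => ((hcT n).mul (by fun_prop : Continuous fun z : ℝ => Real.sin (k * z))).aestronglyMeasurable)
    (fun n => Filter.Eventually.of_forall fun z _ => by
      rw [norm_mul]
      exact (mul_le_of_le_one_right (norm_nonneg _) (Real.abs_sin_le_one _)).trans (hb n z))
    (Filter.Eventually.of_forall fun z _ => hs) intervalIntegrable_const
    (Filter.Eventually.of_forall fun z _ =>
      ((Summable.of_norm_bounded hs fun n => hb n z).hasSum).mul_right _)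
  have h2 : ∀ n, ∫ z in (0 : ℝ)..Real.pi, T n z * Real.sin (k * z)
      = if n = k - 1 then e k else 0 := by
    intro n
    simp only [hT, mul_assoc, intervalIntegral.integral_const_mul]
    rw [integral_sin_mul_sin_half hk (Nat.le_add_left 1 n)]
    by_cases h : n = k - 1
    · have h' : n + 1 = k := by omega
      rw [if_pos h', if_pos h, h']; field_simp
    · rw [if_neg (by omega), if_neg h]; simp
  simp only [h2] at h1
  exact h1.unique (hasSum_ite_eq (k - 1) (e k))

/-- If two functions are coupled through their sine coefficients by a power of the frequency
up to a summable error, and the second is locally affine near a dense set, it vanishes. -/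
theorem eq_zero_of_coeff_balance {p A : ℝ} (hp1 : 1 < p) (hp2 : p < 2) {Γ Ψ g₀ : ℝ → ℝ}
    (hΓ : Continuous Γ) (hΨ : Continuous Ψ) (hΓ0 : Γ 0 = 0) (hΓπ : Γ Real.pi = 0)
    (hΨ0 : Ψ 0 = 0) (hΨπ : Ψ Real.pi = 0) (hg : ContinuousOn g₀ (Ioo 0 Real.pi))
    (hΓg : ∀ z t, 0 < t → 0 < z - t → z + t < Real.pi → secondDiff t Γ z = hatAvg t g₀ z)
    (hd : ∀ a b, 0 < a → a < b → b < Real.pi →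
      ∃ z ∈ Ioo a b, ∃ δ > 0, ∀ t, 0 < t → t < δ → secondDiff t Ψ z = 0)
    (he : Summable fun k : ℕ => |(k : ℝ) ^ 2 * sineCoeff k Ψ + A * (k : ℝ) ^ p * sineCoeff k Γ|) :
    ∀ z ∈ Icc 0 Real.pi, Ψ z = 0 := by
  have hπ := Real.pi_pos
  obtain ⟨E, cE, hE⟩ := exists_continuous_sineCoeff_eq he
  set F := oddExtension Γ with hFdef
  have cF : Continuous F := continuous_oddExtension hΓ hΓ0 hΓπ
  have hFneg : ∀ z, F (-z) = -F z := fun z =>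
    oddExtension_eq_neg hΓ0 hΓπ (Real.cos_neg z) (Real.sin_neg z)
  have hFπ : ∀ s, F (Real.pi + s) = -F (Real.pi - s) := fun s =>
    oddExtension_eq_neg hΓ0 hΓπ (by simp [Real.cos_add, Real.cos_sub])
      (by simp [Real.sin_add, Real.sin_sub])
  have hFeq : ∀ z ∈ Icc 0 Real.pi, F z = Γ z := fun z hz => oddExtension_eq hz
  obtain ⟨M, hM⟩ := (isCompact_Icc (a := 0) (b := Real.pi)).exists_bound_of_continuousOn
    hΓ.continuousOn
  have hFM : ∀ z, |F z| ≤ M := abs_oddExtension_le hM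
  have hM0 : 0 ≤ M := (abs_nonneg _).trans (hFM 0)
  -- F has quadratic bounds on second differences only inside (0,π), so the operator applied to F is
  -- not controlled at the end points. G has them globally, and two derivatives are restored at the
  -- end.
  set G := greenOp F with hGdef
  have cG : Continuous G := continuous_greenOp cF
  have hGneg : ∀ z, G (-z) = -G z := greenOp_neg cF hFneg
  have hGper : Function.Periodic G (2 * Real.pi) := greenOp_periodic cF hFneg hFπ
  have hGF : ∀ t, 0 ≤ t → ∀ z, secondDiff t G z = hatAvg t F z := fun t ht z =>
    secondDiff_greenOp cF ht z
  obtain ⟨M', hM'⟩ := exists_bound_of_periodic cG (by positivity) hGper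
  have hB : ∃ B, ∀ u > 0, ∀ y, |secondDiff u G y| ≤ B * min (u ^ 2) 1 :=
    ⟨_, fun u hu y => abs_secondDiff_le_min (r := 1) one_pos hM' hu fun _ => by
      rw [hGF u hu.le]; exact abs_hatAvg_le hu.le fun y _ => hFM y⟩
  obtain ⟨B, hB⟩ := hB
  -- Away from the end points F has the continuous second derivative g₀ in integrated form, which
  -- bounds small differences; large ones are bounded by the supremum.
  have hC : ∀ r > 0, ∃ C, ∀ u > 0, ∀ y ∈ Icc r (Real.pi - r),
      |secondDiff u F y| ≤ C * min (u ^ 2) 1 := by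
    intro r hr
    obtain ⟨K, hK⟩ := (isCompact_Icc (a := r / 2) (b := Real.pi - r / 2)).exists_bound_of_continuousOn
      (hg.mono fun y hy => ⟨by linarith [hy.1], by linarith [hy.2]⟩)
    refine ⟨_, fun u hu y hy => abs_secondDiff_le_min (r := r / 2) (C := |K|) (by positivity)
      hFM hu fun hur => ?_⟩
    have e : secondDiff u F y = secondDiff u Γ y := by
      simp only [secondDiff]
      rw [hFeq _ ⟨by linarith [hy.1], by linarith [hy.2]⟩,
        hFeq _ ⟨by linarith [hy.1], by linarith [hy.2]⟩, hFeq _ ⟨by linarith [hy.1], by linarith [hy.2]⟩]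
    rw [e, hΓg y u hu (by linarith [hy.1]) (by linarith [hy.2])]
    exact abs_hatAvg_le hu.le fun x hx =>
      (hK x ⟨by linarith [hx.1, hy.1], by linarith [hx.2, hy.2]⟩).trans (le_abs_self K)
  set N := nonlocalOp p G with hN
  set D := nonlocalOp p F with hD
  have cN : Continuous N := by
    rw [← continuousOn_univ]
    exact continuousOn_nonlocalOp hp1 hp2 cG fun u hu z _ => hB u hu z
  have cD : ContinuousOn D (Ioo 0 Real.pi) := by
    intro z hz
    set r := min z (Real.pi - z) / 2 with hr
    have hm : 0 < min z (Real.pi - z) := lt_min hz.1 (by linarith [hz.2])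
    have h1 := min_le_left z (Real.pi - z)
    have h2 := min_le_right z (Real.pi - z)
    obtain ⟨C, hC⟩ := hC r (by positivity)
    exact ((continuousOn_nonlocalOp hp1 hp2 cF hC).continuousAt
      (Icc_mem_nhds (by linarith) (by linarith))).continuousWithinAt
  have hS := symbolConst_pos hp1 hp2
  set b := A / symbolConst p with hb
  -- Both sides have equal sine coefficients: E carries k² Ψ + A k^p Γ, the Green operator divides
  -- by -k², and b turns the symbol of the operator into A k^p.
  have hrep : ∀ z ∈ Icc 0 Real.pi, Ψ z + (b * N z + 1 * greenOp E z) = 0 := by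
    have c1 : Continuous fun z => b * N z + 1 * greenOp E z :=
      (continuous_const.mul cN).add (continuous_const.mul (continuous_greenOp cE))
    have c2 : Continuous fun z => Ψ z + (b * N z + 1 * greenOp E z) := hΨ.add c1
    refine eq_zero_of_integral_mul_sin_eq_zero c2.continuousOn fun n => ?_
    have hk : 1 ≤ n + 1 := Nat.le_add_left 1 n
    have hk0 : (0 : ℝ) < (n + 1 : ℕ) := by exact_mod_cast hk
    have e1 := sineCoeff_mul_add_mul hΨ c1 1 1 (n + 1)
    rw [sineCoeff_mul_add_mul cN (continuous_greenOp cE),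
      sineCoeff_nonlocalOp hp1 hp2 cG hGneg hGper hB hk] at e1
    have e2 := hE (n + 1) hk
    rw [sineCoeff_greenOp cE] at e2
    have e3 := sineCoeff_greenOp cF (n + 1)
    rw [sineCoeff_congr hFeq] at e3
    have e4 : sineCoeff (n + 1) (fun z => 1 * Ψ z + 1 * (b * N z + 1 * greenOp E z)) = 0 := by
      rw [e1]
      rw [e3] at e2
      have e5 : b * symbolConst p = A := div_mul_cancel₀ _ hS.ne'
      have h2 : ((n + 1 : ℕ) : ℝ) ^ 2 ≠ 0 := by positivity
      refine mul_left_cancel₀ h2 ?_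
      rw [mul_zero]
      linear_combination -e2 - ((n + 1 : ℕ) : ℝ) ^ 2 * ((n + 1 : ℕ) : ℝ) ^ p * sineCoeff (n + 1) G * e5
    rw [← e4, sineCoeff]
    congr 1; ext z; ring
  -- H is Ψ'' in integrated form: the operator commutes with second differences and G'' = F, and H
  -- is continuous inside.
  set H : ℝ → ℝ := fun y => -b * D y + -1 * E y with hH
  have cH : ContinuousOn H (Ioo 0 Real.pi) :=
    (continuousOn_const.mul cD).add (continuousOn_const.mul cE.continuousOn)
  have hΨH : ∀ z t, 0 < t → 0 < z - t → z + t < Real.pi → secondDiff t Ψ z = hatAvg t H z := by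
    intro z t ht h1 h2
    obtain ⟨C, hC⟩ := hC (min (z - t) (Real.pi - (z + t))) (lt_min h1 (by linarith))
    have m1 := min_le_left (z - t) (Real.pi - (z + t))
    have m2 := min_le_right (z - t) (Real.pi - (z + t))
    have e1 := secondDiff_nonlocalOp hp1 hp2 cG cF hGF (z := z) ht.le hB fun u hu y hy =>
      hC u hu y ⟨by linarith [hy.1], by linarith [hy.2]⟩
    have e2 := secondDiff_greenOp cE ht.le z
    have hsub : Icc (z - t) (z + t) ⊆ Ioo 0 Real.pi := fun y hy =>
      ⟨h1.trans_le hy.1, hy.2.trans_lt h2⟩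
    rw [hatAvg_mul_add_mul ht.le (cD.mono hsub) cE.continuousOn, ← e1, ← e2]
    have r1 := hrep (z + t) ⟨by linarith, by linarith⟩
    have r2 := hrep (z - t) ⟨by linarith, by linarith⟩
    have r3 := hrep z ⟨by linarith, by linarith⟩
    simp only [secondDiff]
    linear_combination r1 + r2 - 2 * r3
  -- If H were nonzero at y, it would be nonzero on an interval, but that interval contains a point
  -- near which Ψ is affine.
  have hH0 : ∀ y ∈ Ioo 0 Real.pi, H y = 0 := by
    intro y hy
    by_contra hne
    have hopen : IsOpen (Ioo 0 Real.pi ∩ H ⁻¹' {0}ᶜ) :=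
      cH.isOpen_inter_preimage isOpen_Ioo isOpen_compl_singleton
    obtain ⟨ρ, hρ, hball⟩ := Metric.isOpen_iff.1 hopen y ⟨hy, hne⟩
    have hmem : ∀ x ∈ Icc (y - ρ / 2) (y + ρ / 2), x ∈ Ioo 0 Real.pi ∩ H ⁻¹' {0}ᶜ := fun x hx =>
      hball (by
        rw [Metric.mem_ball, Real.dist_eq]
        exact (abs_le.2 ⟨by linarith [hx.1], by linarith [hx.2]⟩ : |x - y| ≤ ρ / 2).trans_lt (by linarith))
    have hl := (hmem (y - ρ / 2) ⟨le_rfl, by linarith⟩).1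
    have hr := (hmem (y + ρ / 2) ⟨by linarith, le_rfl⟩).1
    obtain ⟨z, hz, δ, hδ, hzδ⟩ := hd (y - ρ / 2) (y + ρ / 2) hl.1 (by linarith) hr.2
    have hz1 := (hmem z ⟨hz.1.le, hz.2.le⟩)
    refine hz1.2 (eq_zero_of_hatAvg_eq_zero cH hz1.1
      (lt_min hδ (lt_min hz1.1.1 (sub_pos.2 hz1.1.2))) fun t ht htm => ?_)
    have n1 := htm.trans_le (min_le_left _ _)
    have n2 := htm.trans_le ((min_le_right _ _).trans (min_le_left _ _))
    have n3 := htm.trans_le ((min_le_right _ _).trans (min_le_right _ _))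
    rw [← hΨH z t ht (by linarith) (by linarith), hzδ t ht n1]
  refine eq_zero_of_secondDiff_eq_zero hΨ.continuousOn hΨ0 hΨπ fun z t ht h1 h2 => ?_
  rw [hΨH z t ht h1 h2, hatAvg_congr (g := fun _ => 0) ht.le fun y hy =>
    hH0 y ⟨h1.trans_le hy.1, hy.2.trans_lt h2⟩, hatAvg_const, zero_mul]


/-! ### Vanishing of strip solutions. -/

namespace DirichletStrip

variable {α a c : ℝ} {w h : ℝ → ℝ → ℝ} {g₀ : ℝ → ℝ}

/-- The profile `x` does not occur for orders above `1/2`. -/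
theorem second_profile_eq_zero (S : DirichletStrip α a c w h g₀) (hα : 1 / 2 < α) {Γ Ψ : ℝ → ℝ}
    (cΓ : Continuous Γ) (cΨ : Continuous Ψ) (Γ0 : Γ 0 = 0) (Γπ : Γ Real.pi = 0)
    (Ψ0 : Ψ 0 = 0) (Ψπ : Ψ Real.pi = 0)
    (hΓ : ∀ z t, 0 < t → 0 < z - t → z + t < Real.pi → secondDiff t Γ z = hatAvg t g₀ z)
    (hΦ : ∀ x ∈ Icc (0 : ℝ) 1, ∀ z ∈ Icc 0 Real.pi,
      stripPotential α a c w x z = startProfile α x * Γ z + x * Ψ z) :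
    ∀ z ∈ Icc 0 Real.pi, Ψ z = 0 := by
  have hα0 := S.α_pos
  have hinv1 : 1 < 1 / α := by rw [lt_div_iff₀ hα0]; linarith [S.α_lt]
  have hinv2 : 1 / α < 2 := by rw [div_lt_iff₀ hα0]; linarith
  -- The balance has the factor k^(1-1/α) and the sine coefficients carry k², whence the order 3 -
  -- 1/α; it lies in (1,2) because 1/2 < α < 1. The error k^(-1/α) is summable as 1/α > 1.
  refine eq_zero_of_coeff_balance (p := 3 - 1 / α) (A := a ^ ((α - 1) / (2 * α)))
    (by linarith) (by linarith) cΓ cΨ Γ0 Γπ Ψ0 Ψπ S.continuousOn_start hΓ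
    (fun p q h1 h2 h3 => S.exists_secondDiff_eq_zero hΓ hΦ h1 h2 h3) ?_
  obtain ⟨M, hM⟩ := S.bdd
  have hM0 : 0 ≤ M := (abs_nonneg _).trans (hM 0 0)
  obtain ⟨K₁, hK₁⟩ := (isCompact_Icc (a := 0) (b := Real.pi)).exists_bound_of_continuousOn
    cΓ.continuousOn
  obtain ⟨K₂, hK₂⟩ := (isCompact_Icc (a := 0) (b := Real.pi)).exists_bound_of_continuousOn
    cΨ.continuousOn
  have hπ := Real.pi_pos
  obtain ⟨C, hC⟩ := exists_coeff_balance hα0 S.α_lt S.a_pos c (M := M * Real.pi)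
    (G := max 0 (max K₁ K₂) * Real.pi) (by positivity) (by positivity)
  have hmul : ∀ (k : ℕ) (f : ℝ → ℝ) (K : ℝ), K ≤ max 0 (max K₁ K₂) →
      (∀ z ∈ Icc 0 Real.pi, ‖f z‖ ≤ K) →
      |-(k : ℝ) ^ 2 * sineCoeff k f| ≤ max 0 (max K₁ K₂) * Real.pi * (k : ℝ) ^ 2 := by
    intro k f K hK hf
    rw [abs_mul, abs_neg, abs_of_nonneg (sq_nonneg (k : ℝ)), mul_comm]
    exact mul_le_mul_of_nonneg_right ((abs_sineCoeff_le hf k).trans (by gcongr)) (sq_nonneg _)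
  have hb : ∀ k : ℕ, 1 ≤ k → |(k : ℝ) ^ 2 * sineCoeff k Ψ
      + a ^ ((α - 1) / (2 * α)) * (k : ℝ) ^ (3 - 1 / α) * sineCoeff k Γ| ≤ C * (k : ℝ) ^ (-(1 / α)) := by
    intro k hk
    have hk0 : (0 : ℝ) < k := by exact_mod_cast hk
    have h1 := hC k hk (fun s => sineCoeff k (w s)) _ _ (continuous_sineCoeff S.cont k)
      (fun x _ => abs_sineCoeff_le (fun z _ => hM x z) k)
      (hmul k Γ K₁ ((le_max_left _ _).trans (le_max_right _ _)) hK₁)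
      (hmul k Ψ K₂ ((le_max_right _ _).trans (le_max_right _ _)) hK₂)
      (fun x hx => S.sineCoeff_identity cΓ cΨ hΦ k hx)
    have e : (k : ℝ) ^ (3 - 1 / α) = (k : ℝ) ^ (1 - 1 / α) * (k : ℝ) ^ 2 := by
      rw [← Real.rpow_two, ← Real.rpow_add hk0]; congr 1; ring
    rw [← abs_neg] at h1
    refine le_of_eq_of_le ?_ h1
    rw [e]; congr 1; ring
  refine Summable.of_norm_bounded_eventually_nat
    ((Real.summable_nat_rpow (p := -(1 / α))).2 (by linarith) |>.mul_left C) ?_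
  filter_upwards [Filter.eventually_ge_atTop 1] with k hk
  rw [Real.norm_eq_abs, abs_abs]
  exact hb k hk

/-- A strip solution vanishes on the closed rectangle. -/
theorem eq_zero (S : DirichletStrip α a c w h g₀) :
    ∀ x ∈ Icc (0 : ℝ) 1, ∀ z ∈ Icc 0 Real.pi, w x z = 0 := by
  obtain ⟨Γ, Ψ, cΓ, cΨ, Γ0, Γπ, Ψ0, Ψπ, hΓ, hΦ⟩ := S.exists_potential_eq
  obtain ⟨M, hM⟩ := S.bdd
  have hid := fun (k : ℕ) (x : ℝ) (hx : x ∈ Ioc (0 : ℝ) 1) => S.sineCoeff_identity cΓ cΨ hΦ k hx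
  have hcw : ∀ k, Continuous fun x => sineCoeff k (w x) := continuous_sineCoeff S.cont
  have hB : ∀ k : ℕ, -(k : ℝ) ^ 2 * sineCoeff k Ψ = 0 := by
    intro k
    rcases le_or_gt α (1 / 2) with hα | hα
    · exact coeff_eq_zero_of_le_half S.α_pos hα (hcw k)
        (fun x => abs_sineCoeff_le (fun z _ => hM x z) k) (by simp [sineCoeff, S.left]) (hid k)
    · have h0 := S.second_profile_eq_zero hα cΓ cΨ Γ0 Γπ Ψ0 Ψπ hΓ hΦ
      rw [sineCoeff_congr (g := fun _ => 0) h0]; simp [sineCoeff]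
  intro x hx
  refine eq_zero_of_integral_mul_sin_eq_zero
    (S.cont.comp (by fun_prop : Continuous fun z : ℝ => (x, z))).continuousOn fun n => ?_
  refine eq_zero_of_fracInt_sub_eq S.α_pos S.α_lt (l := a * (n + 1 : ℕ) ^ 2 + c ^ 2)
    (g := -((n + 1 : ℕ) : ℝ) ^ 2 * sineCoeff (n + 1) Γ)
    (add_nonneg (mul_nonneg S.a_pos.le (sq_nonneg _)) (sq_nonneg _)) (hcw (n + 1))
    (by simp [sineCoeff, S.right]) (fun x hx => ?_) x hx
  rw [hid (n + 1) x hx, hB]; ring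

end DirichletStrip


/-! ### From Caputo derivatives to the integrated equation. -/

/-- The doubly integrated form, of order `2 - 2α`, of the relation `D^α D^α f = h` on `(0,1)`. -/
structure IsVolterraPair (α : ℝ) (f h : ℝ → ℝ) : Prop where
  cont : ContinuousOn f (Icc 0 1)
  integrable : ∀ x ∈ Ioo (0 : ℝ) 1, IntervalIntegrable h volume 0 x
  identity : ∃ g, ∀ x ∈ Ioo (0 : ℝ) 1, fracInt (2 - 2 * α) f x
    = f 0 * (x ^ (2 - 2 * α) / Real.Gamma (3 - 2 * α)) + g * (x ^ (2 - α) / Real.Gamma (3 - α))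
      + ∫ s in (0 : ℝ)..x, (x - s) * h s

theorem IsVolterraPair.mul_add_mul {α : ℝ} (hα : α < 1) {f₁ h₁ f₂ h₂ : ℝ → ℝ}
    (p₁ : IsVolterraPair α f₁ h₁) (p₂ : IsVolterraPair α f₂ h₂) (a b : ℝ) :
    IsVolterraPair α (fun x => a * f₁ x + b * f₂ x) (fun x => a * h₁ x + b * h₂ x) where
  cont := (continuousOn_const.mul p₁.cont).add (continuousOn_const.mul p₂.cont)
  integrable x hx := ((p₁.integrable x hx).const_mul a).add ((p₂.integrable x hx).const_mul b)
  identity := by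
    obtain ⟨g₁, e₁⟩ := p₁.identity
    obtain ⟨g₂, e₂⟩ := p₂.identity
    refine ⟨a * g₁ + b * g₂, fun x hx => ?_⟩
    have hsub : Icc 0 x ⊆ Icc (0 : ℝ) 1 := Icc_subset_Icc_right hx.2.le
    have hw : ∀ {h : ℝ → ℝ}, IntervalIntegrable h volume 0 x →
        IntervalIntegrable (fun s => (x - s) * h s) volume 0 x := fun hh =>
      hh.continuousOn_mul (by fun_prop : Continuous fun s : ℝ => x - s).continuousOn
    have hi := intervalIntegral.integral_add ((hw (p₁.integrable x hx)).const_mul a)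
      ((hw (p₂.integrable x hx)).const_mul b)
    rw [intervalIntegral.integral_const_mul, intervalIntegral.integral_const_mul] at hi
    have hi' : ∫ s in (0 : ℝ)..x, (x - s) * (a * h₁ s + b * h₂ s)
        = a * (∫ s in (0 : ℝ)..x, (x - s) * h₁ s) + b * ∫ s in (0 : ℝ)..x, (x - s) * h₂ s := by
      rw [← hi]; congr 1; ext s; ring
    rw [fracInt_mul_add_mul
      (intervalIntegrable_sub_rpow_mul_continuousOn (by linarith) hx.1 (p₁.cont.mono hsub))
      (intervalIntegrable_sub_rpow_mul_continuousOn (by linarith) hx.1 (p₂.cont.mono hsub)),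
      e₁ x hx, e₂ x hx, hi']
    ring

/-- Multiplying the integrable Caputo integrand by the bounded function (x-s)^α returns the
derivative. -/
theorem CaputoDifferentiable.intervalIntegrable_deriv {α : ℝ} (hα0 : 0 < α) (hα1 : α < 1)
    {f : ℝ → ℝ} (hf : CaputoDifferentiable α f) {x : ℝ} (hx : x ∈ Ioo (0 : ℝ) 1) :
    IntervalIntegrable (deriv f) volume 0 x := by
  have h1 := (hf x hx).2 hα1
  have h2 := h1.continuousOn_mul (g := fun s => (x - s) ^ α) (by
    have := Real.continuous_rpow_const (q := α) hα0.le
    exact (this.comp (by fun_prop : Continuous fun s : ℝ => x - s)).continuousOn)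
  rw [intervalIntegrable_iff_integrableOn_Ioo_of_le hx.1.le] at h2 ⊢
  refine h2.congr_fun (fun s hs => ?_) measurableSet_Ioo
  simp only
  rw [← mul_assoc, ← Real.rpow_add (sub_pos.2 hs.2)]
  simp

theorem intervalIntegrable_sub_rpow_mul {γ x : ℝ} (hγ : 1 ≤ γ) {f : ℝ → ℝ}
    (hf : IntervalIntegrable f volume 0 x) :
    IntervalIntegrable (fun s => (x - s) ^ (γ - 1) * f s) volume 0 x :=
  hf.continuousOn_mul ((Real.continuous_rpow_const (q := γ - 1) (by linarith)).comp
    (by fun_prop : Continuous fun s : ℝ => x - s)).continuousOn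

/-- Twofold Caputo differentiation in integrated form. -/
theorem isVolterraPair_caputoDeriv {α : ℝ} (hα0 : 0 < α) (hα1 : α < 1) {f : ℝ → ℝ}
    (hc : ContinuousOn f (Icc 0 1)) (hf : CaputoDifferentiable α f)
    (hg : CaputoDifferentiable α (fun x => caputoDeriv α f x)) :
    IsVolterraPair α f (fun x => caputoDeriv α (fun x => caputoDeriv α f x) x) := by
  have hβ : 0 < 1 - α := by linarith
  set g : ℝ → ℝ := fun x => caputoDeriv α f x with hgdef
  have eg : ∀ x, g x = fracInt (1 - α) (deriv f) x := fun x => caputoDeriv_eq_fracInt hα1 f x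
  have eh : ∀ x, caputoDeriv α g x = fracInt (1 - α) (deriv g) x := fun x =>
    caputoDeriv_eq_fracInt hα1 g x
  have if' := fun x (hx : x ∈ Ioo (0 : ℝ) 1) => hf.intervalIntegrable_deriv hα0 hα1 hx
  have ig' := fun x (hx : x ∈ Ioo (0 : ℝ) 1) => hg.intervalIntegrable_deriv hα0 hα1 hx
  have mf : ∀ x : ℝ, AEStronglyMeasurable (deriv f) (volume.restrict (Ioc 0 x)) := fun x =>
    (measurable_deriv f).aestronglyMeasurable
  have mg : ∀ x : ℝ, AEStronglyMeasurable (deriv g) (volume.restrict (Ioc 0 x)) := fun x =>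
    (measurable_deriv g).aestronglyMeasurable
  have hf1 : ∀ x ∈ Ioo (0 : ℝ) 1, f x = f 0 + fracInt 1 (deriv f) x := by
    intro x hx
    rw [fracInt_one, intervalIntegral.integral_eq_sub_of_hasDerivAt_of_le hx.1.le
      (hc.mono (Icc_subset_Icc_right hx.2.le))
      (fun s hs => (hf s ⟨hs.1, hs.2.trans hx.2⟩).1.hasDerivAt) (if' x hx)]
    ring
  have hhalf : (1 / 2 : ℝ) ∈ Ioo (0 : ℝ) 1 := by norm_num
  -- The limit of g at 0, obtained by integrating back from 1/2. The value `g 0` is 0, an integral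
  -- over an empty interval, and need not be that limit.
  set g₀ : ℝ := g (1 / 2) - ∫ s in (0 : ℝ)..(1 / 2), deriv g s with hg₀
  have hg1 : ∀ x ∈ Ioo (0 : ℝ) 1, g x = g₀ + fracInt 1 (deriv g) x := by
    intro x hx
    have hsub : uIcc (1 / 2) x ⊆ Ioo (0 : ℝ) 1 := ordConnected_Ioo.uIcc_subset hhalf hx
    have h1 := intervalIntegral.integral_eq_sub_of_hasDerivAt (a := 1 / 2) (b := x) (f := g)
      (fun s hs => (hg s (hsub hs)).1.hasDerivAt) ((ig' _ hhalf).symm.trans (ig' x hx))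
    have h2 := intervalIntegral.integral_add_adjacent_intervals (ig' _ hhalf)
      ((ig' _ hhalf).symm.trans (ig' x hx))
    rw [fracInt_one, hg₀]
    linarith
  have hone : ∀ γ : ℝ, 0 < γ → ∀ x : ℝ, 0 < x →
      fracInt γ (fun _ => 1) x = x ^ γ / Real.Gamma (γ + 1) := by
    intro γ hγ x hx
    have := fracInt_rpow (b := 1) hγ one_pos hx
    simp only [sub_self, Real.rpow_zero, Real.Gamma_one, div_one, add_sub_cancel_left] at this
    rw [this, add_comm]
  -- J^γ applied to φ = b + J φ'. It is used once for f and once for g, linked by J^(2-α) J^(1-α) f'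
  -- = J^(2-α) g.
  have hsplit : ∀ γ : ℝ, 1 - α ≤ γ → ∀ (φ φ' : ℝ → ℝ) (b : ℝ),
      (∀ x : ℝ, AEStronglyMeasurable φ' (volume.restrict (Ioc 0 x))) →
      (∀ x ∈ Ioo (0 : ℝ) 1, IntervalIntegrable φ' volume 0 x) →
      (∀ x ∈ Ioo (0 : ℝ) 1, φ x = b + fracInt 1 φ' x) → ∀ x ∈ Ioo (0 : ℝ) 1,
      fracInt γ φ x = b * (x ^ γ / Real.Gamma (γ + 1)) + fracInt (γ + 1) φ' x := by
    intro γ hγ φ φ' b mφ iφ e x hx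
    have hγ0 : 0 < γ := by linarith
    have hi := intervalIntegrable_sub_rpow_mul (γ := γ + 1) (by linarith) (iφ x hx)
    have h1 : fracInt γ φ x = fracInt γ (fun s => b * 1 + 1 * fracInt 1 φ' s) x :=
      fracInt_congr hx.1.le fun s hs => by
        rw [e s ⟨hs.1, hs.2.trans hx.2⟩, mul_one, one_mul]
    have hone' : IntervalIntegrable (fun s => (x - s) ^ (γ - 1) * (1 : ℝ)) volume 0 x := by
      simpa using intervalIntegrable_sub_rpow hγ0 hx.1
    rw [h1, fracInt_mul_add_mul hone'
      (intervalIntegrable_sub_rpow_mul_fracInt hγ0 one_pos hx.1 (mφ x) hi), hone γ hγ0 x hx.1,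
      fracInt_fracInt hγ0 one_pos hx.1 (mφ x) hi, one_mul]
  refine ⟨hc, fun x hx => ?_, g₀, fun x hx => ?_⟩
  · simp only [eh]
    have h1 := intervalIntegrable_sub_rpow_mul (γ := 1 + (1 - α)) (by linarith) (ig' x hx)
    have := intervalIntegrable_sub_rpow_mul_fracInt one_pos hβ hx.1 (mg x) h1
    simpa using this
  · have k1 := hsplit (2 - 2 * α) (by linarith) f (deriv f) (f 0) mf if' hf1 x hx
    have k2 := hsplit (2 - α) (by linarith) g (deriv g) g₀ mg ig' hg1 x hx
    have k3 := fracInt_fracInt (a := 2 - α) (b := 1 - α) (by linarith) hβ hx.1 (mf x)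
      (intervalIntegrable_sub_rpow_mul (by linarith) (if' x hx))
    have k4 := fracInt_fracInt (a := 2) (b := 1 - α) two_pos hβ hx.1 (mg x)
      (intervalIntegrable_sub_rpow_mul (by linarith) (ig' x hx))
    have k5 : fracInt (2 - α) (fracInt (1 - α) (deriv f)) x = fracInt (2 - α) g x :=
      fracInt_congr hx.1.le fun s _ => (eg s).symm
    have k6 : fracInt 2 (fracInt (1 - α) (deriv g)) x
        = ∫ s in (0 : ℝ)..x, (x - s) * caputoDeriv α g s := by
      rw [fracInt_two]; simp only [eh]
    rw [show 2 - 2 * α + 1 = 2 - α + (1 - α) by ring, ← k3, k5, k2,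
      show 2 - α + 1 = 2 + (1 - α) by ring, ← k4, k6] at k1
    rw [k1, show 2 - α + (1 - α) = 3 - 2 * α by ring, show 2 + (1 - α) = 3 - α by ring]
    ring


/-! ### The maximum principle and the reduction to the strip. -/

/-- The second derivative test at a local maximum. -/
theorem deriv_deriv_nonpos_of_isLocalMax {f f1 : ℝ → ℝ} {x₀ b : ℝ}
    (h1 : ∀ᶠ x in nhds x₀, HasDerivAt f (f1 x) x) (h2 : HasDerivAt f1 b x₀)
    (hmax : IsLocalMax f x₀) : b ≤ 0 := by
  have e1 : deriv f =ᶠ[nhds x₀] f1 := h1.mono fun x hx => hx.deriv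
  have e2 : deriv (deriv f) x₀ = b := by rw [e1.deriv_eq, h2.deriv]
  by_contra hb
  -- If b > 0, the point is both a local minimum and a local maximum, so f is locally constant and
  -- its second derivative is 0.
  have hmin := isLocalMin_of_deriv_deriv_pos (by rw [e2]; exact not_le.1 hb) hmax.deriv_eq_zero
    h1.self_of_nhds.continuousAt
  have e3 : f =ᶠ[nhds x₀] fun _ => f x₀ := by
    filter_upwards [hmax, hmin] with x k1 k2 using le_antisymm k1 k2
  have e4 : deriv f =ᶠ[nhds x₀] fun _ => 0 := by simpa using e3.deriv
  have : deriv (deriv f) x₀ = 0 := by rw [e4.deriv_eq]; simp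
  exact hb (by rw [← e2, this])

/-- Functions on the strip whose second derivative in the second variable balances `h`. -/
structure IsStripFunction (a c : ℝ) (V H : ℝ → ℝ → ℝ) : Prop where
  a_pos : 0 < a
  cont : ContinuousOn (Function.uncurry V) (Icc 0 1 ×ˢ Icc 0 Real.pi)
  left : ∀ z ∈ Icc 0 Real.pi, V 0 z = 0
  right : ∀ z ∈ Icc 0 Real.pi, V 1 z = 0
  bottom : ∀ x ∈ Icc (0 : ℝ) 1, V x 0 = 0
  top : ∀ x ∈ Icc (0 : ℝ) 1, V x Real.pi = 0
  h_cont : ContinuousOn (Function.uncurry H) (Ioo 0 1 ×ˢ Ioo 0 Real.pi)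
  zz : ∀ x ∈ Ioo (0 : ℝ) 1, ∃ w1 : ℝ → ℝ, ∀ z ∈ Ioo 0 Real.pi,
    HasDerivAt (V x) (w1 z) z ∧ HasDerivAt w1 ((c ^ 2 * V x z - H x z) / a) z

namespace IsStripFunction

variable {a c : ℝ} {V H : ℝ → ℝ → ℝ}

theorem neg (S : IsStripFunction a c V H) :
    IsStripFunction a c (fun x z => -V x z) (fun x z => -H x z) where
  a_pos := S.a_pos
  cont := S.cont.neg
  left z hz := by rw [S.left z hz, neg_zero]
  right z hz := by rw [S.right z hz, neg_zero]
  bottom x hx := by rw [S.bottom x hx, neg_zero]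
  top x hx := by rw [S.top x hx, neg_zero]
  h_cont := S.h_cont.neg
  zz x hx := by
    obtain ⟨w1, hw⟩ := S.zz x hx
    exact ⟨fun z => -w1 z, fun z hz => ⟨(hw z hz).1.neg,
      (hw z hz).2.neg.congr_deriv (by ring)⟩⟩

/-- The classical maximum principle. -/
theorem le_zero_of_xx (S : IsStripFunction a c V H)
    (hxx : ∀ z ∈ Ioo 0 Real.pi, ∃ v1 : ℝ → ℝ, ∀ x ∈ Ioo (0 : ℝ) 1,
      HasDerivAt (fun x => V x z) (v1 x) x ∧ HasDerivAt v1 (H x z) x) :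
    ∀ x ∈ Icc (0 : ℝ) 1, ∀ z ∈ Icc 0 Real.pi, V x z ≤ 0 := by
  intro x hx z hz
  by_contra hpos
  rw [not_le] at hpos
  set η := V x z / 2 with hη
  have hη0 : 0 < η := by positivity
  -- The perturbation makes the inequality strict: at the maximum H ≤ -2η, while V_zz ≤ 0 gives H ≥
  -- c² V ≥ 0. With η half of the assumed positive value, V stays positive at the maximum, which is
  -- therefore interior.
  set W : ℝ × ℝ → ℝ := fun p => V p.1 p.2 + η * p.1 ^ 2 with hW
  have cW : ContinuousOn W (Icc 0 1 ×ˢ Icc 0 Real.pi) :=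
    S.cont.add (by fun_prop : Continuous fun p : ℝ × ℝ => η * p.1 ^ 2).continuousOn
  obtain ⟨⟨x₀, z₀⟩, ⟨hx₀, hz₀⟩, hmax⟩ :=
    (isCompact_Icc.prod isCompact_Icc).exists_isMaxOn ⟨(x, z), hx, hz⟩ cW
  simp only at hx₀ hz₀
  have hM : ∀ x' ∈ Icc (0 : ℝ) 1, ∀ z' ∈ Icc 0 Real.pi, W (x', z') ≤ W (x₀, z₀) := fun x' h1 z' h2 =>
    hmax (show (x', z') ∈ Icc (0 : ℝ) 1 ×ˢ Icc 0 Real.pi from ⟨h1, h2⟩)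
  have hge := hM x hx z hz
  simp only [hW] at hge hM
  have hxle : η * x₀ ^ 2 ≤ η := 
    mul_le_of_le_one_right hη0.le (pow_le_one₀ hx₀.1 hx₀.2)
  have hVpos : 0 < V x₀ z₀ := by
    have := mul_nonneg hη0.le (sq_nonneg x)
    linarith
  have hx₀' : x₀ ∈ Ioo (0 : ℝ) 1 := by
    refine ⟨lt_of_le_of_ne hx₀.1 fun h => ?_, lt_of_le_of_ne hx₀.2 fun h => ?_⟩
    · rw [← h, S.left z₀ hz₀] at hVpos; exact lt_irrefl _ hVpos
    · rw [h, S.right z₀ hz₀] at hVpos; exact lt_irrefl _ hVpos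
  have hz₀' : z₀ ∈ Ioo 0 Real.pi := by
    refine ⟨lt_of_le_of_ne hz₀.1 fun h => ?_, lt_of_le_of_ne hz₀.2 fun h => ?_⟩
    · rw [← h, S.bottom x₀ hx₀] at hVpos; exact lt_irrefl _ hVpos
    · rw [h, S.top x₀ hx₀] at hVpos; exact lt_irrefl _ hVpos
  have hxn : Ioo (0 : ℝ) 1 ∈ nhds x₀ := isOpen_Ioo.mem_nhds hx₀'
  have hzn : Ioo 0 Real.pi ∈ nhds z₀ := isOpen_Ioo.mem_nhds hz₀'
  obtain ⟨v1, hv⟩ := hxx z₀ hz₀'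
  obtain ⟨w1, hw⟩ := S.zz x₀ hx₀'
  have k1 : H x₀ z₀ + η * 2 ≤ 0 := by
    refine deriv_deriv_nonpos_of_isLocalMax (x₀ := x₀) (f := fun x => V x z₀ + η * x ^ 2)
      (f1 := fun x => v1 x + η * (2 * x)) ?_ ?_ ?_
    · filter_upwards [hxn] with x' hx'
      exact (hv x' hx').1.add (((hasDerivAt_pow 2 x').const_mul η).congr_deriv (by simp))
    · exact (hv x₀ hx₀').2.add (((hasDerivAt_id x₀).const_mul 2).const_mul η |>.congr_deriv (by simp))
    · filter_upwards [hxn] with x' hx' using hM x' (Ioo_subset_Icc_self hx') z₀ hz₀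
  have k2 : (c ^ 2 * V x₀ z₀ - H x₀ z₀) / a ≤ 0 := by
    refine deriv_deriv_nonpos_of_isLocalMax (x₀ := z₀) (f := V x₀) (f1 := w1) ?_ (hw z₀ hz₀').2 ?_
    · filter_upwards [hzn] with z' hz' using (hw z' hz').1
    · filter_upwards [hzn] with z' hz'
      have := hM x₀ hx₀ z' (Ioo_subset_Icc_self hz')
      linarith
  have k3 : c ^ 2 * V x₀ z₀ - H x₀ z₀ ≤ 0 := by
    by_contra hcon
    exact absurd k2 (not_le.2 (div_pos (not_le.1 hcon) S.a_pos))
  have : 0 ≤ c ^ 2 * V x₀ z₀ := by positivity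
  linarith

theorem eq_zero_of_xx (S : IsStripFunction a c V H)
    (hxx : ∀ z ∈ Ioo 0 Real.pi, ∃ v1 : ℝ → ℝ, ∀ x ∈ Ioo (0 : ℝ) 1,
      HasDerivAt (fun x => V x z) (v1 x) x ∧ HasDerivAt v1 (H x z) x) :
    ∀ x ∈ Icc (0 : ℝ) 1, ∀ z ∈ Icc 0 Real.pi, V x z = 0 := by
  intro x hx z hz
  refine le_antisymm (S.le_zero_of_xx hxx x hx z hz) ?_
  have := S.neg.le_zero_of_xx (fun z hz => by
    obtain ⟨v1, hv⟩ := hxx z hz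
    exact ⟨fun x => -v1 x, fun x hx => ⟨(hv x hx).1.neg, (hv x hx).2.neg⟩⟩) x hx z hz
  linarith

theorem eq_zero_of_isVolterraPair (S : IsStripFunction a c V H) {α : ℝ} (hα0 : 0 < α) (hα1 : α < 1)
    (hp : ∀ z ∈ Ioo 0 Real.pi, IsVolterraPair α (fun x => V x z) (fun x => H x z)) :
    ∀ x ∈ Icc (0 : ℝ) 1, ∀ z ∈ Icc 0 Real.pi, V x z = 0 := by
  have hπ := Real.pi_pos
  have hgex : ∀ z, ∃ g, z ∈ Ioo 0 Real.pi → ∀ x ∈ Ioo (0 : ℝ) 1,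
      fracInt (2 - 2 * α) (fun x => V x z) x
      = V 0 z * (x ^ (2 - 2 * α) / Real.Gamma (3 - 2 * α)) + g * (x ^ (2 - α) / Real.Gamma (3 - α))
        + ∫ s in (0 : ℝ)..x, (x - s) * H s z := fun z => by
    by_cases hz : z ∈ Ioo 0 Real.pi
    · obtain ⟨g, hg⟩ := (hp z hz).identity
      exact ⟨g, fun _ => hg⟩
    · exact ⟨0, fun h => absurd h hz⟩
  choose g₀ hg₀ using hgex
  obtain ⟨hcont, hbdd⟩ := exists_continuous_extension zero_le_one hπ.le S.cont
  have hcx : ∀ x : ℝ, max 0 (min 1 x) ∈ Icc (0 : ℝ) 1 := fun x =>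
    ⟨le_max_left _ _, max_le zero_le_one (min_le_left _ _)⟩
  have hcz : ∀ z : ℝ, max 0 (min Real.pi z) ∈ Icc 0 Real.pi := fun z =>
    ⟨le_max_left _ _, max_le hπ.le (min_le_left _ _)⟩
  have c0 : max 0 (min 1 (0 : ℝ)) = 0 := clamp_eq ⟨le_rfl, zero_le_one⟩
  have c1 : max 0 (min 1 (1 : ℝ)) = 1 := clamp_eq ⟨zero_le_one, le_rfl⟩
  have cp0 : max 0 (min Real.pi 0) = 0 := clamp_eq ⟨le_rfl, hπ.le⟩
  have cpπ : max 0 (min Real.pi Real.pi) = Real.pi := clamp_eq ⟨hπ.le, le_rfl⟩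
  -- Clamping both variables extends V to a bounded continuous function on the plane with the same
  -- zero boundary values.
  have D : DirichletStrip α a c (fun x z => V (max 0 (min 1 x)) (max 0 (min Real.pi z))) H g₀ :=
    { α_pos := hα0
      α_lt := hα1
      a_pos := S.a_pos
      cont := hcont
      bdd := hbdd
      left := fun z => by rw [c0]; exact S.left _ (hcz z)
      right := fun z => by rw [c1]; exact S.right _ (hcz z)
      bottom := fun x => by rw [cp0]; exact S.bottom _ (hcx x)
      top := fun x => by rw [cpπ]; exact S.top _ (hcx x)
      h_cont := S.h_cont
      h_int := fun z hz => (hp z hz).integrable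
      identity := fun z hz x hx => by
        have h1 := hg₀ z hz x hx
        rw [S.left z (Ioo_subset_Icc_self hz), zero_mul, zero_add] at h1
        rw [← h1]
        refine fracInt_congr hx.1.le fun s hs => ?_
        rw [clamp_eq (show s ∈ Icc (0 : ℝ) 1 from ⟨hs.1.le, (hs.2.trans hx.2).le⟩),
          clamp_eq (Ioo_subset_Icc_self hz)]
      zz := fun x hx => by
        obtain ⟨w1, hw⟩ := S.zz x hx
        refine ⟨w1, fun z hz => ?_⟩
        rw [clamp_eq (Ioo_subset_Icc_self hx), clamp_eq (Ioo_subset_Icc_self hz)]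
        refine ⟨(hw z hz).1.congr_of_eventuallyEq ?_, (hw z hz).2⟩
        filter_upwards [isOpen_Ioo.mem_nhds hz] with z' hz'
        rw [clamp_eq (Ioo_subset_Icc_self hz')] }
  intro x hx z hz
  have := D.eq_zero x hx z hz
  rwa [clamp_eq hx, clamp_eq hz] at this

end IsStripFunction


/-! ### Removal of the reflection, uniqueness and the theorem. -/

/-- The combination `u(x,y) + σ u(x,-y)` at `y = 2z - π`. -/
noncomputable def fold (σ : ℝ) (u : ℝ → ℝ → ℝ) (x z : ℝ) : ℝ :=
  u x (2 * z - Real.pi) + σ * u x (-(2 * z - Real.pi))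

theorem continuousOn_fold {u : ℝ → ℝ → ℝ} {A S T : Set ℝ}
    (hu : ContinuousOn (Function.uncurry u) (A ×ˢ S))
    (h1 : ∀ z ∈ T, 2 * z - Real.pi ∈ S) (h2 : ∀ z ∈ T, -(2 * z - Real.pi) ∈ S) (σ : ℝ) :
    ContinuousOn (Function.uncurry (fold σ u)) (A ×ˢ T) := by
  have c1 : ContinuousOn (fun v : ℝ × ℝ => u v.1 (2 * v.2 - Real.pi)) (A ×ˢ T) :=
    hu.comp (by fun_prop : Continuous fun v : ℝ × ℝ => (v.1, 2 * v.2 - Real.pi)).continuousOn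
      fun v hv => ⟨hv.1, h1 _ hv.2⟩
  have c2 : ContinuousOn (fun v : ℝ × ℝ => u v.1 (-(2 * v.2 - Real.pi))) (A ×ˢ T) :=
    hu.comp (by fun_prop : Continuous fun v : ℝ × ℝ => (v.1, -(2 * v.2 - Real.pi))).continuousOn
      fun v hv => ⟨hv.1, h2 _ hv.2⟩
  exact c1.add (continuousOn_const.mul c2)

theorem two_mul_sub_pi_mem {z : ℝ} (hz : z ∈ Ioo 0 Real.pi) :
    2 * z - Real.pi ∈ Ioo (-Real.pi) Real.pi ∧ -(2 * z - Real.pi) ∈ Ioo (-Real.pi) Real.pi :=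
  ⟨⟨by linarith [hz.1], by linarith [hz.2]⟩, ⟨by linarith [hz.2], by linarith [hz.1]⟩⟩

theorem two_mul_sub_pi_mem_Icc {z : ℝ} (hz : z ∈ Icc 0 Real.pi) :
    2 * z - Real.pi ∈ Icc (-Real.pi) Real.pi ∧ -(2 * z - Real.pi) ∈ Icc (-Real.pi) Real.pi :=
  ⟨⟨by linarith [hz.1], by linarith [hz.2]⟩, ⟨by linarith [hz.2], by linarith [hz.1]⟩⟩

namespace IsSolutionProblemD

variable {α ε c : ℝ} {φ ψ : ℝ → ℝ} {u v : ℝ → ℝ → ℝ}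

/-- Adding the equation at y and σ times the equation at -y, with σ² = 1, turns u_yy(y) - ε u_yy(-y)
into (1 - εσ) times the second derivative of the combination. The scaling y = 2z - π accounts for
the 4. -/
theorem fold_zz (hu : IsSolutionProblemD α ε c φ ψ u) {σ : ℝ} (hσ : σ ^ 2 = 1)
    (ha : 0 < (1 - ε * σ) / 4) {x : ℝ} (hx : x ∈ Ioo (0 : ℝ) 1) :
    ∃ w1 : ℝ → ℝ, ∀ z ∈ Ioo 0 Real.pi, HasDerivAt (fold σ u x) (w1 z) z ∧
      HasDerivAt w1 ((c ^ 2 * fold σ u x z - fold σ (caputoX α (caputoX α u)) x z)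
        / ((1 - ε * σ) / 4)) z := by
  refine ⟨fun z => 2 * deriv (u x) (2 * z - Real.pi) - 2 * σ * deriv (u x) (-(2 * z - Real.pi)),
    fun z hz => ?_⟩
  obtain ⟨m1, m2⟩ := two_mul_sub_pi_mem hz
  have d1 : HasDerivAt (fun z : ℝ => 2 * z - Real.pi) 2 z := by
    simpa using ((hasDerivAt_id z).const_mul 2).sub_const Real.pi
  have d2 : HasDerivAt (fun z : ℝ => -(2 * z - Real.pi)) (-2) z := d1.neg
  obtain ⟨y1, yy1⟩ := hu.regular.yy_exists x hx _ m1
  obtain ⟨y2, yy2⟩ := hu.regular.yy_exists x hx _ m2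
  constructor
  · have h1 := y1.hasDerivAt.comp z d1
    have h2 := (y2.hasDerivAt.comp z d2).const_mul σ
    exact (h1.add h2).congr_deriv (by ring)
  · have h1 := (yy1.hasDerivAt.comp z d1).const_mul 2
    have h2 := (yy2.hasDerivAt.comp z d2).const_mul (2 * σ)
    refine (h1.sub h2).congr_deriv ?_
    have e1 := hu.equation x hx _ m1
    have e2 := hu.equation x hx _ m2
    rw [neg_neg] at e2
    simp only [partialYY] at e1 e2
    rw [eq_div_iff ha.ne']
    simp only [fold]
    linear_combination e1 + σ * e2
      - ε * deriv (deriv (u x)) (-(2 * z - Real.pi)) * hσ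

theorem isStripFunction (hu : IsSolutionProblemD α ε c φ ψ u) (hv : IsSolutionProblemD α ε c φ ψ v)
    {σ : ℝ} (hσ : σ ^ 2 = 1) (ha : 0 < (1 - ε * σ) / 4) :
    IsStripFunction ((1 - ε * σ) / 4) c (fun x z => 1 * fold σ u x z + -1 * fold σ v x z)
      (fun x z => 1 * fold σ (caputoX α (caputoX α u)) x z
        + -1 * fold σ (caputoX α (caputoX α v)) x z) where
  a_pos := ha
  cont := by
    have h : ∀ {u : ℝ → ℝ → ℝ}, IsSolutionProblemD α ε c φ ψ u →
        ContinuousOn (Function.uncurry (fold σ u)) (Icc 0 1 ×ˢ Icc 0 Real.pi) := fun hu =>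
      continuousOn_fold hu.regular.continuousOn (fun z hz => (two_mul_sub_pi_mem_Icc hz).1)
        (fun z hz => (two_mul_sub_pi_mem_Icc hz).2) σ
    exact (continuousOn_const.mul (h hu)).add (continuousOn_const.mul (h hv))
  left z hz := by
    obtain ⟨m1, m2⟩ := two_mul_sub_pi_mem_Icc hz
    simp only [fold]
    rw [hu.left _ m1, hu.left _ m2, hv.left _ m1, hv.left _ m2]; ring
  right z hz := by
    obtain ⟨m1, m2⟩ := two_mul_sub_pi_mem_Icc hz
    simp only [fold]
    rw [hu.right _ m1, hu.right _ m2, hv.right _ m1, hv.right _ m2]; ring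
  bottom x hx := by
    simp only [fold, mul_zero, zero_sub, neg_neg]
    rw [hu.bottom x hx, hu.top x hx, hv.bottom x hx, hv.top x hx]; ring
  top x hx := by
    have e : 2 * Real.pi - Real.pi = Real.pi := by ring
    simp only [fold, e]
    rw [hu.bottom x hx, hu.top x hx, hv.bottom x hx, hv.top x hx]; ring
  h_cont := by
    have h : ∀ {u : ℝ → ℝ → ℝ}, IsSolutionProblemD α ε c φ ψ u →
        ContinuousOn (Function.uncurry (fold σ (caputoX α (caputoX α u))))
          (Ioo 0 1 ×ˢ Ioo 0 Real.pi) := fun hu =>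
      continuousOn_fold hu.regular.caputo_caputo_continuousOn (fun z hz => (two_mul_sub_pi_mem hz).1)
        (fun z hz => (two_mul_sub_pi_mem hz).2) σ
    exact (continuousOn_const.mul (h hu)).add (continuousOn_const.mul (h hv))
  zz x hx := by
    obtain ⟨w1, hw⟩ := hu.fold_zz hσ ha hx
    obtain ⟨w2, hw'⟩ := hv.fold_zz hσ ha hx
    refine ⟨fun z => 1 * w1 z + -1 * w2 z, fun z hz =>
      ⟨((hw z hz).1.const_mul 1).add ((hw' z hz).1.const_mul (-1)), ?_⟩⟩
    exact (((hw z hz).2.const_mul 1).add ((hw' z hz).2.const_mul (-1))).congr_deriv (by ring)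

theorem isVolterraPair (hu : IsSolutionProblemD α ε c φ ψ u) (hα0 : 0 < α) (hα1 : α < 1) {y : ℝ}
    (hy : y ∈ Ioo (-Real.pi) Real.pi) :
    IsVolterraPair α (fun x => u x y) (fun x => caputoX α (caputoX α u) x y) :=
  isVolterraPair_caputoDeriv hα0 hα1
    (hu.regular.continuousOn.comp (by fun_prop : Continuous fun x : ℝ => (x, y)).continuousOn
      fun x hx => ⟨hx, Ioo_subset_Icc_self hy⟩)
    (hu.regular.caputo_exists y hy) (hu.regular.caputo_caputo_exists y hy)

theorem fold_isVolterraPair (hu : IsSolutionProblemD α ε c φ ψ u) (hα0 : 0 < α) (hα1 : α < 1)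
    (σ : ℝ) {z : ℝ} (hz : z ∈ Ioo 0 Real.pi) :
    IsVolterraPair α (fun x => fold σ u x z) (fun x => fold σ (caputoX α (caputoX α u)) x z) := by
  obtain ⟨m1, m2⟩ := two_mul_sub_pi_mem hz
  have := (hu.isVolterraPair hα0 hα1 m1).mul_add_mul hα1 (hu.isVolterraPair hα0 hα1 m2) 1 σ
  simpa only [one_mul, fold] using this

theorem hasDerivAt_of_order_one (hu : IsSolutionProblemD 1 ε c φ ψ u) {x y : ℝ}
    (hx : x ∈ Ioo (0 : ℝ) 1) (hy : y ∈ Ioo (-Real.pi) Real.pi) :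
    HasDerivAt (fun x => u x y) (caputoX 1 u x y) x ∧
      HasDerivAt (fun x => caputoX 1 u x y) (caputoX 1 (caputoX 1 u) x y) x := by
  constructor
  · have := (hu.regular.caputo_exists y hy x hx).1.hasDerivAt
    simpa only [caputoX, caputoDeriv, if_true] using this
  · have := (hu.regular.caputo_caputo_exists y hy x hx).1.hasDerivAt
    simpa only [caputoX, caputoDeriv, if_true] using this

theorem fold_xx_of_order_one (hu : IsSolutionProblemD 1 ε c φ ψ u) (σ : ℝ) {x z : ℝ}
    (hx : x ∈ Ioo (0 : ℝ) 1) (hz : z ∈ Ioo 0 Real.pi) :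
    HasDerivAt (fun x => fold σ u x z) (fold σ (caputoX 1 u) x z) x ∧
      HasDerivAt (fun x => fold σ (caputoX 1 u) x z) (fold σ (caputoX 1 (caputoX 1 u)) x z) x := by
  obtain ⟨m1, m2⟩ := two_mul_sub_pi_mem hz
  have d1 := hu.hasDerivAt_of_order_one hx m1
  have d2 := hu.hasDerivAt_of_order_one hx m2
  exact ⟨d1.1.add (d2.1.const_mul σ), d1.2.add (d2.2.const_mul σ)⟩

theorem fold_eq (hu : IsSolutionProblemD α ε c φ ψ u) (hv : IsSolutionProblemD α ε c φ ψ v)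
    (hα0 : 0 < α) (hα1 : α ≤ 1) {σ : ℝ} (hσ : σ ^ 2 = 1) (ha : 0 < (1 - ε * σ) / 4) {x z : ℝ}
    (hx : x ∈ Icc (0 : ℝ) 1) (hz : z ∈ Icc 0 Real.pi) : fold σ u x z = fold σ v x z := by
  have S := hu.isStripFunction hv hσ ha
  have h : 1 * fold σ u x z + -1 * fold σ v x z = 0 := by
    rcases hα1.lt_or_eq with hlt | rfl
    · exact S.eq_zero_of_isVolterraPair hα0 hlt (fun z hz =>
        (hu.fold_isVolterraPair hα0 hlt σ hz).mul_add_mul hlt (hv.fold_isVolterraPair hα0 hlt σ hz)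
          1 (-1)) x hx z hz
    · refine S.eq_zero_of_xx (fun z hz => ⟨fun x => 1 * fold σ (caputoX 1 u) x z
        + -1 * fold σ (caputoX 1 v) x z, fun x hx => ?_⟩) x hx z hz
      have d1 := hu.fold_xx_of_order_one σ hx hz
      have d2 := hv.fold_xx_of_order_one σ hx hz
      exact ⟨(d1.1.const_mul 1).add (d2.1.const_mul (-1)), (d1.2.const_mul 1).add (d2.2.const_mul (-1))⟩
  linarith

/-- Regular solutions are unique. -/
theorem unique (hu : IsSolutionProblemD α ε c φ ψ u) (hv : IsSolutionProblemD α ε c φ ψ v)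
    (hα0 : 0 < α) (hα1 : α ≤ 1) (hε : |ε| < 1) {x y : ℝ} (hx : x ∈ Icc (0 : ℝ) 1)
    (hy : y ∈ Icc (-Real.pi) Real.pi) : u x y = v x y := by
  obtain ⟨e1, e2⟩ := abs_lt.1 hε
  have hz : (y + Real.pi) / 2 ∈ Icc 0 Real.pi := ⟨by linarith [hy.1], by linarith [hy.2]⟩
  -- Equality of both combinations, σ = 1 and σ = -1, gives equality of their sum 2u(x,y).
  have h1 := hu.fold_eq hv hα0 hα1 (σ := 1) (by norm_num) (by linarith) hx hz
  have h2 := hu.fold_eq hv hα0 hα1 (σ := -1) (by norm_num) (by linarith) hx hz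
  have e : 2 * ((y + Real.pi) / 2) - Real.pi = y := by ring
  simp only [fold, e] at h1 h2
  linarith

end IsSolutionProblemD

theorem theorem1 (α ε c δ : ℝ) (hα0 : 0 < α) (hα1 : α ≤ 1) (hε : |ε| < 1)
    (hδ0 : 0 < δ) (hδ1 : δ < 1) (φ ψ : ℝ → ℝ)
    (hφ : IsHolderClass 2 δ φ) (hψ : IsHolderClass 1 δ ψ)
    (hφl : φ (-Real.pi) = 0) (hφr : φ Real.pi = 0)
    (hψl : ψ (-Real.pi) = 0) (hψr : ψ Real.pi = 0) :
    ∃ u : ℝ → ℝ → ℝ, IsSolutionProblemD α ε c φ ψ u ∧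
      (∀ v : ℝ → ℝ → ℝ, IsSolutionProblemD α ε c φ ψ v →
        ∀ x ∈ Set.Icc (0 : ℝ) 1, ∀ y ∈ Set.Icc (-Real.pi) Real.pi, v x y = u x y) ∧
      (∀ x ∈ Set.Icc (0 : ℝ) 1, ∀ y ∈ Set.Icc (-Real.pi) Real.pi,
        Summable (fun n : ℕ => sinTerm α ε c φ ψ (n + 1) x y) ∧
        Summable (fun n : ℕ => cosTerm α ε c φ ψ (n + 1) x y) ∧
        u x y = (∑' n : ℕ, sinTerm α ε c φ ψ (n + 1) x y)
          + ∑' n : ℕ, cosTerm α ε c φ ψ (n + 1) x y) := by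
  obtain ⟨u, hu, hs⟩ := exists_solution (c := c) hα0 hα1 hε hφ.1 hψ.1 hφl hφr hψl hψr
  refine ⟨u, hu, fun v hv x hx y hy =>
    hv.unique hu hα0 hα1 hε hx hy, fun x hx y _ => hs x hx y⟩
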